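/- **Setup.** An integral cone is a strongly convex rational polyhedral cone $\sigma$ with the lattice $M^\sigma$ of integral linear functions on it (full-dimensional in $N^\sigma_{\mathbb R}$, $N^\sigma=\operatorname{Hom}(M^\sigma,\mathbb Z)$). A *cone complex* $\Sigma$ is a finite set of integral cones covering a space $|\Sigma|$, closed under taking faces, such that the intersection of any two cones is a union of common faces. It is *weakly embedded* if it comes with a lattice $N^\Sigma$ (dual $M^\Sigma$) and a map $\phi:|\Sigma|\to N^\Sigma_{\mathbb R}$ that is integral linear on every cone; put $N^\Sigma_\tau=N^\Sigma\cap\operatorname{Lin}\phi(\tau)$. A *proper subdivision* of $\Sigma$ is a cone complex with the same support, every cone of which is a subcone of a cone of $\Sigma$. The *star* $\operatorname{Star}(\tau)$ of $\tau\in\Sigma$ is the complex glued from the images $\sigma/\tau$ of the cones $\sigma\supseteq\tau$ in $N^\sigma_{\mathbb R}/N^\tau_{\mathbb R}$, weakly embedded in $N^\Sigma/N^\Sigma_\tau$. The extended complex $\overline\Sigma$ is the disjoint union of the stars $\operatorname{Star}(\tau)$, $\tau\in\Sigma$. **Cycles.** For a face $\tau\prec\sigma$ of codimension one, the lattice normal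 vector $u_{\sigma/\tau}\in N^\Sigma/N^\Sigma_\tau$ is the image of the generator of $N^\sigma/N^\tau$ that lies in the image of $\sigma\cap N^\sigma$. A $k$-dimensional Minkowski weight is a map $c$ from the $k$-dimensional cones to $\mathbb Z$ with $\sum_{\sigma\succ\tau}c(\sigma)u_{\sigma/\tau}=0$ in $N^\Sigma/N^\Sigma_\tau$ for every $(k-1)$-dimensional cone $\tau$. Put $Z_k(\Sigma)=\varinjlim \operatorname{Mink}_k(\Sigma')$ over the proper subdivisions $\Sigma'$ of $\Sigma$, $Z_*(\Sigma)=\bigoplus_kZ_k(\Sigma)$, and $Z_*(\overline\Sigma)=\bigoplus_{\tau\in\Sigma}Z_*(\operatorname{Star}(\tau))$. One has $Z_*(\Sigma)\subseteq Z_*(\overline\Sigma)$ by identifying $\Sigma$ with the star of its zero-dimensional cone. A morphism $f$ of weakly embedded cone complexes maps the stratum $\operatorname{Star}(\sigma)$ to $\operatorname{Star}(\delta)$, where $\delta$ is the minimal cone containing $f(\sigma)$. After suitable proper subdivisions it maps cones onto cones, and then $f_*$ is given on each stratum by $f_*c(\delta)=\sum_{\sigma\mapsto\delta}[N^\delta:f(N^\sigma)]\,c(\sigma)$,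 the sum being over the cones $\sigma$ of dimension $\dim\delta$ with image $\delta$. **Products.** A divisor is a function $\psi:|\Sigma|\to\mathbb R$ that is integral linear on every cone. It is *combinatorially principal* if for every $\sigma\in\Sigma$ there is $\psi_\sigma\in M^\Sigma$ with $\psi=\psi_\sigma\circ\phi$ on $\sigma$. Let $A\in Z_*(\Sigma)$ be represented by a Minkowski weight $c$ on a proper subdivision $\Sigma'$. * The *intersection product* is $\psi\cdot A=f_*\big(\sum_\rho\psi(u_\rho)[i_\rho^*c]\big)\in Z_*(\overline\Sigma)$, where $f:\overline{\Sigma'}\to\overline\Sigma$ is induced by the subdivision, $\rho$ runs over the rays of $\Sigma'$ with primitive generators $u_\rho$, and $i_\rho^*c$ is the weight $\sigma/\rho\mapsto c(\sigma)$ on $\operatorname{Star}_{\Sigma'}(\rho)$. * If $\psi$ is combinatorially principal, the *cup product* is $\psi\cup A=[\psi\cup c]\in Z_*(\Sigma)$, where $(\psi\cup c)(\tau)=\sum_{\sigma}(\psi_\sigma-\psi_\tau)(c(\sigma)u_{\sigma/\tau})$, the sum being over the cones $\sigma\succ\tau$ of $\Sigma'$ with $\dim\sigma=\dim\tau+1$.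 **Rational equivalence.** Let $\Pi^1$ be the complete fan in $\mathbb R$ (lattice $\mathbb Z$), $\psi_{\Pi^1}$ the identity on $\mathbb R$, and $p,q$ the projections of $\Sigma\times\Pi^1$ to $\Sigma$ and $\Pi^1$. For $\sigma\in\Sigma$ the function $q^*\psi_{\Pi^1}$ vanishes on $\sigma\times 0$ and so induces a divisor on $\operatorname{Star}(\sigma\times0)$. Let $R_*(\overline\Sigma)\subseteq Z_*(\overline\Sigma)$ be the subgroup generated by all $p_*(q^*\psi_{\Pi^1}\cdot B)$ with $\sigma\in\Sigma$ and $B\in Z_*(\operatorname{Star}(\sigma\times 0))$, and put $A_*(\overline\Sigma)=Z_*(\overline\Sigma)/R_*(\overline\Sigma)$. **Proposition.** Let $\Sigma$ be a weakly embedded cone complex, $A\in Z_*(\Sigma)$ a tropical cycle, and $\psi$ a combinatorially principal divisor on $\Sigma$. Then $$\psi\cup A=\psi\cdot A\qquad\text{in }A_*(\overline\Sigma),$$ whichever representing Minkowski weights are used to form the two products. -/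

import Mathlib

universe u v w u' v' w'

/-! ### Cones

An integral cone is a set `S` with a lattice `M` of real functions on it. A function on `S` is
stored as a function on an ambient type which vanishes off `S`. The topologies of cones and of cone
complexes are determined by these data (a cone has the topology of its image in `Hom(M, ℝ)`, and a
set in a complex is closed iff it meets each of the finitely many cones in a closed set), and
integral linear maps are continuous for them, so no topology is recorded. -/

/-- Restriction of a group of functions to a subset (functions are extended by zero). -/
noncomputable def restrictLattice {X : Type v} (T : Set X) (M : AddSubgroup (X → ℝ)) :
    AddSubgroup (X → ℝ) :=
  M.map (Set.indicatorHom ℝ T)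

/-- `(S, M)` is an integral cone: `M` is a finitely generated group of real functions on `S`, and
`x ↦ (m ↦ m x)` is a bijection of `S` onto a strongly convex cone in `Hom(M, ℝ)` that is generated
by finitely many vectors of the dual lattice `Hom(M, ℤ)`. -/
structure IsIntegralCone {X : Type v} (S : Set X) (M : AddSubgroup (X → ℝ)) : Prop where
  eq_zero_off : ∀ m ∈ M, ∀ x, x ∉ S → m x = 0
  fg : M.FG
  injOn : ∀ x ∈ S, ∀ y ∈ S, (∀ m ∈ M, m x = m y) → x = y
  polyhedral : ∃ U : Finset X,
    (∀ y ∈ U, y ∈ S ∧ ∀ m ∈ M, ∃ n : ℤ, m y = n) ∧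
    (∀ x ∈ S, ∃ a : X → ℝ, (∀ y, 0 ≤ a y) ∧ ∀ m ∈ M, m x = ∑ y ∈ U, a y * m y) ∧
    (∀ a : X → ℝ, (∀ y, 0 ≤ a y) → ∃ x ∈ S, ∀ m ∈ M, m x = ∑ y ∈ U, a y * m y)
  stronglyConvex : ∀ x ∈ S, ∀ y ∈ S, (∀ m ∈ M, m x + m y = 0) → ∀ m ∈ M, m x = 0

/-- `T` is a face of the cone `(S, M)`: the zero set of a non-negative function in `M`. -/
def IsFaceOf {X : Type v} (S : Set X) (M : AddSubgroup (X → ℝ)) (T : Set X) : Prop :=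
  ∃ m ∈ M, (∀ x ∈ S, 0 ≤ m x) ∧ T = {x | x ∈ S ∧ m x = 0}

/-! ### Weakly embedded cone complexes -/

/-- The data of a weakly embedded cone complex `Σ` with `|Σ| = X`, cones indexed by `ι`, and lattice
`N^Σ = Hom(L, ℤ)`, so that `L = M^Σ` and `N^Σ_ℝ = Hom(L, ℝ)`. The weak embedding `φ` is integral
linear on every cone. The axioms on the cones are in `WComplex.IsConeComplex`. -/
structure WComplex (ι : Type u) (X : Type v) (L : Type w) [AddCommGroup L] where
  /-- the cones, as subsets of `|Σ|` -/
  cone : ι → Set X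
  /-- the lattices `M^σ` -/
  M : ι → AddSubgroup (X → ℝ)
  /-- the weak embedding -/
  φ : X → (L →+ ℝ)
  φ_integral : ∀ (i : ι) (l : L), ∃ m ∈ M i, ∀ x ∈ cone i, φ x l = m x

namespace WComplex

section basic

variable {ι : Type u} {X : Type v} {L : Type w} [AddCommGroup L]

/-- The axioms of a cone complex: finitely many cones that cover `|Σ|`, closed under faces, such
that the intersection of two cones is a union of common faces. -/
structure IsConeComplex (K : WComplex ι X L) : Prop where
  finite : Finite ι
  isCone : ∀ i, IsIntegralCone (K.cone i) (K.M i)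
  cover : ∀ x, ∃ i, x ∈ K.cone i
  injective : Function.Injective K.cone
  face : ∀ i T, IsFaceOf (K.cone i) (K.M i) T →
    ∃ j, K.cone j = T ∧ K.M j = restrictLattice T (K.M i)
  inter : ∀ i j x, x ∈ K.cone i → x ∈ K.cone j →
    ∃ k, IsFaceOf (K.cone i) (K.M i) (K.cone k) ∧ IsFaceOf (K.cone j) (K.M j) (K.cone k) ∧
      x ∈ K.cone k

/-- `K'` is a proper subdivision of `K`: a cone complex with the same support and the same weak
embedding, every cone of which is a subcone of `K`. -/
def IsProperSubdivision {κ : Type u'} (K' : WComplex κ X L) (K : WComplex ι X L) : Prop :=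
  K'.IsConeComplex ∧ K'.φ = K.φ ∧
    ∀ j, ∃ i, K'.cone j ⊆ K.cone i ∧ K'.M j = restrictLattice (K'.cone j) (K.M i)

/-- The dimension of a cone. -/
noncomputable def dim (K : WComplex ι X L) (i : ι) : ℕ := Module.finrank ℤ (K.M i)

/-- Divisors: functions on `|Σ|` that are integral linear on all cones. -/
def IsDivisor (K : WComplex ι X L) (ψ : X → ℝ) : Prop :=
  ∀ i, ∃ m ∈ K.M i, ∀ x ∈ K.cone i, ψ x = m x

/-- Combinatorially principal divisors: induced by an element of `M^Σ` on each cone. -/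
def IsCPDivisor (K : WComplex ι X L) (ψ : X → ℝ) : Prop :=
  ∀ i, ∃ l : L, ∀ x ∈ K.cone i, ψ x = K.φ x l

/-! ### Stars -/

/-- Pairs `(σ, x)` of a cone `σ` containing `τ` and a point `x ∈ σ`. -/
def StarPre (K : WComplex ι X L) (τ : ι) : Type (max u v) :=
  {p : ι × X // K.cone τ ⊆ K.cone p.1 ∧ p.2 ∈ K.cone p.1}

/-- `(σ, x)` and `(σ', x')` are identified if `σ'` is a face of `σ` and `x`, `x'` have the same image
in `σ/τ`, that is, every `m ∈ M^σ` that vanishes on `τ` has the same value at both. -/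
def starRel (K : WComplex ι X L) (τ : ι) (p q : K.StarPre τ) : Prop :=
  K.cone q.1.1 ⊆ K.cone p.1.1 ∧
    ∀ m ∈ K.M p.1.1, (∀ t ∈ K.cone τ, m t = 0) → m p.1.2 = m q.1.2

/-- The space `|Star(τ)|`, glued from the cones `σ/τ` along the face inclusions. -/
def StarPoint (K : WComplex ι X L) (τ : ι) : Type (max u v) := Quot (K.starRel τ)

/-- The point of `|Star(τ)|` defined by a cone `σ ⊇ τ` and `x ∈ σ`. -/
def starMk (K : WComplex ι X L) (τ i : ι) (x : X) (h : K.cone τ ⊆ K.cone i) (hx : x ∈ K.cone i) :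
    K.StarPoint τ :=
  Quot.mk _ ⟨(i, x), h, hx⟩

/-- A divisor that vanishes on `τ` descends to `Star(τ)`. -/
def starFun (K : WComplex ι X L) (τ : ι) (ψ : X → ℝ) (hψ : K.IsDivisor ψ)
    (h0 : ∀ t ∈ K.cone τ, ψ t = 0) : K.StarPoint τ → ℝ :=
  Quot.lift (fun p => ψ p.1.2) (by
    intro p q hpq
    obtain ⟨m, hm, hmx⟩ := hψ p.1.1
    rw [hmx _ p.2.2, hmx _ (hpq.1 q.2.2)]
    exact hpq.2 m hm fun t ht => by rw [← hmx t (p.2.1 ht), h0 t ht])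

/-- `τ^⊥ ⊆ M^Σ`, the lattice dual to `N^Σ / N^Σ_τ`. -/
def perp (K : WComplex ι X L) (τ : ι) : AddSubgroup L where
  carrier := {l | ∀ t ∈ K.cone τ, K.φ t l = 0}
  zero_mem' := fun t _ => map_zero _
  add_mem' := fun {a b} ha hb t ht => by rw [map_add, ha t ht, hb t ht, add_zero]
  neg_mem' := fun {a} ha t ht => by rw [map_neg, ha t ht, neg_zero]

/-- The weak embedding of the star, `|Star(τ)| → (N^Σ / N^Σ_τ)_ℝ = Hom(τ^⊥, ℝ)`. -/
def starφ (K : WComplex ι X L) (τ : ι) : K.StarPoint τ → (K.perp τ →+ ℝ) :=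
  Quot.lift (fun p => (K.φ p.1.2).comp (K.perp τ).subtype) (by
    intro p q hpq
    ext l
    obtain ⟨m, hm, hmx⟩ := K.φ_integral p.1.1 l.1
    change K.φ p.1.2 l.1 = K.φ q.1.2 l.1
    rw [hmx _ p.2.2, hmx _ (hpq.1 q.2.2)]
    exact hpq.2 m hm fun t ht => by rw [← hmx t (p.2.1 ht), l.2 t ht])

/-- The cone `σ/τ` as a subset of `|Star(τ)|`. -/
def starCone (K : WComplex ι X L) (τ : ι) (i : {i : ι // K.cone τ ⊆ K.cone i}) :
    Set (K.StarPoint τ) :=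
  {q | ∃ (x : X) (hx : x ∈ K.cone i.1), q = K.starMk τ i.1 x i.2 hx}

/-- The lattice of `σ/τ`: the functions induced by those `m ∈ M^σ` that vanish on `τ`. -/
def starM (K : WComplex ι X L) (τ : ι) (i : {i : ι // K.cone τ ⊆ K.cone i}) :
    AddSubgroup (K.StarPoint τ → ℝ) where
  carrier := {g | (∀ q, q ∉ K.starCone τ i → g q = 0) ∧
    ∃ m ∈ K.M i.1, (∀ t ∈ K.cone τ, m t = 0) ∧
      ∀ (x : X) (hx : x ∈ K.cone i.1), g (K.starMk τ i.1 x i.2 hx) = m x}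
  zero_mem' := ⟨fun _ _ => rfl, 0, zero_mem _, fun _ _ => rfl, fun _ _ => rfl⟩
  add_mem' := by
    rintro a b ⟨ha, m, hm, hm0, hma⟩ ⟨hb, n, hn, hn0, hnb⟩
    refine ⟨fun q hq => ?_, m + n, add_mem hm hn, fun t ht => ?_, fun x hx => ?_⟩
    · rw [Pi.add_apply, ha q hq, hb q hq, add_zero]
    · rw [Pi.add_apply, hm0 t ht, hn0 t ht, add_zero]
    · rw [Pi.add_apply, Pi.add_apply, hma x hx, hnb x hx]
  neg_mem' := by
    rintro a ⟨ha, m, hm, hm0, hma⟩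
    refine ⟨fun q hq => ?_, -m, neg_mem hm, fun t ht => ?_, fun x hx => ?_⟩
    · rw [Pi.neg_apply, ha q hq, neg_zero]
    · rw [Pi.neg_apply, hm0 t ht, neg_zero]
    · rw [Pi.neg_apply, Pi.neg_apply, hma x hx]

open Classical in
/-- The star of `Σ` at `τ`, as a weakly embedded cone complex. -/
def star (K : WComplex ι X L) (τ : ι) :
    WComplex {i : ι // K.cone τ ⊆ K.cone i} (K.StarPoint τ) (K.perp τ) where
  cone := K.starCone τ
  M := K.starM τ
  φ := K.starφ τ
  φ_integral := by
    intro i l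
    obtain ⟨m, hm, hmx⟩ := K.φ_integral i.1 l.1
    refine ⟨fun q => if q ∈ K.starCone τ i then K.starφ τ q l else 0,
      ⟨fun q hq => if_neg hq, m, hm, fun t ht => ?_, fun x hx => ?_⟩, fun q hq => ?_⟩
    · rw [← hmx t (i.2 ht), l.2 t ht]
    · have hq : K.starMk τ i.1 x i.2 hx ∈ K.starCone τ i := ⟨x, hx, rfl⟩
      simp only [if_pos hq]
      exact hmx x hx
    · simp only [if_pos hq]

/-! ### Minkowski weights and tropical cycles -/

/-- A representative in `N^Σ = Hom(L, ℤ)` of the lattice normal vector `u_{σ/τ} ∈ N^Σ / N^Σ_τ`: the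
image under the weak embedding of a lattice point `x` of `σ` that generates `N^σ/N^τ`. (As `τ` has
codimension one, `x` generates iff some `m ∈ M^σ` vanishing on `τ` has `m x = 1`.) -/
noncomputable def normalVector (K : WComplex ι X L) (σ τ : ι) : L →+ ℤ :=
  Classical.epsilon fun n : L →+ ℤ =>
    ∃ x ∈ K.cone σ, (∀ m ∈ K.M σ, ∃ k : ℤ, m x = k) ∧
      (∃ m ∈ K.M σ, (∀ t ∈ K.cone τ, m t = 0) ∧ m x = 1) ∧ ∀ l : L, K.φ x l = (n l : ℝ)

/-- The cones that contain `τ` as a face of codimension one. -/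
def cofacets (K : WComplex ι X L) (τ : ι) : Set ι :=
  {σ | K.cone τ ⊆ K.cone σ ∧ K.dim σ = K.dim τ + 1}

/-- `c ∈ Mink_*(Σ) = ⨁_k Mink_k(Σ)`: an integer for each cone, such that around every cone `τ` the
sum of `c(σ) u_{σ/τ}` over the `σ` of one dimension more vanishes in
`N^Σ / N^Σ_τ = Hom(τ^⊥, ℤ)`. The part of `c` on the `k`-dimensional cones is its component in
`Mink_k(Σ)`. -/
def IsMinkowskiWeight (K : WComplex ι X L) (c : ι → ℤ) : Prop :=
  ∀ τ, ∀ l ∈ K.perp τ, ∑ᶠ σ ∈ K.cofacets τ, c σ * K.normalVector σ τ l = 0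

/-- The group of values at `x` of the functions in `M^σ`, for a cone `σ` containing `x` (all such
`σ` give the same group). It is the lattice dual to `N^σ ∩ V`, where `V` is the smallest rational
subspace of `N^σ_ℝ` containing `x`. -/
def valueGroup (K : WComplex ι X L) (x : X) : AddSubgroup ℝ :=
  AddSubgroup.closure {r | ∃ i, x ∈ K.cone i ∧ ∃ m ∈ K.M i, r = m x}

/-- The class of a weight `c` modulo refinement, as a function on `|Σ|`. It has the value `c(σ)` at
the points of `σ` that lie in no proper rational subspace of `N^σ_ℝ`, that is, whose value group has
rank `dim σ`. Such points are dense in `σ` and lie on no other cone of dimension at most `dim σ`, so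
two weights on two proper subdivisions give the same function if and only if they induce the same
weight on the common refinements. -/
noncomputable def weightClass (K : WComplex ι X L) (c : ι → ℤ) (x : X) : ℤ :=
  ∑ᶠ i ∈ {i | x ∈ K.cone i ∧ Module.finrank ℤ (K.valueGroup x) = K.dim i}, c i

/-- The cycle `A` is represented by the Minkowski weight `c` on the proper subdivision `K'`. -/
def Represents (K : WComplex ι X L) {κ : Type u} (K' : WComplex κ X L) (c : κ → ℤ)
    (A : X → ℤ) : Prop :=
  K'.IsProperSubdivision K ∧ K'.IsMinkowskiWeight c ∧ A = K'.weightClass c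

/-- `Z_*(Σ)`, the direct limit of `Mink_*(Σ')` over the proper subdivisions `Σ'` of `Σ`. -/
def cycles (K : WComplex ι X L) : Set (X → ℤ) :=
  {A | ∃ (κ : Type u) (K' : WComplex κ X L) (c : κ → ℤ), K.Represents K' c A}

/-! ### The extended complex -/

/-- The extended complex, the disjoint union of the stars of all cones. -/
def ExtPoint (K : WComplex ι X L) : Type (max u v) := Σ τ : ι, K.StarPoint τ

/-- The value group of a point of the extended complex. -/
def extValueGroup (K : WComplex ι X L) (e : K.ExtPoint) : AddSubgroup ℝ :=
  (K.star e.1).valueGroup e.2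

/-- `Z_*(Σ̄) = ⨁_σ Z_*(Star(σ))`. -/
def extCycles (K : WComplex ι X L) : AddSubgroup (K.ExtPoint → ℤ) :=
  AddSubgroup.closure {B | ∀ τ, (fun q => B ⟨τ, q⟩) ∈ (K.star τ).cycles}

end basic

/-! ### Push-forwards -/

/-- Push-forward of weights along the map with graph `F`: at a point `y` of rank `k`, the sum over
the preimages `x` of rank `k` of the weight at `x` times the lattice index. On a `k`-dimensional
cone `σ` mapping injectively onto `δ`, the value groups of `x` and `y` are `M^σ` and `M^δ`, with the
index `[M^σ : f^* M^δ] = [N^δ : f(N^σ)]`. -/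
noncomputable def pushforward {α : Type u} {β : Type v} (Vα : α → AddSubgroup ℝ)
    (Vβ : β → AddSubgroup ℝ) (F : α → β → Prop) (a : α → ℤ) (y : β) : ℤ :=
  ∑ᶠ x ∈ {x | F x y ∧ Module.finrank ℤ (Vα x) = Module.finrank ℤ (Vβ y)},
    ((Vβ y).relIndex (Vα x) : ℤ) * a x

section maps

variable {ι : Type u} {X : Type v} {L : Type w} [AddCommGroup L]
  {κ : Type u'} {Y : Type v'} {L' : Type w'} [AddCommGroup L']

/-- The graph of the map of extended complexes induced by a morphism `f` of cone complexes. The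
stratum `Star(σ)` is mapped to `Star(δ)`, where `δ` is the minimal cone containing `f(σ)`, and the
class of `x ∈ γ` is mapped to that of `f x` in any cone containing `f(γ)`. -/
def extMap (K : WComplex ι X L) (D : WComplex κ Y L') (f : X → Y) (e : K.ExtPoint)
    (e' : D.ExtPoint) : Prop :=
  (f '' K.cone e.1 ⊆ D.cone e'.1 ∧ ∀ j, f '' K.cone e.1 ⊆ D.cone j → D.cone e'.1 ⊆ D.cone j) ∧
  ∃ (i : ι) (x : X) (hi : K.cone e.1 ⊆ K.cone i) (hx : x ∈ K.cone i)
    (j : κ) (hj : D.cone e'.1 ⊆ D.cone j) (hy : f x ∈ D.cone j),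
    f '' K.cone i ⊆ D.cone j ∧ e.2 = K.starMk e.1 i x hi hx ∧ e'.2 = D.starMk e'.1 j (f x) hj hy

/-- The graph of the inclusion of the extended complex of `Star(τ)` into that of `Σ`. It identifies
`Star_{Star(τ)}(σ/τ)` with `Star(σ)`. -/
def starIncl (K : WComplex ι X L) (τ : ι) (e : (K.star τ).ExtPoint) (e' : K.ExtPoint) : Prop :=
  e'.1 = e.1.1 ∧
  ∃ (i : {i : ι // K.cone τ ⊆ K.cone i}) (x : X) (hx : x ∈ K.cone i.1)
    (h : (K.star τ).cone e.1 ⊆ (K.star τ).cone i) (h' : K.cone e'.1 ⊆ K.cone i.1),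
    e.2 = (K.star τ).starMk e.1 i (K.starMk τ i.1 x i.2 hx) h ⟨x, hx, rfl⟩ ∧
    e'.2 = K.starMk e'.1 i.1 x h' hx

/-- The graph of the inclusion of `|Σ|` into the extended complex, which identifies `Σ` with the
star of its zero-dimensional cone. -/
def finiteIncl (K : WComplex ι X L) (x : X) (e : K.ExtPoint) : Prop :=
  K.dim e.1 = 0 ∧
  ∃ (i : ι) (h : K.cone e.1 ⊆ K.cone i) (hx : x ∈ K.cone i), e.2 = K.starMk e.1 i x h hx

/-- The inclusion `Z_*(Σ) → Z_*(Σ̄)`. -/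
noncomputable def finitePart (K : WComplex ι X L) (A : X → ℤ) : K.ExtPoint → ℤ :=
  pushforward K.valueGroup K.extValueGroup K.finiteIncl A

/-! ### Products with divisors -/

/-- `ψ(u_ρ)` for the primitive generator `u_ρ` of a ray `ρ`. -/
noncomputable def raySlope (K : WComplex ι X L) (ψ : X → ℝ) (ρ : ι) : ℤ :=
  Classical.epsilon fun n : ℤ =>
    ∃ x ∈ K.cone ρ, (∀ m ∈ K.M ρ, ∃ k : ℤ, m x = k) ∧ (∃ m ∈ K.M ρ, m x = 1) ∧ ψ x = (n : ℝ)

open Classical in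
/-- `ψ · c = ∑_ρ ψ(u_ρ) [i_ρ^* c]`, the sum being over the rays of `Σ`, where `i_ρ^* c` is the weight
`σ/ρ ↦ c(σ)` on `Star(ρ)`. -/
noncomputable def weightInter (K : WComplex ι X L) (ψ : X → ℝ) (c : ι → ℤ) (e : K.ExtPoint) : ℤ :=
  if K.dim e.1 = 1 then
    K.raySlope ψ e.1 * (K.star e.1).weightClass (fun i => c i.1) e.2
  else 0

/-- `C` is the intersection product `ψ · A`: the push-forward to `Σ̄` of `ψ · c`, for a Minkowski
weight `c` on a proper subdivision that represents `A`. -/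
def IsIntersectionProduct (K : WComplex ι X L) (ψ : X → ℝ) (A : X → ℤ) (C : K.ExtPoint → ℤ) :
    Prop :=
  ∃ (κ : Type u) (K' : WComplex κ X L) (c : κ → ℤ), K.Represents K' c A ∧
    C = pushforward K'.extValueGroup K.extValueGroup (extMap K' K id) (K'.weightInter ψ c)

/-- A linear function `ψ_σ ∈ M^Σ` with `ψ_σ ∘ φ = ψ` on `σ`. -/
noncomputable def localEquation (K : WComplex ι X L) (ψ : X → ℝ) (i : ι) : L :=
  Classical.epsilon fun l : L => ∀ x ∈ K.cone i, ψ x = K.φ x l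

/-- The weight `ψ ∪ c : τ ↦ ∑_σ (ψ_σ - ψ_τ)(c(σ) u_{σ/τ})`. -/
noncomputable def weightCup (K : WComplex ι X L) (ψ : X → ℝ) (c : ι → ℤ) (τ : ι) : ℤ :=
  ∑ᶠ σ ∈ K.cofacets τ,
    c σ * K.normalVector σ τ (K.localEquation ψ σ - K.localEquation ψ τ)

/-- `B` is the cup product `ψ ∪ A = [ψ ∪ c]`, for a Minkowski weight `c` on a proper subdivision
that represents `A`. -/
def IsCupProduct (K : WComplex ι X L) (ψ : X → ℝ) (A B : X → ℤ) : Prop :=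
  ∃ (κ : Type u) (K' : WComplex κ X L) (c : κ → ℤ), K.Represents K' c A ∧
    B = K'.weightClass (K'.weightCup ψ c)

/-! ### Rational equivalence -/

/-- The product of two weakly embedded cone complexes. -/
noncomputable def prod (K : WComplex ι X L) (D : WComplex κ Y L') :
    WComplex (ι × κ) (X × Y) (L × L') where
  cone p := K.cone p.1 ×ˢ D.cone p.2
  M p :=
    { carrier := {g | ∃ m ∈ K.M p.1, ∃ n ∈ D.M p.2,
        g = (K.cone p.1 ×ˢ D.cone p.2).indicator (fun z => m z.1 + n z.2)}
      zero_mem' := ⟨0, zero_mem _, 0, zero_mem _, by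
        ext z
        by_cases hz : z ∈ K.cone p.1 ×ˢ D.cone p.2
        · simp [Set.indicator_of_mem hz]
        · simp [Set.indicator_of_notMem hz]⟩
      add_mem' := by
        rintro _ _ ⟨m, hm, n, hn, rfl⟩ ⟨m', hm', n', hn', rfl⟩
        refine ⟨m + m', add_mem hm hm', n + n', add_mem hn hn', ?_⟩
        ext z
        by_cases hz : z ∈ K.cone p.1 ×ˢ D.cone p.2
        · simp only [Pi.add_apply, Set.indicator_of_mem hz]
          ring
        · simp only [Pi.add_apply, Set.indicator_of_notMem hz, add_zero]
      neg_mem' := by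
        rintro _ ⟨m, hm, n, hn, rfl⟩
        refine ⟨-m, neg_mem hm, -n, neg_mem hn, ?_⟩
        ext z
        by_cases hz : z ∈ K.cone p.1 ×ˢ D.cone p.2
        · simp only [Pi.neg_apply, Set.indicator_of_mem hz]
          ring
        · simp only [Pi.neg_apply, Set.indicator_of_notMem hz, neg_zero] }
  φ z := (K.φ z.1).coprod (D.φ z.2)
  φ_integral := by
    rintro p ⟨l, l'⟩
    obtain ⟨m, hm, hmx⟩ := K.φ_integral p.1 l
    obtain ⟨n, hn, hnx⟩ := D.φ_integral p.2 l'
    refine ⟨_, ⟨m, hm, n, hn, rfl⟩, fun z hz => ?_⟩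
    rw [Set.indicator_of_mem hz, AddMonoidHom.coprod_apply, hmx z.1 hz.1, hnx z.2 hz.2]

/-- The cones of `Π¹`. -/
def lineCone : SignType → Set ℝ
  | SignType.zero => {0}
  | SignType.neg => Set.Iic 0
  | SignType.pos => Set.Ici 0

/-- `Π¹`: the complete fan in `ℝ` with cones `{0}`, `ℝ_{≤0}`, `ℝ_{≥0}` and the lattice `ℤ`. -/
noncomputable def line : WComplex SignType ℝ ℤ where
  cone := lineCone
  M s := restrictLattice (lineCone s) (AddSubgroup.zmultiples (id : ℝ → ℝ))
  φ t := (AddMonoidHom.mulRight t).comp (Int.castAddHom ℝ)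
  φ_integral := by
    intro s n
    refine ⟨_, ⟨n • id, ⟨n, rfl⟩, rfl⟩, fun t ht => ?_⟩
    simp [Set.indicatorHom, Set.indicator_of_mem ht]

/-- The pull-back of the divisor `ψ_{Π¹} = id` along the projection `q : Σ × Π¹ → Π¹`. -/
theorem isDivisor_snd (K : WComplex ι X L) :
    (K.prod line).IsDivisor (Prod.snd : X × ℝ → ℝ) := by
  intro p
  refine ⟨_, ⟨0, zero_mem _, _, ⟨id, ⟨1, one_smul _ _⟩, rfl⟩, rfl⟩, fun z hz => ?_⟩
  have hz2 : z.2 ∈ lineCone p.2 := hz.2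
  have hz' : z ∈ K.cone p.1 ×ˢ line.cone p.2 := hz
  rw [Set.indicator_of_mem hz']
  simp [Set.indicatorHom, Set.indicator_of_mem hz2]

/-- The function induced by `q^* ψ_{Π¹}` on `Star(σ × 0)`. -/
noncomputable def coordinate (K : WComplex ι X L) (σ : ι) :
    (K.prod line).StarPoint (σ, SignType.zero) → ℝ :=
  (K.prod line).starFun (σ, SignType.zero) Prod.snd K.isDivisor_snd (fun _ ht => ht.2)

/-- `R_*(Σ̄)`, generated by the cycles `p_*(q^* ψ_{Π¹} · A)` for `A ∈ Z_*(Star(σ × 0))`, `σ ∈ Σ`,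
where `p`, `q` are the projections of `Σ × Π¹`. -/
noncomputable def ratEquivZero (K : WComplex ι X L) : AddSubgroup (K.ExtPoint → ℤ) :=
  AddSubgroup.closure {B | ∃ (σ : ι)
    (A : (K.prod line).StarPoint (σ, SignType.zero) → ℤ)
    (C : ((K.prod line).star (σ, SignType.zero)).ExtPoint → ℤ),
    A ∈ ((K.prod line).star (σ, SignType.zero)).cycles ∧
    ((K.prod line).star (σ, SignType.zero)).IsIntersectionProduct (K.coordinate σ) A C ∧
    B = pushforward (K.prod line).extValueGroup K.extValueGroup
          (extMap (K.prod line) K Prod.fst)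
          (pushforward ((K.prod line).star (σ, SignType.zero)).extValueGroup
            (K.prod line).extValueGroup (starIncl (K.prod line) (σ, SignType.zero)) C)}

/-- The class modulo tropical rational equivalence of an integral function on the extended
complex. -/
noncomputable def chowClass (K : WComplex ι X L) :
    (K.ExtPoint → ℤ) →+ (K.ExtPoint → ℤ) ⧸ K.ratEquivZero :=
  QuotientAddGroup.mk' K.ratEquivZero

/-- The Chow group `A_*(Σ̄) = Z_*(Σ̄) / R_*(Σ̄)`, as the group of classes of cycles. -/
noncomputable def chow (K : WComplex ι X L) :
    AddSubgroup ((K.ExtPoint → ℤ) ⧸ K.ratEquivZero) :=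
  K.extCycles.map K.chowClass

end maps

end WComplex

/-! ### Ranks of finitely generated groups of real functions -/

/-! The difference of the two products is realised by intersecting one cycle on `Σ × Π¹` with the
height function `q^*ψ_{Π¹}`. Put the weight `c` on the graph of `ψ` in `|Σ| × ℝ`. The graph bends
along the cones of codimension one, so it need not be balanced; over a cone `τ` the sum of the
weighted normal vectors misses zero by the vertical vector of length `(ψ ∪ c)(τ)`. Filling the
region below the graph with the weight `ψ ∪ c` cancels this defect. Balancing along the filled
region itself asks that `ψ ∪ c` be a Minkowski weight. Now take the product with the height. A ray
of the graph lying over a ray `ρ` has slope `ψ(u_ρ)`, so after projection these rays produce `ψ ·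
c`. The only other rays with a contribution are the vertical ones pointing down; they have slope
`-1`, and their stars carry `ψ ∪ c`. Hence the projection is `ψ · c - ψ ∪ c`, and this lies in
`R_*`.

`isMinkowskiWeight_weightCup` shows that `ψ ∪ c` is balanced. The sum over flags `δ ⊂ τ ⊂ σ` is
antisymmetric, and between `δ` and `σ` there are exactly two cones (`exists_two_facets`), whose
flags have opposite orientation (`flag_wedge_add_eq_zero`). `isMinkowskiWeight_graphWeight` is the
balancing of the filled graph.

The graph is handled in sheared coordinates: `graphComplex` has the cones of the product, with `Σ ×
0` playing the role of the graph and `ψ` moved into the weak embedding. This complex is not a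
subdivision of `Σ × Π¹`, since its cones can cross height zero. It is therefore cut along the zero
set of the height (`split`, with `isMinkowskiWeight_splitWeight` for the weight) and transported
back by `shear`; the result is the proper subdivision `graphSubdivision`. The cut creates new rays,
but `pushforward_weightInter_eq` says that the push-forward of an intersection product only depends
on the class of the weight, so `pushforward_graph` can be computed on the uncut complex. The same
lemma settles the independence of `ψ · A` from the representing weight.

That independence is proved by comparing strata of rays. From a generic point `x` in the star of a
ray with generator `u`, move along `x + s u`. For large `s` the points repeatedly meet one cone of
the other subdivision, and this cone contains `u`. Either the ray of `u` occurs in both subdivisions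
with the same weights, or the projection of its stratum loses rank and contributes nothing.

Weights modulo refinement are functions on points, and genericity of a point is expressed by the
rank of its value group, so push-forwards become sums over points with equal rank. Finally, `|Σ|`
may have several zero-dimensional cones. The relation is built on the star of each of them, and
since every cone contains exactly one, the sum of these relations is the global one
(`sub_finitePart_mem_ratEquivZero`). -/

theorem AddSubgroup.FG.moduleFinite {G : Type u} [AddCommGroup G] {P : AddSubgroup G} (hP : P.FG) :
    Module.Finite ℤ P := by
  have : AddGroup.FG P := (AddGroup.fg_iff_addSubgroup_fg P).2 hP
  exact Module.Finite.iff_addGroup_fg.2 this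

theorem finrank_map_add_finrank_inf_ker {G : Type u} {B : Type v} [AddCommGroup G] [AddCommGroup B]
    {P : AddSubgroup G} (hP : P.FG) (f : G →+ B) :
    Module.finrank ℤ (P.map f) + Module.finrank ℤ (P ⊓ f.ker : AddSubgroup G) =
      Module.finrank ℤ P := by
  have := hP.moduleFinite
  have hfg := Submodule.finrank_quotient_add_finrank
    (LinearMap.ker ((f.comp P.subtype).toIntLinearMap))
  rw [← hfg]
  congr 1
  · rw [((f.comp P.subtype).toIntLinearMap).quotKerEquivRange.finrank_eq]
    refine LinearEquiv.finrank_eq (AddEquiv.toIntLinearEquiv ?_)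
    exact
      { toFun := fun x => ⟨x.1, by
          obtain ⟨y, hy, hyx⟩ := x.2
          exact ⟨⟨y, hy⟩, hyx⟩⟩
        invFun := fun x => ⟨x.1, by
          obtain ⟨y, hyx⟩ := x.2
          exact ⟨y.1, y.2, hyx⟩⟩
        left_inv := fun x => rfl
        right_inv := fun x => rfl
        map_add' := fun x y => rfl }
  · refine LinearEquiv.finrank_eq (AddEquiv.toIntLinearEquiv ?_)
    exact
      { toFun := fun x => ⟨⟨x.1, x.2.1⟩, x.2.2⟩
        invFun := fun x => ⟨x.1.1, x.1.2, x.2⟩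
        left_inv := fun x => rfl
        right_inv := fun x => rfl
        map_add' := fun x y => rfl }

theorem AddSubgroup.FG.map_addMonoidHom {G : Type u} {B : Type v} [AddCommGroup G] [AddCommGroup B]
    {P : AddSubgroup G} (hP : P.FG) (f : G →+ B) : (P.map f).FG := by
  rw [AddSubgroup.fg_iff_addSubmonoid_fg] at hP ⊢
  exact AddSubmonoid.FG.map hP f

theorem AddSubgroup.FG.of_le {G : Type u} [AddCommGroup G] {P Q : AddSubgroup G} (hQ : Q.FG)
    (h : P ≤ Q) : P.FG := by
  have := hQ.moduleFinite
  have h1 : (AddSubgroup.toIntSubmodule (P.addSubgroupOf Q)).FG := IsNoetherian.noetherian _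
  have h2 : (P.addSubgroupOf Q).FG := by
    rw [← AddSubgroup.toIntSubmodule_toAddSubgroup (P.addSubgroupOf Q)]
    exact (Submodule.fg_iff_addSubgroup_fg _).1 h1
  have h3 := h2.map_addMonoidHom Q.subtype
  rwa [AddSubgroup.addSubgroupOf_map_subtype, inf_eq_left.2 h] at h3

theorem AddSubgroup.FG.finrank_mono {G : Type u} [AddCommGroup G] {P Q : AddSubgroup G} (hQ : Q.FG)
    (h : P ≤ Q) : Module.finrank ℤ P ≤ Module.finrank ℤ Q := by
  have := hQ.moduleFinite
  exact LinearMap.finrank_le_finrank_of_injective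
    (f := (AddSubgroup.inclusion h).toIntLinearMap) (AddSubgroup.inclusion_injective h)

theorem AddSubgroup.FG.eq_bot_of_finrank_eq_zero {G : Type u} [AddCommGroup G]
    [Module.IsTorsionFree ℤ G] {P : AddSubgroup G} (hP : P.FG) (h : Module.finrank ℤ P = 0) :
    P = ⊥ := by
  have := hP.moduleFinite
  have : Module.IsTorsionFree ℤ P :=
    Function.Injective.moduleIsTorsionFree (Subtype.val : P → G) Subtype.val_injective
      (fun n x => rfl)
  have h2 := Module.finrank_zero_iff.1 h
  exact (AddSubgroup.eq_bot_iff_forall _).2 fun x hx =>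
    congrArg Subtype.val (Subsingleton.elim (⟨x, hx⟩ : P) 0)

/-- The functions in `M` that vanish on `T`. -/
def ann {X : Type v} (M : AddSubgroup (X → ℝ)) (T : Set X) : AddSubgroup (X → ℝ) where
  carrier := {m | m ∈ M ∧ ∀ t ∈ T, m t = 0}
  zero_mem' := ⟨zero_mem _, fun _ _ => rfl⟩
  add_mem' := fun {a b} ha hb => ⟨add_mem ha.1 hb.1, fun t ht => by
    rw [Pi.add_apply, ha.2 t ht, hb.2 t ht, add_zero]⟩
  neg_mem' := fun {a} ha => ⟨neg_mem ha.1, fun t ht => by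
    rw [Pi.neg_apply, ha.2 t ht, neg_zero]⟩

/-- The values at `x` of the functions in `M`. -/
def valuesAt {X : Type v} (M : AddSubgroup (X → ℝ)) (x : X) : AddSubgroup ℝ :=
  M.map (Pi.evalAddMonoidHom (fun _ => ℝ) x)

section Lattice

variable {X : Type v} {M : AddSubgroup (X → ℝ)}

theorem mem_ann {T : Set X} {m : X → ℝ} : m ∈ ann M T ↔ m ∈ M ∧ ∀ t ∈ T, m t = 0 := Iff.rfl

theorem ann_le (T : Set X) : ann M T ≤ M := fun _ hm => hm.1

theorem mem_restrictLattice {T : Set X} {g : X → ℝ} :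
    g ∈ restrictLattice T M ↔ ∃ m ∈ M, T.indicator m = g := Iff.rfl

theorem exists_of_mem_restrictLattice {T : Set X} {g : X → ℝ} (hg : g ∈ restrictLattice T M) :
    ∃ m ∈ M, ∀ x ∈ T, g x = m x := by
  obtain ⟨m, hm, rfl⟩ := mem_restrictLattice.1 hg
  exact ⟨m, hm, fun x hx => Set.indicator_of_mem hx m⟩

theorem exists_restrict {m : X → ℝ} (hm : m ∈ M) (T : Set X) :
    ∃ g ∈ restrictLattice T M, ∀ x ∈ T, g x = m x :=
  ⟨_, mem_restrictLattice.2 ⟨m, hm, rfl⟩, fun _ hx => Set.indicator_of_mem hx m⟩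

theorem restrictLattice_restrictLattice {S T : Set X} (h : T ⊆ S) :
    restrictLattice T (restrictLattice S M) = restrictLattice T M := by
  have key : ∀ m : X → ℝ, T.indicator (S.indicator m) = T.indicator m := fun m => by
    rw [Set.indicator_indicator, Set.inter_eq_left.2 h]
  ext g
  simp only [mem_restrictLattice]
  constructor
  · rintro ⟨_, ⟨m, hm, rfl⟩, rfl⟩
    exact ⟨m, hm, (key m).symm⟩
  · rintro ⟨m, hm, rfl⟩
    exact ⟨_, ⟨m, hm, rfl⟩, key m⟩

theorem restrictLattice_self {S : Set X} (h : ∀ m ∈ M, ∀ x, x ∉ S → m x = 0) :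
    restrictLattice S M = M := by
  have key : ∀ m ∈ M, S.indicator m = m := fun m hm => by
    ext x
    by_cases hx : x ∈ S
    · rw [Set.indicator_of_mem hx]
    · rw [Set.indicator_of_notMem hx, h m hm x hx]
  ext g
  rw [mem_restrictLattice]
  exact ⟨fun ⟨m, hm, h⟩ => h ▸ (key m hm).symm ▸ hm, fun hg => ⟨g, hg, key g hg⟩⟩

theorem ann_fg (hM : M.FG) (T : Set X) : (ann M T).FG := hM.of_le (ann_le T)

theorem valuesAt_fg (hM : M.FG) (x : X) : (valuesAt M x).FG := hM.map_addMonoidHom _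

theorem restrictLattice_fg (hM : M.FG) (T : Set X) : (restrictLattice T M).FG :=
  hM.map_addMonoidHom _

theorem finrank_restrictLattice_add (hM : M.FG) (T : Set X) :
    Module.finrank ℤ (restrictLattice T M) + Module.finrank ℤ (ann M T) = Module.finrank ℤ M := by
  have : ann M T = M ⊓ (Set.indicatorHom ℝ T).ker := by
    ext m
    rw [mem_ann, AddSubgroup.mem_inf, AddMonoidHom.mem_ker]
    refine and_congr_right fun _ => ⟨fun h => ?_, fun h t ht => ?_⟩
    · ext x
      by_cases hx : x ∈ T
      · exact (Set.indicator_of_mem hx m).trans (h x hx)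
      · exact Set.indicator_of_notMem hx m
    · exact (Set.indicator_of_mem ht m).symm.trans (congrFun h t)
  rw [this]
  exact finrank_map_add_finrank_inf_ker hM (Set.indicatorHom ℝ T)

theorem finrank_valuesAt_add (hM : M.FG) (x : X) :
    Module.finrank ℤ (valuesAt M x) + Module.finrank ℤ (ann M {x}) = Module.finrank ℤ M := by
  have : ann M {x} = M ⊓ (Pi.evalAddMonoidHom (fun _ => ℝ) x).ker := by
    ext m
    rw [mem_ann, AddSubgroup.mem_inf, AddMonoidHom.mem_ker]
    simp
  rw [this]
  exact finrank_map_add_finrank_inf_ker hM (Pi.evalAddMonoidHom (fun _ => ℝ) x)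

theorem finrank_valuesAt_le (hM : M.FG) (x : X) :
    Module.finrank ℤ (valuesAt M x) ≤ Module.finrank ℤ M := by
  rw [← finrank_valuesAt_add hM x]
  exact Nat.le_add_right _ _

/-- The kernel of evaluation at `x` has rank zero only if it is trivial, because real functions are
torsion free. This is the working form of genericity of a point in a cone. -/
theorem finrank_valuesAt_eq_iff (hM : M.FG) (x : X) :
    Module.finrank ℤ (valuesAt M x) = Module.finrank ℤ M ↔ ∀ m ∈ M, m x = 0 → m = 0 := by
  rw [← finrank_valuesAt_add hM x, left_eq_add]
  constructor
  · intro h m hm hmx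
    have := (ann_fg hM {x}).eq_bot_of_finrank_eq_zero h
    exact (AddSubgroup.eq_bot_iff_forall _).1 this m ⟨hm, fun t ht => by rwa [ht]⟩
  · intro h
    have : ann M {x} = ⊥ := (AddSubgroup.eq_bot_iff_forall _).2 fun m hm => h m hm.1 (hm.2 x rfl)
    rw [this]
    exact Module.finrank_zero_of_subsingleton

end Lattice

/-! ### Polyhedral cones -/

/-- Fourier-Motzkin elimination: a cone generated by finitely many integral vectors is cut out by
finitely many integral inequalities. -/
theorem exists_dual_inequalities {G : Type u} [AddCommGroup G] (hG : AddGroup.FG G) {κ : Type v}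
    (U : Finset κ) (p : κ → G →+ ℝ) (hp : ∀ k ∈ U, ∀ g, ∃ n : ℤ, p k g = n) :
    ∃ H : Finset G, (∀ h ∈ H, ∀ k ∈ U, 0 ≤ p k h) ∧
      ∀ q : G →+ ℝ, (∀ h ∈ H, 0 ≤ q h) →
        ∃ a : κ → ℝ, (∀ k, 0 ≤ a k) ∧ ∀ g, q g = ∑ k ∈ U, a k * p k g := by
  classical
  induction U using Finset.induction_on with
  | empty =>
    obtain ⟨S, hS⟩ := hG
    -- For the zero cone the generators of `G` together with their negatives force `q` to vanish.
    refine ⟨S ∪ S.image (fun g => -g), by simp, fun q hq => ⟨0, fun _ => le_rfl, fun g => ?_⟩⟩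
    have h0 : q = 0 := by
      refine AddMonoidHom.eq_of_eqOn_dense hS fun s hs => ?_
      have h1 := hq s (Finset.mem_union_left _ hs)
      have h2 := hq (-s) (Finset.mem_union_right _ (Finset.mem_image_of_mem _ hs))
      rw [map_neg] at h2
      rw [AddMonoidHom.zero_apply]
      linarith
    simp [h0]
  | insert k U hk ih =>
    obtain ⟨H, hH, hq⟩ := ih fun j hj => hp j (Finset.mem_insert_of_mem hj)
    choose n hn using hp k (Finset.mem_insert_self k U)
    -- Old inequalities that hold on the new generator `p k` are kept. Those negative on it enter
    -- only together with a positive one, scaled so that the combination vanishes on `p k`.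
    refine ⟨H.filter (fun h => 0 ≤ n h) ∪
      ((H.filter fun h => 0 < n h) ×ˢ (H.filter fun h => n h < 0)).image
        (fun z => n z.1 • z.2 - n z.2 • z.1), ?_, ?_⟩
    · intro h hh j hj
      rcases Finset.mem_union.1 hh with hh | hh
      · obtain ⟨h1, h2⟩ := Finset.mem_filter.1 hh
        rcases Finset.mem_insert.1 hj with rfl | hj
        · rw [hn]; exact_mod_cast h2
        · exact hH h h1 j hj
      · obtain ⟨⟨a, b⟩, hab, rfl⟩ := Finset.mem_image.1 hh
        simp only [Finset.mem_product, Finset.mem_filter] at hab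
        obtain ⟨⟨ha, ha'⟩, hb, hb'⟩ := hab
        simp only [map_sub, map_zsmul, zsmul_eq_mul]
        rcases Finset.mem_insert.1 hj with rfl | hj
        · rw [hn, hn]; linarith
        · have h1 := hH a ha j hj
          have h2 := hH b hb j hj
          have h3 : (0 : ℝ) < n a := by exact_mod_cast ha'
          have h4 : (n b : ℝ) < 0 := by exact_mod_cast hb'
          nlinarith
    · intro q hqH
      have hpos : ∀ h ∈ H, 0 ≤ n h → 0 ≤ q h := fun h hh h0 =>
        hqH h (Finset.mem_union_left _ (Finset.mem_filter.2 ⟨hh, h0⟩))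
      have hmix : ∀ a ∈ H, ∀ b ∈ H, 0 < n a → n b < 0 → 0 ≤ n a * q b - n b * q a := by
        intro a ha b hb ha' hb'
        have := hqH _ (Finset.mem_union_right _ (Finset.mem_image.2 ⟨(a, b), by
          simp [ha, hb, ha', hb'], rfl⟩))
        simpa only [map_sub, map_zsmul, zsmul_eq_mul] using this
      -- The coefficient of `p k` must be at least 0 and at least `q h / n h` wherever `n h < 0`.
      -- The smallest such number is taken; the mixed inequalities then give the upper bounds coming
      -- from `n h > 0`.
      obtain ⟨t, ht, htmax⟩ : ∃ t ∈ insert 0 ((H.filter fun h => n h < 0).image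
          fun h => q h / n h), ∀ s ∈ insert 0 ((H.filter fun h => n h < 0).image
          fun h => q h / n h), s ≤ t :=
        ⟨_, Finset.max'_mem _ ⟨0, Finset.mem_insert_self _ _⟩, fun s hs => Finset.le_max' _ s hs⟩
      have ht0 : 0 ≤ t := htmax 0 (Finset.mem_insert_self _ _)
      obtain ⟨a, ha, haq⟩ := hq (q - (AddMonoidHom.mulLeft t).comp (p k)) (by
        intro h hh
        simp only [AddMonoidHom.sub_apply, AddMonoidHom.comp_apply, AddMonoidHom.coe_mulLeft, hn]
        rcases lt_trichotomy (n h) 0 with h0 | h0 | h0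
        · have h1 := htmax (q h / n h) (Finset.mem_insert_of_mem (Finset.mem_image.2
            ⟨h, Finset.mem_filter.2 ⟨hh, h0⟩, rfl⟩))
          have h2 : (n h : ℝ) < 0 := by exact_mod_cast h0
          rw [div_le_iff_of_neg h2] at h1
          linarith
        · have := hpos h hh h0.ge
          rw [h0]; simpa using this
        · have h2 : (0 : ℝ) < n h := by exact_mod_cast h0
          rcases Finset.mem_insert.1 ht with rfl | ht
          · have := hpos h hh h0.le
            simpa using this
          · obtain ⟨b, hb, rfl⟩ := Finset.mem_image.1 ht
            obtain ⟨hb, hb'⟩ := Finset.mem_filter.1 hb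
            have h3 := hmix h hh b hb h0 hb'
            have h4 : (n b : ℝ) < 0 := by exact_mod_cast hb'
            have h5 : q b / n b * n h ≤ q h := by
              rw [div_mul_eq_mul_div, div_le_iff_of_neg h4]
              linarith
            linarith)
      refine ⟨fun j => if j = k then t else a j, fun j => ?_, fun g => ?_⟩
      · by_cases hj : j = k
        · simp [hj, ht0]
        · simp [hj, ha j]
      · rw [Finset.sum_insert hk]
        have h1 := haq g
        simp only [AddMonoidHom.sub_apply, AddMonoidHom.comp_apply, AddMonoidHom.coe_mulLeft] at h1
        have h2 : ∑ x ∈ U, (if x = k then t else a x) * p x g = ∑ x ∈ U, a x * p x g :=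
          Finset.sum_congr rfl fun x hx => by
            rw [if_neg]; rintro rfl; exact hk hx
        rw [h2]
        simp only [if_true]
        linarith

/-- The smallest face of `(S, M)` containing `x`. -/
def minFace {X : Type v} (S : Set X) (M : AddSubgroup (X → ℝ)) (x : X) : Set X :=
  {y | y ∈ S ∧ ∀ m ∈ M, (∀ z ∈ S, 0 ≤ m z) → m x = 0 → m y = 0}

/-- `x` is a lattice point of a cone with lattice `M`. -/
def IsLatticePt {X : Type v} (M : AddSubgroup (X → ℝ)) (x : X) : Prop :=
  ∀ m ∈ M, ∃ n : ℤ, m x = n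

/-- Finitely many inequalities that hold at `x`, and are equalities at `y` when they are at `x`, hold
at `x - ε y` for small `ε`. -/
theorem exists_pos_mul_le {κ : Type w} (H : Finset κ) (f g : κ → ℝ) (hf : ∀ h ∈ H, 0 ≤ f h)
    (hg : ∀ h ∈ H, 0 ≤ g h) (h0 : ∀ h ∈ H, f h = 0 → g h = 0) :
    ∃ ε : ℝ, 0 < ε ∧ ∀ h ∈ H, ε * g h ≤ f h := by
  classical
  induction H using Finset.induction_on with
  | empty => exact ⟨1, one_pos, by simp⟩
  | insert h H _ ih =>
    obtain ⟨ε, hε, h1⟩ := ih (fun k hk => hf k (Finset.mem_insert_of_mem hk))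
      (fun k hk => hg k (Finset.mem_insert_of_mem hk))
      (fun k hk => h0 k (Finset.mem_insert_of_mem hk))
    have hx0 := hf h (Finset.mem_insert_self h H)
    have hy0 := hg h (Finset.mem_insert_self h H)
    obtain ⟨δ, hδ, h2⟩ : ∃ δ : ℝ, 0 < δ ∧ δ * g h ≤ f h := by
      rcases hx0.eq_or_lt with h3 | h3
      · exact ⟨1, one_pos, by
          rw [h0 h (Finset.mem_insert_self h H) h3.symm]; simpa using hx0⟩
      · refine ⟨f h / (g h + 1), by positivity, ?_⟩
        rw [div_mul_eq_mul_div, div_le_iff₀ (by positivity)]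
        nlinarith
    refine ⟨min ε δ, lt_min hε hδ, fun k hk => ?_⟩
    rcases Finset.mem_insert.1 hk with rfl | hk
    · exact (mul_le_mul_of_nonneg_right (min_le_right _ _) hy0).trans h2
    · exact (mul_le_mul_of_nonneg_right (min_le_left _ _)
        (hg k (Finset.mem_insert_of_mem hk))).trans (h1 k hk)

/-- A cone generated by a finite family of lattice points is polyhedral. -/
theorem polyhedral_of_family {X : Type v} {S : Set X} {M : AddSubgroup (X → ℝ)} {κ : Type w}
    [Fintype κ] (v : κ → X) (hv : ∀ k, v k ∈ S ∧ IsLatticePt M (v k))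
    (h1 : ∀ x ∈ S, ∃ a : κ → ℝ, (∀ k, 0 ≤ a k) ∧ ∀ m ∈ M, m x = ∑ k, a k * m (v k))
    (h2 : ∀ a : κ → ℝ, (∀ k, 0 ≤ a k) → ∃ x ∈ S, ∀ m ∈ M, m x = ∑ k, a k * m (v k)) :
    ∃ U : Finset X,
      (∀ y ∈ U, y ∈ S ∧ ∀ m ∈ M, ∃ n : ℤ, m y = n) ∧
      (∀ x ∈ S, ∃ a : X → ℝ, (∀ y, 0 ≤ a y) ∧ ∀ m ∈ M, m x = ∑ y ∈ U, a y * m y) ∧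
      (∀ a : X → ℝ, (∀ y, 0 ≤ a y) → ∃ x ∈ S, ∀ m ∈ M, m x = ∑ y ∈ U, a y * m y) := by
  classical
  refine ⟨Finset.univ.image v, ?_, ?_, ?_⟩
  · intro y hy
    obtain ⟨k, -, rfl⟩ := Finset.mem_image.1 hy
    exact hv k
  · intro x hx
    obtain ⟨a, ha, hax⟩ := h1 x hx
    refine ⟨fun y => ∑ k with v k = y, a k, fun y => Finset.sum_nonneg fun k _ => ha k,
      fun m hm => ?_⟩
    rw [hax m hm, ← Finset.sum_fiberwise_of_maps_to (s := Finset.univ) (t := Finset.univ.image v)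
      (g := v) (fun k _ => Finset.mem_image_of_mem v (Finset.mem_univ k))]
    refine Finset.sum_congr rfl fun y _ => ?_
    rw [Finset.sum_mul]
    refine Finset.sum_congr rfl fun k hk => ?_
    rw [(Finset.mem_filter.1 hk).2]
  · intro a ha
    -- The family may repeat a point, so its coefficient is shared equally among the indices in the
    -- fibre.
    obtain ⟨x, hx, hxa⟩ := h2 (fun k => a (v k) / (Finset.univ.filter fun j => v j = v k).card)
      fun k => div_nonneg (ha _) (Nat.cast_nonneg _)
    refine ⟨x, hx, fun m hm => ?_⟩
    rw [hxa m hm, ← Finset.sum_fiberwise_of_maps_to (s := Finset.univ) (t := Finset.univ.image v)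
      (g := v) (fun k _ => Finset.mem_image_of_mem v (Finset.mem_univ k))]
    refine Finset.sum_congr rfl fun y hy => ?_
    obtain ⟨k, -, rfl⟩ := Finset.mem_image.1 hy
    rw [Finset.sum_congr rfl (g := fun _ => a (v k) /
      (Finset.univ.filter fun j => v j = v k).card * m (v k))]
    · rw [Finset.sum_const, nsmul_eq_mul, ← mul_assoc, mul_div_cancel₀]
      rw [Nat.cast_ne_zero]
      exact (Finset.card_pos.2 ⟨k, by simp⟩).ne'
    · intro j hj
      rw [(Finset.mem_filter.1 hj).2]

namespace IsIntegralCone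

variable {X : Type v} {S : Set X} {M : AddSubgroup (X → ℝ)}

/-- A cone is cut out by finitely many elements of its lattice. -/
theorem exists_inequalities (hS : IsIntegralCone S M) :
    ∃ H : Finset M, (∀ h ∈ H, ∀ x ∈ S, 0 ≤ h.1 x) ∧
      ∀ q : M →+ ℝ, (∀ h ∈ H, 0 ≤ q h) → ∃ x ∈ S, ∀ m : M, m.1 x = q m := by
  obtain ⟨U, hU, hU1, hU2⟩ := hS.polyhedral
  obtain ⟨H, hH, hq⟩ := exists_dual_inequalities ((AddGroup.fg_iff_addSubgroup_fg M).2 hS.fg) U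
    (fun y => (Pi.evalAddMonoidHom (fun _ => ℝ) y).comp M.subtype)
    (fun y hy m => (hU y hy).2 m.1 m.2)
  refine ⟨H, fun h hh x hx => ?_, fun q hq' => ?_⟩
  · obtain ⟨a, ha, hax⟩ := hU1 x hx
    rw [hax h.1 h.2]
    exact Finset.sum_nonneg fun y hy => mul_nonneg (ha y) (hH h hh y hy)
  · obtain ⟨a, ha, haq⟩ := hq q hq'
    obtain ⟨x, hx, hxa⟩ := hU2 a ha
    exact ⟨x, hx, fun m => by rw [hxa m.1 m.2, haq m]; rfl⟩

theorem exists_comb (hS : IsIntegralCone S M) {x y : X} (hx : x ∈ S) (hy : y ∈ S) {a b : ℝ}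
    (ha : 0 ≤ a) (hb : 0 ≤ b) : ∃ z ∈ S, ∀ m ∈ M, m z = a * m x + b * m y := by
  obtain ⟨U, hU, hU1, hU2⟩ := hS.polyhedral
  obtain ⟨c, hc, hcx⟩ := hU1 x hx
  obtain ⟨d, hd, hdy⟩ := hU1 y hy
  obtain ⟨z, hz, hzm⟩ := hU2 (fun y => a * c y + b * d y) fun y =>
    add_nonneg (mul_nonneg ha (hc y)) (mul_nonneg hb (hd y))
  refine ⟨z, hz, fun m hm => ?_⟩
  rw [hzm m hm, hcx m hm, hdy m hm, Finset.mul_sum, Finset.mul_sum, ← Finset.sum_add_distrib]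
  exact Finset.sum_congr rfl fun y _ => by ring

theorem exists_zero (hS : IsIntegralCone S M) : ∃ o ∈ S, ∀ m ∈ M, m o = 0 := by
  obtain ⟨U, hU, hU1, hU2⟩ := hS.polyhedral
  obtain ⟨z, hz, hzm⟩ := hU2 0 fun _ => le_rfl
  exact ⟨z, hz, fun m hm => by simp [hzm m hm]⟩

theorem ext_of_vanish (hS : IsIntegralCone S M) {m n : X → ℝ} (hm : m ∈ M) (hn : n ∈ M)
    (h : ∀ x ∈ S, m x = n x) : m = n := by
  ext x
  by_cases hx : x ∈ S
  · exact h x hx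
  · rw [hS.eq_zero_off m hm x hx, hS.eq_zero_off n hn x hx]

/-- A point of the form `a x + b y` with real coefficients lies in the cone once the finitely many
inequalities hold. -/
theorem exists_real_comb (hS : IsIntegralCone S M) (x y : X) (a b : ℝ)
    (h : ∀ m ∈ M, (∀ z ∈ S, 0 ≤ m z) → 0 ≤ a * m x + b * m y) :
    ∃ z ∈ S, ∀ m ∈ M, m z = a * m x + b * m y := by
  obtain ⟨H, hH, hq⟩ := hS.exists_inequalities
  obtain ⟨z, hz, hzm⟩ := hq
    (((AddMonoidHom.mulLeft a).comp (Pi.evalAddMonoidHom (fun _ => ℝ) x) +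
      (AddMonoidHom.mulLeft b).comp (Pi.evalAddMonoidHom (fun _ => ℝ) y)).comp M.subtype)
    (fun m hm => h m.1 m.2 (hH m hm))
  exact ⟨z, hz, fun m hm => hzm ⟨m, hm⟩⟩

/-- From a point `x` one can move a little away from any point `y` of its minimal face. -/
theorem exists_sub_smul (hS : IsIntegralCone S M) {x y : X} (hx : x ∈ S) (hy : y ∈ minFace S M x) :
    ∃ ε : ℝ, 0 < ε ∧ ∀ δ, 0 ≤ δ → δ ≤ ε → ∃ z ∈ S, ∀ m ∈ M, m z = m x - δ * m y := by
  classical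
  obtain ⟨H, hH, hq⟩ := hS.exists_inequalities
  obtain ⟨ε, hε, hε'⟩ := exists_pos_mul_le H (fun h => h.1 x) (fun h => h.1 y)
    (fun h hh => hH h hh x hx) (fun h hh => hH h hh y hy.1)
    (fun h hh => hy.2 h.1 h.2 (hH h hh))
  refine ⟨ε, hε, fun δ hδ hδε => ?_⟩
  obtain ⟨z, hz, hzm⟩ := hq
    (((Pi.evalAddMonoidHom (fun _ => ℝ) x) -
      (AddMonoidHom.mulLeft δ).comp (Pi.evalAddMonoidHom (fun _ => ℝ) y)).comp M.subtype)
    (fun h hh => by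
      have h1 := hε' h hh
      have h2 := mul_le_mul_of_nonneg_right hδε (hH h hh y hy.1)
      change 0 ≤ h.1 x - δ * h.1 y
      linarith)
  exact ⟨z, hz, fun m hm => hzm ⟨m, hm⟩⟩

/-- The sum of those defining inequalities that vanish at `x` cuts out the face. At a zero `y` of
this sum each of them vanishes, so `x - ε y` stays in the cone for some `ε > 0`, and a non-negative
function that is zero at `x` cannot be positive at `y`. -/
theorem isFaceOf_minFace (hS : IsIntegralCone S M) {x : X} (hx : x ∈ S) :
    IsFaceOf S M (minFace S M x) := by
  classical
  obtain ⟨H, hH, hq⟩ := hS.exists_inequalities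
  set m₀ : M := ∑ h ∈ H.filter (fun h => h.1 x = 0), h with hm₀
  have hval : ∀ y, m₀.1 y = ∑ h ∈ H.filter (fun h => h.1 x = 0), h.1 y := fun y => by
    rw [hm₀, AddSubgroup.val_finsetSum, Finset.sum_apply]
  refine ⟨m₀.1, m₀.2, fun y hy => ?_, ?_⟩
  · rw [hval]
    exact Finset.sum_nonneg fun h hh => hH h (Finset.mem_filter.1 hh).1 y hy
  · ext y
    refine ⟨fun hy => ⟨hy.1, ?_⟩, fun hy => ⟨hy.1, fun m hm hm0 hmx => ?_⟩⟩
    · rw [hval]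
      exact Finset.sum_eq_zero fun h hh =>
        hy.2 h.1 h.2 (hH h (Finset.mem_filter.1 hh).1) (Finset.mem_filter.1 hh).2
    · have hall : ∀ h ∈ H, h.1 x = 0 → h.1 y = 0 := by
        intro h hh hhx
        have := (Finset.sum_eq_zero_iff_of_nonneg (fun h hh =>
          hH h (Finset.mem_filter.1 hh).1 y hy.1)).1 ((hval y).symm.trans hy.2)
        exact this h (Finset.mem_filter.2 ⟨hh, hhx⟩)
      obtain ⟨ε, hε, hε'⟩ := exists_pos_mul_le H (fun h => h.1 x) (fun h => h.1 y)
        (fun h hh => hH h hh x hx) (fun h hh => hH h hh y hy.1) hall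
      obtain ⟨z, hz, hzm⟩ := hq
        (((Pi.evalAddMonoidHom (fun _ => ℝ) x) -
          (AddMonoidHom.mulLeft ε).comp (Pi.evalAddMonoidHom (fun _ => ℝ) y)).comp M.subtype)
        (fun h hh => sub_nonneg.2 (hε' h hh))
      have h1 : m z = m x - ε * m y := hzm ⟨m, hm⟩
      have h2 := hm0 z hz
      have h3 := hm0 y hy.1
      nlinarith

end IsIntegralCone

theorem IsFaceOf.subset {X : Type v} {S T : Set X} {M : AddSubgroup (X → ℝ)} (h : IsFaceOf S M T) :
    T ⊆ S := by
  obtain ⟨m, -, -, rfl⟩ := h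
  exact fun x hx => hx.1

namespace IsIntegralCone

variable {X : Type v} {S T : Set X} {M : AddSubgroup (X → ℝ)}

theorem mem_minFace {x : X} (hx : x ∈ S) : x ∈ minFace S M x := ⟨hx, fun _ _ _ h => h⟩

/-- Every face is the minimal face of one of its lattice points. -/
theorem exists_lattice_minFace_eq (hS : IsIntegralCone S M) (hT : IsFaceOf S M T) :
    ∃ x ∈ T, IsLatticePt M x ∧ minFace S M x = T := by
  classical
  obtain ⟨U, hU, hU1, hU2⟩ := hS.polyhedral
  obtain ⟨m₀, hm₀, hpos, rfl⟩ := hT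
  -- The sum of the generators on the face is a lattice point of its relative interior.
  obtain ⟨x, hx, hxm⟩ := hU2 (fun y => if m₀ y = 0 then 1 else 0) fun y => by split_ifs <;> simp
  have hx0 : m₀ x = 0 := by
    rw [hxm m₀ hm₀]
    refine Finset.sum_eq_zero fun y hy => ?_
    split_ifs with h <;> simp [h]
  refine ⟨x, ⟨hx, hx0⟩, fun m hm => ?_, ?_⟩
  · choose n hn using fun y : U => (hU y.1 y.2).2 m hm
    refine ⟨∑ y : U, if m₀ y = 0 then n y else 0, ?_⟩
    rw [hxm m hm, ← Finset.sum_coe_sort U]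
    push_cast
    refine Finset.sum_congr rfl fun y _ => ?_
    split_ifs <;> simp [hn]
  · ext y
    refine ⟨fun hy => ⟨hy.1, hy.2 m₀ hm₀ hpos hx0⟩, fun hy => ⟨hy.1, fun m hm hm0 hmx => ?_⟩⟩
    obtain ⟨a, ha, hay⟩ := hU1 y hy.1
    have h1 := hy.2
    rw [hay m₀ hm₀] at h1
    rw [hxm m hm] at hmx
    have h2 := (Finset.sum_eq_zero_iff_of_nonneg fun u hu =>
      mul_nonneg (ha u) (hpos u (hU u hu).1)).1 h1
    have h3 := (Finset.sum_eq_zero_iff_of_nonneg fun u hu => mul_nonneg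
      (by split_ifs <;> simp) (hm0 u (hU u hu).1)).1 hmx
    rw [hay m hm]
    refine Finset.sum_eq_zero fun u hu => ?_
    rcases mul_eq_zero.1 (h2 u hu) with h | h
    · rw [h, zero_mul]
    · have := h3 u hu
      rw [if_pos h, one_mul] at this
      rw [this, mul_zero]

theorem exists_sum (hS : IsIntegralCone S M) {κ : Type w} (t : Finset κ) (v : κ → X)
    (hv : ∀ k, v k ∈ S) (a : κ → ℝ) (ha : ∀ k, 0 ≤ a k) :
    ∃ x ∈ S, ∀ m ∈ M, m x = ∑ k ∈ t, a k * m (v k) := by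
  classical
  induction t using Finset.induction_on with
  | empty =>
    obtain ⟨o, ho, hom⟩ := hS.exists_zero
    exact ⟨o, ho, fun m hm => by simp [hom m hm]⟩
  | insert k t hk ih =>
    obtain ⟨x, hx, hxm⟩ := ih
    obtain ⟨z, hz, hzm⟩ := hS.exists_comb (hv k) hx (ha k) zero_le_one
    exact ⟨z, hz, fun m hm => by rw [hzm m hm, hxm m hm, Finset.sum_insert hk, one_mul]⟩

/-- A proper face is the zero set of a nonzero function, so the functions vanishing on it have
positive rank. -/
theorem finrank_face_lt (hS : IsIntegralCone S M) (hT : IsFaceOf S M T) (hne : T ≠ S) :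
    Module.finrank ℤ (restrictLattice T M) < Module.finrank ℤ M := by
  obtain ⟨m₀, hm₀, hpos, rfl⟩ := hT
  rw [← finrank_restrictLattice_add hS.fg {x | x ∈ S ∧ m₀ x = 0}]
  refine Nat.lt_add_of_pos_right (Nat.pos_of_ne_zero fun h => hne ?_)
  have h1 := (ann_fg hS.fg _).eq_bot_of_finrank_eq_zero h
  have h2 := (AddSubgroup.eq_bot_iff_forall _).1 h1 m₀ ⟨hm₀, fun t ht => ht.2⟩
  ext x
  simp [h2]

/-- The structure of the quotient lattice at a face of codimension one. -/
theorem exists_facet_data (hS : IsIntegralCone S M) (hT : IsFaceOf S M T)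
    (hd : Module.finrank ℤ M = Module.finrank ℤ (restrictLattice T M) + 1) :
    ∃ l ∈ ann M T, (∀ x ∈ S, 0 ≤ l x) ∧ (∀ x ∈ S, l x = 0 → x ∈ T) ∧
      (∀ m ∈ ann M T, ∃ n : ℤ, m = n • l) ∧ ∃ x ∈ S, IsLatticePt M x ∧ l x = 1 := by
  classical
  have hne : T ≠ S := by
    rintro rfl
    rw [restrictLattice_self hS.eq_zero_off] at hd
    omega
  obtain ⟨t₀, ht₀, htlat, htface⟩ := hS.exists_lattice_minFace_eq hT
  have hrank : Module.finrank ℤ (ann M T) = 1 := by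
    have := finrank_restrictLattice_add hS.fg T
    omega
  have hfin := (ann_fg hS.fg T).moduleFinite
  have hfinR := (restrictLattice_fg hS.fg T).moduleFinite
  have htf : ∀ P : AddSubgroup (X → ℝ), Module.IsTorsionFree ℤ P := fun P =>
    Function.Injective.moduleIsTorsionFree (Subtype.val : P → X → ℝ) Subtype.val_injective
      (fun n x => rfl)
  have := htf (ann M T)
  have := htf (restrictLattice T M)
  set b := Module.finBasisOfFinrankEq ℤ (ann M T) hrank
  have hb : ∀ m ∈ ann M T, ∃ n : ℤ, m = n • (b 0).1 := fun m hm => by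
    have h1 := b.sum_repr ⟨m, hm⟩
    rw [Fin.sum_univ_one] at h1
    exact ⟨b.repr ⟨m, hm⟩ 0, by rw [← AddSubgroup.coe_zsmul, h1]⟩
  obtain ⟨m₀, hm₀, hpos, hTeq⟩ := hT
  have hm₀T : m₀ ∈ ann M T := ⟨hm₀, fun t ht => by rw [hTeq] at ht; exact ht.2⟩
  obtain ⟨k, hk⟩ := hb m₀ hm₀T
  have hk0 : k ≠ 0 := by
    rintro rfl
    apply hne
    rw [hTeq]
    ext x
    simp [hk]
  -- The annihilator of `T` has rank one. Of its two generators, `l` is the one of which `m₀` is a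
  -- positive multiple.
  obtain ⟨l, hl, hgen, n, hn, hml⟩ : ∃ l ∈ ann M T, (∀ m ∈ ann M T, ∃ n : ℤ, m = n • l) ∧
      ∃ n : ℤ, 0 < n ∧ m₀ = n • l := by
    rcases lt_or_gt_of_ne hk0 with h | h
    · refine ⟨-(b 0).1, neg_mem (b 0).2, fun m hm => ?_, -k, by omega, by simpa using hk⟩
      obtain ⟨n, hn⟩ := hb m hm
      exact ⟨-n, by simpa using hn⟩
    · exact ⟨(b 0).1, (b 0).2, hb, k, h, hk⟩
  have hnR : (0 : ℝ) < n := by exact_mod_cast hn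
  have hm₀l : ∀ x, m₀ x = n * l x := fun x => by rw [hml]; simp
  have hlpos : ∀ x ∈ S, 0 ≤ l x := fun x hx => by
    have := hpos x hx
    rw [hm₀l] at this
    exact nonneg_of_mul_nonneg_right this hnR
  have hlT : ∀ x ∈ S, l x = 0 → x ∈ T := fun x hx h => by
    rw [hTeq]
    exact ⟨hx, by rw [hm₀l, h, mul_zero]⟩
  refine ⟨l, hl, hlpos, hlT, hgen, ?_⟩
  obtain ⟨z, hzS, hz⟩ : ∃ z ∈ S, l z ≠ 0 := by
    by_contra! h
    exact hne (Set.Subset.antisymm (by rw [hTeq]; exact fun x hx => hx.1)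
      fun x hx => hlT x hx (h x hx))
  let r : M →ₗ[ℤ] restrictLattice T M := AddMonoidHom.toIntLinearMap
    (((Set.indicatorHom ℝ T).comp M.subtype).codRestrict _ fun m => ⟨m.1, m.2, rfl⟩)
  have hr : Function.Surjective r := by
    rintro ⟨g, m, hm, rfl⟩
    exact ⟨⟨m, hm⟩, rfl⟩
  -- The lattice of `T` is finitely generated and torsion free, so restriction to `T` splits. The
  -- functional `q₀` below is the coefficient of `l` in the complementary part; dividing by `l z`
  -- merely computes it.
  obtain ⟨s, hs⟩ := Module.projective_lifting_property r LinearMap.id hr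
  have hann : ∀ m : M, (m - s (r m)).1 ∈ ann M T := fun m => ⟨(m - s (r m)).2, fun t ht => by
    have h1 : r (s (r m)) = r m := LinearMap.congr_fun hs (r m)
    have h2 := congrFun (congrArg Subtype.val h1) t
    have h3 : ∀ g : M, (r g).1 t = g.1 t := fun g => Set.indicator_of_mem ht g.1
    rw [h3, h3] at h2
    rw [AddSubgroup.coe_sub, Pi.sub_apply, h2, sub_self]⟩
  let q₀ : M →+ ℝ := (AddMonoidHom.mulRight (l z)⁻¹).comp
    ((Pi.evalAddMonoidHom (fun _ => ℝ) z).comp (M.subtype.comp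
      (AddMonoidHom.id M - (s.comp r).toAddMonoidHom)))
  have hq₀ : ∀ m : M, q₀ m = (m - s (r m)).1 z * (l z)⁻¹ := fun m => rfl
  have hint : ∀ m : M, ∃ j : ℤ, q₀ m = j := fun m => by
    obtain ⟨j, hj⟩ := hgen _ (hann m)
    refine ⟨j, ?_⟩
    rw [hq₀, hj]
    simp [hz]
  have hq₀l : ∀ j : ℤ, ∀ h : j • l ∈ M, q₀ ⟨j • l, h⟩ = j := fun j h => by
    have h1 : r ⟨j • l, h⟩ = 0 := by
      ext t
      by_cases ht : t ∈ T
      · exact (Set.indicator_of_mem ht _).trans (by simp [hl.2 t ht])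
      · exact Set.indicator_of_notMem ht _
    rw [hq₀, h1, map_zero, sub_zero]
    simp [hz]
  obtain ⟨H, hH, hq⟩ := hS.exists_inequalities
  -- `q₀` is moved into the cone by adding a large multiple of the interior lattice point `t₀` of
  -- `T`. This repairs every inequality that is positive at `t₀`; one that vanishes at `t₀` is a
  -- multiple of `l` and already holds for `q₀`.
  obtain ⟨ε, hε, hεH⟩ := exists_pos_mul_le H (fun h => h.1 t₀)
    (fun h => if h.1 t₀ = 0 then 0 else |q₀ h|) (fun h hh => hH h hh t₀ (htface ▸ ht₀ : _ ∈ minFace S M t₀).1)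
    (fun h _ => by split_ifs <;> simp) (fun h _ h0 => if_pos h0)
  obtain ⟨N, hN⟩ := exists_nat_ge ε⁻¹
  have ht₀S : t₀ ∈ S := (htface ▸ ht₀ : _ ∈ minFace S M t₀).1
  obtain ⟨x, hx, hxm⟩ := hq (q₀ + (AddMonoidHom.mulLeft (N : ℝ)).comp
    ((Pi.evalAddMonoidHom (fun _ => ℝ) t₀).comp M.subtype)) (fun h hh => by
      change 0 ≤ q₀ h + N * h.1 t₀
      by_cases h0 : h.1 t₀ = 0
      · have h1 : h.1 ∈ ann M T := ⟨h.2, fun t ht => by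
          rw [← htface] at ht
          exact ht.2 h.1 h.2 (hH h hh) h0⟩
        obtain ⟨j, hj⟩ := hgen _ h1
        have h2 : h = ⟨j • l, hj ▸ h.2⟩ := Subtype.ext hj
        rw [h0, mul_zero, add_zero, h2, hq₀l]
        have h3 := hH h hh z hzS
        rw [hj] at h3
        simp only [Pi.smul_apply, zsmul_eq_mul] at h3
        exact nonneg_of_mul_nonneg_left h3 (lt_of_le_of_ne (hlpos z hzS) (Ne.symm hz))
      · have h1 := hεH h hh
        simp only [if_neg h0] at h1
        have h2 : 0 ≤ h.1 t₀ := hH h hh t₀ ht₀S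
        have h3 : |q₀ h| ≤ N * h.1 t₀ := by
          calc |q₀ h| = ε⁻¹ * (ε * |q₀ h|) := by field_simp
            _ ≤ ε⁻¹ * h.1 t₀ := mul_le_mul_of_nonneg_left h1 (inv_nonneg.2 hε.le)
            _ ≤ N * h.1 t₀ := mul_le_mul_of_nonneg_right hN h2
        linarith [neg_abs_le (q₀ h)])
  have hxv : ∀ m : M, m.1 x = q₀ m + N * m.1 t₀ := hxm
  refine ⟨x, hx, fun m hm => ?_, ?_⟩
  · obtain ⟨j, hj⟩ := hint ⟨m, hm⟩
    obtain ⟨i, hi⟩ := htlat m hm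
    refine ⟨j + N * i, ?_⟩
    rw [show m x = q₀ ⟨m, hm⟩ + N * m t₀ from hxv ⟨m, hm⟩, hj, hi]
    push_cast
    ring
  · have h1 := hxv ⟨(1 : ℤ) • l, by rw [one_smul]; exact hl.1⟩
    rw [hq₀l] at h1
    simpa [hl.2 t₀ ht₀] using h1

/-- The part of a cone where an integral linear function is non-negative is an integral cone. -/
theorem half (hS : IsIntegralCone S M) {h : X → ℝ} (hh : h ∈ M) :
    IsIntegralCone {x | x ∈ S ∧ 0 ≤ h x} (restrictLattice {x | x ∈ S ∧ 0 ≤ h x} M) where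
  eq_zero_off := by
    rintro _ ⟨m, -, rfl⟩ x hx
    exact Set.indicator_of_notMem hx m
  fg := restrictLattice_fg hS.fg _
  injOn x hx y hy hxy := hS.injOn x hx.1 y hy.1 fun m hm => by
    obtain ⟨g, hg, hgm⟩ := exists_restrict hm {x | x ∈ S ∧ 0 ≤ h x}
    rw [← hgm x hx, ← hgm y hy, hxy g hg]
  stronglyConvex x hx y hy hxy g hg := by
    obtain ⟨m, hm, hgm⟩ := exists_of_mem_restrictLattice hg
    rw [hgm x hx]
    refine hS.stronglyConvex x hx.1 y hy.1 (fun n hn => ?_) m hm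
    obtain ⟨g, hg, hgm⟩ := exists_restrict hn {x | x ∈ S ∧ 0 ≤ h x}
    rw [← hgm x hx, ← hgm y hy, hxy g hg]
  polyhedral := by
    classical
    obtain ⟨U, hU, hU1, hU2⟩ := hS.polyhedral
    let p : X → ℝ := fun u => if 0 < h u then 1 else 0
    let n : X → ℝ := fun u => if h u < 0 then 1 else 0
    have hp0 : ∀ u, 0 ≤ p u := fun u => by dsimp only [p]; split_ifs <;> simp
    have hn0 : ∀ u, 0 ≤ n u := fun u => by dsimp only [n]; split_ifs <;> simp
    have hn1 : ∀ u, n u ≤ 1 := fun u => by dsimp only [n]; split_ifs <;> simp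
    have hpn : ∀ u, p u * n u = 0 := fun u => by
      dsimp only [p, n]; split_ifs <;> linarith
    have hph : ∀ u, 0 ≤ p u * h u := fun u => by
      dsimp only [p]; split_ifs with h0
      · linarith
      · simp
    have hnh : ∀ u, 0 ≤ n u * -h u := fun u => by
      dsimp only [n]; split_ifs with h0
      · linarith
      · simp
    -- The new generators are the old ones with `h ≥ 0` and, for each pair with `h u > 0 > h v`, the
    -- combination `h(u) v - h(v) u` on the wall `h = 0`. The indicators `p` and `n` turn all other
    -- indices into zero.
    have hw : ∀ k : U ⊕ U × U, ∃ w ∈ S, (∀ m ∈ M, m w = Sum.elim (fun u : U => (1 - n u) * m u)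
        (fun z : U × U => (p z.1 * h z.1 * n z.2) * m z.2 + (n z.2 * -h z.2 * p z.1) * m z.1) k) := by
      rintro (u | z)
      · obtain ⟨w, hw, hwm⟩ := hS.exists_comb (hU u.1 u.2).1 (hU u.1 u.2).1
          (sub_nonneg.2 (hn1 u.1)) le_rfl
        exact ⟨w, hw, fun m hm => by rw [hwm m hm]; simp⟩
      · exact hS.exists_comb (hU z.2.1 z.2.2).1 (hU z.1.1 z.1.2).1
          (mul_nonneg (hph _) (hn0 _)) (mul_nonneg (hnh _) (hp0 _))
    choose w hwS hwm using hw
    have hw0 : ∀ k, 0 ≤ h (w k) := by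
      rintro (u | z)
      · rw [hwm _ h hh]
        dsimp only [Sum.elim_inl, n]
        split_ifs with h0
        · simp
        · simpa using h0
      · rw [hwm _ h hh]
        dsimp only [Sum.elim_inr]
        linarith
    have hlat : ∀ k, IsLatticePt M (w k) := by
      intro k m hm
      have hcast : ∀ u : X, (∃ i : ℤ, p u = i) ∧ ∃ i : ℤ, n u = i := fun u => by
        constructor
        · exact ⟨if 0 < h u then 1 else 0, by dsimp only [p]; split_ifs <;> simp⟩
        · exact ⟨if h u < 0 then 1 else 0, by dsimp only [n]; split_ifs <;> simp⟩
      rw [hwm k m hm]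
      rcases k with u | z
      · obtain ⟨a, ha⟩ := (hU u.1 u.2).2 m hm
        obtain ⟨-, b, hb⟩ := hcast u
        refine ⟨(1 - b) * a, ?_⟩
        dsimp only [Sum.elim_inl]
        rw [ha, hb]
        push_cast
        ring
      · obtain ⟨a, ha⟩ := (hU z.1.1 z.1.2).2 m hm
        obtain ⟨b, hb⟩ := (hU z.2.1 z.2.2).2 m hm
        obtain ⟨c, hc⟩ := (hU z.1.1 z.1.2).2 h hh
        obtain ⟨d, hd⟩ := (hU z.2.1 z.2.2).2 h hh
        obtain ⟨⟨i, hi⟩, -⟩ := hcast z.1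
        obtain ⟨-, j, hj⟩ := hcast z.2
        refine ⟨(i * c * j) * b + (j * -d * i) * a, ?_⟩
        dsimp only [Sum.elim_inr]
        rw [ha, hb, hc, hd, hi, hj]
        push_cast
        ring
    refine polyhedral_of_family w (fun k => ⟨⟨hwS k, hw0 k⟩, fun g hg => ?_⟩) ?_ ?_
    · obtain ⟨m, hm, hgm⟩ := exists_of_mem_restrictLattice hg
      rw [hgm _ ⟨hwS k, hw0 k⟩]
      exact hlat k m hm
    · intro x hx
      obtain ⟨a, ha, hax⟩ := hU1 x hx.1
      set P := ∑ u : U, a u * (p u * h u) with hP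
      set Q := ∑ u : U, a u * (n u * -h u) with hQ
      have hP0 : 0 ≤ P := Finset.sum_nonneg fun u _ => mul_nonneg (ha _) (hph _)
      have hQ0 : 0 ≤ Q := Finset.sum_nonneg fun u _ => mul_nonneg (ha _) (hnh _)
      have hPQ : h x = P - Q := by
        rw [hax h hh, hP, hQ, ← Finset.sum_sub_distrib, ← Finset.sum_coe_sort U]
        refine Finset.sum_congr rfl fun u _ => ?_
        dsimp only [p, n]
        rcases lt_trichotomy (h u) 0 with h0 | h0 | h0
        · rw [if_neg h0.le.not_gt, if_pos h0]; ring
        · rw [h0]; simp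
        · rw [if_pos h0, if_neg h0.le.not_gt]; ring
      have hQP : Q ≤ P := by linarith [hx.2]
      -- `P` and `Q` are the positive and negative parts of `h x`. If `P = 0` then `Q = 0` as well,
      -- no negative generator occurs in `x`, and `0 / 0 = 0` does no harm.
      have hPP : ∀ u ∈ U, P / P * (a u * n u) = a u * n u := by
        intro u hu
        rcases hP0.eq_or_lt with h0 | h0
        · have h1 : Q = 0 := by linarith
          have h2 := (Finset.sum_eq_zero_iff_of_nonneg fun u _ => mul_nonneg (ha _) (hnh _)).1
            (hQ ▸ h1) ⟨u, hu⟩ (Finset.mem_univ _)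
          have h3 : a u * n u = 0 := by
            dsimp only [n] at h2 ⊢
            split_ifs at h2 ⊢ with h4
            · rcases mul_eq_zero.1 h2 with h5 | h5
              · rw [h5, zero_mul]
              · linarith
            · simp
          rw [h3, mul_zero]
        · rw [div_self h0.ne', one_mul]
      -- Each negative generator is distributed over all positive ones `u` in proportion to `a u * h
      -- u`. This absorbs it completely and uses up the fraction `Q / P` of every positive
      -- generator.
      refine ⟨Sum.elim (fun u => a u * (1 - p u * (Q / P))) (fun z => a z.1 * a z.2 / P), ?_, ?_⟩
      · rintro (u | z)
        · refine mul_nonneg (ha _) (sub_nonneg.2 (mul_le_one₀ ?_ (div_nonneg hQ0 hP0)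
            (div_le_one_of_le₀ hQP hP0)))
          dsimp only [p]; split_ifs <;> simp
        · exact div_nonneg (mul_nonneg (ha _) (ha _)) hP0
      · intro g hg
        obtain ⟨m, hm, hgm⟩ := exists_of_mem_restrictLattice hg
        have hgw : ∀ k, g (w k) = m (w k) := fun k => hgm _ ⟨hwS k, hw0 k⟩
        rw [hgm x hx, hax m hm, Fintype.sum_sum_type, Fintype.sum_prod_type]
        simp only [hgw, hwm _ m hm, Sum.elim_inl, Sum.elim_inr]
        have h1 : ∑ u : U, ∑ v : U, a u * a v / P * (p u * h u * n v * m v + n v * -h v * p u * m u) =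
            ∑ v : U, P / P * (a v * n v) * m v + ∑ u : U, Q / P * (a u * p u) * m u := by
          have h2 : ∀ v : U, P / P * (a v * n v) * m v =
              ∑ u : U, a u * a v / P * (p u * h u * n v * m v) := fun v => by
            rw [hP, Finset.sum_div, Finset.sum_mul, Finset.sum_mul, ← hP]
            exact Finset.sum_congr rfl fun u _ => by ring
          have h3 : ∀ u : U, Q / P * (a u * p u) * m u =
              ∑ v : U, a u * a v / P * (n v * -h v * p u * m u) := fun u => by
            rw [hQ, Finset.sum_div, Finset.sum_mul, Finset.sum_mul]
            exact Finset.sum_congr rfl fun v _ => by ring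
          simp only [h2, h3]
          rw [Finset.sum_comm (f := fun (v u : U) => a u * a v / P * (p u * h u * n v * m v)),
            ← Finset.sum_add_distrib]
          refine Finset.sum_congr rfl fun u _ => ?_
          rw [← Finset.sum_add_distrib]
          exact Finset.sum_congr rfl fun v _ => by ring
        rw [h1, ← Finset.sum_add_distrib, ← Finset.sum_add_distrib, ← Finset.sum_coe_sort U]
        refine Finset.sum_congr rfl fun u _ => ?_
        rw [hPP u.1 u.2]
        linear_combination (-(a u * m u * (Q / P))) * hpn u
    · intro a ha
      obtain ⟨x, hx, hxm⟩ := hS.exists_sum Finset.univ w hwS a ha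
      have hx0 : 0 ≤ h x := by
        rw [hxm h hh]
        exact Finset.sum_nonneg fun k _ => mul_nonneg (ha k) (hw0 k)
      refine ⟨x, ⟨hx, hx0⟩, fun g hg => ?_⟩
      obtain ⟨m, hm, hgm⟩ := exists_of_mem_restrictLattice hg
      rw [hgm x ⟨hx, hx0⟩, hxm m hm]
      exact Finset.sum_congr rfl fun k _ => by rw [hgm _ ⟨hwS k, hw0 k⟩]

end IsIntegralCone

/-- The product of two integral cones. -/
theorem IsIntegralCone.prod {X : Type v} {Y : Type v'} {S : Set X} {M : AddSubgroup (X → ℝ)}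
    {T : Set Y} {N : AddSubgroup (Y → ℝ)} (hS : IsIntegralCone S M) (hT : IsIntegralCone T N)
    {P : AddSubgroup (X × Y → ℝ)} (hP : ∀ g, g ∈ P ↔ ∃ m ∈ M, ∃ n ∈ N,
      g = (S ×ˢ T).indicator (fun z => m z.1 + n z.2)) : IsIntegralCone (S ×ˢ T) P := by
  have hval : ∀ g ∈ P, ∃ m ∈ M, ∃ n ∈ N, ∀ z ∈ S ×ˢ T, g z = m z.1 + n z.2 := fun g hg => by
    obtain ⟨m, hm, n, hn, rfl⟩ := (hP g).1 hg
    exact ⟨m, hm, n, hn, fun z hz => Set.indicator_of_mem hz _⟩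
  have hval' : ∀ m ∈ M, ∀ n ∈ N, ∃ g ∈ P, ∀ z ∈ S ×ˢ T, g z = m z.1 + n z.2 :=
    fun m hm n hn => ⟨_, (hP _).2 ⟨m, hm, n, hn, rfl⟩, fun z hz => Set.indicator_of_mem hz _⟩
  obtain ⟨o, ho, hom⟩ := hS.exists_zero
  obtain ⟨o', ho', hom'⟩ := hT.exists_zero
  have hcomp : ∀ z ∈ S ×ˢ T, ∀ w ∈ S ×ˢ T, ∀ c d : ℝ,
      (∀ g ∈ P, c * g z + d * g w = 0) →
      (∀ m ∈ M, c * m z.1 + d * m w.1 = 0) ∧ ∀ n ∈ N, c * n z.2 + d * n w.2 = 0 := by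
    intro z hz w hw c d h
    constructor
    · intro m hm
      obtain ⟨g, hg, hgm⟩ := hval' m hm 0 (zero_mem _)
      have := h g hg
      rw [hgm z hz, hgm w hw] at this
      simpa using this
    · intro n hn
      obtain ⟨g, hg, hgm⟩ := hval' 0 (zero_mem _) n hn
      have := h g hg
      rw [hgm z hz, hgm w hw] at this
      simpa using this
  refine ⟨?_, ?_, ?_, ?_, ?_⟩
  · intro g hg x hx
    obtain ⟨m, hm, n, hn, rfl⟩ := (hP g).1 hg
    exact Set.indicator_of_notMem hx _
  · have h1 : P = (M.prod N).map ((Set.indicatorHom ℝ (S ×ˢ T)).comp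
        (AddMonoidHom.coprod
          (AddMonoidHom.pi fun z : X × Y => Pi.evalAddMonoidHom (fun _ : X => ℝ) z.1)
          (AddMonoidHom.pi fun z : X × Y => Pi.evalAddMonoidHom (fun _ : Y => ℝ) z.2))) := by
      ext g
      rw [hP, AddSubgroup.mem_map]
      constructor
      · rintro ⟨m, hm, n, hn, rfl⟩
        exact ⟨(m, n), ⟨hm, hn⟩, rfl⟩
      · rintro ⟨⟨m, n⟩, ⟨hm, hn⟩, rfl⟩
        exact ⟨m, hm, n, hn, rfl⟩
    rw [h1]
    exact (AddSubgroup.FG.prod hS.fg hT.fg).map_addMonoidHom _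
  · intro x hx y hy h
    obtain ⟨h1, h2⟩ := hcomp x hx y hy 1 (-1) fun g hg => by rw [h g hg]; ring
    refine Prod.ext (hS.injOn _ hx.1 _ hy.1 fun m hm => ?_) (hT.injOn _ hx.2 _ hy.2 fun n hn => ?_)
    · linarith [h1 m hm]
    · linarith [h2 n hn]
  · obtain ⟨U, hU, hU1, hU2⟩ := hS.polyhedral
    obtain ⟨V, hV, hV1, hV2⟩ := hT.polyhedral
    let v : U ⊕ V → X × Y := Sum.elim (fun u => (u.1, o')) (fun u => (o, u.1))
    have hv : ∀ k, v k ∈ S ×ˢ T := by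
      rintro (u | u)
      · exact ⟨(hU u.1 u.2).1, ho'⟩
      · exact ⟨ho, (hV u.1 u.2).1⟩
    refine polyhedral_of_family v (fun k => ⟨hv k, fun g hg => ?_⟩) ?_ ?_
    · obtain ⟨m, hm, n, hn, hgm⟩ := hval g hg
      rw [hgm _ (hv k)]
      rcases k with u | u
      · obtain ⟨i, hi⟩ := (hU u.1 u.2).2 m hm
        exact ⟨i, by simp [v, hi, hom' n hn]⟩
      · obtain ⟨i, hi⟩ := (hV u.1 u.2).2 n hn
        exact ⟨i, by simp [v, hi, hom m hm]⟩
    · rintro ⟨x, y⟩ ⟨hx, hy⟩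
      obtain ⟨a, ha, hax⟩ := hU1 x hx
      obtain ⟨b, hb, hby⟩ := hV1 y hy
      refine ⟨Sum.elim (fun u => a u) (fun u => b u), ?_, fun g hg => ?_⟩
      · rintro (u | u)
        · exact ha _
        · exact hb _
      · obtain ⟨m, hm, n, hn, hgm⟩ := hval g hg
        simp only [hgm _ (hv _), Fintype.sum_sum_type]
        rw [hgm _ ⟨hx, hy⟩]
        simp only [v, Sum.elim_inl, Sum.elim_inr, hom m hm, hom' n hn, add_zero, zero_add]
        rw [hax m hm, hby n hn, ← Finset.sum_coe_sort U, ← Finset.sum_coe_sort V]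
    · intro a ha
      obtain ⟨x, hx, hxm⟩ := hS.exists_sum Finset.univ (fun u : U => u.1)
        (fun u => (hU u.1 u.2).1) (fun u => a (Sum.inl u)) fun u => ha _
      obtain ⟨y, hy, hym⟩ := hT.exists_sum Finset.univ (fun u : V => u.1)
        (fun u => (hV u.1 u.2).1) (fun u => a (Sum.inr u)) fun u => ha _
      refine ⟨(x, y), ⟨hx, hy⟩, fun g hg => ?_⟩
      obtain ⟨m, hm, n, hn, hgm⟩ := hval g hg
      simp only [hgm _ (hv _), Fintype.sum_sum_type]
      rw [hgm _ ⟨hx, hy⟩]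
      simp only [v, Sum.elim_inl, Sum.elim_inr, hom m hm, hom' n hn, add_zero, zero_add]
      rw [hxm m hm, hym n hn]
  · intro x hx y hy h g hg
    obtain ⟨h1, h2⟩ := hcomp x hx y hy 1 1 fun g hg => by rw [one_mul, one_mul]; exact h g hg
    obtain ⟨m, hm, n, hn, hgm⟩ := hval g hg
    rw [hgm x hx, hS.stronglyConvex x.1 hx.1 y.1 hy.1 (fun m hm => by linarith [h1 m hm]) m hm,
      hT.stronglyConvex x.2 hx.2 y.2 hy.2 (fun n hn => by linarith [h2 n hn]) n hn, add_zero]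

namespace WComplex

/-! ### Cone complexes: minimal cones, faces and dimensions -/

section complexes

variable {ι : Type u} {X : Type v} {L : Type w} [AddCommGroup L] {K : WComplex ι X L}

/-- The axioms of a cone complex in terms of minimal faces. -/
theorem IsConeComplex.of_minFace [Finite ι] (h1 : ∀ i, IsIntegralCone (K.cone i) (K.M i))
    (h2 : ∀ x, ∃ i, x ∈ K.cone i) (h3 : Function.Injective K.cone)
    (h4 : ∀ x, ∃ k, ∀ i, x ∈ K.cone i → K.cone k = minFace (K.cone i) (K.M i) x ∧
      K.M k = restrictLattice (K.cone k) (K.M i)) : K.IsConeComplex where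
  finite := inferInstance
  isCone := h1
  cover := h2
  injective := h3
  face i T hT := by
    obtain ⟨x, hx, -, hxT⟩ := (h1 i).exists_lattice_minFace_eq hT
    obtain ⟨k, hk⟩ := h4 x
    obtain ⟨h5, h6⟩ := hk i (hT.subset hx)
    refine ⟨k, h5.trans hxT, ?_⟩
    rw [h6, h5, hxT]
  inter i j x hi hj := by
    obtain ⟨k, hk⟩ := h4 x
    refine ⟨k, ?_, ?_, ?_⟩
    · rw [(hk i hi).1]; exact (h1 i).isFaceOf_minFace hi
    · rw [(hk j hj).1]; exact (h1 j).isFaceOf_minFace hj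
    · rw [(hk i hi).1]; exact IsIntegralCone.mem_minFace hi

namespace IsConeComplex

/-- Take a cone through `x` that is minimal under inclusion. The common face through `x` that it
shares with any other cone through `x` must be all of it. -/
theorem exists_carrier (hK : K.IsConeComplex) (x : X) :
    ∃ i, x ∈ K.cone i ∧ ∀ j, x ∈ K.cone j → IsFaceOf (K.cone j) (K.M j) (K.cone i) := by
  have := hK.finite
  obtain ⟨i, hi, hmin⟩ := Set.Finite.exists_minimalFor K.cone {i | x ∈ K.cone i} (Set.toFinite _)
    (hK.cover x)
  refine ⟨i, hi, fun j hj => ?_⟩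
  obtain ⟨k, hki, hkj, hxk⟩ := hK.inter i j x hi hj
  rwa [Set.Subset.antisymm (hmin hxk hki.subset) hki.subset]

/-- The smallest cone containing a point. -/
noncomputable def carrier (hK : K.IsConeComplex) (x : X) : ι := (hK.exists_carrier x).choose

variable (hK : K.IsConeComplex)
include hK

theorem mem_carrier (x : X) : x ∈ K.cone (hK.carrier x) := (hK.exists_carrier x).choose_spec.1

theorem isFaceOf_carrier {x : X} {j : ι} (h : x ∈ K.cone j) :
    IsFaceOf (K.cone j) (K.M j) (K.cone (hK.carrier x)) := (hK.exists_carrier x).choose_spec.2 j h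

theorem carrier_subset {x : X} {j : ι} (h : x ∈ K.cone j) : K.cone (hK.carrier x) ⊆ K.cone j :=
  (hK.isFaceOf_carrier h).subset

theorem carrier_subset_iff {x : X} {j : ι} : K.cone (hK.carrier x) ⊆ K.cone j ↔ x ∈ K.cone j :=
  ⟨fun h => h (hK.mem_carrier x), hK.carrier_subset⟩

theorem M_of_isFaceOf {i j : ι} (h : IsFaceOf (K.cone i) (K.M i) (K.cone j)) :
    K.M j = restrictLattice (K.cone j) (K.M i) := by
  obtain ⟨k, h1, h2⟩ := hK.face i _ h
  rw [← h2, hK.injective h1]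

/-- The minimal cone of `x` is determined by linear inequalities in any cone containing `x`. -/
theorem carrier_eq {x : X} {i : ι} (hx : x ∈ K.cone i)
    (h : ∀ m ∈ K.M i, (∀ z ∈ K.cone i, 0 ≤ m z) → m x = 0 → m = 0) : hK.carrier x = i := by
  apply hK.injective
  obtain ⟨m, hm, hpos, heq⟩ := hK.isFaceOf_carrier hx
  have h1 : m x = 0 := by
    have := hK.mem_carrier x
    rw [heq] at this
    exact this.2
  rw [heq, h m hm hpos h1]
  simp

/-- The zero set of `m` is a face through `x`, hence it contains the minimal cone of `x`. In this
sense `x` is a relative interior point of that cone. -/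
theorem eq_zero_of_carrier {x : X} {m : X → ℝ} (hm : m ∈ K.M (hK.carrier x))
    (hpos : ∀ z ∈ K.cone (hK.carrier x), 0 ≤ m z) (hx : m x = 0) : m = 0 := by
  obtain ⟨k, hk, -⟩ := hK.face (hK.carrier x) {z | z ∈ K.cone (hK.carrier x) ∧ m z = 0}
    ⟨m, hm, hpos, rfl⟩
  have h1 : K.cone (hK.carrier x) ⊆ K.cone k :=
    hK.carrier_subset (by rw [hk]; exact ⟨hK.mem_carrier x, hx⟩)
  refine (hK.isCone _).ext_of_vanish hm (zero_mem _) fun z hz => ?_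
  have := h1 hz
  rw [hk] at this
  exact this.2

theorem minFace_carrier (x : X) :
    minFace (K.cone (hK.carrier x)) (K.M (hK.carrier x)) x = K.cone (hK.carrier x) := by
  ext y
  refine ⟨fun hy => hy.1, fun hy => ⟨hy, fun m hm hpos hx => ?_⟩⟩
  rw [hK.eq_zero_of_carrier hm hpos hx]
  rfl

theorem cone_carrier_eq_minFace {x : X} {i : ι} (hx : x ∈ K.cone i) :
    K.cone (hK.carrier x) = minFace (K.cone i) (K.M i) x := by
  obtain ⟨k, hk, -⟩ := hK.face i _ ((hK.isCone i).isFaceOf_minFace hx)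
  refine Set.Subset.antisymm ?_ ?_
  · rw [← hk]
    exact hK.carrier_subset (by rw [hk]; exact IsIntegralCone.mem_minFace hx)
  · intro y hy
    obtain ⟨m, hm, hpos, heq⟩ := hK.isFaceOf_carrier hx
    have h1 := hK.mem_carrier x
    rw [heq] at h1 ⊢
    exact ⟨hy.1, hy.2 m hm hpos h1.2⟩

/-- The improper face of a cone is also the minimal face of a lattice point. This supplies relative
interior points throughout. -/
theorem exists_carrier_eq (i : ι) : ∃ x, hK.carrier x = i ∧ IsLatticePt (K.M i) x := by
  obtain ⟨x, hx, hlat, hface⟩ := (hK.isCone i).exists_lattice_minFace_eq (T := K.cone i)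
    ⟨0, zero_mem _, fun _ _ => le_rfl, by simp⟩
  refine ⟨x, hK.injective ?_, hlat⟩
  rw [hK.cone_carrier_eq_minFace hx, hface]

/-- The smaller cone is the minimal cone of one of its points, and a minimal cone is a face of every
cone through the point. Inclusion alone therefore detects faces. -/
theorem isFaceOf_of_subset {i j : ι} (h : K.cone j ⊆ K.cone i) :
    IsFaceOf (K.cone i) (K.M i) (K.cone j) := by
  obtain ⟨x, rfl, -⟩ := hK.exists_carrier_eq j
  exact hK.isFaceOf_carrier (h (hK.mem_carrier x))

theorem M_of_subset {i j : ι} (h : K.cone j ⊆ K.cone i) :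
    K.M j = restrictLattice (K.cone j) (K.M i) := hK.M_of_isFaceOf (hK.isFaceOf_of_subset h)

/-- If a sum with positive coefficients lies in a face, so do the summands. -/
theorem mem_of_comb {i j : ι} (h : K.cone j ⊆ K.cone i) {x y z : X} (hx : x ∈ K.cone i)
    (hy : y ∈ K.cone i) (hz : z ∈ K.cone j) {a b : ℝ} (ha : 0 < a) (hb : 0 < b)
    (hzm : ∀ m ∈ K.M i, m z = a * m x + b * m y) : x ∈ K.cone j ∧ y ∈ K.cone j := by
  obtain ⟨m, hm, hpos, heq⟩ := hK.isFaceOf_of_subset h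
  rw [heq] at hz ⊢
  have h1 := hzm m hm
  have h2 := mul_nonneg ha.le (hpos x hx)
  have h3 := mul_nonneg hb.le (hpos y hy)
  rw [hz.2] at h1
  refine ⟨⟨hx, ?_⟩, hy, ?_⟩
  · exact (mul_eq_zero.1 (by linarith : a * m x = 0)).resolve_left ha.ne'
  · exact (mul_eq_zero.1 (by linarith : b * m y = 0)).resolve_left hb.ne'

theorem eq_of_subset_of_dim_le {i j : ι} (h : K.cone j ⊆ K.cone i) (hd : K.dim i ≤ K.dim j) :
    j = i := by
  by_contra hne
  have := (hK.isCone i).finrank_face_lt (hK.isFaceOf_of_subset h) fun h => hne (hK.injective h)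
  rw [← hK.M_of_subset h] at this
  exact absurd hd (not_le.2 this)

theorem dim_le_of_subset {i j : ι} (h : K.cone j ⊆ K.cone i) : K.dim j ≤ K.dim i := by
  have := finrank_restrictLattice_add (hK.isCone i).fg (K.cone j)
  rw [← hK.M_of_subset h] at this
  exact Nat.le.intro this

theorem finrank_ann_add {i j : ι} (h : K.cone j ⊆ K.cone i) :
    Module.finrank ℤ (ann (K.M i) (K.cone j)) + K.dim j = K.dim i := by
  have := finrank_restrictLattice_add (hK.isCone i).fg (K.cone j)
  rw [← hK.M_of_subset h] at this
  rw [add_comm]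
  exact this

/-! ### Value groups and weight classes -/

/-- Two cones through `x` share a face through `x`, and the functions on that face are the
restrictions from either cone. So all cones through `x` give the same values. -/
theorem valueGroup_eq {x : X} {i : ι} (hx : x ∈ K.cone i) :
    K.valueGroup x = valuesAt (K.M i) x := by
  apply le_antisymm
  · refine (AddSubgroup.closure_le _).2 ?_
    rintro _ ⟨j, hj, m, hm, rfl⟩
    obtain ⟨k, hki, hkj, hxk⟩ := hK.inter i j x hx hj
    obtain ⟨g, hg, hgm⟩ := exists_restrict hm (K.cone k)
    rw [← hK.M_of_isFaceOf hkj, hK.M_of_isFaceOf hki] at hg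
    obtain ⟨n, hn, hgn⟩ := exists_of_mem_restrictLattice hg
    exact ⟨n, hn, by rw [← hgm x hxk, hgn x hxk]; rfl⟩
  · rintro _ ⟨m, hm, rfl⟩
    exact AddSubgroup.subset_closure ⟨i, hx, m, hm, rfl⟩

theorem finrank_valueGroup_le {x : X} {i : ι} (hx : x ∈ K.cone i) :
    Module.finrank ℤ (K.valueGroup x) ≤ K.dim i := by
  rw [hK.valueGroup_eq hx]
  exact finrank_valuesAt_le (hK.isCone i).fg x

theorem eq_carrier_of_finrank {x : X} {i : ι} (hx : x ∈ K.cone i)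
    (h : Module.finrank ℤ (K.valueGroup x) = K.dim i) : i = hK.carrier x :=
  (hK.eq_of_subset_of_dim_le (hK.carrier_subset hx)
    (h ▸ hK.finrank_valueGroup_le (hK.mem_carrier x))).symm

/-- The value group of `x` has full rank iff no function of the lattice vanishes at `x`. -/
theorem finrank_valueGroup_eq_iff {x : X} {i : ι} (hx : x ∈ K.cone i) :
    Module.finrank ℤ (K.valueGroup x) = K.dim i ↔ ∀ m ∈ K.M i, m x = 0 → m = 0 := by
  rw [hK.valueGroup_eq hx]
  exact finrank_valuesAt_eq_iff (hK.isCone i).fg x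

omit hK in
open Classical in
-- The sum has at most one term: the rank of the value group is bounded by the dimension of the
-- minimal cone, so a cone through `x` of exactly that dimension must be the minimal one.
theorem weightClass_eq (hK : K.IsConeComplex) (c : ι → ℤ) (x : X) : K.weightClass c x =
    if Module.finrank ℤ (K.valueGroup x) = K.dim (hK.carrier x) then c (hK.carrier x) else 0 := by
  unfold weightClass
  split_ifs with h
  · have : {i | x ∈ K.cone i ∧ Module.finrank ℤ (K.valueGroup x) = K.dim i} = {hK.carrier x} := by
      ext i
      refine ⟨fun hi => hK.eq_carrier_of_finrank hi.1 hi.2, ?_⟩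
      rintro rfl
      exact ⟨hK.mem_carrier x, h⟩
    rw [this, finsum_mem_singleton]
  · have : {i | x ∈ K.cone i ∧ Module.finrank ℤ (K.valueGroup x) = K.dim i} = ∅ := by
      ext i
      refine ⟨fun hi => h ?_, fun hi => hi.elim⟩
      rw [← hK.eq_carrier_of_finrank hi.1 hi.2]
      exact hi.2
    rw [this, finsum_mem_empty]

end IsConeComplex

end complexes

end WComplex

theorem eq_zero_of_mem_restrictLattice {X : Type v} {T : Set X} {M : AddSubgroup (X → ℝ)}
    {g : X → ℝ} (hg : g ∈ restrictLattice T M) {x : X} (hx : x ∉ T) : g x = 0 := by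
  obtain ⟨m, -, rfl⟩ := mem_restrictLattice.1 hg
  exact Set.indicator_of_notMem hx m

/-- Two lattices of functions supported on `S` agree if they have the same restrictions to `S`. -/
theorem lattice_eq_of_values {X : Type v} {S : Set X} {P Q : AddSubgroup (X → ℝ)}
    (hP : ∀ m ∈ P, ∀ x, x ∉ S → m x = 0) (hQ : ∀ m ∈ Q, ∀ x, x ∉ S → m x = 0)
    (h1 : ∀ m ∈ P, ∃ n ∈ Q, ∀ x ∈ S, m x = n x) (h2 : ∀ m ∈ Q, ∃ n ∈ P, ∀ x ∈ S, m x = n x) :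
    P = Q := by
  have key : ∀ A B : AddSubgroup (X → ℝ), (∀ m ∈ A, ∀ x, x ∉ S → m x = 0) →
      (∀ m ∈ B, ∀ x, x ∉ S → m x = 0) → (∀ m ∈ A, ∃ n ∈ B, ∀ x ∈ S, m x = n x) → A ≤ B := by
    intro A B hA hB h m hm
    obtain ⟨n, hn, hmn⟩ := h m hm
    have : m = n := by
      ext x
      by_cases hx : x ∈ S
      · exact hmn x hx
      · rw [hA m hm x hx, hB n hn x hx]
    rwa [this]
  exact le_antisymm (key P Q hP hQ h1) (key Q P hQ hP h2)

theorem finrank_eq_of_range {A : Type u} {G : Type v} [AddCommGroup A] [AddCommGroup G]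
    {P : AddSubgroup G} (f : A →+ G) (hf : Function.Injective f) (hP : ∀ g, g ∈ P ↔ ∃ a, f a = g) :
    Module.finrank ℤ P = Module.finrank ℤ A := by
  let f' : A →ₗ[ℤ] P := (f.codRestrict P fun a => (hP _).2 ⟨a, rfl⟩).toIntLinearMap
  refine (LinearEquiv.ofBijective f' ⟨fun a b h => hf (congrArg Subtype.val h), ?_⟩).finrank_eq.symm
  rintro ⟨g, hg⟩
  obtain ⟨a, rfl⟩ := (hP g).1 hg
  exact ⟨a, rfl⟩

/-! ### Subdivision along the zero set of a divisor -/

theorem sign_eq_zero_or_one_iff (a : ℝ) :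
    (SignType.sign a = 0 ∨ SignType.sign a = 1) ↔ 0 ≤ a := by
  rw [sign_eq_zero_iff, sign_eq_one_iff]
  exact ⟨fun h => h.elim (fun h => h.ge) le_of_lt, fun h => h.eq_or_lt.imp_left Eq.symm⟩

theorem sign_eq_zero_or_neg_one_iff (a : ℝ) :
    (SignType.sign a = 0 ∨ SignType.sign a = -1) ↔ a ≤ 0 := by
  rw [sign_eq_zero_iff, sign_eq_neg_one_iff]
  exact ⟨fun h => h.elim (fun h => h.le) le_of_lt, fun h => h.eq_or_lt⟩

theorem IsIntegralCone.congr_set {X : Type v} {S T : Set X} {M : AddSubgroup (X → ℝ)}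
    (hS : IsIntegralCone S (restrictLattice S M)) (h : S = T) :
    IsIntegralCone T (restrictLattice T M) := h ▸ hS

/-- The part of a cone where an integral linear function has a prescribed sign or vanishes. -/
theorem IsIntegralCone.signPart {X : Type v} {S : Set X} {M : AddSubgroup (X → ℝ)}
    (hS : IsIntegralCone S M) {h : X → ℝ} (hh : ∃ m ∈ M, ∀ x ∈ S, h x = m x) (s : SignType) :
    IsIntegralCone {x | x ∈ S ∧ (SignType.sign (h x) = 0 ∨ SignType.sign (h x) = s)}
      (restrictLattice {x | x ∈ S ∧ (SignType.sign (h x) = 0 ∨ SignType.sign (h x) = s)} M) := by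
  obtain ⟨m, hm, hmx⟩ := hh
  have hpos := hS.half hm
  cases s with
  | pos =>
    refine hpos.congr_set (Set.ext fun x => and_congr_right fun hx => ?_)
    rw [hmx x hx]
    exact (sign_eq_zero_or_one_iff _).symm
  | neg =>
    refine (hS.half (neg_mem hm)).congr_set (Set.ext fun x => and_congr_right fun hx => ?_)
    rw [hmx x hx, Pi.neg_apply, neg_nonneg]
    exact (sign_eq_zero_or_neg_one_iff _).symm
  | zero =>
    -- The zero set is cut out in two steps, by `m ≥ 0` and then by `-m ≥ 0`.
    obtain ⟨g, hg, hgm⟩ := exists_restrict (neg_mem hm) {x | x ∈ S ∧ 0 ≤ m x}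
    have h1 := hpos.half hg
    rw [restrictLattice_restrictLattice (fun x hx => hx.1)] at h1
    refine h1.congr_set (Set.ext fun x => ⟨fun hx => ?_, fun hx => ?_⟩)
    · refine ⟨hx.1.1, Or.inl ?_⟩
      have h2 := hx.2
      rw [hgm x hx.1, Pi.neg_apply] at h2
      rw [hmx x hx.1.1, sign_eq_zero_iff]
      linarith [hx.1.2]
    · have h2 : m x = 0 := by
        rw [← hmx x hx.1]
        exact sign_eq_zero_iff.1 (hx.2.elim id id)
      have h3 : x ∈ {x | x ∈ S ∧ 0 ≤ m x} := ⟨hx.1, h2.ge⟩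
      exact ⟨h3, by rw [hgm x h3, Pi.neg_apply, h2, neg_zero]⟩

namespace WComplex

section split

variable {ι : Type u} {X : Type v} {L : Type w} [AddCommGroup L]

/-- The part of a cone of `K` where `h` vanishes or has a given sign. -/
def splitCone (K : WComplex ι X L) (h : X → ℝ) (p : ι × SignType) : Set X :=
  {x | x ∈ K.cone p.1 ∧ (SignType.sign (h x) = 0 ∨ SignType.sign (h x) = p.2)}

/-- The index set of the subdivision of `K` along the zero set of `h`: pairs `(i, s)` such that `h`
has sign `s` somewhere in the relative interior of the cone `i`. -/
abbrev SplitIndex (K : WComplex ι X L) (h : X → ℝ) : Type u :=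
  {p : ι × SignType // ∃ x ∈ K.cone p.1, (∀ j, x ∈ K.cone j → K.cone p.1 ⊆ K.cone j) ∧
    SignType.sign (h x) = p.2}

/-- The subdivision of `K` along the zero set of `h`. -/
noncomputable def split (K : WComplex ι X L) (h : X → ℝ) :
    WComplex (K.SplitIndex h) X L where
  cone p := K.splitCone h p.1
  M p := restrictLattice (K.splitCone h p.1) (K.M p.1.1)
  φ := K.φ
  φ_integral p l := by
    obtain ⟨m, hm, hmx⟩ := K.φ_integral p.1.1 l
    obtain ⟨g, hg, hgm⟩ := exists_restrict hm (K.splitCone h p.1)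
    exact ⟨g, hg, fun x hx => by rw [hgm x hx, hmx x hx.1]⟩

variable {K : WComplex ι X L}

theorem mem_split_cone {h : X → ℝ} {p} {x : X} : x ∈ (K.split h).cone p ↔
    x ∈ K.cone p.1.1 ∧ (SignType.sign (h x) = 0 ∨ SignType.sign (h x) = p.1.2) := Iff.rfl

/-- The piece indexed by the minimal cone of `x` and the sign of `h x` is the minimal face of `x` in
every piece through `x`, so the criterion by minimal faces applies. -/
theorem isConeComplex_split (hK : K.IsConeComplex) {h : X → ℝ} (hh : K.IsDivisor h) :
    (K.split h).IsConeComplex := by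
  have := hK.finite
  have hsgn : ∀ s t : SignType, (s = 0 ∨ s = t) → (t = 0 ∨ t = s) → s = t := by decide
  refine IsConeComplex.of_minFace (fun p => (hK.isCone p.1.1).signPart (hh p.1.1) p.1.2) ?_ ?_ ?_
  · exact fun x => ⟨⟨(hK.carrier x, SignType.sign (h x)), x, hK.mem_carrier x,
      fun j hj => hK.carrier_subset hj, rfl⟩, hK.mem_carrier x, Or.inr rfl⟩
  · rintro ⟨⟨i, s⟩, x, hx, hxi, hxs⟩ ⟨⟨j, t⟩, y, hy, hyj, hyt⟩ hpq
    have hpq' : K.splitCone h (i, s) = K.splitCone h (j, t) := hpq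
    have hx' : x ∈ K.splitCone h (i, s) := ⟨hx, Or.inr hxs⟩
    have hy' : y ∈ K.splitCone h (j, t) := ⟨hy, Or.inr hyt⟩
    rw [hpq'] at hx'
    rw [← hpq'] at hy'
    have h1 : i = j := hK.injective (Set.Subset.antisymm (hxi j hx'.1) (hyj i hy'.1))
    have h2 := hx'.2
    have h3 := hy'.2
    simp only at hxs hyt h2 h3
    rw [hxs] at h2
    rw [hyt] at h3
    subst h1
    have h4 := hsgn s t h2 h3
    subst h4
    rfl
  · intro x
    refine ⟨⟨(hK.carrier x, SignType.sign (h x)), x, hK.mem_carrier x,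
      fun j hj => hK.carrier_subset hj, rfl⟩, ?_⟩
    rintro ⟨⟨i, s⟩, hp⟩ ⟨hxi, hxs⟩
    simp only at hxi hxs
    have hsub : K.splitCone h (hK.carrier x, SignType.sign (h x)) ⊆ K.splitCone h (i, s) := by
      rintro y ⟨hy, hys⟩
      refine ⟨hK.carrier_subset hxi hy, ?_⟩
      rcases hys with h1 | h1
      · exact Or.inl h1
      · change SignType.sign (h y) = SignType.sign (h x) at h1
        rwa [h1]
    refine ⟨?_, ?_⟩
    · obtain ⟨mh, hmh, hmhx⟩ := hh i
      refine Set.Subset.antisymm (fun y hy => ⟨hsub hy, fun g hg hpos hgx => ?_⟩) ?_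
      · obtain ⟨m, hm, hgm⟩ := exists_of_mem_restrictLattice hg
        have hface : y ∈ minFace (K.cone i) (K.M i) x := by
          rw [← hK.cone_carrier_eq_minFace hxi]; exact hy.1
        have hy0 := hpos y (hsub hy)
        obtain ⟨ε, hε, hεz⟩ := (hK.isCone i).exists_sub_smul hxi hface
        -- The point `x - δ y` must stay in the piece. Either `h y = 0` and nothing changes, or `h
        -- x` and `h y` have equal signs and it suffices that `δ |h y|` is at most half of `|h x|`.
        obtain ⟨δ, hδ, hδε, hδh⟩ : ∃ δ : ℝ, 0 < δ ∧ δ ≤ ε ∧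
            (SignType.sign (h x - δ * h y) = 0 ∨ SignType.sign (h x - δ * h y) = s) := by
          rcases hy.2 with h1 | h1
          · refine ⟨ε, hε, le_rfl, ?_⟩
            rw [sign_eq_zero_iff.1 h1]
            simpa using hxs
          · change SignType.sign (h y) = SignType.sign (h x) at h1
            obtain ⟨δ, hδ, h2⟩ := exists_pos_mul_le {()} (fun _ => |h x|) (fun _ => 2 * |h y|)
              (by simp) (by simp) (fun _ _ h3 => by
                rw [abs_eq_zero] at h3
                rw [h3, sign_zero, sign_eq_zero_iff] at h1
                simp [h1])
            have h3 := h2 () (by simp)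
            refine ⟨min ε δ, lt_min hε hδ, min_le_left _ _, ?_⟩
            have h4 : SignType.sign (h x - min ε δ * h y) = SignType.sign (h x) := by
              have h5 : min ε δ * (2 * |h y|) ≤ |h x| :=
                (mul_le_mul_of_nonneg_right (min_le_right _ _) (by positivity)).trans h3
              have h6 : 0 < min ε δ := lt_min hε hδ
              rcases lt_trichotomy (h x) 0 with h7 | h7 | h7
              · rw [sign_neg h7] at h1 ⊢
                rw [sign_eq_neg_one_iff] at h1
                rw [abs_of_neg h1, abs_of_neg h7] at h5
                exact sign_neg (by nlinarith)
              · rw [h7, sign_zero, sign_eq_zero_iff] at h1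
                rw [h1, mul_zero, sub_zero]
              · rw [sign_pos h7] at h1 ⊢
                rw [sign_eq_one_iff] at h1
                rw [abs_of_pos h1, abs_of_pos h7] at h5
                exact sign_pos (by nlinarith)
            rwa [h4]
        obtain ⟨z, hz, hzm⟩ := hεz δ hδ.le hδε
        have hzs : z ∈ K.splitCone h (i, s) := ⟨hz, by
          rw [hmhx z hz, hzm mh hmh, ← hmhx x hxi, ← hmhx y (hsub hy).1]
          exact hδh⟩
        have h8 := hpos z hzs
        rw [hgm z hzs, hzm m hm, ← hgm x ⟨hxi, hxs⟩, hgx, ← hgm y (hsub hy)] at h8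
        nlinarith
      · rintro y ⟨hy, hyx⟩
        have hgen : ∀ m ∈ K.M i, (∀ z ∈ K.splitCone h (i, s), 0 ≤ m z) → m x = 0 → m y = 0 := by
          intro m hm hpos hmx
          obtain ⟨g, hg, hgm⟩ := exists_restrict hm (K.splitCone h (i, s))
          rw [← hgm y hy]
          exact hyx g hg (fun z hz => by rw [hgm z hz]; exact hpos z hz)
            (by rw [hgm x ⟨hxi, hxs⟩, hmx])
        refine ⟨?_, ?_⟩
        · change y ∈ K.cone (hK.carrier x)
          rw [hK.cone_carrier_eq_minFace hxi]
          exact ⟨hy.1, fun m hm hpos hmx => hgen m hm (fun z hz => hpos z hz.1) hmx⟩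
        -- If `h x = 0` and the piece lies on one side, then `h` or `-h` is non-negative on it and
        -- vanishes at `x`, so it vanishes on the minimal face.
        · rcases eq_or_ne (h x) 0 with h0 | h0
          · left
            have h1 : h y = 0 := by
              rw [hmhx x hxi] at h0
              rw [hmhx y hy.1]
              cases s with
              | zero => rw [← hmhx y hy.1]; exact sign_eq_zero_iff.1 (hy.2.elim id id)
              | pos =>
                refine hgen mh hmh (fun z hz => ?_) h0
                rw [← hmhx z hz.1]
                exact (sign_eq_zero_or_one_iff _).1 hz.2
              | neg =>
                have := hgen (-mh) (neg_mem hmh) (fun z hz => ?_) (by rw [Pi.neg_apply, h0, neg_zero])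
                · rwa [Pi.neg_apply, neg_eq_zero] at this
                · rw [Pi.neg_apply, ← hmhx z hz.1, neg_nonneg]
                  exact (sign_eq_zero_or_neg_one_iff _).1 hz.2
            rw [h1, sign_zero]
          · have h1 : SignType.sign (h x) = s := hxs.resolve_left (by rwa [sign_eq_zero_iff])
            change SignType.sign (h y) = 0 ∨ SignType.sign (h y) = SignType.sign (h x)
            rw [h1]
            exact hy.2
    · change restrictLattice (K.splitCone h (hK.carrier x, SignType.sign (h x)))
        (K.M (hK.carrier x)) =
        restrictLattice (K.splitCone h (hK.carrier x, SignType.sign (h x))) (restrictLattice (K.splitCone h (i, s)) (K.M i))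
      rw [restrictLattice_restrictLattice hsub, hK.M_of_isFaceOf (hK.isFaceOf_carrier hxi)]
      exact restrictLattice_restrictLattice fun y hy => hy.1

/-- The cone of the subdivision that contains `x` in its relative interior. -/
theorem split_carrier_val (hK : K.IsConeComplex) {h : X → ℝ} (hh : K.IsDivisor h) (x : X) :
    ((isConeComplex_split hK hh).carrier x).1 = (hK.carrier x, SignType.sign (h x)) := by
  have hS := isConeComplex_split hK hh
  let p : K.SplitIndex h :=
    ⟨(hK.carrier x, SignType.sign (h x)), x, hK.mem_carrier x,
      fun j hj => hK.carrier_subset hj, rfl⟩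
  have hxp : x ∈ (K.split h).cone p := ⟨hK.mem_carrier x, Or.inr rfl⟩
  have h1 : (K.split h).cone (hS.carrier x) ⊆ (K.split h).cone p := hS.carrier_subset hxp
  have h2 : (K.split h).cone p ⊆ (K.split h).cone (hS.carrier x) := by
    have hx := hS.mem_carrier x
    rintro y ⟨hy, hys⟩
    refine ⟨hK.carrier_subset hx.1 hy, ?_⟩
    rcases hys with h3 | h3
    · exact Or.inl h3
    · change SignType.sign (h y) = SignType.sign (h x) at h3
      rw [h3]
      exact hx.2
  exact congrArg Subtype.val (hS.injective (Set.Subset.antisymm h1 h2))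

theorem isProperSubdivision_split (hK : K.IsConeComplex) {h : X → ℝ} (hh : K.IsDivisor h) :
    (K.split h).IsProperSubdivision K :=
  ⟨isConeComplex_split hK hh, rfl, fun p => ⟨p.1.1, fun _ hx => hx.1, rfl⟩⟩

end split

/-! ### The product with the line -/

section line

variable {ι : Type u} {X : Type v} {L : Type w} [AddCommGroup L] {K : WComplex ι X L}

theorem mem_lineCone {s : SignType} {t : ℝ} :
    t ∈ lineCone s ↔ SignType.sign t = 0 ∨ SignType.sign t = s := by
  cases s with
  | pos => exact (sign_eq_zero_or_one_iff t).symm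
  | neg => exact (sign_eq_zero_or_neg_one_iff t).symm
  | zero => exact (Set.mem_singleton_iff.trans sign_eq_zero_iff.symm).trans (or_self_iff).symm

theorem zero_mem_lineCone (s : SignType) : (0 : ℝ) ∈ lineCone s :=
  mem_lineCone.2 (Or.inl sign_zero)

theorem eq_abs_mul_of_mem_lineCone {s : SignType} {t : ℝ} (ht : t ∈ lineCone s) :
    t = |t| * (s : ℝ) := by
  rcases mem_lineCone.1 ht with h | h
  · rw [sign_eq_zero_iff.1 h, abs_zero, zero_mul]
  · rw [← h, abs_mul_sign]

theorem mul_mem_lineCone (s : SignType) {a : ℝ} (ha : 0 ≤ a) : a * (s : ℝ) ∈ lineCone s := by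
  rw [mem_lineCone]
  rcases ha.eq_or_lt with rfl | ha
  · left; simp
  · right
    rw [sign_mul, sign_pos ha, one_mul]
    cases s <;> simp

theorem mem_line_M {s : SignType} {n : ℝ → ℝ} :
    n ∈ line.M s ↔ ∃ k : ℤ, n = (lineCone s).indicator fun t => k * t := by
  constructor
  · rintro ⟨_, ⟨k, rfl⟩, rfl⟩
    exact ⟨k, congrArg (lineCone s).indicator (by ext t; simp)⟩
  · rintro ⟨k, rfl⟩
    exact ⟨k • id, ⟨k, rfl⟩, congrArg (lineCone s).indicator (by ext t; simp)⟩

theorem isIntegralCone_line (s : SignType) : IsIntegralCone (line.cone s) (line.M s) := by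
  have hval : ∀ n ∈ line.M s, ∃ k : ℤ, ∀ t ∈ lineCone s, n t = k * t := fun n hn => by
    obtain ⟨k, rfl⟩ := mem_line_M.1 hn
    exact ⟨k, fun t ht => Set.indicator_of_mem ht _⟩
  obtain ⟨e, he, hev⟩ : ∃ e ∈ line.M s, ∀ t ∈ lineCone s, e t = t :=
    ⟨_, mem_line_M.2 ⟨1, rfl⟩, fun t ht => by rw [Set.indicator_of_mem ht]; simp⟩
  refine ⟨?_, ?_, ?_, ?_, ?_⟩
  · intro n hn t ht
    exact eq_zero_of_mem_restrictLattice hn ht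
  · refine restrictLattice_fg ⟨{id}, ?_⟩ _
    rw [Finset.coe_singleton, AddSubgroup.zmultiples_eq_closure]
  · intro x hx y hy h
    rw [← hev x hx, ← hev y hy, h e he]
  · refine polyhedral_of_family (fun _ : Unit => (s : ℝ)) (fun _ => ?_) ?_ ?_
    · have hs : (s : ℝ) ∈ lineCone s := by simpa using mul_mem_lineCone s zero_le_one
      refine ⟨hs, fun n hn => ?_⟩
      obtain ⟨k, hk⟩ := hval n hn
      refine ⟨k * s, ?_⟩
      rw [hk _ hs]
      cases s <;> simp
    · intro t ht
      have hs : (s : ℝ) ∈ lineCone s := by simpa using mul_mem_lineCone s zero_le_one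
      refine ⟨fun _ => |t|, fun _ => abs_nonneg _, fun n hn => ?_⟩
      obtain ⟨k, hk⟩ := hval n hn
      rw [hk t ht, hk _ hs, Finset.univ_unique, Finset.sum_singleton]
      conv_lhs => rw [eq_abs_mul_of_mem_lineCone ht]
      ring
    · intro a ha
      have hs : (s : ℝ) ∈ lineCone s := by simpa using mul_mem_lineCone s zero_le_one
      refine ⟨a () * s, mul_mem_lineCone s (ha _), fun n hn => ?_⟩
      obtain ⟨k, hk⟩ := hval n hn
      rw [hk _ (mul_mem_lineCone s (ha _)), hk _ hs, Finset.univ_unique, Finset.sum_singleton]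
      change k * (a () * (s : ℝ)) = a () * (k * s)
      ring
  · intro x hx y hy h n hn
    have h1 := h e he
    rw [hev x hx, hev y hy] at h1
    obtain ⟨k, hk⟩ := hval n hn
    have hx0 : x = 0 := by
      have h2 := mem_lineCone.1 hx
      have h3 := mem_lineCone.1 hy
      cases s with
      | zero => exact sign_eq_zero_iff.1 (h2.elim id id)
      | pos =>
        have := (sign_eq_zero_or_one_iff x).1 h2
        have := (sign_eq_zero_or_one_iff y).1 h3
        linarith
      | neg =>
        have := (sign_eq_zero_or_neg_one_iff x).1 h2
        have := (sign_eq_zero_or_neg_one_iff y).1 h3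
        linarith
    rw [hk x hx, hx0, mul_zero]

theorem mem_prod_cone {p : ι × SignType} {z : X × ℝ} : z ∈ (K.prod line).cone p ↔
    z.1 ∈ K.cone p.1 ∧ (SignType.sign z.2 = 0 ∨ SignType.sign z.2 = p.2) :=
  and_congr_right fun _ => mem_lineCone

theorem exists_of_mem_prod_M {p : ι × SignType} {g : X × ℝ → ℝ} (hg : g ∈ (K.prod line).M p) :
    ∃ m ∈ K.M p.1, ∃ k : ℤ, ∀ z ∈ (K.prod line).cone p, g z = m z.1 + k * z.2 := by
  obtain ⟨m, hm, n, hn, rfl⟩ := hg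
  obtain ⟨k, rfl⟩ := mem_line_M.1 hn
  refine ⟨m, hm, k, fun z hz => ?_⟩
  have hz' : z ∈ K.cone p.1 ×ˢ line.cone p.2 := hz
  rw [Set.indicator_of_mem hz', Set.indicator_of_mem (show z.2 ∈ lineCone p.2 from hz'.2)]

theorem exists_mem_prod_M {p : ι × SignType} {m : X → ℝ} (hm : m ∈ K.M p.1) (k : ℤ) :
    ∃ g ∈ (K.prod line).M p, ∀ z ∈ (K.prod line).cone p, g z = m z.1 + k * z.2 := by
  refine ⟨_, ⟨m, hm, _, mem_line_M.2 ⟨k, rfl⟩, rfl⟩, fun z hz => ?_⟩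
  have hz' : z ∈ K.cone p.1 ×ˢ line.cone p.2 := hz
  rw [Set.indicator_of_mem hz', Set.indicator_of_mem (show z.2 ∈ lineCone p.2 from hz'.2)]

theorem eq_zero_of_mem_prod_M {p : ι × SignType} {g : X × ℝ → ℝ} (hg : g ∈ (K.prod line).M p)
    {z : X × ℝ} (hz : z ∉ (K.prod line).cone p) : g z = 0 := by
  obtain ⟨m, hm, n, hn, rfl⟩ := hg
  exact Set.indicator_of_notMem hz _

/-- A function on a product cone has the form `m x + k t`. Testing it on `σ × 0` and over the zero
of `σ` shows that it is non-negative exactly when both summands are, so minimal faces are products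
of minimal faces. -/
theorem isConeComplex_prod_line (hK : K.IsConeComplex) : (K.prod line).IsConeComplex := by
  have := hK.finite
  refine IsConeComplex.of_minFace (fun p => (hK.isCone p.1).prod (isIntegralCone_line p.2)
    fun g => Iff.rfl) ?_ ?_ ?_
  · exact fun z => ⟨(hK.carrier z.1, SignType.sign z.2), mem_prod_cone.2
      ⟨hK.mem_carrier z.1, Or.inr rfl⟩⟩
  · rintro ⟨i, s⟩ ⟨j, t⟩ hpq
    have hpq' : ∀ z : X × ℝ, (z.1 ∈ K.cone i ∧ (SignType.sign z.2 = 0 ∨ SignType.sign z.2 = s)) ↔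
        (z.1 ∈ K.cone j ∧ (SignType.sign z.2 = 0 ∨ SignType.sign z.2 = t)) := fun z => by
      rw [← mem_prod_cone (p := (i, s)), ← mem_prod_cone (p := (j, t)), hpq]
    have hij : i = j := hK.injective <| by
      ext x
      simpa using hpq' (x, 0)
    obtain ⟨o, ho, -⟩ := (hK.isCone i).exists_zero
    have hsgn : ∀ s : SignType, SignType.sign (s : ℝ) = s := fun s => by cases s <;> simp
    have h1 := (hpq' (o, (s : ℝ))).1 ⟨ho, Or.inr (hsgn s)⟩
    have h2 := (hpq' (o, (t : ℝ))).2 ⟨hij ▸ ho, Or.inr (hsgn t)⟩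
    have h3 := h1.2
    have h4 := h2.2
    simp only [hsgn] at h3 h4
    have : ∀ s t : SignType, (s = 0 ∨ s = t) → (t = 0 ∨ t = s) → s = t := by decide
    rw [hij, this s t h3 h4]
  · rintro ⟨x, t⟩
    refine ⟨(hK.carrier x, SignType.sign t), ?_⟩
    rintro ⟨i, s⟩ hz
    obtain ⟨hxi, hts⟩ := mem_prod_cone.1 hz
    simp only at hxi hts
    have hsub : (K.prod line).cone (hK.carrier x, SignType.sign t) ⊆ (K.prod line).cone (i, s) := by
      rintro ⟨y, r⟩ hy
      obtain ⟨hy1, hy2⟩ := mem_prod_cone.1 hy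
      refine mem_prod_cone.2 ⟨hK.carrier_subset hxi hy1, ?_⟩
      rcases hy2 with h1 | h1
      · exact Or.inl h1
      · simp only at h1
        simp only [h1]
        exact hts
    have hx0 : ∀ y ∈ K.cone i, (y, (0 : ℝ)) ∈ (K.prod line).cone (i, s) := fun y hy =>
      ⟨hy, zero_mem_lineCone s⟩
    obtain ⟨o, ho, hom⟩ := (hK.isCone i).exists_zero
    have ho' : ∀ r ∈ lineCone s, (o, r) ∈ (K.prod line).cone (i, s) := fun r hr => ⟨ho, hr⟩
    refine ⟨?_, ?_⟩
    · refine Set.Subset.antisymm (fun y hy => ⟨hsub hy, fun g hg hpos hgx => ?_⟩) ?_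
      · obtain ⟨m, hm, k, hgm⟩ := exists_of_mem_prod_M hg
        have hmpos : ∀ z ∈ K.cone i, 0 ≤ m z := fun z hz => by
          have := hpos _ (hx0 z hz)
          rw [hgm _ (hx0 z hz)] at this
          simpa using this
        have hkpos : ∀ r ∈ lineCone s, 0 ≤ k * r := fun r hr => by
          have := hpos _ (ho' r hr)
          rw [hgm _ (ho' r hr)] at this
          simpa [hom m hm] using this
        rw [hgm _ hz] at hgx
        have h1 := hmpos x hxi
        have h2 := hkpos t (mem_lineCone.2 hts)
        simp only at hgx
        have h3 : m x = 0 := by linarith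
        have h4 : k * t = 0 := by linarith
        rw [hgm y (hsub hy)]
        obtain ⟨hy1, hy2⟩ := mem_prod_cone.1 hy
        rw [hK.cone_carrier_eq_minFace hxi] at hy1
        rw [hy1.2 m hm hmpos h3, zero_add]
        rcases mul_eq_zero.1 h4 with h5 | h5
        · rw [h5, zero_mul]
        · simp only [h5, sign_zero, or_self] at hy2
          rw [sign_eq_zero_iff.1 hy2, mul_zero]
      · rintro ⟨y, r⟩ ⟨hy, hyx⟩
        obtain ⟨hy1, hy2⟩ := mem_prod_cone.1 hy
        simp only at hy1 hy2
        refine mem_prod_cone.2 ⟨?_, ?_⟩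
        · simp only
          rw [hK.cone_carrier_eq_minFace hxi]
          refine ⟨hy1, fun m hm hpos hmx => ?_⟩
          obtain ⟨g, hg, hgm⟩ := exists_mem_prod_M (p := (i, s)) hm 0
          have := hyx g hg (fun z hz => by
            rw [hgm z hz]
            simpa using hpos z.1 hz.1) (by rw [hgm _ hz]; simpa using hmx)
          rw [hgm _ hy] at this
          simpa using this
        · simp only
          rcases eq_or_ne t 0 with h0 | h0
          · left
            -- The function `s t` is non-negative on the line cone of sign `s` and vanishes at `t =
            -- 0`; on the minimal face it must vanish too, which forces `r = 0`.
            obtain ⟨g, hg, hgm⟩ := exists_mem_prod_M (K := K) (p := (i, s)) (m := 0) (zero_mem _) (s : ℤ)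
            have := hyx g hg (fun z hz => by
              rw [hgm z hz, Pi.zero_apply, zero_add]
              obtain ⟨-, hz2⟩ := mem_prod_cone.1 hz
              cases s with
              | zero => simp
              | pos => simpa using (sign_eq_zero_or_one_iff _).1 hz2
              | neg => simpa using (sign_eq_zero_or_neg_one_iff _).1 hz2)
              (by rw [hgm _ hz, h0]; simp)
            rw [hgm _ hy] at this
            cases s with
            | zero => exact hy2.elim id id
            | pos => simpa using this
            | neg => simpa using this
          · have h1 : SignType.sign t = s := hts.resolve_left (by rwa [sign_eq_zero_iff])
            rw [h1]
            exact hy2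
    · refine lattice_eq_of_values (S := (K.prod line).cone (hK.carrier x, SignType.sign t))
        (fun g hg z hz => eq_zero_of_mem_prod_M hg hz)
        (fun g hg z hz => eq_zero_of_mem_restrictLattice hg hz) ?_ ?_
      · intro g hg
        obtain ⟨m, hm, k, hgm⟩ := exists_of_mem_prod_M hg
        change m ∈ K.M (hK.carrier x) at hm
        rw [hK.M_of_isFaceOf (hK.isFaceOf_carrier hxi)] at hm
        obtain ⟨m', hm', hmm'⟩ := exists_of_mem_restrictLattice hm
        obtain ⟨g', hg', hgm'⟩ := exists_mem_prod_M (p := (i, s)) hm' k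
        obtain ⟨g'', hg'', hgm''⟩ := exists_restrict hg'
          ((K.prod line).cone (hK.carrier x, SignType.sign t))
        exact ⟨g'', hg'', fun z hz => by rw [hgm z hz, hgm'' z hz, hgm' z (hsub hz), hmm' _ hz.1]⟩
      · intro g hg
        obtain ⟨g', hg', hgg'⟩ := exists_of_mem_restrictLattice hg
        obtain ⟨m, hm, k, hgm⟩ := exists_of_mem_prod_M hg'
        obtain ⟨m', hm', hmm'⟩ := exists_restrict hm (K.cone (hK.carrier x))
        rw [← hK.M_of_isFaceOf (hK.isFaceOf_carrier hxi)] at hm'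
        obtain ⟨g'', hg'', hgm''⟩ := exists_mem_prod_M
          (p := (hK.carrier x, SignType.sign t)) hm' k
        exact ⟨g'', hg'', fun z hz => by rw [hgm'' z hz, hmm' _ hz.1, hgg' z hz, hgm z (hsub hz)]⟩

theorem prod_line_carrier (hK : K.IsConeComplex) (hP : (K.prod line).IsConeComplex) (z : X × ℝ) :
    hP.carrier z = (hK.carrier z.1, SignType.sign z.2) := by
  have hz : z ∈ (K.prod line).cone (hK.carrier z.1, SignType.sign z.2) :=
    mem_prod_cone.2 ⟨hK.mem_carrier _, Or.inr rfl⟩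
  refine hP.injective (Set.Subset.antisymm (hP.carrier_subset hz) fun y hy => ?_)
  obtain ⟨hy1, hy2⟩ := mem_prod_cone.1 hy
  obtain ⟨hz1, hz2⟩ := mem_prod_cone.1 (hP.mem_carrier z)
  refine mem_prod_cone.2 ⟨hK.carrier_subset hz1 hy1, ?_⟩
  rcases hy2 with h | h
  · exact Or.inl h
  · simp only at h
    rw [h]
    exact hz2

theorem dim_prod_line_zero (hK : K.IsConeComplex) (i : ι) : (K.prod line).dim (i, 0) = K.dim i := by
  have hc : ∀ x : X, (x, (0 : ℝ)) ∈ (K.prod line).cone (i, 0) ↔ x ∈ K.cone i := fun x =>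
    ⟨fun h => h.1, fun h => ⟨h, zero_mem_lineCone 0⟩⟩
  refine finrank_eq_of_range ((Set.indicatorHom ℝ ((K.prod line).cone (i, 0))).comp
    ((AddMonoidHom.pi fun z : X × ℝ => Pi.evalAddMonoidHom (fun _ : X => ℝ) z.1).comp
      (K.M i).subtype)) (fun m n h => Subtype.ext ?_) fun g => ⟨fun hg => ?_, ?_⟩
  · refine (hK.isCone i).ext_of_vanish m.2 n.2 fun x hx => ?_
    have := congrFun h (x, 0)
    exact (Set.indicator_of_mem ((hc x).2 hx) _).symm.trans
      (this.trans (Set.indicator_of_mem ((hc x).2 hx) _))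
  · obtain ⟨m, hm, k, hgm⟩ := exists_of_mem_prod_M hg
    refine ⟨⟨m, hm⟩, ?_⟩
    ext z
    by_cases hz : z ∈ (K.prod line).cone (i, 0)
    · refine (Set.indicator_of_mem hz _).trans ?_
      rw [hgm z hz]
      have h0 : z.2 = 0 := sign_eq_zero_iff.1 ((mem_prod_cone.1 hz).2.elim id id)
      simp [h0]
    · rw [eq_zero_of_mem_prod_M hg hz]
      exact Set.indicator_of_notMem hz _
  · rintro ⟨m, rfl⟩
    refine ⟨m.1, m.2, 0, zero_mem _, ?_⟩
    simp only [Pi.zero_apply, add_zero]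
    rfl

/-- Restriction to `σ × 0` recovers the part on `σ`, and the value at the zero of `σ` and at `s ≠ 0`
recovers the integer slope, so the lattice is `M^σ × ℤ`. -/
theorem dim_prod_line_of_ne (hK : K.IsConeComplex) (i : ι) {s : SignType} (hs : s ≠ 0) :
    (K.prod line).dim (i, s) = K.dim i + 1 := by
  have hss : (s : ℝ) ∈ lineCone s := by simpa using mul_mem_lineCone s zero_le_one
  have hs0 : (s : ℝ) ≠ 0 := by cases s <;> simp_all
  obtain ⟨o, ho, hom⟩ := (hK.isCone i).exists_zero
  have := (hK.isCone i).fg.moduleFinite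
  have : Module.IsTorsionFree ℤ (K.M i) :=
    Function.Injective.moduleIsTorsionFree (Subtype.val : K.M i → X → ℝ) Subtype.val_injective
      (fun n x => rfl)
  have hfr : Module.finrank ℤ (K.M i × ℤ) = K.dim i + 1 := by
    rw [Module.finrank_prod, Module.finrank_self]; rfl
  rw [← hfr]
  refine finrank_eq_of_range ((Set.indicatorHom ℝ ((K.prod line).cone (i, s))).comp
    (AddMonoidHom.coprod
      ((AddMonoidHom.pi fun z : X × ℝ => Pi.evalAddMonoidHom (fun _ : X => ℝ) z.1).comp
        (K.M i).subtype)
      (AddMonoidHom.pi fun z : X × ℝ => (AddMonoidHom.mulRight z.2).comp (Int.castAddHom ℝ))))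
    ?_ fun g => ⟨fun hg => ?_, ?_⟩
  · rintro ⟨m, a⟩ ⟨n, b⟩ h
    have hval : ∀ z ∈ (K.prod line).cone (i, s), m.1 z.1 + a * z.2 = n.1 z.1 + b * z.2 :=
      fun z hz => (Set.indicator_of_mem hz _).symm.trans
        ((congrFun h z).trans (Set.indicator_of_mem hz _))
    refine Prod.ext (Subtype.ext ?_) ?_
    · refine (hK.isCone i).ext_of_vanish m.2 n.2 fun x hx => ?_
      simpa using hval (x, 0) ⟨hx, zero_mem_lineCone s⟩
    · have h1 := hval (o, s) ⟨ho, hss⟩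
      simp only [hom _ m.2, hom _ n.2, zero_add] at h1
      exact_mod_cast mul_right_cancel₀ hs0 h1
  · obtain ⟨m, hm, k, hgm⟩ := exists_of_mem_prod_M hg
    refine ⟨(⟨m, hm⟩, k), ?_⟩
    ext z
    by_cases hz : z ∈ (K.prod line).cone (i, s)
    · rw [hgm z hz]
      exact Set.indicator_of_mem hz _
    · rw [eq_zero_of_mem_prod_M hg hz]
      exact Set.indicator_of_notMem hz _
  · rintro ⟨⟨m, k⟩, rfl⟩
    obtain ⟨g, hg, hgm⟩ := exists_mem_prod_M (p := (i, s)) m.2 k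
    have : g = ((K.prod line).cone (i, s)).indicator (fun z => m.1 z.1 + k * z.2) := by
      ext z
      by_cases hz : z ∈ (K.prod line).cone (i, s)
      · rw [hgm z hz, Set.indicator_of_mem hz]
      · rw [eq_zero_of_mem_prod_M hg hz, Set.indicator_of_notMem hz]
    rw [this] at hg
    exact hg

/-- The product `Σ × Π¹` with the weak embedding sheared along the graph of a divisor `ψ`. Its cones
correspond to the pieces of `|Σ| × ℝ` on, below and above the graph of `ψ`. -/
noncomputable def graphComplex (K : WComplex ι X L) (ψ : X → ℝ) (hψ : K.IsDivisor ψ) :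
    WComplex (ι × SignType) (X × ℝ) (L × ℤ) where
  cone := (K.prod line).cone
  M := (K.prod line).M
  φ z := (K.φ z.1).coprod (line.φ (z.2 + ψ z.1))
  φ_integral := by
    rintro p ⟨l, k⟩
    obtain ⟨m, hm, hmx⟩ := K.φ_integral p.1 l
    obtain ⟨n, hn, hnx⟩ := hψ p.1
    obtain ⟨g, hg, hgm⟩ := exists_mem_prod_M (p := p) (add_mem hm (zsmul_mem hn k)) k
    refine ⟨g, hg, fun z hz => ?_⟩
    rw [hgm z hz, AddMonoidHom.coprod_apply, hmx z.1 hz.1]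
    change m z.1 + k * (z.2 + ψ z.1) = _
    rw [hnx z.1 hz.1, Pi.add_apply, Pi.smul_apply, zsmul_eq_mul]
    ring

theorem graphComplex_φ (ψ : X → ℝ) (hψ : K.IsDivisor ψ) (z : X × ℝ) (l : L × ℤ) :
    (K.graphComplex ψ hψ).φ z l = K.φ z.1 l.1 + l.2 * (z.2 + ψ z.1) := rfl

/-- The axioms involve only cones and lattices, which are those of the product; shearing the weak
embedding does not touch them. -/
theorem isConeComplex_graphComplex (hK : K.IsConeComplex) (ψ : X → ℝ) (hψ : K.IsDivisor ψ) :
    (K.graphComplex ψ hψ).IsConeComplex :=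
  have h := isConeComplex_prod_line hK
  ⟨h.finite, h.isCone, h.cover, h.injective, h.face, h.inter⟩

/-- The vertical coordinate is a divisor on the sheared product. -/
theorem isDivisor_height (ψ : X → ℝ) (hψ : K.IsDivisor ψ) :
    (K.graphComplex ψ hψ).IsDivisor fun z => z.2 + ψ z.1 := by
  intro p
  obtain ⟨n, hn, hnx⟩ := hψ p.1
  obtain ⟨g, hg, hgm⟩ := exists_mem_prod_M (p := p) hn 1
  refine ⟨g, hg, fun z hz => ?_⟩
  change z.2 + ψ z.1 = g z
  rw [hgm z hz, hnx z.1 hz.1]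
  push_cast
  ring

end line

end WComplex

namespace WComplex

/-! ### Lattice normal vectors and the balancing of the cup product -/

section normal

variable {ι : Type u} {X : Type v} {L : Type w} [AddCommGroup L] {K : WComplex ι X L}

/-- `x` is a lattice point of `σ` that generates `N^σ/N^τ`. -/
def IsFacetPt (K : WComplex ι X L) (σ τ : ι) (x : X) : Prop :=
  x ∈ K.cone σ ∧ IsLatticePt (K.M σ) x ∧ ∃ m ∈ ann (K.M σ) (K.cone τ), m x = 1

theorem exists_pullback (K : WComplex ι X L) {σ τ : ι} (h : K.cone τ ⊆ K.cone σ) {l : L}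
    (hl : l ∈ K.perp τ) : ∃ m ∈ ann (K.M σ) (K.cone τ), ∀ x ∈ K.cone σ, K.φ x l = m x := by
  obtain ⟨m, hm, hmx⟩ := K.φ_integral σ l
  exact ⟨m, ⟨hm, fun t ht => by rw [← hmx t (h ht)]; exact hl t ht⟩, hmx⟩

theorem exists_intHom_of_isLatticePt (K : WComplex ι X L) {σ : ι} {x : X} (hx : x ∈ K.cone σ)
    (hlat : IsLatticePt (K.M σ) x) : ∃ n : L →+ ℤ, ∀ l, K.φ x l = n l := by
  have : ∀ l, ∃ n : ℤ, K.φ x l = n := fun l => by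
    obtain ⟨m, hm, hmx⟩ := K.φ_integral σ l
    obtain ⟨n, hn⟩ := hlat m hm
    exact ⟨n, by rw [hmx x hx, hn]⟩
  choose n hn using this
  refine ⟨⟨⟨n, ?_⟩, ?_⟩, hn⟩
  · have := hn 0
    rw [map_zero] at this
    exact_mod_cast this.symm
  · intro a b
    have := hn (a + b)
    rw [map_add, hn, hn] at this
    exact_mod_cast this.symm

namespace IsConeComplex

variable (hK : K.IsConeComplex)
include hK

/-- The primitive integral function on `σ` that defines the facet `τ`. -/
theorem exists_facet_functional {σ τ : ι} (h : σ ∈ K.cofacets τ) :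
    ∃ f ∈ ann (K.M σ) (K.cone τ), (∀ x ∈ K.cone σ, 0 ≤ f x) ∧
      (∀ x ∈ K.cone σ, f x = 0 → x ∈ K.cone τ) ∧
      (∀ m ∈ ann (K.M σ) (K.cone τ), ∃ n : ℤ, m = n • f) ∧
      (∀ x, K.IsFacetPt σ τ x → f x = 1) ∧ ∃ x, K.IsFacetPt σ τ x := by
  have hd := h.2
  unfold dim at hd
  rw [hK.M_of_subset h.1] at hd
  obtain ⟨f, hf, hpos, hzero, hgen, x, hx, hlat, hfx⟩ :=
    (hK.isCone σ).exists_facet_data (hK.isFaceOf_of_subset h.1) hd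
  refine ⟨f, hf, hpos, hzero, hgen, ?_, x, hx, hlat, f, hf, hfx⟩
  rintro y ⟨hy, hylat, m, hm, hmy⟩
  obtain ⟨n, rfl⟩ := hgen m hm
  obtain ⟨k, hk⟩ := hylat f hf.1
  have h0 := hpos y hy
  rw [hk] at h0 ⊢
  rw [Pi.smul_apply, zsmul_eq_mul, hk] at hmy
  have h1 : n * k = 1 := by exact_mod_cast hmy
  have h2 : 0 ≤ k := by exact_mod_cast h0
  rcases Int.isUnit_iff.1 (IsUnit.of_mul_eq_one_right n h1) with h3 | h3
  · rw [h3]; simp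
  · omega

/-- The choice in `normalVector` has a witness, because a facet point exists and the weak embedding
takes integral values at it. -/
theorem normalVector_spec {σ τ : ι} (h : σ ∈ K.cofacets τ) :
    ∃ x, K.IsFacetPt σ τ x ∧ ∀ l, K.φ x l = K.normalVector σ τ l := by
  obtain ⟨f, -, -, -, -, -, x, hx⟩ := hK.exists_facet_functional h
  obtain ⟨n, hn⟩ := K.exists_intHom_of_isLatticePt hx.1 hx.2.1
  obtain ⟨y, hy, hylat, ⟨m, hm, hm0, hmy⟩, hyn⟩ := Classical.epsilon_spec
    (p := fun n : L →+ ℤ => ∃ x ∈ K.cone σ, (∀ m ∈ K.M σ, ∃ k : ℤ, m x = k) ∧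
      (∃ m ∈ K.M σ, (∀ t ∈ K.cone τ, m t = 0) ∧ m x = 1) ∧ ∀ l : L, K.φ x l = (n l : ℝ))
    (by
      obtain ⟨hx1, hx2, m, hm, hmx⟩ := hx
      exact ⟨n, x, hx1, hx2, ⟨m, hm.1, hm.2, hmx⟩, hn⟩)
  exact ⟨y, ⟨hy, hylat, m, ⟨hm, hm0⟩, hmy⟩, hyn⟩

/-- Modulo `N_τ` the normal vector is the image of any generator. -/
theorem normalVector_eq {σ τ : ι} (h : σ ∈ K.cofacets τ) {x : X} (hx : K.IsFacetPt σ τ x) {l : L}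
    (hl : l ∈ K.perp τ) : (K.normalVector σ τ l : ℝ) = K.φ x l := by
  obtain ⟨f, hf, -, -, hgen, hone, -⟩ := hK.exists_facet_functional h
  obtain ⟨y, hy, hyn⟩ := hK.normalVector_spec h
  obtain ⟨m, hm, hmx⟩ := K.exists_pullback h.1 hl
  obtain ⟨n, rfl⟩ := hgen m hm
  rw [← hyn, hmx y hy.1, hmx x hx.1]
  simp [hone y hy, hone x hx]

/-- On a cofacet every element of `τ^⊥` restricts to a multiple of one primitive function, and the
multiple is its value at the normal vector. -/
theorem exists_phi_eq_mul {σ τ : ι} (h : σ ∈ K.cofacets τ) :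
    ∃ f : X → ℝ, ∀ l ∈ K.perp τ, ∀ x ∈ K.cone σ, K.φ x l = K.normalVector σ τ l * f x := by
  obtain ⟨f, hf, -, -, hgen, hone, z, hz⟩ := hK.exists_facet_functional h
  refine ⟨f, fun l hl x hx => ?_⟩
  obtain ⟨m, hm, hmx⟩ := K.exists_pullback h.1 hl
  obtain ⟨n, rfl⟩ := hgen m hm
  rw [hK.normalVector_eq h hz hl, hmx x hx, hmx z hz.1]
  simp [hone z hz]

/-- Between two cones whose dimensions differ by two there are exactly two cones. -/
theorem exists_two_facets {σ δ : ι} (h : K.cone δ ⊆ K.cone σ) (hd : K.dim σ = K.dim δ + 2) :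
    ∃ τ₁ τ₂, τ₁ ≠ τ₂ ∧ ∀ τ, (τ ∈ K.cofacets δ ∧ σ ∈ K.cofacets τ) ↔ τ = τ₁ ∨ τ = τ₂ := by
  obtain ⟨m₀, hm₀, hpos₀, hδ⟩ := hK.isFaceOf_of_subset h
  have hδσ : K.cone δ ≠ K.cone σ := fun h => by
    rw [hK.injective h] at hd
    omega
  have hm₀ann : m₀ ∈ ann (K.M σ) (K.cone δ) := ⟨hm₀, fun t ht => by rw [hδ] at ht; exact ht.2⟩
  have hm₀0 : m₀ ≠ 0 := by
    rintro rfl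
    exact hδσ (by rw [hδ]; simp)
  have hrank : Module.finrank ℤ (ann (K.M σ) (K.cone δ)) = 2 := by
    have := hK.finrank_ann_add h
    omega
  have hfin := (ann_fg (hK.isCone σ).fg (K.cone δ)).moduleFinite
  have htf : Module.IsTorsionFree ℤ (ann (K.M σ) (K.cone δ)) :=
    Function.Injective.moduleIsTorsionFree (Subtype.val : ann (K.M σ) (K.cone δ) → X → ℝ)
      Subtype.val_injective (fun n x => rfl)
  -- `m₀` and `μ` span the functions vanishing on `δ` up to finite index, so they are coordinates on
  -- the two-dimensional cone `σ/δ`.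
  obtain ⟨⟨μ, hμ⟩, hind⟩ := exists_linearIndependent_pair_of_one_lt_finrank (R := ℤ)
    (by rw [hrank]; norm_num) (x := (⟨m₀, hm₀ann⟩ : ann (K.M σ) (K.cone δ)))
    fun h => hm₀0 (congrArg Subtype.val h)
  have hind' : ∀ a b : ℤ, a • m₀ + b • μ = 0 → a = 0 ∧ b = 0 := fun a b hab =>
    LinearIndependent.pair_iff.1 hind a b (Subtype.ext hab)
  have hdep : ∀ f ∈ ann (K.M σ) (K.cone δ), ∃ d a b : ℤ, d ≠ 0 ∧ d • f = a • m₀ + b • μ := by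
    intro f hf
    have hnot : ¬ LinearIndependent ℤ
        ![(⟨f, hf⟩ : ann (K.M σ) (K.cone δ)), ⟨m₀, hm₀ann⟩, ⟨μ, hμ⟩] := fun hli => by
      have := hli.fintype_card_le_finrank
      rw [hrank] at this
      simp at this
    obtain ⟨g, hg, i, hi⟩ := Fintype.not_linearIndependent_iff.1 hnot
    have hg' : g 0 • f + g 1 • m₀ + g 2 • μ = 0 := by
      have := congrArg Subtype.val hg
      rw [Fin.sum_univ_three] at this
      exact this
    refine ⟨g 0, -g 1, -g 2, fun h0 => hi ?_, ?_⟩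
    · rw [h0, zero_smul, zero_add] at hg'
      obtain ⟨h1, h2⟩ := hind' _ _ hg'
      fin_cases i
      · exact h0
      · exact h1
      · exact h2
    · rw [neg_smul, neg_smul, ← sub_eq_zero, ← hg']
      abel
  obtain ⟨U, hU, hU1, hU2⟩ := (hK.isCone σ).polyhedral
  have hnonneg : ∀ m ∈ K.M σ, (∀ u ∈ U, 0 ≤ m u) → ∀ x ∈ K.cone σ, 0 ≤ m x := fun m hm hmU x hx => by
    obtain ⟨a, ha, hax⟩ := hU1 x hx
    rw [hax m hm]
    exact Finset.sum_nonneg fun u hu => mul_nonneg (ha u) (hmU u hu)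
  have hvanish : ∀ m ∈ K.M σ, (∀ u ∈ U, m u = 0) → m = 0 := fun m hm hmU =>
    (hK.isCone σ).ext_of_vanish hm (zero_mem _) fun x hx => by
      obtain ⟨a, ha, hax⟩ := hU1 x hx
      rw [hax m hm]
      exact Finset.sum_eq_zero fun u hu => by rw [hmU u hu, mul_zero]
  classical
  set V := U.filter fun u => m₀ u ≠ 0 with hV
  have hVU : ∀ u ∈ V, u ∈ U := fun u hu => (Finset.mem_filter.1 hu).1
  have hVpos : ∀ u ∈ V, 0 < m₀ u := fun u hu =>
    lt_of_le_of_ne (hpos₀ u (hU u (hVU u hu)).1) (Ne.symm (Finset.mem_filter.1 hu).2)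
  have hUV : ∀ m ∈ ann (K.M σ) (K.cone δ), ∀ u ∈ U, u ∉ V → m u = 0 := fun m hm u hu huV => by
    refine hm.2 u ?_
    rw [hδ]
    exact ⟨(hU u hu).1, by_contra fun h0 => huV (Finset.mem_filter.2 ⟨hu, h0⟩)⟩
  have hVne : V.Nonempty := by
    by_contra hne
    rw [Finset.not_nonempty_iff_eq_empty] at hne
    exact hm₀0 (hvanish m₀ hm₀ fun u hu => hUV m₀ hm₀ann u hu (by simp [hne]))
  -- The function `m₀(u₁) μ - μ(u₁) m₀` vanishes at `δ` and at `u₁`. If it has a constant sign on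
  -- the generators it cuts out a face strictly between `δ` and `σ`; the integer `e` carries the
  -- sign.
  have key : ∀ e : ℤ, e ≠ 0 → ∀ u₁ ∈ V, (∀ u ∈ V, 0 ≤ e * (m₀ u₁ * μ u - μ u₁ * m₀ u)) →
      ∃ τ, (τ ∈ K.cofacets δ ∧ σ ∈ K.cofacets τ) ∧
        ∀ x, x ∈ K.cone τ ↔ x ∈ K.cone σ ∧ m₀ u₁ * μ x - μ u₁ * m₀ x = 0 := by
    intro e he u₁ hu₁ hmin
    obtain ⟨a, ha⟩ := (hU u₁ (hVU u₁ hu₁)).2 m₀ hm₀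
    obtain ⟨b, hb⟩ := (hU u₁ (hVU u₁ hu₁)).2 μ hμ.1
    have ha0 : a ≠ 0 := by
      rintro rfl
      exact (Finset.mem_filter.1 hu₁).2 (by rw [ha]; simp)
    have he' : (e : ℝ) ≠ 0 := by exact_mod_cast he
    set f : X → ℝ := e • (a • μ - b • m₀) with hf
    have hfx : ∀ x, f x = e * (m₀ u₁ * μ x - μ u₁ * m₀ x) := fun x => by
      rw [hf, ha, hb]; simp
    have hfann : f ∈ ann (K.M σ) (K.cone δ) :=
      zsmul_mem (sub_mem (zsmul_mem hμ _) (zsmul_mem hm₀ann _)) _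
    have hfpos : ∀ x ∈ K.cone σ, 0 ≤ f x := hnonneg f hfann.1 fun u hu => by
      by_cases huV : u ∈ V
      · rw [hfx]; exact hmin u huV
      · rw [hUV f hfann u hu huV]
    obtain ⟨τ, hτ, -⟩ := hK.face σ {x | x ∈ K.cone σ ∧ f x = 0} ⟨f, hfann.1, hfpos, rfl⟩
    have hmem : ∀ x, x ∈ K.cone τ ↔ x ∈ K.cone σ ∧ f x = 0 := fun x => by rw [hτ]; rfl
    have h1 : K.cone δ ⊆ K.cone τ := fun x hx => (hmem x).2 ⟨h hx, hfann.2 x hx⟩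
    have h2 : K.cone τ ⊆ K.cone σ := fun x hx => ((hmem x).1 hx).1
    have h3 : τ ≠ δ := by
      rintro rfl
      have : u₁ ∈ K.cone τ := (hmem u₁).2 ⟨(hU u₁ (hVU u₁ hu₁)).1, by rw [hfx]; ring⟩
      exact (hVpos u₁ hu₁).ne' (hm₀ann.2 u₁ this)
    have h4 : σ ≠ τ := by
      rintro rfl
      have hf0 : f = 0 := (hK.isCone σ).ext_of_vanish hfann.1 (zero_mem _)
        fun x hx => ((hmem x).1 hx).2
      have h5 : (-(e * b)) • m₀ + (e * a) • μ = 0 := by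
        rw [← hf0, hf, smul_sub, smul_smul, smul_smul, neg_smul]
        abel
      exact (mul_ne_zero he ha0) (hind' _ _ h5).2
    have h5 : K.dim δ < K.dim τ := by
      by_contra h5
      exact h3 (hK.eq_of_subset_of_dim_le h1 (not_lt.1 h5)).symm
    have h6 : K.dim τ < K.dim σ := by
      by_contra h6
      exact h4 (hK.eq_of_subset_of_dim_le h2 (not_lt.1 h6)).symm
    refine ⟨τ, ⟨⟨h1, by omega⟩, h2, by omega⟩, fun x => ?_⟩
    rw [hmem, hfx, mul_eq_zero, or_iff_right he']
  have hslope : ∀ u ∈ V, ∀ u' ∈ V, μ u' / m₀ u' ≤ μ u / m₀ u ↔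
      0 ≤ m₀ u' * μ u - μ u' * m₀ u := fun u hu u' hu' => by
    rw [div_le_div_iff₀ (hVpos u' hu') (hVpos u hu), sub_nonneg, mul_comm (m₀ u')]
  -- In the plane of `(m₀, μ)` the two edges of `σ/δ` are the generators of smallest and largest
  -- slope `μ / m₀`.
  obtain ⟨u₁, hu₁, hmin⟩ := V.exists_min_image (fun u => μ u / m₀ u) hVne
  obtain ⟨u₂, hu₂, hmax⟩ := V.exists_max_image (fun u => μ u / m₀ u) hVne
  obtain ⟨τ₁, hτ₁, hmem₁⟩ := key 1 one_ne_zero u₁ hu₁ fun u hu => by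
    have := (hslope u hu u₁ hu₁).1 (hmin u hu)
    simpa using this
  obtain ⟨τ₂, hτ₂, hmem₂⟩ := key (-1) (by norm_num) u₂ hu₂ fun u hu => by
    have := (hslope u₂ hu₂ u hu).1 (hmax u hu)
    push_cast
    linarith
  refine ⟨τ₁, τ₂, ?_, fun τ => ⟨fun hτ => ?_, ?_⟩⟩
  · rintro rfl
    have h1 : u₂ ∈ K.cone τ₁ := (hmem₂ u₂).2 ⟨(hU u₂ (hVU u₂ hu₂)).1, by ring⟩
    have h2 : μ u₂ / m₀ u₂ ≤ μ u₁ / m₀ u₁ := (hslope u₁ hu₁ u₂ hu₂).2 <| by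
      linarith [((hmem₁ u₂).1 h1).2]
    have h3 : ∀ u ∈ V, m₀ u₁ * μ u - μ u₁ * m₀ u = 0 := fun u hu => by
      have h4 := (hslope u hu u₁ hu₁).1 (hmin u hu)
      have h5 := (hslope u₁ hu₁ u hu).1 ((hmax u hu).trans h2)
      linarith
    have h6 : K.cone τ₁ = K.cone σ := by
      refine Set.Subset.antisymm hτ₁.2.1 fun x hx => (hmem₁ x).2 ⟨hx, ?_⟩
      obtain ⟨a, ha, hax⟩ := hU1 x hx
      rw [hax m₀ hm₀, hax μ hμ.1, Finset.mul_sum, Finset.mul_sum, ← Finset.sum_sub_distrib]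
      refine Finset.sum_eq_zero fun u hu => ?_
      by_cases huV : u ∈ V
      · linear_combination a u * h3 u huV
      · rw [hUV m₀ hm₀ann u hu huV, hUV μ hμ u hu huV]; ring
    have h7 := hτ₁.2.2
    rw [hK.injective h6] at h7
    omega
  · obtain ⟨⟨hδτ, hdτ⟩, hτσ, hdσ⟩ := hτ
    obtain ⟨f, hf, hfpos, hfzero, -⟩ := hK.exists_facet_functional ⟨hτσ, hdσ⟩
    have hfann : f ∈ ann (K.M σ) (K.cone δ) := ⟨hf.1, fun t ht => hf.2 t (hδτ ht)⟩
    obtain ⟨d, a, b, hd0, hdab⟩ := hdep f hfann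
    have hdab' : ∀ x, d * f x = a * m₀ x + b * μ x := fun x => by
      have := congrFun hdab x
      simpa using this
    have hd0' : (d : ℝ) ≠ 0 := by exact_mod_cast hd0
    -- A facet of `σ` above `δ` contains a generator outside `δ`, since otherwise it would be
    -- contained in `δ`.
    obtain ⟨u, huV, hfu⟩ : ∃ u ∈ V, f u = 0 := by
      by_contra! hne
      have h1 : K.cone τ ⊆ K.cone δ := fun x hx => by
        obtain ⟨c, hc, hcx⟩ := hU1 x (hτσ hx)
        have h2 := hf.2 x hx
        rw [hcx f hf.1] at h2
        have h3 := (Finset.sum_eq_zero_iff_of_nonneg fun u hu =>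
          mul_nonneg (hc u) (hfpos u (hU u hu).1)).1 h2
        rw [hδ]
        refine ⟨hτσ hx, ?_⟩
        rw [hcx m₀ hm₀]
        refine Finset.sum_eq_zero fun u hu => ?_
        by_cases huV : u ∈ V
        · rw [(mul_eq_zero.1 (h3 u hu)).resolve_right (hne u huV), zero_mul]
        · rw [hUV m₀ hm₀ann u hu huV, mul_zero]
      have := hK.dim_le_of_subset h1
      omega
    have hu0 := hVpos u huV
    have h1 : a * m₀ u + b * μ u = 0 := by rw [← hdab', hfu, mul_zero]
    -- Vanishing at `u` makes `f` proportional to the function attached to `u`. As `f` has one sign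
    -- on `σ`, the slope of `u` is extremal.
    have hmulf : ∀ x, m₀ u * (d * f x) = b * (m₀ u * μ x - μ u * m₀ x) := fun x => by
      rw [hdab']
      linear_combination m₀ x * h1
    have hb0 : (b : ℝ) ≠ 0 := by
      intro hb
      have h2 : f = 0 := by
        ext x
        have := hmulf x
        rw [hb, zero_mul] at this
        simpa [hu0.ne', hd0'] using this
      have h3 : K.cone τ = K.cone σ := Set.Subset.antisymm hτσ fun x hx => hfzero x hx (by simp [h2])
      rw [hK.injective h3] at hdσ
      omega
    have hτmem : ∀ x, x ∈ K.cone τ ↔ x ∈ K.cone σ ∧ m₀ u * μ x - μ u * m₀ x = 0 := fun x => by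
      constructor
      · intro hx
        have := hmulf x
        rw [hf.2 x hx, mul_zero, mul_zero, eq_comm, mul_eq_zero] at this
        exact ⟨hτσ hx, this.resolve_left hb0⟩
      · rintro ⟨hx, h2⟩
        refine hfzero x hx ?_
        have := hmulf x
        rw [h2, mul_zero, mul_eq_zero, mul_eq_zero] at this
        exact (this.resolve_left hu0.ne').resolve_left hd0'
    have hsame : ∀ u' ∈ V, m₀ u' * μ u - μ u' * m₀ u = 0 → ∀ x,
        (m₀ u * μ x - μ u * m₀ x = 0 ↔ m₀ u' * μ x - μ u' * m₀ x = 0) := fun u' hu' h2 x => by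
      have hu'0 := hVpos u' hu'
      have h3 : m₀ u * (m₀ u' * μ x - μ u' * m₀ x) = m₀ u' * (m₀ u * μ x - μ u * m₀ x) := by
        linear_combination m₀ x * h2
      constructor
      · intro h4
        rw [h4, mul_zero, mul_eq_zero] at h3
        exact h3.resolve_left hu0.ne'
      · intro h4
        rw [h4, mul_zero, eq_comm, mul_eq_zero] at h3
        exact h3.resolve_left hu'0.ne'
    have hcase : (∀ u' ∈ V, 0 ≤ m₀ u * μ u' - μ u * m₀ u') ∨
        (∀ u' ∈ V, m₀ u * μ u' - μ u * m₀ u' ≤ 0) := by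
      have h2 : ∀ u' ∈ V, 0 ≤ (b / d) * (m₀ u * μ u' - μ u * m₀ u') := fun u' hu' => by
        have h3 : (b / d) * (m₀ u * μ u' - μ u * m₀ u') = m₀ u * f u' := by
          have := hmulf u'
          field_simp
          linarith
        rw [h3]
        exact mul_nonneg hu0.le (hfpos u' (hU u' (hVU u' hu')).1)
      rcases lt_or_gt_of_ne (div_ne_zero hb0 hd0') with h3 | h3
      · right
        intro u' hu'
        by_contra! h4
        linarith [h2 u' hu', mul_neg_of_neg_of_pos h3 h4]
      · left
        intro u' hu'
        exact nonneg_of_mul_nonneg_right (h2 u' hu') h3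
    rcases hcase with h2 | h2
    · left
      have h3 := h2 u₁ hu₁
      have h4 := (hslope u huV u₁ hu₁).1 (hmin u huV)
      apply hK.injective
      ext x
      rw [hτmem, hmem₁, hsame u₁ hu₁ (by linarith)]
    · right
      have h3 := h2 u₂ hu₂
      have h4 := (hslope u₂ hu₂ u huV).1 (hmax u huV)
      apply hK.injective
      ext x
      rw [hτmem, hmem₂, hsame u₂ hu₂ (by linarith)]
  · rintro (rfl | rfl)
    · exact hτ₁
    · exact hτ₂

/-- Coordinates on `N^σ/N^δ` for a flag `δ ⊂ τ ⊂ σ`. -/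
theorem exists_flag_basis {σ τ δ : ι} (hτ : τ ∈ K.cofacets δ) (hσ : σ ∈ K.cofacets τ) {v w : X}
    (hv : K.IsFacetPt τ δ v) (hw : K.IsFacetPt σ τ w) :
    ∃ f ∈ ann (K.M σ) (K.cone δ), ∃ g ∈ ann (K.M σ) (K.cone δ), f v = 0 ∧ f w = 1 ∧ g v = 1 ∧
      g w = 0 ∧ (∀ x ∈ K.cone σ, 0 ≤ f x) ∧ (∀ x ∈ K.cone σ, f x = 0 → x ∈ K.cone τ) ∧
      ∀ m ∈ ann (K.M σ) (K.cone δ), ∀ x ∈ K.cone σ, m x = m w * f x + m v * g x := by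
  obtain ⟨f, hf, hfpos, hfzero, hfgen, hfone, -⟩ := hK.exists_facet_functional hσ
  obtain ⟨e, he, -, -, hegen, heone, -⟩ := hK.exists_facet_functional hτ
  have heM := he.1
  rw [hK.M_of_subset hσ.1] at heM
  obtain ⟨e', he', hee'⟩ := exists_of_mem_restrictLattice heM
  obtain ⟨k, hk⟩ := hw.2.1 e' he'
  have hfv : f v = 0 := hf.2 v hv.1
  have hfw : f w = 1 := hfone w hw
  have he'v : e' v = 1 := by rw [← hee' v hv.1]; exact heone v hv
  have hfann : f ∈ ann (K.M σ) (K.cone δ) := ⟨hf.1, fun t ht => hf.2 t (hτ.1 ht)⟩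
  -- `e'` extends the facet function of `δ ⊂ τ` to `σ`. Subtracting its value at `w` times `f` makes
  -- the pair dual to `(w, v)`.
  have hgann : e' - k • f ∈ ann (K.M σ) (K.cone δ) :=
    sub_mem ⟨he', fun t ht => by rw [← hee' t (hτ.1 ht)]; exact he.2 t ht⟩ (zsmul_mem hfann _)
  refine ⟨f, hfann, e' - k • f, hgann, hfv, hfw, by simp [he'v, hfv], by simp [hk, hfw], hfpos,
    hfzero, fun m hm x hx => ?_⟩
  obtain ⟨a, ha⟩ := hw.2.1 m hm.1
  have hvlat : ∃ b : ℤ, m v = b := by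
    obtain ⟨m', hm', hmm'⟩ := exists_restrict hm.1 (K.cone τ)
    rw [← hK.M_of_subset hσ.1] at hm'
    rw [← hmm' v hv.1]
    exact hv.2.1 m' hm'
  obtain ⟨b, hb⟩ := hvlat
  set r := m - a • f - b • (e' - k • f) with hr
  have hrann : r ∈ ann (K.M σ) (K.cone δ) :=
    sub_mem (sub_mem hm (zsmul_mem hfann _)) (zsmul_mem hgann _)
  have hrv : r v = 0 := by simp [hr, hb, hfv, he'v]
  have hrw : r w = 0 := by simp [hr, ha, hfw, hk]
  have hrτ : ∀ t ∈ K.cone τ, r t = 0 := by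
    obtain ⟨r', hr', hrr'⟩ := exists_restrict hrann.1 (K.cone τ)
    rw [← hK.M_of_subset hσ.1] at hr'
    obtain ⟨n, rfl⟩ := hegen r' ⟨hr', fun t ht => by rw [hrr' t (hτ.1 ht)]; exact hrann.2 t ht⟩
    have h1 := hrr' v hv.1
    rw [hrv] at h1
    simp only [Pi.smul_apply, heone v hv, zsmul_eq_mul, mul_one, Int.cast_eq_zero] at h1
    intro t ht
    rw [← hrr' t ht, h1]
    simp
  obtain ⟨n, hn⟩ := hfgen r ⟨hrann.1, hrτ⟩
  have hn0 : n = 0 := by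
    rw [hn] at hrw
    simpa [hfw] using hrw
  have hrx : r x = 0 := by rw [hn, hn0]; simp
  rw [ha, hb]
  simp only [hr, Pi.sub_apply, zsmul_eq_mul, Pi.mul_apply, Pi.intCast_apply] at hrx ⊢
  linarith

/-- The two flags `δ ⊂ τ₁ ⊂ σ` and `δ ⊂ τ₂ ⊂ σ` have opposite orientations. -/
theorem flag_wedge_add_eq_zero {σ τ₁ τ₂ δ : ι} (hne : τ₁ ≠ τ₂) (h₁ : τ₁ ∈ K.cofacets δ)
    (h₁' : σ ∈ K.cofacets τ₁) (h₂ : τ₂ ∈ K.cofacets δ) (h₂' : σ ∈ K.cofacets τ₂) {v₁ w₁ v₂ w₂ : X}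
    (hv₁ : K.IsFacetPt τ₁ δ v₁) (hw₁ : K.IsFacetPt σ τ₁ w₁) (hv₂ : K.IsFacetPt τ₂ δ v₂)
    (hw₂ : K.IsFacetPt σ τ₂ w₂) {m n : X → ℝ} (hm : m ∈ ann (K.M σ) (K.cone δ))
    (hn : n ∈ ann (K.M σ) (K.cone δ)) :
    (m v₁ * n w₁ - n v₁ * m w₁) + (m v₂ * n w₂ - n v₂ * m w₂) = 0 := by
  obtain ⟨f, hf, g, hg, hfv, hfw, hgv, hgw, hfpos, hfz, hfg⟩ :=
    hK.exists_flag_basis h₁ h₁' hv₁ hw₁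
  obtain ⟨f', hf', g', hg', hfv', hfw', hgv', hgw', hfpos', hfz', hfg'⟩ :=
    hK.exists_flag_basis h₂ h₂' hv₂ hw₂
  have hv₁σ := h₁'.1 hv₁.1
  have hv₂σ := h₂'.1 hv₂.1
  have hnotmem : ∀ {τ τ' : ι} {v : X}, τ ≠ τ' → τ ∈ K.cofacets δ → σ ∈ K.cofacets τ →
      τ' ∈ K.cofacets δ → σ ∈ K.cofacets τ' → K.IsFacetPt τ' δ v → v ∉ K.cone τ := by
    intro τ τ' v hne h h' k k' hv hvτ
    obtain ⟨e, he, hpos, hzero, hgen, hone, -⟩ := hK.exists_facet_functional h'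
    have hc : K.cone τ' ⊆ K.cone τ := by
      obtain ⟨a, ha, -, -, hgena, honea, -⟩ := hK.exists_facet_functional k
      obtain ⟨e', he', hee'⟩ := exists_restrict he.1 (K.cone τ')
      rw [← hK.M_of_subset k'.1] at he'
      obtain ⟨j, rfl⟩ := hgena e' ⟨he', fun t ht => by
        rw [hee' t (k.1 ht)]; exact he.2 t (h.1 ht)⟩
      have h1 := hee' v hv.1
      rw [he.2 v hvτ] at h1
      have hj : j = 0 := by simpa [honea v hv] using h1
      intro x hx
      refine hzero x (k'.1 hx) ?_
      rw [← hee' x hx, hj]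
      simp
    exact hne (hK.eq_of_subset_of_dim_le hc (by rw [h.2, k.2])).symm
  have hint : ∀ {τ : ι} {v : X}, σ ∈ K.cofacets τ → K.IsFacetPt τ δ v →
      ∀ m ∈ K.M σ, ∃ a : ℤ, m v = a := by
    intro τ v h hv m hm
    obtain ⟨m', hm', hmm'⟩ := exists_restrict hm (K.cone τ)
    rw [← hK.M_of_subset h.1] at hm'
    rw [← hmm' v hv.1]
    exact hv.2.1 m' hm'
  have hpos1 : 0 < f v₂ := lt_of_le_of_ne (hfpos _ hv₂σ) fun h0 =>
    hnotmem hne h₁ h₁' h₂ h₂' hv₂ (hfz _ hv₂σ h0.symm)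
  have hpos2 : 0 < f' v₁ := lt_of_le_of_ne (hfpos' _ hv₁σ) fun h0 =>
    hnotmem hne.symm h₂ h₂' h₁ h₁' hv₁ (hfz' _ hv₁σ h0.symm)
  -- `D` and `D'` are the determinants comparing the two flags. They are mutually inverse integers,
  -- and the relation `f v₂ = -D * f' v₁` between positive values makes `D` negative, so `D = -1`.
  set D := g v₂ * f w₂ - f v₂ * g w₂ with hD
  set D' := g' v₁ * f' w₁ - f' v₁ * g' w₁ with hD'
  have hDm : ∀ m ∈ ann (K.M σ) (K.cone δ), ∀ n ∈ ann (K.M σ) (K.cone δ),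
      m v₂ * n w₂ - n v₂ * m w₂ = D * (m v₁ * n w₁ - n v₁ * m w₁) := fun m hm n hn => by
    rw [hfg m hm v₂ hv₂σ, hfg n hn w₂ hw₂.1, hfg n hn v₂ hv₂σ, hfg m hm w₂ hw₂.1, hD]
    ring
  have hDm' : ∀ m ∈ ann (K.M σ) (K.cone δ), ∀ n ∈ ann (K.M σ) (K.cone δ),
      m v₁ * n w₁ - n v₁ * m w₁ = D' * (m v₂ * n w₂ - n v₂ * m w₂) := fun m hm n hn => by
    rw [hfg' m hm v₁ hv₁σ, hfg' n hn w₁ hw₁.1, hfg' n hn v₁ hv₁σ, hfg' m hm w₁ hw₁.1, hD']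
    ring
  have hDD : D' * D = 1 := by
    have h1 := hDm g hg f hf
    have h2 := hDm' g hg f hf
    rw [hgv, hfw, hfv, hgw] at h1 h2
    rw [h1] at h2
    linarith
  have hDneg : D < 0 := by
    have h1 := hDm f hf f' hf'
    rw [hfw', hfv', hfv, hfw] at h1
    by_contra! h2
    nlinarith
  obtain ⟨d, hd⟩ : ∃ d : ℤ, D = d := by
    obtain ⟨a, ha⟩ := hint h₂' hv₂ g hg.1
    obtain ⟨b, hb⟩ := hw₂.2.1 f hf.1
    obtain ⟨c, hc⟩ := hint h₂' hv₂ f hf.1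
    obtain ⟨d, hd⟩ := hw₂.2.1 g hg.1
    exact ⟨a * b - c * d, by rw [hD, ha, hb, hc, hd]; push_cast; ring⟩
  obtain ⟨d', hd'⟩ : ∃ d : ℤ, D' = d := by
    obtain ⟨a, ha⟩ := hint h₁' hv₁ g' hg'.1
    obtain ⟨b, hb⟩ := hw₁.2.1 f' hf'.1
    obtain ⟨c, hc⟩ := hint h₁' hv₁ f' hf'.1
    obtain ⟨d, hd⟩ := hw₁.2.1 g' hg'.1
    exact ⟨a * b - c * d, by rw [hD', ha, hb, hc, hd]; push_cast; ring⟩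
  have hD1 : D = -1 := by
    rw [hd, hd'] at hDD
    rw [hd] at hDneg
    have h1 : d' * d = 1 := by exact_mod_cast hDD
    have h2 : d < 0 := by exact_mod_cast hDneg
    rcases Int.isUnit_iff.1 (IsUnit.of_mul_eq_one_right d' h1) with h3 | h3
    · omega
    · rw [hd, h3]; simp
  rw [hDm m hm n hn, hD1]
  ring

end IsConeComplex

theorem IsCPDivisor.localEquation_spec {ψ : X → ℝ} (hψ : K.IsCPDivisor ψ) (i : ι) :
    ∀ x ∈ K.cone i, ψ x = K.φ x (K.localEquation ψ i) :=
  Classical.epsilon_spec (p := fun l : L => ∀ x ∈ K.cone i, ψ x = K.φ x l) (hψ i)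

theorem IsCPDivisor.isDivisor {ψ : X → ℝ} (hψ : K.IsCPDivisor ψ) : K.IsDivisor ψ := fun i => by
  obtain ⟨l, hl⟩ := hψ i
  obtain ⟨m, hm, hmx⟩ := K.φ_integral i l
  exact ⟨m, hm, fun x hx => by rw [hl x hx, hmx x hx]⟩

open Classical in
theorem finsum_mem_eq_sum_ite {κ : Type v'} [Fintype κ] (s : Set κ) (f : κ → ℤ) :
    ∑ᶠ i ∈ s, f i = ∑ i, if i ∈ s then f i else 0 := by
  rw [finsum_mem_def, finsum_eq_sum_of_fintype]
  exact Finset.sum_congr rfl fun i _ => Set.indicator_apply s f i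

/-- The cup product of a Minkowski weight with a combinatorially principal divisor is a Minkowski
weight. -/
theorem isMinkowskiWeight_weightCup (hK : K.IsConeComplex) {ψ : X → ℝ} (hψ : K.IsCPDivisor ψ)
    {c : ι → ℤ} (hc : K.IsMinkowskiWeight c) : K.IsMinkowskiWeight (K.weightCup ψ c) := by
  classical
  have := hK.finite
  have := Fintype.ofFinite ι
  intro δ l hl
  -- Only differences of local equations enter. Normalising by the one at `δ` puts those of the
  -- cones above `δ` into `δ^⊥`.
  set f : ι → L := fun σ => K.localEquation ψ σ - K.localEquation ψ δ with hf
  have hfφ : ∀ σ, ∀ x ∈ K.cone σ, K.φ x (f σ) = ψ x - K.φ x (K.localEquation ψ δ) :=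
    fun σ x hx => by rw [hf, map_sub, ← hψ.localEquation_spec σ x hx]
  have hfperp : ∀ σ, K.cone δ ⊆ K.cone σ → f σ ∈ K.perp δ := fun σ hσ t ht => by
    rw [hfφ σ t (hσ ht), ← hψ.localEquation_spec δ t ht, sub_self]
  have hτ : ∀ τ ∈ K.cofacets δ, K.weightCup ψ c τ * K.normalVector τ δ l =
      ∑ σ, if σ ∈ K.cofacets τ then c σ * (K.normalVector τ δ l * K.normalVector σ τ (f σ) -
        K.normalVector τ δ (f τ) * K.normalVector σ τ l) else 0 := by
    intro τ hτ
    -- Two elements of `δ^⊥` restrict to proportional functions on `τ`. This combination therefore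
    -- vanishes on `τ`, and the balancing of `c` at `τ` can be applied to it.
    have hperp : K.normalVector τ δ (f τ) • l - K.normalVector τ δ l • f τ ∈ K.perp τ := by
      obtain ⟨e, he⟩ := hK.exists_phi_eq_mul hτ
      intro t ht
      rw [map_sub, map_zsmul, map_zsmul, he l hl t ht, he (f τ) (hfperp τ hτ.1) t ht]
      simp only [zsmul_eq_mul]
      ring
    have hbal := hc τ _ hperp
    rw [finsum_mem_eq_sum_ite] at hbal
    unfold weightCup
    rw [finsum_mem_eq_sum_ite, Finset.sum_mul]
    refine sub_eq_zero.1 (Eq.trans ?_ hbal)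
    rw [← Finset.sum_sub_distrib]
    refine Finset.sum_congr rfl fun σ _ => ?_
    split_ifs with h
    · have : K.localEquation ψ σ - K.localEquation ψ τ = f σ - f τ := by simp [hf]
      rw [this, map_sub _ (f σ) (f τ), map_sub _ (_ • l), map_zsmul, map_zsmul]
      simp only [smul_eq_mul]
      ring
    · ring
  rw [finsum_mem_eq_sum_ite]
  -- Sorted by the top cone `σ`, the terms belong to flags `δ ⊂ τ ⊂ σ`. For each `σ` there are two
  -- flags or none, and the contributions of the two cancel.
  have hswap : (∑ τ, if τ ∈ K.cofacets δ then K.weightCup ψ c τ * K.normalVector τ δ l else 0) =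
      ∑ σ, ∑ τ, if τ ∈ K.cofacets δ ∧ σ ∈ K.cofacets τ then
        c σ * (K.normalVector τ δ l * K.normalVector σ τ (f σ) -
        K.normalVector τ δ (f τ) * K.normalVector σ τ l) else 0 := by
    rw [Finset.sum_comm]
    refine Finset.sum_congr rfl fun τ _ => ?_
    by_cases h : τ ∈ K.cofacets δ
    · rw [if_pos h, hτ τ h]
      simp [h]
    · simp [h]
  rw [hswap]
  refine Finset.sum_eq_zero fun σ _ => ?_
  by_cases hex : ∃ τ, τ ∈ K.cofacets δ ∧ σ ∈ K.cofacets τ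
  · obtain ⟨τ₀, h0, h0'⟩ := hex
    have hδσ := h0.1.trans h0'.1
    obtain ⟨τ₁, τ₂, hne, hiff⟩ := hK.exists_two_facets hδσ (by rw [h0'.2, h0.2])
    obtain ⟨h₁, h₁'⟩ := (hiff τ₁).2 (Or.inl rfl)
    obtain ⟨h₂, h₂'⟩ := (hiff τ₂).2 (Or.inr rfl)
    have hsum : ∀ F : ι → ℤ, (∑ τ, if τ ∈ K.cofacets δ ∧ σ ∈ K.cofacets τ then F τ else 0) =
        F τ₁ + F τ₂ := fun F => by
      rw [← Finset.sum_filter]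
      have : (Finset.univ.filter fun τ => τ ∈ K.cofacets δ ∧ σ ∈ K.cofacets τ) = {τ₁, τ₂} := by
        ext τ
        simp [hiff τ]
      rw [this, Finset.sum_pair hne]
    rw [hsum]
    obtain ⟨v₁, hv₁, hv₁n⟩ := hK.normalVector_spec h₁
    obtain ⟨w₁, hw₁, hw₁n⟩ := hK.normalVector_spec h₁'
    obtain ⟨v₂, hv₂, hv₂n⟩ := hK.normalVector_spec h₂
    obtain ⟨w₂, hw₂, hw₂n⟩ := hK.normalVector_spec h₂'
    obtain ⟨m, hm, hmx⟩ := K.exists_pullback hδσ hl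
    obtain ⟨n, hn, hnx⟩ := K.exists_pullback hδσ (hfperp σ hδσ)
    have hwedge := hK.flag_wedge_add_eq_zero hne h₁ h₁' h₂ h₂' hv₁ hw₁ hv₂ hw₂ hm hn
    have e1 : K.φ v₁ (f τ₁) = n v₁ := by
      rw [← hnx v₁ (h₁'.1 hv₁.1), hfφ τ₁ v₁ hv₁.1, hfφ σ v₁ (h₁'.1 hv₁.1)]
    have e2 : K.φ v₂ (f τ₂) = n v₂ := by
      rw [← hnx v₂ (h₂'.1 hv₂.1), hfφ τ₂ v₂ hv₂.1, hfφ σ v₂ (h₂'.1 hv₂.1)]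
    rw [← hmx v₁ (h₁'.1 hv₁.1), ← hnx w₁ hw₁.1, ← e1, ← hmx w₁ hw₁.1, ← hmx v₂ (h₂'.1 hv₂.1),
      ← hnx w₂ hw₂.1, ← e2, ← hmx w₂ hw₂.1, hv₁n, hw₁n, hv₁n, hw₁n, hv₂n, hw₂n, hv₂n,
      hw₂n] at hwedge
    have : (K.normalVector τ₁ δ l * K.normalVector σ τ₁ (f σ) -
        K.normalVector τ₁ δ (f τ₁) * K.normalVector σ τ₁ l) +
        (K.normalVector τ₂ δ l * K.normalVector σ τ₂ (f σ) -
        K.normalVector τ₂ δ (f τ₂) * K.normalVector σ τ₂ l) = 0 := by exact_mod_cast hwedge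
    linear_combination c σ * this
  · refine Finset.sum_eq_zero fun τ _ => if_neg fun h => hex ⟨τ, h⟩

end normal

end WComplex

namespace WComplex

/-! ### Balancing of the filled graph -/

section graph

variable {ι : Type u} {X : Type v} {L : Type w} [AddCommGroup L] {K : WComplex ι X L}

/-- The weight on `Σ × Π¹` that is `c` on the graph of `ψ` and `ψ ∪ c` below it. -/
noncomputable def graphWeight (K : WComplex ι X L) (ψ : X → ℝ) (c : ι → ℤ) :
    ι × SignType → ℤ
  | (i, SignType.zero) => c i
  | (i, SignType.neg) => K.weightCup ψ c i
  | (_, SignType.pos) => 0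

theorem prod_cone_subset_iff (hK : K.IsConeComplex) {i j : ι} {s t : SignType} :
    (K.prod line).cone (i, s) ⊆ (K.prod line).cone (j, t) ↔
      K.cone i ⊆ K.cone j ∧ (s = 0 ∨ s = t) := by
  constructor
  · intro h
    obtain ⟨o, ho, -⟩ := (hK.isCone i).exists_zero
    refine ⟨fun x hx => (h (show (x, (0 : ℝ)) ∈ (K.prod line).cone (i, s) from ⟨hx, zero_mem_lineCone s⟩)).1, ?_⟩
    have hs : (s : ℝ) ∈ lineCone s := by simpa using mul_mem_lineCone s zero_le_one
    have h1 := (mem_prod_cone.1 (h (show (o, (s : ℝ)) ∈ (K.prod line).cone (i, s) from ⟨ho, hs⟩))).2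
    have hsgn : SignType.sign (s : ℝ) = s := by cases s <;> simp
    simpa only [hsgn] using h1
  · rintro ⟨h1, h2⟩ z hz
    obtain ⟨h3, h4⟩ := mem_prod_cone.1 hz
    refine mem_prod_cone.2 ⟨h1 h3, ?_⟩
    simp only at h4 ⊢
    rcases h2 with rfl | rfl
    · exact Or.inl (h4.elim id id)
    · exact h4

/-- The weight of the graph of `ψ` is balanced. -/
theorem isMinkowskiWeight_graphWeight (hK : K.IsConeComplex) {ψ : X → ℝ} (hψ : K.IsCPDivisor ψ)
    {c : ι → ℤ} (hc : K.IsMinkowskiWeight c) :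
    (K.graphComplex ψ hψ.isDivisor).IsMinkowskiWeight (K.graphWeight ψ c) := by
  classical
  have := hK.finite
  have := Fintype.ofFinite ι
  set G := K.graphComplex ψ hψ.isDivisor with hG
  have hGK : G.IsConeComplex := isConeComplex_graphComplex hK ψ hψ.isDivisor
  have hsub : ∀ {i j : ι} {s t : SignType}, G.cone (i, s) ⊆ G.cone (j, t) ↔
      K.cone i ⊆ K.cone j ∧ (s = 0 ∨ s = t) := prod_cone_subset_iff hK
  have hd0 : ∀ i, G.dim (i, 0) = K.dim i := dim_prod_line_zero hK
  have hd1 : ∀ i {s}, s ≠ 0 → G.dim (i, s) = K.dim i + 1 := fun i s => dim_prod_line_of_ne hK i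
  have hφ : ∀ z l, G.φ z l = K.φ z.1 l.1 + l.2 * (z.2 + ψ z.1) := graphComplex_φ ψ hψ.isDivisor
  have hψ0 : ∀ i, ∃ o ∈ K.cone i, (∀ m ∈ K.M i, m o = 0) ∧ (∀ l, K.φ o l = 0) ∧ ψ o = 0 := by
    intro i
    obtain ⟨o, ho, hom⟩ := (hK.isCone i).exists_zero
    have h1 : ∀ l, K.φ o l = 0 := fun l => by
      obtain ⟨m, hm, hmx⟩ := K.φ_integral i l
      rw [hmx o ho, hom m hm]
    exact ⟨o, ho, hom, h1, by rw [hψ.localEquation_spec i o ho, h1]⟩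
  have hcof : ∀ {i j : ι} {s : SignType}, (i, s) ∈ G.cofacets (j, s) ↔ i ∈ K.cofacets j := by
    intro i j s
    unfold cofacets
    simp only [Set.mem_ofPred_eq, hsub, or_true, and_true]
    by_cases hs : s = 0
    · rw [hs, hd0, hd0]
    · rw [hd1 i hs, hd1 j hs, add_left_inj]
  -- A normal vector `u` of `Σ` lifts to `(u, ψ_σ(u))`, because the weak embedding is sheared by
  -- `ψ`.
  have hnormal : ∀ {i j : ι} {s : SignType} (l : L × ℤ), i ∈ K.cofacets j → l ∈ G.perp (j, s) →
      G.normalVector (i, s) (j, s) l = K.normalVector i j l.1 +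
        l.2 * K.normalVector i j (K.localEquation ψ i) := by
    intro i j s l hij hl
    obtain ⟨x, ⟨hx, hlat, m, hm, hmx⟩, hxn⟩ := hK.normalVector_spec hij
    have hz : ((x, (0 : ℝ)) : X × ℝ) ∈ (K.prod line).cone (i, s) := ⟨hx, zero_mem_lineCone s⟩
    have h1 : G.IsFacetPt (i, s) (j, s) (x, 0) := by
      refine ⟨hz, fun g hg => ?_, ?_⟩
      · obtain ⟨n, hn, k, hgn⟩ := exists_of_mem_prod_M hg
        obtain ⟨a, ha⟩ := hlat n hn
        exact ⟨a, by rw [hgn _ hz]; simp [ha]⟩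
      · obtain ⟨g, hg, hgm⟩ := exists_mem_prod_M (p := (i, s)) hm.1 0
        refine ⟨g, ⟨hg, fun t ht => ?_⟩, by rw [hgm _ hz]; simp [hmx]⟩
        rw [hgm t (hsub.2 ⟨hij.1, Or.inr rfl⟩ ht), hm.2 _ ht.1]
        simp
    have h2 := hGK.normalVector_eq (hcof.2 hij) h1 hl
    rw [hφ, hxn, zero_add, hψ.localEquation_spec i x hx, hxn] at h2
    exact_mod_cast h2
  rintro ⟨τ, s⟩ ⟨l, k⟩ hl
  rw [finsum_mem_eq_sum_ite, Fintype.sum_prod_type]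
  obtain ⟨o, ho, hom, hoφ, hoψ⟩ := hψ0 τ
  have huniv : ∀ F : SignType → ℤ, ∑ t, F t = F 0 + F (-1) + F 1 := fun F => by
    rw [SignType.univ_eq]
    simp [add_assoc]
  cases s with
  | zero =>
    change (l, k) ∈ G.perp (τ, 0) at hl
    change ∑ x, ∑ y, (if (x, y) ∈ G.cofacets (τ, 0) then K.graphWeight ψ c (x, y) *
      G.normalVector (x, y) (τ, 0) (l, k) else 0) = 0
    -- Over `τ` the height on the graph is `ψ_τ`, so orthogonality of `(l, k)` becomes orthogonality
    -- of `l + k ψ_τ` in `Σ`.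
    have hl' : l + k • K.localEquation ψ τ ∈ K.perp τ := fun t ht => by
      have := hl (t, 0) ⟨ht, zero_mem_lineCone 0⟩
      rw [hφ] at this
      rw [map_add, map_zsmul, ← hψ.localEquation_spec τ t ht, zsmul_eq_mul]
      linarith [this]
    have hneg : G.normalVector (τ, -1) (τ, 0) (l, k) = -k := by
      have hz : ((o, (-1 : ℝ)) : X × ℝ) ∈ (K.prod line).cone (τ, -1) :=
        ⟨ho, show (-1 : ℝ) ∈ lineCone SignType.neg from mem_lineCone.2 (Or.inr (sign_neg (by norm_num)))⟩
      have h1 : G.IsFacetPt (τ, -1) (τ, 0) (o, -1) := by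
        refine ⟨hz, fun g hg => ?_, ?_⟩
        · obtain ⟨n, hn, j, hgn⟩ := exists_of_mem_prod_M hg
          exact ⟨-j, by rw [hgn _ hz]; simp [hom n hn]⟩
        · obtain ⟨g, hg, hgm⟩ := exists_mem_prod_M (K := K) (p := (τ, -1)) (m := 0)
            (zero_mem _) (-1)
          refine ⟨g, ⟨hg, fun t ht => ?_⟩, by rw [hgm _ hz]; simp⟩
          have ht2 : t.2 = 0 := ht.2
          rw [hgm t (hsub.2 ⟨subset_rfl, Or.inl rfl⟩ ht), ht2]
          simp
      have h2 := hGK.normalVector_eq (σ := (τ, -1)) (τ := (τ, 0))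
        ⟨hsub.2 ⟨subset_rfl, Or.inl rfl⟩, by rw [hd0, hd1 τ (by decide)]⟩ h1 hl
      rw [hφ, hoφ, hoψ] at h2
      simp only [add_zero, zero_add, mul_neg, mul_one] at h2
      exact_mod_cast h2
    -- There are three contributions: the balancing of `c` tested on `l + k ψ_τ`, the bend of the
    -- graph `k (ψ ∪ c)(τ)`, and the vertical cone below `τ` with normal `(0, -1)` and weight `(ψ ∪
    -- c)(τ)`. The last two cancel.
    have hterm : ∀ x, (∑ y, if (x, y) ∈ G.cofacets (τ, 0) then K.graphWeight ψ c (x, y) *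
        G.normalVector (x, y) (τ, 0) (l, k) else 0) =
        (if x ∈ K.cofacets τ then c x * K.normalVector x τ (l + k • K.localEquation ψ τ) else 0) +
        k * (if x ∈ K.cofacets τ then c x * K.normalVector x τ
          (K.localEquation ψ x - K.localEquation ψ τ) else 0) +
        if x = τ then K.weightCup ψ c τ * -k else 0 := by
      intro x
      rw [huniv]
      have e0 : (if (x, (0 : SignType)) ∈ G.cofacets (τ, 0) then K.graphWeight ψ c (x, 0) *
          G.normalVector (x, 0) (τ, 0) (l, k) else 0) =
          (if x ∈ K.cofacets τ then c x * K.normalVector x τ (l + k • K.localEquation ψ τ) else 0) +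
          k * (if x ∈ K.cofacets τ then c x * K.normalVector x τ
            (K.localEquation ψ x - K.localEquation ψ τ) else 0) := by
        by_cases hx : x ∈ K.cofacets τ
        · rw [if_pos (hcof.2 hx), if_pos hx, if_pos hx, hnormal (l, k) hx hl, map_add, map_zsmul,
            map_sub]
          change c x * _ = _
          simp only [smul_eq_mul]
          ring
        · rw [if_neg (fun h => hx (hcof.1 h)), if_neg hx, if_neg hx]
          ring
      have e1 : (if (x, (-1 : SignType)) ∈ G.cofacets (τ, 0) then K.graphWeight ψ c (x, -1) *
          G.normalVector (x, -1) (τ, 0) (l, k) else 0) =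
          if x = τ then K.weightCup ψ c τ * -k else 0 := by
        by_cases hx : x = τ
        · subst hx
          rw [if_pos ⟨hsub.2 ⟨subset_rfl, Or.inl rfl⟩, by rw [hd0, hd1 x (by decide)]⟩, if_pos rfl,
            hneg]
          rfl
        · rw [if_neg hx, if_neg]
          rintro ⟨h1, h2⟩
          rw [hd0, hd1 x (by decide), add_left_inj] at h2
          exact hx (hK.eq_of_subset_of_dim_le (hsub.1 h1).1 h2.le).symm
      have e2 : (if (x, (1 : SignType)) ∈ G.cofacets (τ, 0) then K.graphWeight ψ c (x, 1) *
          G.normalVector (x, 1) (τ, 0) (l, k) else 0) = 0 := by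
        have : K.graphWeight ψ c (x, 1) = 0 := rfl
        rw [this]
        simp
      rw [e0, e1, e2, add_zero]
    rw [Finset.sum_congr rfl fun x _ => hterm x, Finset.sum_add_distrib, Finset.sum_add_distrib,
      ← Finset.mul_sum, Finset.sum_ite_eq' Finset.univ τ, if_pos (Finset.mem_univ _),
      ← finsum_mem_eq_sum_ite, ← finsum_mem_eq_sum_ite, hc τ _ hl']
    unfold weightCup
    ring
  | neg =>
    change (l, k) ∈ G.perp (τ, -1) at hl
    change ∑ x, ∑ y, (if (x, y) ∈ G.cofacets (τ, -1) then K.graphWeight ψ c (x, y) *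
      G.normalVector (x, y) (τ, -1) (l, k) else 0) = 0
    -- A cone below the graph contains the vertical direction, so its orthogonal complement has no
    -- vertical part. What remains is the balancing of `ψ ∪ c`.
    have hk : k = 0 := by
      have := hl (o, -1) ⟨ho, show (-1 : ℝ) ∈ lineCone SignType.neg from mem_lineCone.2 (Or.inr (sign_neg (by norm_num)))⟩
      rw [hφ, hoφ, hoψ] at this
      simpa using this
    have hl' : l ∈ K.perp τ := fun t ht => by
      have := hl (t, 0) ⟨ht, show (0 : ℝ) ∈ lineCone SignType.neg from zero_mem_lineCone _⟩
      rw [hφ, hk] at this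
      simp only [Int.cast_zero, zero_mul, add_zero] at this
      exact this
    have hcup := isMinkowskiWeight_weightCup hK hψ hc τ l hl'
    rw [finsum_mem_eq_sum_ite] at hcup
    refine (Finset.sum_congr rfl fun x _ => ?_).trans hcup
    have hno : ∀ t : SignType, t ≠ -1 → (x, t) ∉ G.cofacets (τ, -1) := fun t ht h =>
      (hsub.1 h.1).2.elim (by decide) (fun h => ht h.symm)
    have e0 : (if (x, 0) ∈ G.cofacets (τ, -1) then K.graphWeight ψ c (x, 0) *
        G.normalVector (x, 0) (τ, -1) (l, k) else 0) = 0 := if_neg (hno 0 (by decide))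
    have e1 : (if (x, 1) ∈ G.cofacets (τ, -1) then K.graphWeight ψ c (x, 1) *
        G.normalVector (x, 1) (τ, -1) (l, k) else 0) = 0 := if_neg (hno 1 (by decide))
    rw [huniv, e0, e1, zero_add, add_zero]
    by_cases hx : x ∈ K.cofacets τ
    · rw [if_pos (hcof.2 hx), if_pos hx, hnormal (l, k) hx hl, hk]
      simp only [zero_mul, add_zero]
      rfl
    · rw [if_neg (fun h => hx (hcof.1 h)), if_neg hx]
  | pos =>
    change ∑ x, ∑ y, (if (x, y) ∈ G.cofacets (τ, 1) then K.graphWeight ψ c (x, y) *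
      G.normalVector (x, y) (τ, 1) (l, k) else 0) = 0
    refine Finset.sum_eq_zero fun x _ => ?_
    have hno : ∀ t : SignType, t ≠ 1 → (x, t) ∉ G.cofacets (τ, 1) := fun t ht h =>
      (hsub.1 h.1).2.elim (by decide) (fun h => ht h.symm)
    have e0 : (if (x, 0) ∈ G.cofacets (τ, 1) then K.graphWeight ψ c (x, 0) *
        G.normalVector (x, 0) (τ, 1) (l, k) else 0) = 0 := if_neg (hno 0 (by decide))
    have e1 : (if (x, -1) ∈ G.cofacets (τ, 1) then K.graphWeight ψ c (x, -1) *
        G.normalVector (x, -1) (τ, 1) (l, k) else 0) = 0 := if_neg (hno (-1) (by decide))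
    have : K.graphWeight ψ c (x, 1) = 0 := rfl
    rw [huniv, e0, e1, this]
    simp

end graph

end WComplex

namespace WComplex

/-! ### Refinement of weights along the zero set of a divisor -/

section splitWeight

variable {ι : Type u} {X : Type v} {L : Type w} [AddCommGroup L] {K : WComplex ι X L} {h : X → ℝ}

/-- The refinement of a weight to the subdivision along the zero set of `h`. -/
noncomputable def splitWeight (K : WComplex ι X L) (h : X → ℝ) (c : ι → ℤ) (p : K.SplitIndex h) :
    ℤ :=
  if (K.split h).dim p = K.dim p.1.1 then c p.1.1 else 0

/-- The cone of the subdivision along the zero set of `h` with `z` in its relative interior. -/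
noncomputable def splitOf (hK : K.IsConeComplex) (h : X → ℝ) (z : X) : K.SplitIndex h :=
  ⟨(hK.carrier z, SignType.sign (h z)), z, hK.mem_carrier z, fun _ => hK.carrier_subset, rfl⟩

theorem exists_splitOf_eq (hK : K.IsConeComplex) (p : K.SplitIndex h) :
    ∃ z, splitOf hK h z = p := by
  obtain ⟨⟨i, s⟩, x, hx, hxi, hxs⟩ := p
  refine ⟨x, Subtype.ext (Prod.ext ?_ hxs)⟩
  exact hK.injective (Set.Subset.antisymm (hK.carrier_subset hx) (hxi _ (hK.mem_carrier x)))

/-- The drop in dimension is the rank of the functions of the big cone that vanish on the piece. -/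
theorem split_dim_eq_iff (hK : K.IsConeComplex) {p : K.SplitIndex h} :
    (K.split h).dim p = K.dim p.1.1 ↔
      ∀ m ∈ K.M p.1.1, (∀ x ∈ (K.split h).cone p, m x = 0) → m = 0 := by
  have hfg := (hK.isCone p.1.1).fg
  have h1 : (K.split h).dim p + Module.finrank ℤ (ann (K.M p.1.1) ((K.split h).cone p)) =
    K.dim p.1.1 := finrank_restrictLattice_add hfg _
  constructor
  · intro hd m hm hmx
    have h2 := (ann_fg hfg ((K.split h).cone p)).eq_bot_of_finrank_eq_zero (by omega)
    exact (AddSubgroup.mem_bot).1 (h2 ▸ (⟨hm, hmx⟩ : m ∈ ann (K.M p.1.1) ((K.split h).cone p)))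
  · intro hz
    have h2 : ann (K.M p.1.1) ((K.split h).cone p) = ⊥ :=
      (AddSubgroup.eq_bot_iff_forall _).2 fun m hm => hz m hm.1 hm.2
    rw [h2, Module.finrank_zero_of_subsingleton, add_zero] at h1
    exact h1

theorem split_dim_le (hK : K.IsConeComplex) (p : K.SplitIndex h) :
    (K.split h).dim p ≤ K.dim p.1.1 := by
  have h1 : (K.split h).dim p + Module.finrank ℤ (ann (K.M p.1.1) ((K.split h).cone p)) =
    K.dim p.1.1 := finrank_restrictLattice_add (hK.isCone p.1.1).fg _
  omega

theorem exists_sign_add_mul {a : ℝ} (ha : a ≠ 0) (b : ℝ) :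
    ∃ ε : ℝ, 0 < ε ∧ SignType.sign (a + ε * b) = SignType.sign a := by
  have h1 : 0 < |a| := abs_pos.2 ha
  have h2 : 0 < 2 * (|b| + 1) := by positivity
  refine ⟨|a| / (2 * (|b| + 1)), by positivity, ?_⟩
  have h3 : |(|a| / (2 * (|b| + 1)) * b)| < |a| := by
    rw [abs_mul, abs_of_pos (by positivity : 0 < |a| / (2 * (|b| + 1))), div_mul_eq_mul_div,
      div_lt_iff₀ h2]
    nlinarith [abs_nonneg b]
  obtain ⟨h4, h5⟩ := abs_lt.1 h3
  rcases lt_or_gt_of_ne ha with h | h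
  · rw [abs_of_neg h] at h5
    rw [sign_neg h, sign_neg]
    rw [abs_of_neg h]
    linarith
  · rw [abs_of_pos h] at h4
    rw [sign_pos h, sign_pos]
    rw [abs_of_pos h]
    linarith

/-- On a part where `h` is not zero the dimension does not drop. -/
theorem split_dim_eq_of_ne_zero (hK : K.IsConeComplex) (hh : K.IsDivisor h) {p : K.SplitIndex h}
    (hp : p.1.2 ≠ 0) : (K.split h).dim p = K.dim p.1.1 := by
  rw [split_dim_eq_iff hK]
  intro m hm hmp
  obtain ⟨⟨i, s⟩, x, hx, hxi, hxs⟩ := p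
  change x ∈ K.cone i at hx
  change SignType.sign (h x) = s at hxs
  change s ≠ 0 at hp
  change m ∈ K.M i at hm
  obtain ⟨n, hn, hnx⟩ := hh i
  refine (hK.isCone i).ext_of_vanish hm (zero_mem _) fun y hy => ?_
  have hx0 : h x ≠ 0 := fun h0 => hp (by rw [← hxs, h0, sign_zero])
  obtain ⟨ε, hε, hεs⟩ := exists_sign_add_mul hx0 (h y)
  obtain ⟨z, hz, hzm⟩ := (hK.isCone i).exists_comb hx hy zero_le_one hε.le
  have h1 : h z = h x + ε * h y := by rw [hnx z hz, hzm n hn, hnx x hx, hnx y hy, one_mul]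
  have h2 := hmp z (mem_split_cone.2 ⟨hz, Or.inr ((congrArg SignType.sign h1).trans (hεs.trans hxs))⟩)
  have h3 := hmp x (mem_split_cone.2 ⟨hx, Or.inr hxs⟩)
  rw [hzm m hm, h3] at h2
  have h4 : ε * m y = 0 := by linarith
  exact (mul_eq_zero.1 h4).resolve_left hε.ne'

theorem split_dim_eq_of_vanish (hK : K.IsConeComplex) {p : K.SplitIndex h}
    (hp : ∀ x ∈ K.cone p.1.1, h x = 0) : (K.split h).dim p = K.dim p.1.1 := by
  rw [split_dim_eq_iff hK]
  intro m hm hmp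
  refine (hK.isCone p.1.1).ext_of_vanish hm (zero_mem _) fun y hy => ?_
  exact hmp y (mem_split_cone.2 ⟨hy, Or.inl (by rw [hp y hy, sign_zero])⟩)

/-- The primitive integral function on a cone which defines a facet of a part of full dimension. -/
theorem exists_normal_functional (hK : K.IsConeComplex) (hh : K.IsDivisor h)
    {p q : K.SplitIndex h} (hq : q ∈ (K.split h).cofacets p)
    (hd : (K.split h).dim q = K.dim q.1.1) :
    ∃ G ∈ ann (K.M q.1.1) ((K.split h).cone p), G ≠ 0 ∧ (∀ x ∈ (K.split h).cone q, 0 ≤ G x) ∧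
      (∀ m ∈ ann (K.M q.1.1) ((K.split h).cone p), ∃ n : ℤ, m = n • G) ∧
      ∀ l ∈ (K.split h).perp p, ∀ x ∈ K.cone q.1.1,
        K.φ x l = (K.split h).normalVector q p l * G x := by
  have hS := isConeComplex_split hK hh
  have hinj := (split_dim_eq_iff hK).1 hd
  have hinj' : ∀ m ∈ K.M q.1.1, ∀ m' ∈ K.M q.1.1,
      (∀ x ∈ (K.split h).cone q, m x = m' x) → m = m' := fun m hm m' hm' he =>
    sub_eq_zero.1 (hinj _ (sub_mem hm hm') fun x hx => by rw [Pi.sub_apply, he x hx, sub_self])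
  obtain ⟨f, hf, hpos, -, hgen, hpt, x, hx⟩ := hS.exists_facet_functional hq
  obtain ⟨G, hG, hGf⟩ := exists_of_mem_restrictLattice hf.1
  have hG1 : ∀ m ∈ ann (K.M q.1.1) ((K.split h).cone p), ∃ n : ℤ, m = n • G := by
    rintro m ⟨hm, hmp⟩
    obtain ⟨g, hg, hgm⟩ := exists_restrict hm ((K.split h).cone q)
    obtain ⟨n, hn⟩ := hgen g ⟨hg, fun t ht => by rw [hgm t (hq.1 ht), hmp t ht]⟩
    refine ⟨n, hinj' _ hm _ (zsmul_mem hG n) fun y hy => ?_⟩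
    rw [← hgm y hy, hn, Pi.smul_apply, Pi.smul_apply, hGf y hy]
  have hG0 : G ∈ ann (K.M q.1.1) ((K.split h).cone p) :=
    ⟨hG, fun t ht => by rw [← hGf t (hq.1 ht), hf.2 t ht]⟩
  have hGx : G x = 1 := by rw [← hGf x hx.1, hpt x hx]
  refine ⟨G, hG0, fun h0 => by simp [h0] at hGx,
    fun y hy => by rw [← hGf y hy]; exact hpos y hy, hG1, fun l hl y hy => ?_⟩
  obtain ⟨m, hm, hmx⟩ := K.φ_integral q.1.1 l
  obtain ⟨n, rfl⟩ := hG1 m ⟨hm, fun t ht => by rw [← hmx t (hq.1 ht).1]; exact hl t ht⟩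
  have h1 := hS.normalVector_eq hq hx hl
  have h2 : (K.split h).φ x l = K.φ x l := rfl
  rw [h2, hmx x hx.1.1, Pi.smul_apply, hGx, zsmul_eq_mul, mul_one] at h1
  rw [hmx y hy, h1, Pi.smul_apply, zsmul_eq_mul]

theorem eq_or_eq_neg_of_zsmul {V : Type u} [AddCommGroup V] [Module.IsTorsionFree ℤ V] {f g : V}
    {a b : ℤ} (hf : f = a • g) (hg : g = b • f) (h0 : g ≠ 0) : f = g ∨ f = -g := by
  have h1 : (b * a - 1) • g = 0 := by rw [sub_smul, mul_smul, ← hf, ← hg, one_smul, sub_self]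
  have h2 : b * a = 1 := by
    rcases smul_eq_zero.1 h1 with h | h
    · omega
    · exact absurd h h0
  rcases Int.isUnit_iff.1 (IsUnit.of_mul_eq_one_right b h2) with h | h
  · exact Or.inl (by rw [hf, h, one_smul])
  · exact Or.inr (by rw [hf, h, neg_smul, one_smul])

/-- Existence and uniqueness of the part of a cofacet next to a part of full dimension. -/
theorem existsUnique_split_cofacet (hK : K.IsConeComplex) (hh : K.IsDivisor h)
    {p : K.SplitIndex h} (hp : (K.split h).dim p = K.dim p.1.1) {σ : ι}
    (hσ : σ ∈ K.cofacets p.1.1) :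
    ∃! q : K.SplitIndex h, q ∈ (K.split h).cofacets p ∧ (K.split h).dim q = K.dim q.1.1 ∧
      q.1.1 = σ := by
  obtain ⟨x, rfl⟩ := exists_splitOf_eq hK p
  obtain ⟨f, hf, hpos, hzero, hgen, hpt, y, hy⟩ := hK.exists_facet_functional hσ
  obtain ⟨n, hn, hnx⟩ := hh σ
  have hxσ : x ∈ K.cone σ := hσ.1 (hK.mem_carrier x)
  have hfx : f x = 0 := hf.2 x (hK.mem_carrier x)
  have hfy := hpt y hy
  have hcar : ∀ {z ε}, z ∈ K.cone σ → 0 < ε → (∀ m ∈ K.M σ, m z = 1 * m x + ε * m y) →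
      hK.carrier z = σ := by
    intro z ε hz hε hzm
    refine hK.carrier_eq hz fun m hm hm0 hmz => ?_
    have h1 := hm0 x hxσ
    have h2 := mul_nonneg hε.le (hm0 y hy.1)
    rw [hzm m hm] at hmz
    have h3 : m x = 0 := by linarith
    have h4 : ε * m y = 0 := by linarith
    have h5 : m ∈ ann (K.M σ) (K.cone (hK.carrier x)) := by
      refine ⟨hm, fun t ht => ?_⟩
      rw [hK.cone_carrier_eq_minFace hxσ] at ht
      exact ht.2 m hm hm0 h3
    obtain ⟨k, rfl⟩ := hgen m h5
    rw [Pi.smul_apply, hfy, zsmul_eq_mul, mul_one] at h4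
    have h6 : (k : ℝ) = 0 := (mul_eq_zero.1 h4).resolve_left hε.ne'
    have h7 : k = 0 := by exact_mod_cast h6
    rw [h7, zero_smul]
  have hsub : ∀ q : K.SplitIndex h, q.1.1 = σ → (SignType.sign (h x) = 0 ∨
      SignType.sign (h x) = q.1.2) → (K.split h).dim q = K.dim q.1.1 →
      q ∈ (K.split h).cofacets (splitOf hK h x) := by
    intro q hq hs hd
    refine ⟨?_, ?_⟩
    · rintro z ⟨hz, hzs⟩
      refine mem_split_cone.2 ⟨hq ▸ hσ.1 hz, ?_⟩
      change SignType.sign (h z) = 0 ∨ SignType.sign (h z) = SignType.sign (h x) at hzs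
      rcases hzs with h1 | h1
      · exact Or.inl h1
      · rw [h1]
        exact hs
    · rw [hd, hp, hq]
      exact hσ.2
  -- If `h x = 0`, the full-dimensional piece lies in the zero set and `h` vanishes on all of the
  -- smaller cone. On `σ` it is then a multiple of the facet function, so it has a single sign in
  -- the interior. If `h x ≠ 0`, the sign near `x` selects the piece.
  by_cases hx0 : h x = 0
  · have hτ : ∀ t ∈ K.cone (hK.carrier x), h t = 0 := by
      obtain ⟨m, hm, hmx⟩ := hh (hK.carrier x)
      have h1 := (split_dim_eq_iff hK).1 hp m hm fun t ht => by
        rw [← hmx t ht.1]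
        have h2 : SignType.sign (h t) = 0 ∨ SignType.sign (h t) = SignType.sign (h x) := ht.2
        rw [hx0, sign_zero, or_self] at h2
        exact sign_eq_zero_iff.1 h2
      intro t ht
      rw [hmx t ht, h1, Pi.zero_apply]
    obtain ⟨k, hk⟩ := hgen n ⟨hn, fun t ht => by rw [← hnx t (hσ.1 ht), hτ t ht]⟩
    have hhf : ∀ z ∈ K.cone σ, h z = k * f z := fun z hz => by
      rw [hnx z hz, hk, Pi.smul_apply, zsmul_eq_mul]
    obtain ⟨z, hz, hzm⟩ := (hK.isCone σ).exists_comb hxσ hy.1 zero_le_one zero_le_one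
    have hzc := hcar hz one_pos hzm
    have hhz : h z = k := by rw [hhf z hz, hzm f hf.1, hfx, hfy]; ring
    have hdq : (K.split h).dim (splitOf hK h z) = K.dim (splitOf hK h z).1.1 := by
      by_cases hk0 : k = 0
      · refine split_dim_eq_of_vanish hK fun t ht => ?_
        rw [hhf t (hzc ▸ ht), hk0]
        simp
      · refine split_dim_eq_of_ne_zero hK hh ?_
        change SignType.sign (h z) ≠ 0
        rw [hhz]
        simpa using hk0
    refine ⟨splitOf hK h z, ⟨hsub _ hzc (Or.inl (by rw [hx0, sign_zero])) hdq, hdq, hzc⟩, ?_⟩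
    rintro q ⟨-, -, hqσ⟩
    obtain ⟨w, rfl⟩ := exists_splitOf_eq hK q
    refine Subtype.ext (Prod.ext (hqσ.trans hzc.symm) ?_)
    change SignType.sign (h w) = SignType.sign (h z)
    change hK.carrier w = σ at hqσ
    have hwσ : w ∈ K.cone σ := hqσ ▸ hK.mem_carrier w
    have hfw : 0 < f w := by
      refine lt_of_le_of_ne (hpos w hwσ) fun h0 => ?_
      subst hqσ
      have h1 := hK.eq_zero_of_carrier hf.1 hpos h0.symm
      rw [h1] at hfy
      simp at hfy
    rw [hhf w hwσ, hhz, sign_mul, sign_pos hfw, mul_one]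
  · obtain ⟨ε, hε, hεs⟩ := exists_sign_add_mul hx0 (h y)
    obtain ⟨z, hz, hzm⟩ := (hK.isCone σ).exists_comb hxσ hy.1 zero_le_one hε.le
    have hzc := hcar hz hε hzm
    have hhz : SignType.sign (h z) = SignType.sign (h x) := by
      rw [hnx z hz, hzm n hn, ← hnx x hxσ, ← hnx y hy.1, one_mul, hεs]
    have hdq : (K.split h).dim (splitOf hK h z) = K.dim (splitOf hK h z).1.1 := by
      refine split_dim_eq_of_ne_zero hK hh ?_
      change SignType.sign (h z) ≠ 0
      rw [hhz]
      exact fun h0 => hx0 (sign_eq_zero_iff.1 h0)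
    refine ⟨splitOf hK h z, ⟨hsub _ hzc (Or.inr hhz.symm) hdq, hdq, hzc⟩, ?_⟩
    rintro q ⟨hq, -, hqσ⟩
    refine Subtype.ext (Prod.ext (hqσ.trans hzc.symm) ?_)
    have h1 : x ∈ (K.split h).cone q := hq.1 ⟨hK.mem_carrier x, Or.inr rfl⟩
    have h2 := h1.2.resolve_left fun h0 => hx0 (sign_eq_zero_iff.1 h0)
    rw [← h2, ← hhz]
    rfl

/-- The refinement of a Minkowski weight along the zero set of a divisor is balanced. -/
theorem isMinkowskiWeight_splitWeight (hK : K.IsConeComplex) (hh : K.IsDivisor h) {c : ι → ℤ}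
    (hc : K.IsMinkowskiWeight c) : (K.split h).IsMinkowskiWeight (K.splitWeight h c) := by
  classical
  have hS := isConeComplex_split hK hh
  have := hK.finite
  have := hS.finite
  intro p l hl
  have hmono : ∀ q ∈ (K.split h).cofacets p, K.cone p.1.1 ⊆ K.cone q.1.1 := by
    intro q hq
    obtain ⟨x, hx, hxi, hxs⟩ := p.2
    exact hxi _ (hq.1 (mem_split_cone.2 ⟨hx, Or.inr hxs⟩)).1
  -- Around a piece of full dimension the refinement looks like the original complex: its weighted
  -- cofacets correspond to the cofacets of the cone containing it, with the same normal vectors.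
  by_cases hA : (K.split h).dim p = K.dim p.1.1
  · have hperp : l ∈ K.perp p.1.1 := by
      obtain ⟨m, hm, hmx⟩ := K.φ_integral p.1.1 l
      have h1 := (split_dim_eq_iff hK).1 hA m hm fun x hx => by rw [← hmx x hx.1]; exact hl x hx
      intro t ht
      rw [hmx t ht, h1, Pi.zero_apply]
    rw [← hc p.1.1 l hperp]
    have hrestr : ∑ᶠ q ∈ (K.split h).cofacets p, K.splitWeight h c q *
        (K.split h).normalVector q p l =
        ∑ᶠ q ∈ {q | q ∈ (K.split h).cofacets p ∧ (K.split h).dim q = K.dim q.1.1},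
          K.splitWeight h c q * (K.split h).normalVector q p l := by
      refine finsum_mem_inter_support_eq' _ _ _ fun q hq => ⟨fun h1 => ⟨h1, ?_⟩, fun h1 => h1.1⟩
      by_contra h2
      exact hq (by simp only [splitWeight]; rw [if_neg h2, zero_mul])
    rw [hrestr]
    refine finsum_mem_eq_of_bijOn (fun q => q.1.1) ⟨?_, ?_, ?_⟩ ?_
    · rintro q ⟨h1, h2⟩
      exact ⟨hmono q h1, by rw [← h2, ← hA]; exact h1.2⟩
    · rintro q ⟨h1, h2⟩ q' ⟨h1', h2'⟩ he
      exact (existsUnique_split_cofacet hK hh hA (σ := q.1.1)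
        ⟨hmono q h1, by rw [← h2, ← hA]; exact h1.2⟩).unique ⟨h1, h2, rfl⟩ ⟨h1', h2', he.symm⟩
    · intro σ hσ
      obtain ⟨q, ⟨h1, h2, h3⟩, -⟩ := existsUnique_split_cofacet hK hh hA hσ
      exact ⟨q, ⟨h1, h2⟩, h3⟩
    · rintro q ⟨h1, h2⟩
      have hσ : q.1.1 ∈ K.cofacets p.1.1 := ⟨hmono q h1, by rw [← h2, ← hA]; exact h1.2⟩
      obtain ⟨G, hG, hG0, hGpos, hGgen, hGl⟩ := exists_normal_functional hK hh h1 h2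
      obtain ⟨f, hf, hpos, hzero, hgen, hpt, y, hy⟩ := hK.exists_facet_functional hσ
      have hpp : (K.split h).cone p ⊆ K.cone p.1.1 := fun x hx => hx.1
      obtain ⟨a, ha⟩ := hGgen f ⟨hf.1, fun t ht => hf.2 t (hpp ht)⟩
      have hGτ : G ∈ ann (K.M q.1.1) (K.cone p.1.1) := by
        obtain ⟨g, hg, hgm⟩ := exists_restrict hG.1 (K.cone p.1.1)
        rw [← hK.M_of_subset hσ.1] at hg
        have h3 := (split_dim_eq_iff hK).1 hA g hg fun t ht => by
          rw [hgm t (hpp ht), hG.2 t ht]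
        exact ⟨hG.1, fun t ht => by rw [← hgm t ht, h3, Pi.zero_apply]⟩
      obtain ⟨b, hb⟩ := hgen G hGτ
      have hfG : f = G := by
        -- Each function is a multiple of the other and both are non-negative on the piece `q`, so
        -- they agree rather than being opposite.
        refine (eq_or_eq_neg_of_zsmul ha hb hG0).resolve_right fun h3 => hG0 ?_
        refine (split_dim_eq_iff hK).1 h2 G hG.1 fun x hx => le_antisymm ?_ (hGpos x hx)
        have h4 := hpos x hx.1
        rw [h3, Pi.neg_apply] at h4
        linarith
      have h3 := hK.normalVector_eq hσ hy hperp
      rw [hGl l hl y hy.1, ← hfG, hpt y hy, mul_one] at h3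
      have h4 : K.normalVector q.1.1 p.1.1 l = (K.split h).normalVector q p l := by
        exact_mod_cast h3
      rw [h4]
      unfold splitWeight
      rw [if_pos h2]
  · have hle := split_dim_le hK p
    have hlt : (K.split h).dim p < K.dim p.1.1 := lt_of_le_of_ne hle hA
    have hs : p.1.2 = 0 := by
      by_contra h0
      exact hA (split_dim_eq_of_ne_zero hK hh h0)
    have hval : ∀ q ∈ (K.split h).cofacets p, (K.split h).dim q = K.dim q.1.1 →
        K.dim p.1.1 = (K.split h).dim p + 1 ∧ q.1.1 = p.1.1 := by
      intro q hq hd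
      have h1 := hK.dim_le_of_subset (hmono q hq)
      have h2 := hq.2
      exact ⟨by omega, (hK.eq_of_subset_of_dim_le (hmono q hq) (by omega)).symm⟩
    -- A piece that has lost dimension lies in the zero set. The cofacets with weight are
    -- full-dimensional pieces of the same cone, and these exist only if the piece has codimension
    -- one in it.
    by_cases hB : K.dim p.1.1 = (K.split h).dim p + 1
    · obtain ⟨x, rfl⟩ := exists_splitOf_eq hK p
      have hx0 : h x = 0 := sign_eq_zero_iff.1 hs
      have hxτ := hK.mem_carrier x
      set τ := hK.carrier x with hτ
      obtain ⟨n, hn, hnx⟩ := hh τ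
      obtain ⟨y, hy, hy0⟩ : ∃ y ∈ K.cone τ, h y ≠ 0 := by
        by_contra! h0
        exact hA (split_dim_eq_of_vanish hK h0)
      have hcof : ∀ z, hK.carrier z = τ → h z ≠ 0 →
          splitOf hK h z ∈ (K.split h).cofacets (splitOf hK h x) ∧
          (K.split h).dim (splitOf hK h z) = K.dim (splitOf hK h z).1.1 := by
        intro z hz hz0
        have hd : (K.split h).dim (splitOf hK h z) = K.dim (splitOf hK h z).1.1 :=
          split_dim_eq_of_ne_zero hK hh fun h0 => hz0 (sign_eq_zero_iff.1 h0)
        refine ⟨⟨?_, ?_⟩, hd⟩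
        · rintro w ⟨hw, hws⟩
          refine mem_split_cone.2 ⟨show w ∈ K.cone (hK.carrier z) from hz ▸ hw, Or.inl ?_⟩
          change SignType.sign (h w) = 0 ∨ SignType.sign (h w) = SignType.sign (h x) at hws
          rwa [hx0, sign_zero, or_self] at hws
        · rw [hd, ← hB]
          exact congrArg K.dim hz
      -- One steps from `x` to both sides of the wall, to `z₁ = x - (ε/2) y` and `z₂ = x + y`. Since
      -- `x - ε y` still lies in `τ`, half the step keeps `z₁` in the relative interior.
      obtain ⟨ε, hε, hεz⟩ := (hK.isCone τ).exists_sub_smul hxτ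
        (y := y) (by rw [hτ, hK.minFace_carrier x]; exact hy)
      obtain ⟨z₀, hz₀, hz₀m⟩ := hεz ε hε.le le_rfl
      obtain ⟨z₁, hz₁, hz₁m⟩ := hεz (ε / 2) (by positivity) (by linarith)
      obtain ⟨z₂, hz₂, hz₂m⟩ := (hK.isCone τ).exists_comb hxτ hy zero_le_one zero_le_one
      have hc₁ : hK.carrier z₁ = τ := by
        refine hK.carrier_eq hz₁ fun m hm hm0 hmz => hK.eq_zero_of_carrier hm hm0 ?_
        have h1 := hm0 z₀ hz₀
        have h2 := hm0 x hxτ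
        rw [hz₀m m hm] at h1
        rw [hz₁m m hm] at hmz
        linarith
      have hc₂ : hK.carrier z₂ = τ := by
        refine hK.carrier_eq hz₂ fun m hm hm0 hmz => hK.eq_zero_of_carrier hm hm0 ?_
        have h1 := hm0 y hy
        have h2 := hm0 x hxτ
        rw [hz₂m m hm] at hmz
        linarith
      have hh₁ : h z₁ = -(ε / 2) * h y := by
        rw [hnx z₁ hz₁, hz₁m n hn, ← hnx x hxτ, ← hnx y hy, hx0]
        ring
      have hh₂ : h z₂ = h y := by
        rw [hnx z₂ hz₂, hz₂m n hn, ← hnx x hxτ, ← hnx y hy, hx0]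
        ring
      have hn₁ : h z₁ ≠ 0 := by
        rw [hh₁]
        exact mul_ne_zero (by linarith) hy0
      have hn₂ : h z₂ ≠ 0 := by rwa [hh₂]
      obtain ⟨hq₁, hd₁⟩ := hcof z₁ hc₁ hn₁
      obtain ⟨hq₂, hd₂⟩ := hcof z₂ hc₂ hn₂
      have hsign : SignType.sign (h z₁) = -SignType.sign (h z₂) := by
        rw [hh₁, hh₂, sign_mul, sign_neg (by linarith : -(ε / 2) < 0), neg_one_mul]
      have hne : splitOf hK h z₁ ≠ splitOf hK h z₂ := by
        intro he
        have h1 : SignType.sign (h z₁) = SignType.sign (h z₂) := congrArg (fun q => q.1.2) he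
        rw [h1] at hsign
        exact hn₂ (sign_eq_zero_iff.1 (by
          generalize SignType.sign (h z₂) = s at hsign
          revert hsign
          cases s <;> decide))
      have hall : ∀ q ∈ (K.split h).cofacets (splitOf hK h x), K.splitWeight h c q ≠ 0 →
          q = splitOf hK h z₁ ∨ q = splitOf hK h z₂ := by
        intro q hq hq0
        have hdq : (K.split h).dim q = K.dim q.1.1 := by
          by_contra h1
          exact hq0 (if_neg h1)
        have hqτ := (hval q hq hdq).2
        have hqs : q.1.2 ≠ 0 := by
          intro h0
          obtain ⟨w, rfl⟩ := exists_splitOf_eq hK q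
          have h1 : splitOf hK h w = splitOf hK h x := Subtype.ext (Prod.ext hqτ (h0.trans hs.symm))
          rw [h1] at hq
          have := hq.2
          omega
        have h3 : q.1.2 = SignType.sign (h z₁) ∨ q.1.2 = SignType.sign (h z₂) := by
          have h4 : SignType.sign (h z₂) ≠ 0 := fun h0 => hn₂ (sign_eq_zero_iff.1 h0)
          rw [hsign]
          generalize SignType.sign (h z₂) = s at h4 ⊢
          generalize q.1.2 = t at hqs ⊢
          revert h4 hqs
          cases s <;> cases t <;> decide
        rcases h3 with h3 | h3
        · exact Or.inl (Subtype.ext (Prod.ext (hqτ.trans hc₁.symm) h3))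
        · exact Or.inr (Subtype.ext (Prod.ext (hqτ.trans hc₂.symm) h3))
      have hsum : ∑ᶠ q ∈ (K.split h).cofacets (splitOf hK h x), K.splitWeight h c q *
          (K.split h).normalVector q (splitOf hK h x) l =
          ∑ᶠ q ∈ ({splitOf hK h z₁, splitOf hK h z₂} : Set (K.SplitIndex h)), K.splitWeight h c q *
          (K.split h).normalVector q (splitOf hK h x) l := by
        refine finsum_mem_inter_support_eq' _ _ _ fun q hq => ⟨fun h1 => ?_, ?_⟩
        · exact hall q h1 fun h0 => hq (by simp only [h0, zero_mul])
        · rintro (rfl | rfl)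
          · exact hq₁
          · exact hq₂
      rw [hsum, finsum_mem_pair hne]
      have hw₁ : K.splitWeight h c (splitOf hK h z₁) = c τ := by
        unfold splitWeight
        rw [if_pos hd₁]
        exact congrArg c hc₁
      have hw₂ : K.splitWeight h c (splitOf hK h z₂) = c τ := by
        unfold splitWeight
        rw [if_pos hd₂]
        exact congrArg c hc₂
      rw [hw₁, hw₂]
      obtain ⟨G₁, hG₁, hG₁0, hG₁pos, hG₁gen, hG₁l⟩ := exists_normal_functional hK hh hq₁ hd₁
      obtain ⟨G₂, hG₂, hG₂0, hG₂pos, hG₂gen, hG₂l⟩ := exists_normal_functional hK hh hq₂ hd₂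
      have e₁ : (splitOf hK h z₁).1.1 = τ := hc₁
      have e₂ : (splitOf hK h z₂).1.1 = τ := hc₂
      rw [e₁] at hG₁ hG₁gen hG₁l
      rw [e₂] at hG₂ hG₂gen hG₂l
      obtain ⟨a, ha⟩ := hG₂gen G₁ hG₁
      obtain ⟨b, hb⟩ := hG₁gen G₂ hG₂
      -- If `G₁ = G₂`, this function would be non-negative on both sides, hence on all of `τ`, and
      -- vanish at the interior point `x`, so it would be zero. The two normals are opposite and
      -- both carry the weight `c τ`.
      have hGneg : G₁ = -G₂ := by
        refine (eq_or_eq_neg_of_zsmul ha hb hG₂0).resolve_left fun h1 => hG₂0 ?_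
        refine hK.eq_zero_of_carrier hG₂.1 (fun w hw => ?_)
          (hG₂.2 x ⟨hxτ, Or.inr rfl⟩)
        have h4 : SignType.sign (h z₂) ≠ 0 := fun h0 => hn₂ (sign_eq_zero_iff.1 h0)
        have h5 : SignType.sign (h w) = 0 ∨ SignType.sign (h w) = SignType.sign (h z₁) ∨
            SignType.sign (h w) = SignType.sign (h z₂) := by
          rw [hsign]
          generalize SignType.sign (h z₂) = s at h4 ⊢
          generalize SignType.sign (h w) = t
          revert h4
          cases s <;> cases t <;> decide
        by_cases h6 : SignType.sign (h w) = 0 ∨ SignType.sign (h w) = SignType.sign (h z₁)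
        · rw [← h1]
          exact hG₁pos w ⟨by rw [e₁]; exact hw, h6⟩
        · exact hG₂pos w ⟨by rw [e₂]; exact hw, by tauto⟩
      obtain ⟨w, hw, hw0⟩ : ∃ w ∈ K.cone τ, G₂ w ≠ 0 := by
        by_contra! h0
        exact hG₂0 ((hK.isCone τ).ext_of_vanish hG₂.1 (zero_mem _) h0)
      have h1 := hG₁l l hl w hw
      rw [hG₂l l hl w hw, hGneg, Pi.neg_apply] at h1
      have h2 : (((K.split h).normalVector (splitOf hK h z₂) (splitOf hK h x) l : ℝ) +
          (K.split h).normalVector (splitOf hK h z₁) (splitOf hK h x) l) * G₂ w = 0 := by linarith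
      have h3 := (mul_eq_zero.1 h2).resolve_right hw0
      have h4 : (K.split h).normalVector (splitOf hK h z₂) (splitOf hK h x) l +
          (K.split h).normalVector (splitOf hK h z₁) (splitOf hK h x) l = 0 := by exact_mod_cast h3
      rw [← mul_add, add_comm ((K.split h).normalVector (splitOf hK h z₁) (splitOf hK h x) l), h4,
        mul_zero]
    · refine finsum_mem_eq_zero_of_forall_eq_zero fun q hq => ?_
      unfold splitWeight
      rw [if_neg fun h1 => hB (hval q hq h1).1, zero_mul]

/-- The lattices of a proper subdivision are restrictions, so they have the same values at each
point. Genericity can thus be tested in any subdivision, up to the dimension of the minimal cone. -/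
theorem valueGroup_of_isProperSubdivision {κ : Type u'} {K' : WComplex κ X L}
    (hK : K.IsConeComplex) (h' : K'.IsProperSubdivision K) (x : X) :
    K'.valueGroup x = K.valueGroup x := by
  obtain ⟨j, hj⟩ := h'.1.cover x
  obtain ⟨i, hi, hM⟩ := h'.2.2 j
  rw [h'.1.valueGroup_eq hj, hK.valueGroup_eq (hi hj), hM]
  ext r
  constructor
  · rintro ⟨m, hm, rfl⟩
    obtain ⟨n, hn, hmn⟩ := exists_of_mem_restrictLattice hm
    exact ⟨n, hn, (hmn x hj).symm⟩
  · rintro ⟨m, hm, rfl⟩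
    obtain ⟨n, hn, hmn⟩ := exists_restrict hm (K'.cone j)
    exact ⟨n, hn, hmn x hj⟩

/-- The dimension of the piece of `x` lies between the rank of the value group and the dimension of
the minimal cone. At a generic point all three agree; at any other point both sides are zero. -/
theorem weightClass_splitWeight (hK : K.IsConeComplex) (hh : K.IsDivisor h) (c : ι → ℤ) :
    (K.split h).weightClass (K.splitWeight h c) = K.weightClass c := by
  have hS := isConeComplex_split hK hh
  funext x
  rw [hS.weightClass_eq, hK.weightClass_eq,
    valueGroup_of_isProperSubdivision hK (isProperSubdivision_split hK hh)]
  have h1 : (hS.carrier x).1.1 = hK.carrier x :=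
    congrArg Prod.fst (split_carrier_val hK hh x)
  have h2 := split_dim_le hK (hS.carrier x)
  have h3 := hS.finrank_valueGroup_le (hS.mem_carrier x)
  have h4 := hK.finrank_valueGroup_le (hK.mem_carrier x)
  rw [valueGroup_of_isProperSubdivision hK (isProperSubdivision_split hK hh)] at h3
  unfold splitWeight
  rw [h1] at h2 ⊢
  by_cases h5 : Module.finrank ℤ (K.valueGroup x) = K.dim (hK.carrier x)
  · rw [if_pos h5, if_pos (by omega), if_pos (by omega)]
  · rw [if_neg h5]
    split_ifs
    · omega
    · rfl
    · rfl

end splitWeight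

end WComplex

namespace WComplex

/-! ### Morphisms of cone complexes -/

section morphism

variable {ι : Type u} {X : Type v} {L : Type w} [AddCommGroup L] {K : WComplex ι X L}
  {κ : Type u'} {Y : Type v'} {L' : Type w'} [AddCommGroup L'] {D : WComplex κ Y L'} {f : X → Y}

/-- `f` maps every cone of `K` into a cone of `D` by an integral linear map. -/
def IsMorphism (K : WComplex ι X L) (D : WComplex κ Y L') (f : X → Y) : Prop :=
  ∀ i, ∃ j, (∀ x ∈ K.cone i, f x ∈ D.cone j) ∧
    ∀ n ∈ D.M j, ∃ m ∈ K.M i, ∀ x ∈ K.cone i, n (f x) = m x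

/-- As `x` is in the relative interior, it is a sum `(x - ε y) + ε y` inside its minimal cone. The
sum of the images lies in a face, so the summands do as well. -/
theorem IsMorphism.mem_carrier (hf : K.IsMorphism D f) (hK : K.IsConeComplex)
    (hD : D.IsConeComplex) (x : X) :
    ∀ y ∈ K.cone (hK.carrier x), f y ∈ D.cone (hD.carrier (f x)) := by
  intro y hy
  obtain ⟨j, hj, hpull⟩ := hf (hK.carrier x)
  have hx := hK.mem_carrier x
  obtain ⟨ε, hε, hεz⟩ := (hK.isCone (hK.carrier x)).exists_sub_smul hx
    (y := y) (by rw [hK.minFace_carrier x]; exact hy)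
  obtain ⟨z, hz, hzm⟩ := hεz ε hε.le le_rfl
  refine (hD.mem_of_comb (hD.carrier_subset (hj x hx)) (hj z hz) (hj y hy) (hD.mem_carrier _)
    one_pos hε fun n hn => ?_).2
  obtain ⟨m, hm, hmx⟩ := hpull n hn
  rw [hmx x hx, hmx y hy, hmx z hz, hzm m hm]
  ring

/-- The definition provides pull-backs from one target cone only. Any two target cones containing
the image share the minimal cone of the image of an interior point, and functions pass through this
common face. -/
theorem IsMorphism.exists_pullback (hf : K.IsMorphism D f) (hK : K.IsConeComplex)
    (hD : D.IsConeComplex) {i : ι} {j : κ} (hij : ∀ x ∈ K.cone i, f x ∈ D.cone j) :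
    ∀ n ∈ D.M j, ∃ m ∈ K.M i, ∀ x ∈ K.cone i, n (f x) = m x := by
  intro n hn
  obtain ⟨x, hx, -⟩ := hK.exists_carrier_eq i
  obtain ⟨j₀, hj₀, hpull⟩ := hf i
  have hxi : x ∈ K.cone i := hx ▸ hK.mem_carrier x
  have hd : ∀ y ∈ K.cone i, f y ∈ D.cone (hD.carrier (f x)) := fun y hy =>
    hf.mem_carrier hK hD x y (hx ▸ hy)
  obtain ⟨n', hn', hnn'⟩ := exists_restrict hn (D.cone (hD.carrier (f x)))
  rw [← hD.M_of_subset (hD.carrier_subset (hij x hxi)),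
    hD.M_of_subset (hD.carrier_subset (hj₀ x hxi))] at hn'
  obtain ⟨n₀, hn₀, hnn₀⟩ := exists_of_mem_restrictLattice hn'
  obtain ⟨m, hm, hmx⟩ := hpull n₀ hn₀
  exact ⟨m, hm, fun y hy => by rw [← hmx y hy, ← hnn₀ _ (hd y hy), hnn' _ (hd y hy)]⟩

theorem isMorphism_id_of_isProperSubdivision {κ : Type u'} {K' : WComplex κ X L}
    (h' : K'.IsProperSubdivision K) : K'.IsMorphism K id := by
  intro j
  obtain ⟨i, hi, hM⟩ := h'.2.2 j
  refine ⟨i, hi, fun n hn => ?_⟩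
  obtain ⟨g, hg, hgn⟩ := exists_restrict hn (K'.cone j)
  exact ⟨g, hM ▸ hg, fun x hx => (hgn x hx).symm⟩

theorem IsMorphism.comp {ι₃ : Type*} {Z : Type*} {L₃ : Type*} [AddCommGroup L₃]
    {E : WComplex ι₃ Z L₃} {g : Y → Z} (hg : D.IsMorphism E g) (hf : K.IsMorphism D f) :
    K.IsMorphism E (g ∘ f) := by
  intro i
  obtain ⟨j, hj, hjp⟩ := hf i
  obtain ⟨k, hk, hkp⟩ := hg j
  refine ⟨k, fun x hx => hk _ (hj x hx), fun n hn => ?_⟩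
  obtain ⟨m, hm, hmx⟩ := hkp n hn
  obtain ⟨l, hl, hlx⟩ := hjp m hm
  exact ⟨l, hl, fun x hx => by rw [← hlx x hx, ← hmx _ (hj x hx)]; rfl⟩

theorem M_carrier_of_isProperSubdivision {κ : Type u'} {K' : WComplex κ X L}
    (hK : K.IsConeComplex) (h' : K'.IsProperSubdivision K) (x : X) :
    K'.cone (h'.1.carrier x) ⊆ K.cone (hK.carrier x) ∧
      K'.M (h'.1.carrier x) =
        restrictLattice (K'.cone (h'.1.carrier x)) (K.M (hK.carrier x)) := by
  have hsub : K'.cone (h'.1.carrier x) ⊆ K.cone (hK.carrier x) :=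
    (isMorphism_id_of_isProperSubdivision h').mem_carrier h'.1 hK x
  refine ⟨hsub, ?_⟩
  obtain ⟨i, hi, hM⟩ := h'.2.2 (h'.1.carrier x)
  rw [hM, hK.M_of_subset (hK.carrier_subset (hi (h'.1.mem_carrier x))),
    restrictLattice_restrictLattice hsub]

end morphism

/-! ### Points, lattices and weights of stars -/

section star

variable {ι : Type u} {X : Type v} {L : Type w} [AddCommGroup L] {K : WComplex ι X L}

theorem starMk_eq {τ i j : ι} {x y : X} {hi : K.cone τ ⊆ K.cone i} {hx : x ∈ K.cone i}
    {hj : K.cone τ ⊆ K.cone j} {hy : y ∈ K.cone j} (h : K.cone j ⊆ K.cone i)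
    (hxy : ∀ m ∈ ann (K.M i) (K.cone τ), m x = m y) :
    K.starMk τ i x hi hx = K.starMk τ j y hj hy :=
  Quot.sound ⟨h, fun m hm hm0 => hxy m ⟨hm, hm0⟩⟩

/-- The sum of a point and a point in the relative interior of `τ`. -/
theorem IsConeComplex.exists_shift (hK : K.IsConeComplex) {i : ι} {x u : X} (hx : x ∈ K.cone i)
    (hu : u ∈ K.cone i) : ∃ w ∈ K.cone i, (∀ m ∈ K.M i, m w = m x + m u) ∧
      K.cone (hK.carrier u) ⊆ K.cone (hK.carrier w) := by
  obtain ⟨w, hw, hwm⟩ := (hK.isCone i).exists_comb hx hu zero_le_one zero_le_one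
  refine ⟨w, hw, fun m hm => by rw [hwm m hm, one_mul, one_mul], hK.carrier_subset ?_⟩
  exact (hK.mem_of_comb (hK.carrier_subset hw) hx hu (hK.mem_carrier w) one_pos one_pos hwm).2

variable (hK : K.IsConeComplex)
include hK

open Classical in
/-- A complete invariant of a point of the star: the smallest cone, and the values of the integral
functions on it that vanish on `τ`. -/
theorem IsConeComplex.exists_star_invariant (τ : ι) :
    ∃ F : K.StarPoint τ → ι × ((X → ℝ) → ℝ), ∀ (w : X) (h : K.cone τ ⊆ K.cone (hK.carrier w)),
      F (K.starMk τ (hK.carrier w) w h (hK.mem_carrier w)) = (hK.carrier w, fun m =>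
        if m ∈ ann (K.M (hK.carrier w)) (K.cone τ) then m w else 0) := by
  obtain ⟨u, hu, -⟩ := hK.exists_carrier_eq τ
  have huτ : u ∈ K.cone τ := hu ▸ hK.mem_carrier u
  -- Adding the interior point `u` of `τ` keeps the class modulo `τ` and gives a representative
  -- whose minimal cone contains `τ`.
  have hex : ∀ p : K.StarPre τ, ∃ w ∈ K.cone p.1.1, (∀ m ∈ K.M p.1.1, m w = m p.1.2 + m u) ∧
      K.cone (hK.carrier u) ⊆ K.cone (hK.carrier w) := fun p => hK.exists_shift p.2.2 (p.2.1 huτ)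
  choose W hW hWm hWc using hex
  have key : ∀ {i : ι} {w w' : X}, K.cone τ ⊆ K.cone i → w ∈ K.cone i → w' ∈ K.cone i →
      K.cone τ ⊆ K.cone (hK.carrier w) → K.cone τ ⊆ K.cone (hK.carrier w') →
      (∀ m ∈ ann (K.M i) (K.cone τ), m w = m w') →
      (hK.carrier w, fun m => if m ∈ ann (K.M (hK.carrier w)) (K.cone τ) then m w else 0) =
      (hK.carrier w', fun m =>
        if m ∈ ann (K.M (hK.carrier w')) (K.cone τ) then m w' else (0 : ℝ)) := by
    intro i w w' hi hw hw' hτw hτw' hmm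
    -- The function cutting out the minimal cone of `w` vanishes on `τ`, so it cannot distinguish
    -- `w` from `w'`. By symmetry the minimal cones coincide.
    have hsub : ∀ {w w'}, w ∈ K.cone i → w' ∈ K.cone i → K.cone τ ⊆ K.cone (hK.carrier w) →
        (∀ m ∈ ann (K.M i) (K.cone τ), m w = m w') → w' ∈ K.cone (hK.carrier w) := by
      intro w w' hw hw' hτw hmm
      obtain ⟨m, hm, -, hT⟩ := hK.isFaceOf_carrier hw
      have hmτ : m ∈ ann (K.M i) (K.cone τ) := ⟨hm, fun t ht => by
        have := hτw ht
        rw [hT] at this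
        exact this.2⟩
      have hmw : m w = 0 := by
        have := hK.mem_carrier w
        rw [hT] at this
        exact this.2
      rw [hT]
      exact ⟨hw', by rw [← hmm m hmτ, hmw]⟩
    have h1 := hsub hw hw' hτw hmm
    have h2 := hsub hw' hw hτw' fun m hm => (hmm m hm).symm
    have hc : hK.carrier w = hK.carrier w' :=
      hK.injective (Set.Subset.antisymm (hK.carrier_subset h2) (hK.carrier_subset h1))
    rw [← hc]
    refine Prod.ext rfl (funext fun m => ?_)
    by_cases hm : m ∈ ann (K.M (hK.carrier w)) (K.cone τ)
    · simp only [if_pos hm]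
      have hm1 := hm.1
      rw [hK.M_of_subset (hK.carrier_subset hw)] at hm1
      obtain ⟨n, hn, hmn⟩ := exists_of_mem_restrictLattice hm1
      rw [hmn w (hK.mem_carrier w), hmn w' h1]
      exact hmm n ⟨hn, fun t ht => by rw [← hmn t (hτw ht), hm.2 t ht]⟩
    · simp only [if_neg hm]
  have hτc : ∀ p, K.cone τ ⊆ K.cone (hK.carrier (W p)) := fun p => by
    have := hWc p
    rwa [hu] at this
  refine ⟨Quot.lift (fun p => (hK.carrier (W p), fun m =>
    if m ∈ ann (K.M (hK.carrier (W p))) (K.cone τ) then m (W p) else 0)) ?_, ?_⟩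
  · intro p q hpq
    refine key p.2.1 (hW p) (hpq.1 (hW q)) (hτc p) (hτc q) fun m hm => ?_
    obtain ⟨g, hg, hgm⟩ := exists_restrict hm.1 (K.cone q.1.1)
    rw [← hK.M_of_subset hpq.1] at hg
    rw [hWm p m hm.1, hm.2 u huτ, add_zero, ← hgm _ (hW q), hWm q g hg, hgm _ (q.2.1 huτ),
      hm.2 u huτ, add_zero, hgm _ q.2.2]
    exact hpq.2 m hm.1 hm.2
  · intro w h
    exact key h (hW ⟨(hK.carrier w, w), h, hK.mem_carrier w⟩) (hK.mem_carrier w) (hτc _) h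
      fun m hm => by
        rw [hWm ⟨(hK.carrier w, w), h, hK.mem_carrier w⟩ m hm.1, hm.2 u huτ, add_zero]

/-- The gluing relation only generates an equivalence relation, so equality in the quotient is read
off from an invariant constant on classes. On these representatives the invariant determines the
point. -/
theorem IsConeComplex.starMk_carrier_eq_iff {τ : ι} {w w' : X}
    (h : K.cone τ ⊆ K.cone (hK.carrier w)) (h' : K.cone τ ⊆ K.cone (hK.carrier w')) :
    K.starMk τ (hK.carrier w) w h (hK.mem_carrier w) =
      K.starMk τ (hK.carrier w') w' h' (hK.mem_carrier w') ↔
    hK.carrier w = hK.carrier w' ∧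
      ∀ m ∈ ann (K.M (hK.carrier w)) (K.cone τ), m w = m w' := by
  constructor
  · intro he
    obtain ⟨F, hF⟩ := hK.exists_star_invariant τ
    have h1 := hF w h
    rw [he, hF w' h'] at h1
    have h2 : hK.carrier w' = hK.carrier w := congrArg Prod.fst h1
    refine ⟨h2.symm, fun m hm => ?_⟩
    have h3 := congrFun (congrArg Prod.snd h1) m
    rw [← h2] at hm
    simp only [if_pos hm] at h3
    rw [h2] at hm
    simp only [if_pos hm] at h3
    exact h3.symm
  · rintro ⟨h1, h2⟩
    exact starMk_eq (h1 ▸ subset_rfl) h2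

/-- Every point of the star has a representative in the relative interior of its cone. -/
theorem IsConeComplex.exists_starMk_eq {τ i : ι} (hi : K.cone τ ⊆ K.cone i) {x : X}
    (hx : x ∈ K.cone i) {u : X} (hu : hK.carrier u = τ) : ∃ w ∈ K.cone i,
      ∃ h : K.cone τ ⊆ K.cone (hK.carrier w), (∀ m ∈ K.M i, m w = m x + m u) ∧
        K.starMk τ i x hi hx = K.starMk τ (hK.carrier w) w h (hK.mem_carrier w) := by
  have huτ : u ∈ K.cone τ := hu ▸ hK.mem_carrier u
  obtain ⟨w, hw, hwm, hc⟩ := hK.exists_shift hx (hi huτ)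
  rw [hu] at hc
  exact ⟨w, hw, hc, hwm, starMk_eq (hK.carrier_subset hw) fun m hm => by
    rw [hwm m hm.1, hm.2 u huτ, add_zero]⟩

theorem IsConeComplex.exists_eq_starMk {τ : ι} (q : K.StarPoint τ) :
    ∃ (w : X) (h : K.cone τ ⊆ K.cone (hK.carrier w)),
      q = K.starMk τ (hK.carrier w) w h (hK.mem_carrier w) := by
  obtain ⟨⟨⟨i, x⟩, hi, hx⟩, rfl⟩ := Quot.exists_rep q
  obtain ⟨u, hu, -⟩ := hK.exists_carrier_eq τ
  obtain ⟨w, -, h, -, he⟩ := hK.exists_starMk_eq hi hx hu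
  exact ⟨w, h, he⟩

theorem IsConeComplex.mem_of_starMk_mem {τ i : ι} (hi : K.cone τ ⊆ K.cone i) {w : X}
    {h : K.cone τ ⊆ K.cone (hK.carrier w)}
    (hw : K.starMk τ (hK.carrier w) w h (hK.mem_carrier w) ∈ K.starCone τ ⟨i, hi⟩) :
    w ∈ K.cone i := by
  obtain ⟨x, hx, he⟩ := hw
  obtain ⟨u, hu, -⟩ := hK.exists_carrier_eq τ
  obtain ⟨w', hw', h', -, he'⟩ := hK.exists_starMk_eq hi hx hu
  have h1 := ((hK.starMk_carrier_eq_iff h h').1 (he.trans he')).1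
  exact hK.carrier_subset_iff.1 (h1 ▸ hK.carrier_subset hw')

theorem IsConeComplex.eq_of_starMk_eq {τ i : ι} (hi : K.cone τ ⊆ K.cone i) {x y : X}
    (hx : x ∈ K.cone i) (hy : y ∈ K.cone i) (he : K.starMk τ i x hi hx = K.starMk τ i y hi hy)
    {m : X → ℝ} (hm : m ∈ ann (K.M i) (K.cone τ)) : m x = m y := by
  obtain ⟨u, hu, -⟩ := hK.exists_carrier_eq τ
  have huτ : u ∈ K.cone τ := hu ▸ hK.mem_carrier u
  obtain ⟨w, hw, h, hwm, hwe⟩ := hK.exists_starMk_eq hi hx hu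
  obtain ⟨w', hw', h', hwm', hwe'⟩ := hK.exists_starMk_eq hi hy hu
  obtain ⟨h1, h2⟩ := (hK.starMk_carrier_eq_iff h h').1 (by rw [← hwe, he, hwe'])
  obtain ⟨g, hg, hgm⟩ := exists_restrict hm.1 (K.cone (hK.carrier w))
  rw [← hK.M_of_subset (hK.carrier_subset hw)] at hg
  have h3 := h2 g ⟨hg, fun t ht => by rw [hgm t (h ht), hm.2 t ht]⟩
  rw [hgm w (hK.mem_carrier w), hgm w' (h1 ▸ hK.mem_carrier w'), hwm m hm.1, hwm' m hm.1] at h3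
  linarith

omit hK in
theorem exists_of_mem_starM {τ : ι} {i : {i : ι // K.cone τ ⊆ K.cone i}} {g : K.StarPoint τ → ℝ}
    (hg : g ∈ K.starM τ i) : ∃ m ∈ ann (K.M i.1) (K.cone τ),
      ∀ (x : X) (hx : x ∈ K.cone i.1), g (K.starMk τ i.1 x i.2 hx) = m x := by
  obtain ⟨-, m, hm, hm0, hgm⟩ := hg
  exact ⟨m, ⟨hm, hm0⟩, hgm⟩

open Classical in
-- Identifies the lattice of `σ/τ` with the functions on `σ` vanishing on `τ`. Values are taken at
-- chosen representatives, and such functions only depend on the class.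
theorem IsConeComplex.exists_starM_hom {τ : ι} (i : {i : ι // K.cone τ ⊆ K.cone i}) :
    ∃ f : ann (K.M i.1) (K.cone τ) →+ (K.StarPoint τ → ℝ), Function.Injective f ∧
      (∀ g, g ∈ K.starM τ i ↔ ∃ a, f a = g) ∧
      ∀ m (x : X) (hx : x ∈ K.cone i.1), f m (K.starMk τ i.1 x i.2 hx) = m.1 x := by
  have hex : ∀ q ∈ K.starCone τ i, ∃ x, ∃ hx : x ∈ K.cone i.1, q = K.starMk τ i.1 x i.2 hx :=
    fun q hq => hq
  choose r hr hrq using hex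
  let f : ann (K.M i.1) (K.cone τ) →+ (K.StarPoint τ → ℝ) :=
    { toFun := fun m q => if h : q ∈ K.starCone τ i then m.1 (r q h) else 0
      map_zero' := by
        funext q
        by_cases h : q ∈ K.starCone τ i
        · simp only [dif_pos h]; rfl
        · simp only [dif_neg h]; rfl
      map_add' := by
        intro a b
        funext q
        by_cases h : q ∈ K.starCone τ i
        · simp only [dif_pos h, Pi.add_apply]; rfl
        · simp only [dif_neg h, Pi.add_apply, add_zero] }
  have hf : ∀ (m : ann (K.M i.1) (K.cone τ)) (x : X) (hx : x ∈ K.cone i.1),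
      f m (K.starMk τ i.1 x i.2 hx) = m.1 x := by
    intro m x hx
    have hq : K.starMk τ i.1 x i.2 hx ∈ K.starCone τ i := ⟨x, hx, rfl⟩
    change (if h : _ then _ else _) = _
    rw [dif_pos hq]
    exact (hK.eq_of_starMk_eq i.2 hx (hr _ hq) (hrq _ hq) m.2).symm
  refine ⟨f, fun a b hab => Subtype.ext ?_, fun g => ⟨fun hg => ?_, ?_⟩, hf⟩
  · exact (hK.isCone i.1).ext_of_vanish a.2.1 b.2.1 fun x hx => by rw [← hf a x hx, hab, hf b x hx]
  · obtain ⟨hg0, m, hm, hm0, hgm⟩ := hg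
    refine ⟨⟨m, hm, hm0⟩, funext fun q => ?_⟩
    by_cases hq : q ∈ K.starCone τ i
    · obtain ⟨x, hx, rfl⟩ := hq
      rw [hf, hgm x hx]
    · rw [hg0 q hq]
      exact dif_neg hq
  · rintro ⟨m, rfl⟩
    exact ⟨fun q hq => dif_neg hq, m.1, m.2.1, m.2.2, hf m⟩

theorem IsConeComplex.exists_mem_starM {τ : ι} (i : {i : ι // K.cone τ ⊆ K.cone i}) {m : X → ℝ}
    (hm : m ∈ ann (K.M i.1) (K.cone τ)) :
    ∃ g ∈ K.starM τ i, ∀ (x : X) (hx : x ∈ K.cone i.1), g (K.starMk τ i.1 x i.2 hx) = m x := by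
  obtain ⟨f, -, hf, hfx⟩ := hK.exists_starM_hom i
  exact ⟨f ⟨m, hm⟩, (hf _).2 ⟨_, rfl⟩, hfx ⟨m, hm⟩⟩

theorem IsConeComplex.isIntegralCone_star {τ : ι} (i : {i : ι // K.cone τ ⊆ K.cone i}) :
    IsIntegralCone (K.starCone τ i) (K.starM τ i) where
  eq_zero_off m hm x hx := hm.1 x hx
  fg := by
    obtain ⟨f, -, hf, -⟩ := hK.exists_starM_hom i
    have h1 : K.starM τ i = f.range := by
      ext g
      rw [hf, AddMonoidHom.mem_range]
    have h2 : AddGroup.FG (ann (K.M i.1) (K.cone τ)) :=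
      (AddGroup.fg_iff_addSubgroup_fg _).2 (ann_fg (hK.isCone i.1).fg _)
    rw [h1, ← AddGroup.fg_iff_addSubgroup_fg]
    exact AddGroup.fg_range f
  injOn := by
    rintro _ ⟨x, hx, rfl⟩ _ ⟨y, hy, rfl⟩ h
    refine starMk_eq subset_rfl fun m hm => ?_
    obtain ⟨g, hg, hgm⟩ := hK.exists_mem_starM i hm
    rw [← hgm x hx, ← hgm y hy]
    exact h g hg
  polyhedral := by
    obtain ⟨U, hU, h1, h2⟩ := (hK.isCone i.1).polyhedral
    refine polyhedral_of_family (κ := U) (fun y => K.starMk τ i.1 y.1 i.2 (hU y.1 y.2).1)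
      (fun y => ⟨⟨y.1, (hU y.1 y.2).1, rfl⟩, fun g hg => ?_⟩) ?_ ?_
    · obtain ⟨m, hm, hgm⟩ := exists_of_mem_starM hg
      rw [hgm]
      exact (hU y.1 y.2).2 m hm.1
    · rintro _ ⟨x, hx, rfl⟩
      obtain ⟨a, ha, hax⟩ := h1 x hx
      refine ⟨fun y => a y.1, fun y => ha y.1, fun g hg => ?_⟩
      obtain ⟨m, hm, hgm⟩ := exists_of_mem_starM hg
      rw [hgm, hax m hm.1, ← Finset.sum_coe_sort]
      exact Finset.sum_congr rfl fun y _ => by rw [hgm]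
    · intro a ha
      classical
      obtain ⟨x, hx, hxm⟩ := h2 (fun y => if h : y ∈ U then a ⟨y, h⟩ else 0) fun y => by
        split_ifs
        · exact ha _
        · exact le_rfl
      refine ⟨_, ⟨x, hx, rfl⟩, fun g hg => ?_⟩
      obtain ⟨m, hm, hgm⟩ := exists_of_mem_starM hg
      rw [hgm, hxm m hm.1, ← Finset.sum_coe_sort]
      exact Finset.sum_congr rfl fun y _ => by rw [hgm, dif_pos y.2]
  stronglyConvex := by
    rintro _ ⟨x, hx, rfl⟩ _ ⟨y, hy, rfl⟩ h g hg
    -- The function defining `τ` is non-negative on `σ`, so a point whose class has an inverse lies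
    -- in `τ` and represents zero.
    obtain ⟨n, hn, hpos, hT⟩ := hK.isFaceOf_of_subset i.2
    have hnτ : n ∈ ann (K.M i.1) (K.cone τ) := ⟨hn, fun t ht => by
      rw [hT] at ht
      exact ht.2⟩
    obtain ⟨g', hg', hgn⟩ := hK.exists_mem_starM i hnτ
    have h1 := h g' hg'
    rw [hgn, hgn] at h1
    have h2 : x ∈ K.cone τ := by
      rw [hT]
      exact ⟨hx, by linarith [hpos x hx, hpos y hy]⟩
    obtain ⟨m, hm, hgm⟩ := exists_of_mem_starM hg
    rw [hgm, hm.2 x h2]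

/-- Represent a point of the star by some `w` whose minimal cone contains `τ`. The image of that
cone is the minimal face of the point in every cone of the star through it, because the functions
defining the faces involved vanish on `τ`. -/
theorem IsConeComplex.isConeComplex_star (τ : ι) : (K.star τ).IsConeComplex := by
  have := hK.finite
  refine IsConeComplex.of_minFace (fun i => hK.isIntegralCone_star i) ?_ ?_ ?_
  · intro q
    obtain ⟨⟨⟨i, x⟩, hi, hx⟩, rfl⟩ := Quot.exists_rep q
    exact ⟨⟨i, hi⟩, x, hx, rfl⟩
  · have hsub : ∀ i j : {i : ι // K.cone τ ⊆ K.cone i}, K.starCone τ i ⊆ K.starCone τ j →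
        K.cone i.1 ⊆ K.cone j.1 := by
      intro i j hij
      obtain ⟨w, hw, -⟩ := hK.exists_carrier_eq i.1
      have h1 : K.starMk τ (hK.carrier w) w (hw ▸ i.2) (hK.mem_carrier w) ∈ K.starCone τ i := by
        refine ⟨w, hw ▸ hK.mem_carrier w, ?_⟩
        congr 1
      have h2 := hK.mem_of_starMk_mem j.2 (hij h1)
      exact hw ▸ hK.carrier_subset h2
    intro i j hij
    exact Subtype.ext (hK.injective
      (Set.Subset.antisymm (hsub i j hij.subset) (hsub j i hij.symm.subset)))
  · intro q
    obtain ⟨w, h, rfl⟩ := hK.exists_eq_starMk q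
    refine ⟨⟨hK.carrier w, h⟩, fun i hqi => ?_⟩
    have hwi := hK.mem_of_starMk_mem i.2 hqi
    have hki := hK.carrier_subset hwi
    have hmk : ∀ (x : X) (hx : x ∈ K.cone (hK.carrier w)),
        K.starMk τ (hK.carrier w) x h hx = K.starMk τ i.1 x i.2 (hki hx) :=
      fun x hx => (starMk_eq hki fun _ _ => rfl).symm
    constructor
    · ext q
      constructor
      · rintro ⟨y, hy, rfl⟩
        refine ⟨⟨y, hki hy, hmk y hy⟩, fun g hg hpos hg0 => ?_⟩
        obtain ⟨m, hm, hgm⟩ := exists_of_mem_starM hg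
        rw [hmk, hgm] at hg0 ⊢
        rw [hK.cone_carrier_eq_minFace hwi] at hy
        exact hy.2 m hm.1 (fun z hz => by rw [← hgm z hz]; exact hpos _ ⟨z, hz, rfl⟩) hg0
      · rintro ⟨⟨y, hy, rfl⟩, hmin⟩
        obtain ⟨n, hn, hpos, hT⟩ := hK.isFaceOf_of_subset hki
        have hn0 : ∀ t ∈ K.cone (hK.carrier w), n t = 0 := fun t ht => by
          rw [hT] at ht
          exact ht.2
        obtain ⟨g, hg, hgn⟩ := hK.exists_mem_starM i ⟨hn, fun t ht => hn0 t (h ht)⟩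
        have h1 := hmin g hg (by rintro _ ⟨z, hz, rfl⟩; rw [hgn]; exact hpos z hz)
          (by rw [hmk, hgn]; exact hn0 w (hK.mem_carrier w))
        rw [hgn] at h1
        have hyk : y ∈ K.cone (hK.carrier w) := by
          rw [hT]
          exact ⟨hy, h1⟩
        exact ⟨y, hyk, (hmk y hyk).symm⟩
    · refine lattice_eq_of_values (S := K.starCone τ ⟨hK.carrier w, h⟩) (fun g hg q hq => hg.1 q hq)
        (fun g hg q hq => eq_zero_of_mem_restrictLattice hg hq) ?_ ?_
      · intro g hg
        obtain ⟨m, hm, hgm⟩ := exists_of_mem_starM hg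
        have hm1 := hm.1
        simp only at hm1
        rw [hK.M_of_subset hki] at hm1
        obtain ⟨n, hn, hmn⟩ := exists_of_mem_restrictLattice hm1
        obtain ⟨g', hg', hgn⟩ := hK.exists_mem_starM i
          ⟨hn, fun t ht => by rw [← hmn t (h ht), hm.2 t ht]⟩
        obtain ⟨g'', hg'', hgg⟩ := exists_restrict hg' (K.starCone τ ⟨hK.carrier w, h⟩)
        refine ⟨g'', hg'', ?_⟩
        rintro _ ⟨x, hx, rfl⟩
        rw [hgg _ ⟨x, hx, rfl⟩, hgm, hmk, hgn, hmn x hx]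
      · intro g hg
        obtain ⟨g', hg', hgg⟩ := exists_of_mem_restrictLattice hg
        obtain ⟨n, hn, hgn⟩ := exists_of_mem_starM hg'
        obtain ⟨m, hm, hmn⟩ := exists_restrict hn.1 (K.cone (hK.carrier w))
        rw [← hK.M_of_subset hki] at hm
        obtain ⟨g'', hg'', hgm⟩ := hK.exists_mem_starM ⟨hK.carrier w, h⟩
          ⟨hm, fun t ht => by rw [hmn t (h ht), hn.2 t ht]⟩
        refine ⟨g'', hg'', ?_⟩
        rintro _ ⟨x, hx, rfl⟩
        rw [hgg _ ⟨x, hx, rfl⟩, hgm, hmk, hgn, hmn x hx]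

theorem IsConeComplex.star_carrier (τ : ι) {w : X} (h : K.cone τ ⊆ K.cone (hK.carrier w))
    (hS : (K.star τ).IsConeComplex) :
    hS.carrier (K.starMk τ (hK.carrier w) w h (hK.mem_carrier w)) = ⟨hK.carrier w, h⟩ := by
  refine hS.carrier_eq ⟨w, hK.mem_carrier w, rfl⟩ fun g hg hpos hg0 => ?_
  obtain ⟨m, hm, hgm⟩ := exists_of_mem_starM hg
  rw [hgm] at hg0
  have h1 := hK.eq_zero_of_carrier hm.1
    (fun z hz => by rw [← hgm z hz]; exact hpos _ ⟨z, hz, rfl⟩) hg0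
  refine (hS.isCone _).ext_of_vanish hg (zero_mem _) ?_
  rintro _ ⟨x, hx, rfl⟩
  rw [hgm, h1]
  rfl

theorem IsConeComplex.star_dim (τ : ι) (i : {i : ι // K.cone τ ⊆ K.cone i}) :
    (K.star τ).dim i + K.dim τ = K.dim i.1 := by
  obtain ⟨f, hf, hfg, -⟩ := hK.exists_starM_hom i
  have h1 : (K.star τ).dim i = Module.finrank ℤ (ann (K.M i.1) (K.cone τ)) :=
    finrank_eq_of_range f hf hfg
  rw [h1, hK.finrank_ann_add i.2]

theorem IsConeComplex.star_valueGroup (τ : ι) {w : X} (h : K.cone τ ⊆ K.cone (hK.carrier w)) :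
    (K.star τ).valueGroup (K.starMk τ (hK.carrier w) w h (hK.mem_carrier w)) =
      valuesAt (ann (K.M (hK.carrier w)) (K.cone τ)) w := by
  rw [(hK.isConeComplex_star τ).valueGroup_eq
    (i := ⟨hK.carrier w, h⟩) ⟨w, hK.mem_carrier w, rfl⟩]
  ext r
  constructor
  · rintro ⟨g, hg, rfl⟩
    obtain ⟨m, hm, hgm⟩ := exists_of_mem_starM hg
    exact ⟨m, hm, (hgm w (hK.mem_carrier w)).symm⟩
  · rintro ⟨m, hm, rfl⟩
    obtain ⟨g, hg, hgm⟩ := hK.exists_mem_starM ⟨hK.carrier w, h⟩ hm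
    exact ⟨g, hg, hgm w (hK.mem_carrier w)⟩

theorem IsConeComplex.star_weightClass (τ : ι) {w : X} (h : K.cone τ ⊆ K.cone (hK.carrier w))
    (c : ι → ℤ) :
    (K.star τ).weightClass (fun i => c i.1)
        (K.starMk τ (hK.carrier w) w h (hK.mem_carrier w)) =
      if Module.finrank ℤ (valuesAt (ann (K.M (hK.carrier w)) (K.cone τ)) w) + K.dim τ =
        K.dim (hK.carrier w) then c (hK.carrier w) else 0 := by
  rw [(hK.isConeComplex_star τ).weightClass_eq, hK.star_carrier τ h, hK.star_valueGroup τ h]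
  have h1 := hK.star_dim τ ⟨hK.carrier w, h⟩
  simp only at h1
  exact if_congr (by omega) rfl rfl

end star

end WComplex

/-- Equal ranks make the quotient a torsion group. -/
theorem AddSubgroup.FG.exists_zsmul_mem {G : Type u} [AddCommGroup G] {P Q : AddSubgroup G}
    (hQ : Q.FG) (h : P ≤ Q) (hr : Module.finrank ℤ P = Module.finrank ℤ Q) {q : G} (hq : q ∈ Q) :
    ∃ n : ℤ, n ≠ 0 ∧ n • q ∈ P := by
  have := hQ.moduleFinite
  have h1 := Submodule.finrank_quotient_add_finrank (AddSubgroup.toIntSubmodule (P.addSubgroupOf Q))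
  have h2 : Module.finrank ℤ (AddSubgroup.toIntSubmodule (P.addSubgroupOf Q)) =
      Module.finrank ℤ P :=
    (AddSubgroup.addSubgroupOfEquivOfLe h).toIntLinearEquiv.finrank_eq
  have h3 : Module.finrank ℤ (Q ⧸ AddSubgroup.toIntSubmodule (P.addSubgroupOf Q)) = 0 := by omega
  obtain ⟨n, hn, hnq⟩ := Module.finrank_eq_zero_iff.1 h3 (Submodule.Quotient.mk ⟨q, hq⟩)
  refine ⟨n, hn, ?_⟩
  rw [← Submodule.Quotient.mk_smul, Submodule.Quotient.mk_eq_zero] at hnq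
  exact hnq

/-- A relation that is a partial bijection, defined only where a summand is nonzero, is enough to
compare sums. No map between the index types is needed, which suits strata that exist in only one of
two subdivisions. -/
theorem finsum_mem_eq_of_rel {α : Type u} {β : Type v} {s : Set α} {t : Set β} {f : α → ℤ}
    {g : β → ℤ} (R : α → β → Prop) (h1 : ∀ a ∈ s, f a ≠ 0 → ∃ b ∈ t, R a b)
    (h2 : ∀ b ∈ t, g b ≠ 0 → ∃ a ∈ s, R a b) (hfg : ∀ a ∈ s, ∀ b ∈ t, R a b → f a = g b)
    (hl : ∀ a b b', R a b → R a b' → b = b') (hr : ∀ a a' b, R a b → R a' b → a = a') :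
    ∑ᶠ a ∈ s, f a = ∑ᶠ b ∈ t, g b := by
  classical
  rw [← finsum_mem_inter_support f s, ← finsum_mem_inter_support g t]
  have hex : ∀ a ∈ s ∩ Function.support f, ∃ b ∈ t, R a b := fun a ha => h1 a ha.1 ha.2
  rcases isEmpty_or_nonempty β with hβ | hβ
  · exact (finsum_mem_eq_zero_of_forall_eq_zero
      fun a ha => (hβ.false (hex a ha).choose).elim).trans (finsum_of_isEmpty _).symm
  choose! F hFt hFR using hex
  refine finsum_mem_eq_of_bijOn F ⟨?_, ?_, ?_⟩ fun a ha => hfg a ha.1 _ (hFt a ha) (hFR a ha)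
  · intro a ha
    refine ⟨hFt a ha, ?_⟩
    rw [Function.mem_support, ← hfg a ha.1 _ (hFt a ha) (hFR a ha)]
    exact ha.2
  · intro a ha a' ha' he
    exact hr a a' (F a) (hFR a ha) (by rw [he]; exact hFR a' ha')
  · rintro b ⟨hb, hb0⟩
    obtain ⟨a, ha, hab⟩ := h2 b hb hb0
    have ha' : a ∈ s ∩ Function.support f := ⟨ha, by
      rw [Function.mem_support, hfg a ha b hb hab]
      exact hb0⟩
    exact ⟨a, ha', hl a _ _ (hFR a ha') hab⟩

namespace WComplex

/-! ### Push-forwards of functions on points -/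

section pushforward

variable {α : Type u} {β : Type v} {γ : Type w} {Vα : α → AddSubgroup ℝ} {Vβ : β → AddSubgroup ℝ}
  {Vγ : γ → AddSubgroup ℝ} {F : α → β → Prop} {G : β → γ → Prop} {a : α → ℤ}

theorem pushforward_eq_zero {b : β → ℤ} {z : γ} (h : ∀ y, G y z →
    Module.finrank ℤ (Vβ y) = Module.finrank ℤ (Vγ z) → b y = 0) :
    pushforward Vβ Vγ G b z = 0 :=
  finsum_mem_eq_zero_of_forall_eq_zero fun y hy => by rw [h y hy.1 hy.2, mul_zero]

/-- Two push-forwards agree if their summands correspond to each other under a relation. -/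
theorem pushforward_eq_of_rel {b : β → ℤ} {G : β → γ → Prop} {F : α → γ → Prop} {z : γ}
    (R : α → β → Prop)
    (h1 : ∀ x, F x z → Module.finrank ℤ (Vα x) = Module.finrank ℤ (Vγ z) → a x ≠ 0 → ∃ y, R x y)
    (h2 : ∀ y, G y z → Module.finrank ℤ (Vβ y) = Module.finrank ℤ (Vγ z) → b y ≠ 0 → ∃ x, R x y)
    (hF : ∀ x y, R x y → (F x z ↔ G y z)) (hV : ∀ x y, R x y → Vα x = Vβ y)
    (hab : ∀ x y, R x y → a x = b y)
    (hl : ∀ x y y', R x y → R x y' → y = y') (hr : ∀ x x' y, R x y → R x' y → x = x') :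
    pushforward Vα Vγ F a z = pushforward Vβ Vγ G b z := by
  refine finsum_mem_eq_of_rel R ?_ ?_ ?_ hl hr
  · rintro x ⟨hx, hxr⟩ hx0
    obtain ⟨y, hy⟩ := h1 x hx hxr (right_ne_zero_of_mul hx0)
    exact ⟨y, ⟨(hF x y hy).1 hx, by rw [← hV x y hy]; exact hxr⟩, hy⟩
  · rintro y ⟨hy, hyr⟩ hy0
    obtain ⟨x, hx⟩ := h2 y hy hyr (right_ne_zero_of_mul hy0)
    exact ⟨x, ⟨(hF x y hx).2 hy, by rw [hV x y hx]; exact hyr⟩, hx⟩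
  · intro x _ y _ hxy
    rw [hV x y hxy, hab x y hxy]

/-- Push-forward is functorial. -/
theorem pushforward_comp {z : γ} (hF : ∀ x y y', F x y → F x y' → y = y')
    (hFV : ∀ x y, F x y → Vβ y ≤ Vα x) (hGV : ∀ y, G y z → Vγ z ≤ Vβ y)
    (hα : ∀ x, (Vα x).FG) (hβ : ∀ y, (Vβ y).FG)
    (hfin : {x | (∃ y, F x y ∧ G y z) ∧ Module.finrank ℤ (Vα x) = Module.finrank ℤ (Vγ z) ∧
      a x ≠ 0}.Finite) :
    pushforward Vβ Vγ G (pushforward Vα Vβ F a) z =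
      pushforward Vα Vγ (fun x z => ∃ y, F x y ∧ G y z) a z := by
  classical
  set s := hfin.toFinset with hs
  have hmem : ∀ x, x ∈ s ↔ (∃ y, F x y ∧ G y z) ∧
      Module.finrank ℤ (Vα x) = Module.finrank ℤ (Vγ z) ∧ a x ≠ 0 := fun x => by
    rw [hs, Set.Finite.mem_toFinset]
    rfl
  have hex : ∀ x ∈ s, ∃ y, F x y ∧ G y z := fun x hx => ((hmem x).1 hx).1
  rcases isEmpty_or_nonempty β with hβ0 | hβ0
  · unfold pushforward
    rw [finsum_of_isEmpty]
    exact (finsum_mem_eq_zero_of_forall_eq_zero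
      fun x hx => (hβ0.false hx.1.choose).elim).symm
  choose! p hpF hpG using hex
  -- Value groups can only shrink along a map, so the rank at the intermediate point is squeezed
  -- between two equal ranks. The same points therefore contribute to both sides, and the indices
  -- multiply.
  have hrank : ∀ x ∈ s, Module.finrank ℤ (Vβ (p x)) = Module.finrank ℤ (Vγ z) := by
    intro x hx
    have h1 := (hα x).finrank_mono (hFV x _ (hpF x hx))
    have h2 := (hβ (p x)).finrank_mono (hGV _ (hpG x hx))
    have h3 := ((hmem x).1 hx).2.1
    omega
  have hinner : ∀ y ∈ {y | G y z ∧ Module.finrank ℤ (Vβ y) = Module.finrank ℤ (Vγ z)},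
      ((Vγ z).relIndex (Vβ y) : ℤ) * pushforward Vα Vβ F a y =
        ∑ x ∈ s, if F x y then ((Vγ z).relIndex (Vα x) : ℤ) * a x else 0 := by
    rintro y ⟨hy, hyr⟩
    have h1 : pushforward Vα Vβ F a y =
        ∑ x ∈ s.filter fun x => F x y, ((Vβ y).relIndex (Vα x) : ℤ) * a x := by
      refine finsum_mem_eq_sum_of_inter_support_eq _ (Set.ext fun x => ⟨?_, ?_⟩)
      · rintro ⟨⟨hx, hxr⟩, hx0⟩
        refine ⟨?_, hx0⟩
        rw [Finset.mem_coe, Finset.mem_filter, hmem]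
        exact ⟨⟨⟨y, hx, hy⟩, by rw [hxr, hyr], right_ne_zero_of_mul hx0⟩, hx⟩
      · rintro ⟨hx, hx0⟩
        rw [Finset.mem_coe, Finset.mem_filter, hmem] at hx
        exact ⟨⟨hx.2, by rw [hx.1.2.1, hyr]⟩, hx0⟩
    rw [h1, Finset.mul_sum, Finset.sum_filter]
    refine Finset.sum_congr rfl fun x _ => ?_
    split_ifs with hx
    · rw [← AddSubgroup.relIndex_mul_relIndex _ _ _ (hGV y hy) (hFV x y hx), Nat.cast_mul, mul_assoc]
    · rfl
  unfold pushforward at hinner ⊢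
  rw [finsum_mem_congr rfl hinner, finsum_mem_eq_sum_of_subset (t := s.image p), Finset.sum_comm]
  · have h2 : ∀ x ∈ s, (∑ y ∈ s.image p, if F x y then ((Vγ z).relIndex (Vα x) : ℤ) * a x else 0) =
        ((Vγ z).relIndex (Vα x) : ℤ) * a x := by
      intro x hx
      rw [Finset.sum_eq_single (p x), if_pos (hpF x hx)]
      · intro y _ hy
        exact if_neg fun h => hy (hF x _ _ h (hpF x hx))
      · intro h
        exact absurd (Finset.mem_image_of_mem p hx) h
    rw [Finset.sum_congr rfl h2]
    symm
    refine finsum_mem_eq_sum_of_inter_support_eq _ (Set.ext fun x => ⟨?_, ?_⟩)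
    · rintro ⟨⟨hx, hxr⟩, hx0⟩
      exact ⟨(hmem x).2 ⟨hx, hxr, right_ne_zero_of_mul hx0⟩, hx0⟩
    · rintro ⟨hx, hx0⟩
      have := (hmem x).1 hx
      exact ⟨⟨this.1, this.2.1⟩, hx0⟩
  · rintro y ⟨-, hy0⟩
    obtain ⟨x, hx, hx0⟩ := Finset.exists_ne_zero_of_sum_ne_zero hy0
    have hxy : F x y := by
      by_contra h
      exact hx0 (if_neg h)
    exact Finset.mem_coe.2 (Finset.mem_image.2 ⟨x, hx, hF x _ _ (hpF x hx) hxy⟩)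
  · intro y hy
    obtain ⟨x, hx, rfl⟩ := Finset.mem_image.1 (Finset.mem_coe.1 hy)
    exact ⟨hpG x hx, hrank x hx⟩

end pushforward

/-! ### The extended complex and its maps -/

section ext

variable {ι : Type u} {X : Type v} {L : Type w} [AddCommGroup L] {K : WComplex ι X L}
  {κ : Type u'} {Y : Type v'} {L' : Type w'} [AddCommGroup L'] {D : WComplex κ Y L'} {f : X → Y}

theorem starMk_of_subset {τ i j : ι} {x : X} {hi : K.cone τ ⊆ K.cone i} {hj : K.cone τ ⊆ K.cone j}
    (h : K.cone j ⊆ K.cone i) (hx : x ∈ K.cone j) :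
    K.starMk τ i x hi (h hx) = K.starMk τ j x hj hx :=
  starMk_eq h fun _ _ => rfl

/-- The point of the extended complex in the stratum of `τ` defined by a point `z` whose smallest
cone contains `τ`. -/
noncomputable def IsConeComplex.extPt (hK : K.IsConeComplex) (τ : ι) (z : X)
    (h : K.cone τ ⊆ K.cone (hK.carrier z)) : K.ExtPoint :=
  ⟨τ, K.starMk τ (hK.carrier z) z h (hK.mem_carrier z)⟩

namespace IsConeComplex

theorem exists_eq_extPt (hK : K.IsConeComplex) (e : K.ExtPoint) :
    ∃ z h, e = hK.extPt e.1 z h := by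
  obtain ⟨τ, q⟩ := e
  obtain ⟨w, h, rfl⟩ := hK.exists_eq_starMk q
  exact ⟨w, h, rfl⟩

theorem exists_eq_extPt_carrier (hK : K.IsConeComplex) (e : K.ExtPoint) :
    ∃ u z h, e = hK.extPt (hK.carrier u) z h := by
  obtain ⟨τ, q⟩ := e
  obtain ⟨w, h, rfl⟩ := hK.exists_eq_starMk q
  obtain ⟨u, rfl, -⟩ := hK.exists_carrier_eq τ
  exact ⟨u, w, h, rfl⟩

theorem extPt_eq_iff (hK : K.IsConeComplex) {τ τ' : ι} {z z' : X} {h h'} :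
    hK.extPt τ z h = hK.extPt τ' z' h' ↔ τ = τ' ∧ hK.carrier z = hK.carrier z' ∧
      ∀ m ∈ ann (K.M (hK.carrier z)) (K.cone τ), m z = m z' := by
  constructor
  · intro he
    obtain rfl : τ = τ' := congrArg Sigma.fst he
    exact ⟨rfl, (hK.starMk_carrier_eq_iff h h').1 (eq_of_heq (Sigma.mk.inj he).2)⟩
  · rintro ⟨rfl, he⟩
    exact congrArg (Sigma.mk τ) ((hK.starMk_carrier_eq_iff h h').2 he)

theorem mk_eq_extPt (hK : K.IsConeComplex) {τ i : ι} {x w : X} {hi : K.cone τ ⊆ K.cone i}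
    {hx : x ∈ K.cone i} (hw : w ∈ K.cone i) (h : K.cone τ ⊆ K.cone (hK.carrier w))
    (hxw : ∀ m ∈ ann (K.M i) (K.cone τ), m x = m w) :
    (⟨τ, K.starMk τ i x hi hx⟩ : K.ExtPoint) = hK.extPt τ w h :=
  congrArg (Sigma.mk τ) (starMk_eq (hK.carrier_subset hw) hxw)

theorem extValueGroup_extPt (hK : K.IsConeComplex) {τ : ι} {z : X} {h} :
    K.extValueGroup (hK.extPt τ z h) = valuesAt (ann (K.M (hK.carrier z)) (K.cone τ)) z :=
  hK.star_valueGroup τ h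

theorem extValueGroup_fg (hK : K.IsConeComplex) (e : K.ExtPoint) : (K.extValueGroup e).FG := by
  obtain ⟨z, h, he⟩ := hK.exists_eq_extPt e
  rw [he, hK.extValueGroup_extPt]
  exact valuesAt_fg (ann_fg (hK.isCone _).fg _) _

theorem weightInter_extPt (hK : K.IsConeComplex) (ψ : X → ℝ) (c : ι → ℤ) {τ : ι} {z : X} {h} :
    K.weightInter ψ c (hK.extPt τ z h) = if K.dim τ = 1 ∧
      Module.finrank ℤ (valuesAt (ann (K.M (hK.carrier z)) (K.cone τ)) z) + 1 =
        K.dim (hK.carrier z) then K.raySlope ψ τ * c (hK.carrier z) else 0 := by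
  unfold weightInter
  change (if K.dim τ = 1 then K.raySlope ψ τ * (K.star τ).weightClass (fun i => c i.1)
    (K.starMk τ (hK.carrier z) z h (hK.mem_carrier z)) else 0) = _
  rw [hK.star_weightClass]
  by_cases h1 : K.dim τ = 1
  · rw [if_pos h1, h1]
    by_cases h2 : Module.finrank ℤ (valuesAt (ann (K.M (hK.carrier z)) (K.cone τ)) z) + 1 =
        K.dim (hK.carrier z)
    · rw [if_pos h2, if_pos ⟨rfl, h2⟩]
    · rw [if_neg h2, if_neg fun h => h2 h.2, mul_zero]
  · rw [if_neg h1, if_neg fun h => h1 h.1]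

theorem eq_zero_of_dim_eq_zero (hK : K.IsConeComplex) {τ i : ι} (hd : K.dim τ = 0)
    (hi : K.cone τ ⊆ K.cone i) {m : X → ℝ} (hm : m ∈ K.M i) {t : X} (ht : t ∈ K.cone τ) :
    m t = 0 := by
  obtain ⟨g, hg, hgm⟩ := exists_restrict hm (K.cone τ)
  rw [← hK.M_of_subset hi, (hK.isCone τ).fg.eq_bot_of_finrank_eq_zero hd,
    AddSubgroup.mem_bot] at hg
  rw [← hgm t ht, hg, Pi.zero_apply]

/-- All lattice functions vanish on a zero-dimensional cone, so it is contained in every face of a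
cone that contains it. -/
theorem subset_carrier_of_dim_eq_zero (hK : K.IsConeComplex) {τ i : ι} (hd : K.dim τ = 0)
    (hi : K.cone τ ⊆ K.cone i) {x : X} (hx : x ∈ K.cone i) :
    K.cone τ ⊆ K.cone (hK.carrier x) := by
  obtain ⟨m, hm, -, hT⟩ := hK.isFaceOf_carrier hx
  intro t ht
  rw [hT]
  exact ⟨hi ht, hK.eq_zero_of_dim_eq_zero hd hi hm ht⟩

theorem finiteIncl_iff (hK : K.IsConeComplex) {x : X} {e : K.ExtPoint} :
    K.finiteIncl x e ↔ K.dim e.1 = 0 ∧ ∃ h, e = hK.extPt e.1 x h := by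
  obtain ⟨τ, q⟩ := e
  refine and_congr_right fun hd => ⟨?_, ?_⟩
  · rintro ⟨i, hi, hx, he⟩
    change K.cone τ ⊆ K.cone i at hi
    have he' : (⟨τ, q⟩ : K.ExtPoint) = ⟨τ, K.starMk τ i x hi hx⟩ := congrArg (Sigma.mk τ) he
    have h := hK.subset_carrier_of_dim_eq_zero hd hi hx
    exact ⟨h, he'.trans (hK.mk_eq_extPt hx h fun _ _ => rfl)⟩
  · rintro ⟨h, he⟩
    exact ⟨hK.carrier x, h, hK.mem_carrier x, eq_of_heq (Sigma.mk.inj he).2⟩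

end IsConeComplex

theorem IsMorphism.carrier_subset (hf : K.IsMorphism D f) (hK : K.IsConeComplex)
    (hD : D.IsConeComplex) {u z : X} (h : K.cone (hK.carrier u) ⊆ K.cone (hK.carrier z)) :
    D.cone (hD.carrier (f u)) ⊆ D.cone (hD.carrier (f z)) :=
  hD.carrier_subset (hf.mem_carrier hK hD z u (h (hK.mem_carrier u)))

/-- The induced map of extended complexes on representatives. -/
theorem IsMorphism.extMap_iff (hf : K.IsMorphism D f) (hK : K.IsConeComplex)
    (hD : D.IsConeComplex) {u z : X} (h : K.cone (hK.carrier u) ⊆ K.cone (hK.carrier z))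
    {e' : D.ExtPoint} : extMap K D f (hK.extPt (hK.carrier u) z h) e' ↔
      e' = hD.extPt (hD.carrier (f u)) (f z) (hf.carrier_subset hK hD h) := by
  have hmin : ∀ j, f '' K.cone (hK.carrier u) ⊆ D.cone j ↔
      D.cone (hD.carrier (f u)) ⊆ D.cone j := by
    refine fun j => ⟨fun hj => hD.carrier_subset (hj ⟨u, hK.mem_carrier u, rfl⟩), fun hj => ?_⟩
    rintro _ ⟨y, hy, rfl⟩
    exact hj (hf.mem_carrier hK hD u y hy)
  constructor
  · rintro ⟨⟨h1, h2⟩, i, x, hi, hx, j, hj, hy, hij, he, he'⟩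
    obtain ⟨τ', q'⟩ := e'
    have hτ' : τ' = hD.carrier (f u) := hD.injective (Set.Subset.antisymm
      (h2 _ ((hmin _).2 subset_rfl)) ((hmin _).1 h1))
    subst hτ'
    simp only at hj he'
    subst he'
    have hij' : ∀ y ∈ K.cone i, f y ∈ D.cone j := fun y hy => hij ⟨y, hy, rfl⟩
    -- The representative is replaced by one whose minimal cone contains that of `u`. Adding `u`
    -- changes neither the class modulo the stratum cone nor the class of the image.
    obtain ⟨w, hw, hτw, hwm, hwe⟩ := hK.exists_starMk_eq hi hx (u := u) rfl
    have hzw := (hK.extPt_eq_iff (h := h) (h' := hτw)).1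
      (congrArg (Sigma.mk (hK.carrier u)) (he.trans hwe))
    have hcw : hD.carrier (f z) = hD.carrier (f w) := hD.injective (Set.Subset.antisymm
      (hf.carrier_subset hK hD (by rw [hzw.2.1])) (hf.carrier_subset hK hD (by rw [hzw.2.1])))
    have hpull := hf.exists_pullback hK hD hij'
    rw [hD.mk_eq_extPt (hij' w hw) (hf.carrier_subset hK hD hτw), hD.extPt_eq_iff]
    · refine ⟨rfl, hcw.symm, fun n hn => ?_⟩
      rw [← hcw] at hn
      obtain ⟨m, hm, hmx⟩ := hf.exists_pullback hK hD (hf.mem_carrier hK hD z) n hn.1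
      rw [hmx z (hK.mem_carrier z), hmx w (hzw.2.1 ▸ hK.mem_carrier w)]
      refine (hzw.2.2 m ⟨hm, fun t ht => ?_⟩).symm
      rw [← hmx t (h ht)]
      exact hn.2 _ (hf.mem_carrier hK hD u t ht)
    · intro n hn
      obtain ⟨m, hm, hmx⟩ := hpull n hn.1
      have h3 : m u = 0 := by
        rw [← hmx u (hi (hK.mem_carrier u))]
        exact hn.2 _ (hD.mem_carrier _)
      rw [hmx x hx, hmx w hw, hwm m hm, h3, add_zero]
  · rintro rfl
    refine ⟨⟨(hmin _).2 subset_rfl, fun j hj => (hmin j).1 hj⟩, hK.carrier z, z, h,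
      hK.mem_carrier z, hD.carrier (f z), hf.carrier_subset hK hD h, hD.mem_carrier _, ?_, rfl, rfl⟩
    rintro _ ⟨y, hy, rfl⟩
    exact hf.mem_carrier hK hD z y hy

theorem IsMorphism.extMap_unique (hf : K.IsMorphism D f) (hK : K.IsConeComplex)
    (hD : D.IsConeComplex) {e : K.ExtPoint} {e' e'' : D.ExtPoint} (h : extMap K D f e e')
    (h' : extMap K D f e e'') : e' = e'' := by
  obtain ⟨u, z, hz, rfl⟩ := hK.exists_eq_extPt_carrier e
  rw [(hf.extMap_iff hK hD hz).1 h, (hf.extMap_iff hK hD hz).1 h']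

theorem IsMorphism.exists_pullback_ann (hf : K.IsMorphism D f) (hK : K.IsConeComplex)
    (hD : D.IsConeComplex) {u z : X} (h : K.cone (hK.carrier u) ⊆ K.cone (hK.carrier z))
    {n : Y → ℝ} (hn : n ∈ ann (D.M (hD.carrier (f z))) (D.cone (hD.carrier (f u)))) :
    ∃ m ∈ ann (K.M (hK.carrier z)) (K.cone (hK.carrier u)),
      ∀ x ∈ K.cone (hK.carrier z), n (f x) = m x := by
  obtain ⟨m, hm, hmx⟩ := hf.exists_pullback hK hD (hf.mem_carrier hK hD z) n hn.1
  refine ⟨m, ⟨hm, fun t ht => ?_⟩, hmx⟩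
  rw [← hmx t (h ht)]
  exact hn.2 _ (hf.mem_carrier hK hD u t ht)

theorem IsMorphism.extValueGroup_le (hf : K.IsMorphism D f) (hK : K.IsConeComplex)
    (hD : D.IsConeComplex) {e : K.ExtPoint} {e' : D.ExtPoint} (h : extMap K D f e e') :
    D.extValueGroup e' ≤ K.extValueGroup e := by
  obtain ⟨u, z, hz, rfl⟩ := hK.exists_eq_extPt_carrier e
  rw [(hf.extMap_iff hK hD hz).1 h, hD.extValueGroup_extPt, hK.extValueGroup_extPt]
  rintro _ ⟨n, hn, rfl⟩
  obtain ⟨m, hm, hmx⟩ := hf.exists_pullback_ann hK hD hz hn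
  exact ⟨m, hm, (hmx z (hK.mem_carrier z)).symm⟩

/-- A point has finitely many preimages of the same rank at which a weight can be nonzero. -/
theorem IsMorphism.finite_fiber (hf : K.IsMorphism D f) (hK : K.IsConeComplex)
    (hD : D.IsConeComplex) (ψ : X → ℝ) (c : ι → ℤ) (e' : D.ExtPoint) :
    {e | extMap K D f e e' ∧ Module.finrank ℤ (K.extValueGroup e) =
      Module.finrank ℤ (D.extValueGroup e') ∧ K.weightInter ψ c e ≠ 0}.Finite := by
  have := hK.finite
  choose z hz hez using hK.exists_eq_extPt
  -- There are finitely many strata and cones, so it suffices that a point of the fibre is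
  -- determined by its stratum and its minimal cone.
  refine Set.Finite.of_finite_image (f := fun e => (e.1, hK.carrier (z e))) (Set.toFinite _) ?_
  rintro e₁ ⟨h1, hr1, hw1⟩ e₂ ⟨h2, -, -⟩ he
  obtain ⟨he1, he2⟩ := Prod.mk.inj he
  obtain ⟨u, hu, -⟩ := hK.exists_carrier_eq e₁.1
  have hz1 : K.cone (hK.carrier u) ⊆ K.cone (hK.carrier (z e₁)) := by rw [hu]; exact hz e₁
  have hz2 : K.cone (hK.carrier u) ⊆ K.cone (hK.carrier (z e₂)) := by rw [hu, he1]; exact hz e₂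
  have E1 : e₁ = hK.extPt (hK.carrier u) (z e₁) hz1 :=
    (hez e₁).trans ((hK.extPt_eq_iff).2 ⟨hu.symm, rfl, fun _ _ => rfl⟩)
  have E2 : e₂ = hK.extPt (hK.carrier u) (z e₂) hz2 :=
    (hez e₂).trans ((hK.extPt_eq_iff).2 ⟨by rw [hu, he1], rfl, fun _ _ => rfl⟩)
  generalize z e₁ = z₁ at *
  generalize z e₂ = z₂ at *
  rw [E1] at h1 hr1 hw1
  rw [E2] at h2
  rw [hf.extMap_iff hK hD] at h1 h2
  rw [E1, E2, hK.extPt_eq_iff]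
  refine ⟨rfl, he2, fun m hm => ?_⟩
  have hgen : ∀ m ∈ ann (K.M (hK.carrier z₁)) (K.cone (hK.carrier u)), m z₁ = 0 → m = 0 := by
    rw [hK.weightInter_extPt] at hw1
    have h3 := (ite_ne_right_iff.1 hw1).1
    have h4 := hK.finrank_ann_add hz1
    exact (finrank_valuesAt_eq_iff (ann_fg (hK.isCone _).fg _) z₁).1 (by omega)
  have hle := hf.extValueGroup_le hK hD ((hf.extMap_iff hK hD hz1).2 h1)
  have hmz : m z₁ ∈ K.extValueGroup (hK.extPt (hK.carrier u) z₁ hz1) := by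
    rw [hK.extValueGroup_extPt]
    exact ⟨m, hm, rfl⟩
  -- Equal rank means that a multiple of every value at `z₁` comes from the target. By genericity
  -- the multiple of the function itself is a pull-back, so it agrees at two points with the same
  -- image.
  obtain ⟨N, hN, hNm⟩ := (hK.extValueGroup_fg _).exists_zsmul_mem hle hr1.symm hmz
  rw [h1, hD.extValueGroup_extPt] at hNm
  obtain ⟨n, hn, hnz⟩ := hNm
  obtain ⟨p, hp, hpx⟩ := hf.exists_pullback_ann hK hD hz1 hn
  have h5 : N • m - p = 0 := by
    refine hgen _ (sub_mem (zsmul_mem hm N) hp) ?_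
    rw [Pi.sub_apply, ← hpx z₁ (hK.mem_carrier _), Pi.smul_apply]
    exact sub_eq_zero.2 hnz.symm
  have h6 : N • m = p := sub_eq_zero.1 h5
  have h7 := (hD.extPt_eq_iff.1 (h1.symm.trans h2)).2.2 n hn
  rw [hpx z₁ (hK.mem_carrier _), hpx z₂ (he2 ▸ hK.mem_carrier z₂), ← h6, Pi.smul_apply,
    Pi.smul_apply, zsmul_eq_mul, zsmul_eq_mul] at h7
  exact mul_left_cancel₀ (by exact_mod_cast hN) h7

/-- The inclusion of the extended complex of a star on representatives. -/
theorem IsConeComplex.starIncl_iff (hK : K.IsConeComplex) {τ : ι}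
    (hS : (K.star τ).IsConeComplex) {u w : X} {hu : K.cone τ ⊆ K.cone (hK.carrier u)}
    {hw : K.cone τ ⊆ K.cone (hK.carrier w)} (huw : K.cone (hK.carrier u) ⊆ K.cone (hK.carrier w))
    {h} {e' : K.ExtPoint} :
    K.starIncl τ (hS.extPt ⟨hK.carrier u, hu⟩
      (K.starMk τ (hK.carrier w) w hw (hK.mem_carrier w)) h) e' ↔
      e' = hK.extPt (hK.carrier u) w huw := by
  have hcw := hK.star_carrier τ hw hS
  constructor
  · obtain ⟨σ, q'⟩ := e'
    rintro ⟨h1, i, x, hx, hi, hi', he, he'⟩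
    change σ = hK.carrier u at h1
    subst h1
    change K.cone (hK.carrier u) ⊆ K.cone i.1 at hi'
    have he'' : (⟨hK.carrier u, q'⟩ : K.ExtPoint) = ⟨_, K.starMk (hK.carrier u) i.1 x hi' hx⟩ :=
      congrArg (Sigma.mk _) he'
    obtain ⟨y, hy, hyc, hym, hye⟩ := hK.exists_starMk_eq hi' hx (u := u) rfl
    have hτy : K.cone τ ⊆ K.cone (hK.carrier y) := hu.trans hyc
    have e1 : hS.extPt ⟨hK.carrier u, hu⟩ (K.starMk τ (hK.carrier w) w hw (hK.mem_carrier w)) h =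
        hS.extPt ⟨hK.carrier u, hu⟩ (K.starMk τ (hK.carrier y) y hτy (hK.mem_carrier y))
          (by
            rw [hK.star_carrier τ hτy hS]
            rintro _ ⟨t, ht, rfl⟩
            exact ⟨t, hyc ht, (starMk_of_subset hyc ht).symm⟩) := by
      refine (congrArg (Sigma.mk _) he).trans (hS.mk_eq_extPt ?_ _ ?_)
      · exact ⟨y, hy, (starMk_of_subset (hK.carrier_subset hy) (hK.mem_carrier y)).symm⟩
      · rintro g ⟨hg, hg0⟩
        obtain ⟨m, hm, hgm⟩ := exists_of_mem_starM hg
        have h3 : m u = 0 := (hgm u (hi' (hK.mem_carrier u))).symm.trans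
          ((congrArg g (starMk_of_subset hi' (hK.mem_carrier u))).trans
            (hg0 _ ⟨u, hK.mem_carrier u, rfl⟩))
        refine (hgm x hx).trans (Eq.trans ?_ ((hgm y hy).symm.trans
          (congrArg g (starMk_of_subset (hK.carrier_subset hy) (hK.mem_carrier y)))))
        rw [hym m hm.1, h3, add_zero]
    obtain ⟨-, e2, e3⟩ := hS.extPt_eq_iff.1 e1
    rw [hcw, hK.star_carrier τ hτy hS] at e2
    have e4 : hK.carrier w = hK.carrier y := congrArg Subtype.val e2
    refine (he''.trans (congrArg (Sigma.mk _) hye)).trans ?_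
    refine (hK.extPt_eq_iff (h := hyc) (h' := huw)).2 ⟨rfl, e4.symm, fun m hm => ?_⟩
    rw [← e4] at hm
    obtain ⟨g, hg, hgm⟩ := hK.exists_mem_starM ⟨hK.carrier w, hw⟩
      ⟨hm.1, fun t ht => hm.2 t (hu ht)⟩
    have h4 := e3 g (by
      rw [hcw]
      refine ⟨hg, ?_⟩
      rintro _ ⟨t, ht, rfl⟩
      exact (congrArg g (starMk_of_subset huw ht)).symm.trans
        ((hgm t (huw ht)).trans (hm.2 t ht)))
    have hyw : K.cone (hK.carrier y) ⊆ K.cone (hK.carrier w) := by rw [e4]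
    exact ((hgm w (hK.mem_carrier w)).symm.trans (h4.trans ((congrArg g (starMk_of_subset hyw
      (hK.mem_carrier y))).symm.trans (hgm y (hyw (hK.mem_carrier y)))))).symm
  · rintro rfl
    refine ⟨rfl, ⟨hK.carrier w, hw⟩, w, hK.mem_carrier w, ?_, huw, ?_, rfl⟩
    · rintro _ ⟨t, ht, rfl⟩
      exact ⟨t, huw ht, (starMk_of_subset huw ht).symm⟩
    · exact (starMk_of_subset (K := K.star τ) (hj := h) (by rw [hcw]) (hS.mem_carrier _)).symm

theorem IsConeComplex.exists_eq_star_extPt (hK : K.IsConeComplex) {τ : ι}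
    (hS : (K.star τ).IsConeComplex) (e : (K.star τ).ExtPoint) :
    ∃ (u w : X) (hu : K.cone τ ⊆ K.cone (hK.carrier u)) (hw : K.cone τ ⊆ K.cone (hK.carrier w))
      (_ : K.cone (hK.carrier u) ⊆ K.cone (hK.carrier w)) (h : _),
      e = hS.extPt ⟨hK.carrier u, hu⟩ (K.starMk τ (hK.carrier w) w hw (hK.mem_carrier w)) h := by
  obtain ⟨q, hq, he⟩ := hS.exists_eq_extPt e
  obtain ⟨⟨σ, hσ⟩, e2⟩ := e
  obtain ⟨u, rfl, -⟩ := hK.exists_carrier_eq σ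
  obtain ⟨w, hw, rfl⟩ := hK.exists_eq_starMk q
  refine ⟨u, w, hσ, hw, ?_, hq, he⟩
  have h1 := hq (⟨u, hK.mem_carrier u, rfl⟩ :
    K.starMk τ (hK.carrier u) u hσ (hK.mem_carrier u) ∈ K.starCone τ ⟨hK.carrier u, hσ⟩)
  rw [hK.star_carrier τ hw hS] at h1
  exact hK.carrier_subset (hK.mem_of_starMk_mem hw h1)

/-- The functions on the star of `τ` that vanish on `σ/τ` are those on `Σ` that vanish on `σ`. So
the identification of iterated stars preserves value groups and has index one. -/
theorem IsConeComplex.extValueGroup_starIncl (hK : K.IsConeComplex) {τ : ι}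
    (hS : (K.star τ).IsConeComplex) {e : (K.star τ).ExtPoint} {e' : K.ExtPoint}
    (he : K.starIncl τ e e') : (K.star τ).extValueGroup e = K.extValueGroup e' := by
  obtain ⟨u, w, hu, hw, huw, h, rfl⟩ := hK.exists_eq_star_extPt hS e
  rw [(hK.starIncl_iff hS huw).1 he, hS.extValueGroup_extPt, hK.extValueGroup_extPt,
    hK.star_carrier τ hw hS]
  ext r
  constructor
  · rintro ⟨g, ⟨hg, hg0⟩, rfl⟩
    obtain ⟨m, hm, hgm⟩ := exists_of_mem_starM hg
    refine ⟨m, ⟨hm.1, fun t ht => ?_⟩, (hgm w (hK.mem_carrier w)).symm⟩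
    exact (hgm t (huw ht)).symm.trans
      ((congrArg g (starMk_of_subset huw ht)).trans (hg0 _ ⟨t, ht, rfl⟩))
  · rintro ⟨m, hm, rfl⟩
    obtain ⟨g, hg, hgm⟩ := hK.exists_mem_starM ⟨hK.carrier w, hw⟩
      ⟨hm.1, fun t ht => hm.2 t (hu ht)⟩
    refine ⟨g, ⟨hg, ?_⟩, hgm w (hK.mem_carrier w)⟩
    rintro _ ⟨t, ht, rfl⟩
    exact (congrArg g (starMk_of_subset huw ht)).symm.trans ((hgm t (huw ht)).trans (hm.2 t ht))

end ext

end WComplex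

theorem AddSubgroup.FG.countable {G : Type u} [AddCommGroup G] {P : AddSubgroup G} (hP : P.FG) :
    (P : Set G).Countable := by
  have := hP.moduleFinite
  have : AddGroup.FG P := (AddGroup.fg_iff_addSubgroup_fg _).2 hP
  obtain ⟨n, f, hf⟩ := Module.Finite.exists_fin' ℤ P
  exact Set.countable_coe_iff.1 hf.countable

/-- Near zero one can move away from `y`, so both `ε y` and `-ε y` are represented in the cone;
strong convexity then makes `y` a zero of every function. -/
theorem IsIntegralCone.eq_zero_of_mem_minFace_zero {X : Type v} {S : Set X}
    {M : AddSubgroup (X → ℝ)} (hS : IsIntegralCone S M) {o : X} (ho : o ∈ S)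
    (hom : ∀ m ∈ M, m o = 0) {y : X} (hy : y ∈ minFace S M o) {m : X → ℝ} (hm : m ∈ M) :
    m y = 0 := by
  obtain ⟨ε, hε, hεz⟩ := hS.exists_sub_smul ho hy
  obtain ⟨z, hz, hzm⟩ := hεz ε hε.le le_rfl
  obtain ⟨y', hy', hym⟩ := hS.exists_comb hy.1 hy.1 hε.le le_rfl
  have h1 := hS.stronglyConvex y' hy' z hz (fun n hn => by
    rw [hym n hn, hzm n hn, hom n hn]
    ring) m hm
  rw [hym m hm, zero_mul, add_zero] at h1
  exact (mul_eq_zero.1 h1).resolve_left hε.ne'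

namespace WComplex

/-! ### Zero-dimensional cones and rays -/

section ray

variable {ι : Type u} {X : Type v} {L : Type w} [AddCommGroup L] {K : WComplex ι X L}

/-- A ray is a cofacet of the minimal face of its zero, on which every function vanishes. The facet
structure thus yields a generator of its whole lattice and a primitive point in its relative
interior. -/
theorem IsConeComplex.exists_ray_data (hK : K.IsConeComplex) {ρ : ι} (hd : K.dim ρ = 1) :
    ∃ l ∈ K.M ρ, (∀ x ∈ K.cone ρ, 0 ≤ l x) ∧ (∀ m ∈ K.M ρ, ∃ n : ℤ, m = n • l) ∧
      ∃ u ∈ K.cone ρ, IsLatticePt (K.M ρ) u ∧ l u = 1 ∧ hK.carrier u = ρ := by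
  have hS := hK.isCone ρ
  obtain ⟨o, ho, hom⟩ := hS.exists_zero
  have hT : ∀ y ∈ minFace (K.cone ρ) (K.M ρ) o, ∀ m ∈ K.M ρ, m y = 0 := fun y hy m hm =>
    hS.eq_zero_of_mem_minFace_zero ho hom hy hm
  have hbot : restrictLattice (minFace (K.cone ρ) (K.M ρ) o) (K.M ρ) = ⊥ := by
    rw [AddSubgroup.eq_bot_iff_forall]
    rintro _ ⟨m, hm, rfl⟩
    funext y
    by_cases hy : y ∈ minFace (K.cone ρ) (K.M ρ) o
    · exact (Set.indicator_of_mem hy _).trans (hT y hy m hm)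
    · exact Set.indicator_of_notMem hy _
  obtain ⟨l, hl, hpos, -, hgen, u, hu, hlat, hlu⟩ :=
    hS.exists_facet_data (hS.isFaceOf_minFace ho) (by
      have h0 : Module.finrank ℤ (⊥ : AddSubgroup (X → ℝ)) = 0 :=
        Module.finrank_zero_of_subsingleton
      rw [hbot, h0]
      exact hd)
  have hgen' : ∀ m ∈ K.M ρ, ∃ n : ℤ, m = n • l := fun m hm =>
    hgen m ⟨hm, fun t ht => hT t ht m hm⟩
  refine ⟨l, hl.1, hpos, hgen', u, hu, hlat, hlu, hK.carrier_eq hu fun m hm _ hmu => ?_⟩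
  obtain ⟨n, rfl⟩ := hgen' m hm
  rw [Pi.smul_apply, hlu, zsmul_eq_mul, mul_one] at hmu
  have h2 : n = 0 := by exact_mod_cast hmu
  rw [h2, zero_smul]

/-- The smallest cone containing a zero is zero-dimensional. -/
theorem IsConeComplex.dim_carrier_eq_zero (hK : K.IsConeComplex) {o : X}
    (ho : ∀ m ∈ K.M (hK.carrier o), m o = 0) : K.dim (hK.carrier o) = 0 := by
  have h1 : K.M (hK.carrier o) = ⊥ := by
    rw [AddSubgroup.eq_bot_iff_forall]
    intro m hm
    refine (hK.isCone _).ext_of_vanish hm (zero_mem _) fun y hy => ?_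
    exact (hK.isCone _).eq_zero_of_mem_minFace_zero (hK.mem_carrier o) ho
      (by rw [hK.minFace_carrier]; exact hy) hm
  unfold dim
  rw [h1]
  exact Module.finrank_zero_of_subsingleton

theorem IsConeComplex.exists_zero_cone (hK : K.IsConeComplex) (i : ι) :
    ∃ τ, K.dim τ = 0 ∧ K.cone τ ⊆ K.cone i := by
  obtain ⟨o, ho, hom⟩ := (hK.isCone i).exists_zero
  refine ⟨hK.carrier o, hK.dim_carrier_eq_zero fun m hm => ?_, hK.carrier_subset ho⟩
  rw [hK.M_of_subset (hK.carrier_subset ho)] at hm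
  obtain ⟨n, hn, hmn⟩ := exists_of_mem_restrictLattice hm
  rw [hmn o (hK.mem_carrier o), hom n hn]

theorem IsConeComplex.eq_of_dim_eq_zero (hK : K.IsConeComplex) {τ τ' i : ι} (hd : K.dim τ = 0)
    (hd' : K.dim τ' = 0) (h : K.cone τ ⊆ K.cone i) (h' : K.cone τ' ⊆ K.cone i) : τ = τ' := by
  obtain ⟨o, ho, -⟩ := (hK.isCone τ').exists_zero
  refine hK.eq_of_subset_of_dim_le (i := τ') ?_ (by omega)
  exact (hK.subset_carrier_of_dim_eq_zero hd h (h' ho)).trans (hK.carrier_subset ho)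

/-- The slope does not depend on the chosen point: a lattice point at which some function is 1 has
value 1 under the positive generator, since that value is a non-negative unit. -/
theorem IsConeComplex.raySlope_eq (hK : K.IsConeComplex) {ρ : ι} (hd : K.dim ρ = 1) {ψ : X → ℝ}
    (hψ : K.IsDivisor ψ) {x : X} (hx : x ∈ K.cone ρ) (hlat : IsLatticePt (K.M ρ) x)
    (h1 : ∃ m ∈ K.M ρ, m x = 1) : (K.raySlope ψ ρ : ℝ) = ψ x := by
  obtain ⟨p, hp, hpψ⟩ := hψ ρ
  obtain ⟨k, hk⟩ := hlat p hp
  obtain ⟨l, hl, hpos, hgen, -⟩ := hK.exists_ray_data hd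
  have hone : ∀ y ∈ K.cone ρ, IsLatticePt (K.M ρ) y → (∃ m ∈ K.M ρ, m y = 1) → l y = 1 := by
    rintro y hy hylat ⟨m, hm, hmy⟩
    obtain ⟨n, rfl⟩ := hgen m hm
    obtain ⟨a, ha⟩ := hylat l hl
    have h0 := hpos y hy
    rw [Pi.smul_apply, zsmul_eq_mul, ha] at hmy
    rw [ha] at h0 ⊢
    have h2 : n * a = 1 := by exact_mod_cast hmy
    have h3 : 0 ≤ a := by exact_mod_cast h0
    rcases Int.isUnit_iff.1 (IsUnit.of_mul_eq_one_right n h2) with h4 | h4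
    · rw [h4, Int.cast_one]
    · omega
  obtain ⟨y, hy, hylat, hy1, hyψ⟩ := Classical.epsilon_spec (p := fun n : ℤ =>
    ∃ x ∈ K.cone ρ, (∀ m ∈ K.M ρ, ∃ k : ℤ, m x = k) ∧ (∃ m ∈ K.M ρ, m x = 1) ∧ ψ x = (n : ℝ))
    ⟨k, x, hx, hlat, h1, by rw [hpψ x hx, hk]⟩
  obtain ⟨n, rfl⟩ := hgen p hp
  change ψ y = (K.raySlope ψ ρ : ℝ) at hyψ
  rw [← hyψ, hpψ y hy, hpψ x hx, Pi.smul_apply, Pi.smul_apply, hone y hy hylat hy1,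
    hone x hx hlat h1]

/-- At a generic point of a ray's star the intersection weight is given by the class of the
weight. -/
theorem IsConeComplex.weightInter_eq_mul (hK : K.IsConeComplex) (ψ : X → ℝ) (c : ι → ℤ) {ρ : ι}
    {z : X} {h} (hd : K.dim ρ = 1) (hr : Module.finrank ℤ (K.valueGroup z) =
      Module.finrank ℤ (K.extValueGroup (hK.extPt ρ z h)) + 1) :
    K.weightInter ψ c (hK.extPt ρ z h) = K.raySlope ψ ρ * K.weightClass c z := by
  rw [hK.weightInter_extPt, hK.weightClass_eq, hr, hK.extValueGroup_extPt]
  simp only [hd, true_and]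
  split_ifs
  · rfl
  · rw [mul_zero]

end ray

/-! ### Comparison of the strata of a common ray -/

section subdivision

variable {ι : Type u} {X : Type v} {L : Type w} [AddCommGroup L] {K₀ : WComplex ι X L}
  {κ₁ : Type u'} {κ₂ : Type v'} {K₁ : WComplex κ₁ X L} {K₂ : WComplex κ₂ X L}

theorem M_eq_of_cone_eq (hK₀ : K₀.IsConeComplex) (h₁ : K₁.IsProperSubdivision K₀)
    (h₂ : K₂.IsProperSubdivision K₀) {ρ₁ : κ₁} {ρ₂ : κ₂} (h : K₁.cone ρ₁ = K₂.cone ρ₂) :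
    K₁.M ρ₁ = K₂.M ρ₂ := by
  obtain ⟨u, rfl, -⟩ := h₁.1.exists_carrier_eq ρ₁
  obtain ⟨h3, h4⟩ := M_carrier_of_isProperSubdivision hK₀ h₁ u
  obtain ⟨i, hi, hM⟩ := h₂.2.2 ρ₂
  have hui : u ∈ K₀.cone i := hi (h ▸ h₁.1.mem_carrier u)
  rw [h4, hM, ← h, hK₀.M_of_subset (hK₀.carrier_subset hui), restrictLattice_restrictLattice h3]

theorem exists_M_subdivision (hK₀ : K₀.IsConeComplex) (h₁ : K₁.IsProperSubdivision K₀) {z : X}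
    {m : X → ℝ} (hm : m ∈ K₁.M (h₁.1.carrier z)) : ∃ n ∈ K₀.M (hK₀.carrier z),
      ∀ x ∈ K₁.cone (h₁.1.carrier z), m x = n x := by
  rw [(M_carrier_of_isProperSubdivision hK₀ h₁ z).2] at hm
  exact exists_of_mem_restrictLattice hm

theorem exists_M_of_subdivision (hK₀ : K₀.IsConeComplex) (h₁ : K₁.IsProperSubdivision K₀) {z : X}
    {n : X → ℝ} (hn : n ∈ K₀.M (hK₀.carrier z)) : ∃ m ∈ K₁.M (h₁.1.carrier z),
      ∀ x ∈ K₁.cone (h₁.1.carrier z), m x = n x := by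
  rw [(M_carrier_of_isProperSubdivision hK₀ h₁ z).2]
  exact exists_restrict hn _

theorem extValueGroup_subdivision (hK₀ : K₀.IsConeComplex) (h₁ : K₁.IsProperSubdivision K₀)
    {ρ : κ₁} {z : X} {h} : K₁.extValueGroup (h₁.1.extPt ρ z h) =
      valuesAt (ann (K₀.M (hK₀.carrier z)) (K₁.cone ρ)) z := by
  rw [h₁.1.extValueGroup_extPt]
  ext r
  constructor
  · rintro ⟨m, hm, rfl⟩
    obtain ⟨n, hn, hmn⟩ := exists_M_subdivision hK₀ h₁ hm.1
    exact ⟨n, ⟨hn, fun t ht => by rw [← hmn t (h ht), hm.2 t ht]⟩, (hmn z (h₁.1.mem_carrier z)).symm⟩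
  · rintro ⟨n, hn, rfl⟩
    obtain ⟨m, hm, hmn⟩ := exists_M_of_subdivision hK₀ h₁ hn.1
    exact ⟨m, ⟨hm, fun t ht => by rw [hmn t (h ht), hn.2 t ht]⟩, hmn z (h₁.1.mem_carrier z)⟩

/-- A ray of a subdivision is determined by a point on it. -/
theorem cone_eq_of_dim_eq_one (hK₀ : K₀.IsConeComplex) (h₁ : K₁.IsProperSubdivision K₀) {u : X}
    (hd : K₁.dim (h₁.1.carrier u) = 1) : K₁.cone (h₁.1.carrier u) =
      {y | y ∈ K₀.cone (hK₀.carrier u) ∧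
        ∃ t : ℝ, 0 ≤ t ∧ ∀ m ∈ K₀.M (hK₀.carrier u), m y = t * m u} := by
  have hu := h₁.1.mem_carrier u
  have hsub := (M_carrier_of_isProperSubdivision hK₀ h₁ u).1
  obtain ⟨l, hl, hpos, hgen, v, hv, -, hlv, -⟩ := h₁.1.exists_ray_data hd
  ext y
  constructor
  · intro hy
    refine ⟨hsub hy, l y / l u, div_nonneg (hpos y hy) (hpos u hu), fun m hm => ?_⟩
    have hlu : l u ≠ 0 := by
      intro h0
      have := h₁.1.eq_zero_of_carrier hl hpos h0
      simp [this] at hlv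
    obtain ⟨g, hg, hgm⟩ := exists_M_of_subdivision hK₀ h₁ hm
    obtain ⟨n, rfl⟩ := hgen g hg
    rw [← hgm y hy, ← hgm u hu, Pi.smul_apply, Pi.smul_apply, zsmul_eq_mul, zsmul_eq_mul]
    field_simp
  · rintro ⟨hy, t, ht, hyt⟩
    obtain ⟨w, hw, hwm⟩ := (h₁.1.isCone (h₁.1.carrier u)).exists_comb hu hu ht le_rfl
    have : y = w := by
      refine (hK₀.isCone _).injOn y hy w (hsub hw) fun m hm => ?_
      obtain ⟨g, hg, hgm⟩ := exists_M_of_subdivision hK₀ h₁ hm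
      rw [hyt m hm, ← hgm w hw, hwm g hg, hgm u hu]
      ring
    rwa [this]

/-- Adding a multiple of `u ∈ ρ` changes nothing modulo `ρ`. The minimal cone in the subdivision is
also unchanged: that of `z'` contains `u` and hence `z`, and conversely `z'` is a summand of `z`. -/
theorem extPt_eq_of_shift (hK₀ : K₀.IsConeComplex) (h₂ : K₂.IsProperSubdivision K₀) {ρ : κ₂}
    {u z z' : X} (hu : u ∈ K₂.cone ρ) {h h'} (hc : hK₀.carrier z = hK₀.carrier z') {a : ℝ}
    (ha : 0 ≤ a) (hz : ∀ m ∈ K₀.M (hK₀.carrier z), m z = m z' + a * m u) :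
    h₂.1.extPt ρ z h = h₂.1.extPt ρ z' h' := by
  have hK₂ := h₂.1
  have hsub := (M_carrier_of_isProperSubdivision hK₀ h₂ z').1
  have hz'k := h₂.1.mem_carrier z'
  have huk := h' hu
  have hM : ∀ m ∈ K₂.M (h₂.1.carrier z'), ∃ n ∈ K₀.M (hK₀.carrier z),
      ∀ x ∈ K₂.cone (h₂.1.carrier z'), m x = n x := by
    rw [hc]
    exact fun m hm => exists_M_subdivision hK₀ h₂ hm
  have hzk : z ∈ K₂.cone (h₂.1.carrier z') := by
    obtain ⟨w, hw, hwm⟩ := (h₂.1.isCone (h₂.1.carrier z')).exists_comb hz'k huk zero_le_one ha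
    have : z = w := by
      refine (hK₀.isCone _).injOn z (hK₀.mem_carrier z) w (hc ▸ hsub hw) fun n hn => ?_
      have hn' := hn
      rw [hc] at hn'
      obtain ⟨m, hm, hmn⟩ := exists_M_of_subdivision hK₀ h₂ hn'
      rw [hz n hn, ← hmn w hw, hwm m hm, hmn _ hz'k, hmn _ huk, one_mul]
    rwa [this]
  have hzk' := h₂.1.carrier_subset hzk
  have hz'z : z' ∈ K₂.cone (h₂.1.carrier z) := by
    rcases ha.eq_or_lt with rfl | ha
    · have : z' = z := by
        refine (hK₀.isCone (hK₀.carrier z)).injOn z' (hc ▸ hK₀.mem_carrier z') z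
          (hK₀.mem_carrier z) fun n hn => ?_
        rw [hz n hn, zero_mul, add_zero]
      rw [this]
      exact h₂.1.mem_carrier z
    · refine (h₂.1.mem_of_comb hzk' hz'k huk (h₂.1.mem_carrier z) one_pos ha fun m hm => ?_).1
      obtain ⟨n, hn, hmn⟩ := hM m hm
      rw [hmn z hzk, hmn _ hz'k, hmn _ huk, hz n hn, one_mul]
  have hcc : h₂.1.carrier z = h₂.1.carrier z' := h₂.1.injective
    (Set.Subset.antisymm hzk' (h₂.1.carrier_subset hz'z))
  refine h₂.1.extPt_eq_iff.2 ⟨rfl, hcc, fun m hm => ?_⟩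
  rw [hcc] at hm
  obtain ⟨n, hn, hmn⟩ := hM m hm.1
  have h3 : n u = 0 := by rw [← hmn u huk, hm.2 u hu]
  rw [hmn z hzk, hmn z' hz'k, hz n hn, h3, mul_zero, add_zero]

theorem carrier_eq_of_subdivision (hK₀ : K₀.IsConeComplex) (h₁ : K₁.IsProperSubdivision K₀)
    {z z' : X} (h : h₁.1.carrier z = h₁.1.carrier z') : hK₀.carrier z = hK₀.carrier z' := by
  refine hK₀.injective (Set.Subset.antisymm (hK₀.carrier_subset ?_) (hK₀.carrier_subset ?_))
  · exact (M_carrier_of_isProperSubdivision hK₀ h₁ z').1 (h ▸ h₁.1.mem_carrier z)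
  · exact (M_carrier_of_isProperSubdivision hK₀ h₁ z).1 (h ▸ h₁.1.mem_carrier z')

/-- Points with the same class modulo a ray differ by a real multiple of its generator, a condition
that does not mention the subdivision. Depending on the sign of the multiple, one point is a shift
of the other. -/
theorem extPt_eq_of_extPt_eq (hK₀ : K₀.IsConeComplex) (h₁ : K₁.IsProperSubdivision K₀)
    (h₂ : K₂.IsProperSubdivision K₀) {ρ₁ : κ₁} {ρ₂ : κ₂} (hd : K₁.dim ρ₁ = 1)
    (hρ : K₁.cone ρ₁ = K₂.cone ρ₂) {z z' : X} {k k' h h'}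
    (he : h₁.1.extPt ρ₁ z k = h₁.1.extPt ρ₁ z' k') :
    h₂.1.extPt ρ₂ z h = h₂.1.extPt ρ₂ z' h' := by
  obtain ⟨-, hc, hm⟩ := h₁.1.extPt_eq_iff.1 he
  have hc₀ := carrier_eq_of_subdivision hK₀ h₁ hc
  obtain ⟨l, hl, -, hgen, u, hu, -, hlu, -⟩ := h₁.1.exists_ray_data hd
  rw [h₁.1.M_of_subset k] at hl
  obtain ⟨p, hp, hlp⟩ := exists_of_mem_restrictLattice hl
  have key : ∀ n ∈ K₀.M (hK₀.carrier z), n z - n z' = (p z - p z') * n u := by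
    intro n hn
    obtain ⟨g, hg, hgn⟩ := exists_M_of_subdivision hK₀ h₁ hn
    obtain ⟨g', hg', hgg⟩ := exists_restrict hg (K₁.cone ρ₁)
    rw [← h₁.1.M_of_subset k] at hg'
    obtain ⟨a, rfl⟩ := hgen g' hg'
    have h3 : ∀ t ∈ K₁.cone ρ₁, g t = a * p t := fun t ht => by
      rw [← hgg t ht, Pi.smul_apply, zsmul_eq_mul, hlp t ht]
    have h4 := hm (g - a • p) ⟨sub_mem hg (zsmul_mem hp a), fun t ht => by
      rw [Pi.sub_apply, Pi.smul_apply, zsmul_eq_mul, h3 t ht, sub_self]⟩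
    have h5 : n u = a := by rw [← hgn u (k hu), h3 u hu, ← hlp u hu, hlu, mul_one]
    rw [Pi.sub_apply, Pi.sub_apply, Pi.smul_apply, Pi.smul_apply, zsmul_eq_mul, zsmul_eq_mul,
      hgn z (h₁.1.mem_carrier z), hgn z' (hc ▸ h₁.1.mem_carrier z')] at h4
    rw [h5]
    linarith
  rcases le_total 0 (p z - p z') with ha | ha
  · exact extPt_eq_of_shift hK₀ h₂ (hρ ▸ hu) hc₀ ha fun n hn => by linarith [key n hn]
  · refine (extPt_eq_of_shift hK₀ h₂ (hρ ▸ hu) hc₀.symm (a := p z' - p z) (by linarith)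
      fun n hn => ?_).symm
    rw [← hc₀] at hn
    linarith [key n hn]

end subdivision

end WComplex

namespace WComplex

/-! ### Independence of the intersection product from the subdivision -/

section ends

variable {ι : Type u} {X : Type v} {L : Type w} [AddCommGroup L] {K₀ : WComplex ι X L}
  {κ₁ : Type u'} {κ₂ : Type v'} {K₁ : WComplex κ₁ X L} {K₂ : WComplex κ₂ X L}
  {κ : Type*} {Y : Type*} {L' : Type*} [AddCommGroup L'] {D : WComplex κ Y L'} {f : X → Y}

/-- Points of the strata of the same ray in two subdivisions which are defined by the same generic
point. -/
def EndRel (K₀ : WComplex ι X L) (hK₁ : K₁.IsConeComplex) (hK₂ : K₂.IsConeComplex)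
    (e₁ : K₁.ExtPoint) (e₂ : K₂.ExtPoint) : Prop :=
  ∃ ρ₁ ρ₂ z h₁ h₂, e₁ = hK₁.extPt ρ₁ z h₁ ∧ e₂ = hK₂.extPt ρ₂ z h₂ ∧ K₁.cone ρ₁ = K₂.cone ρ₂ ∧
    K₁.dim ρ₁ = 1 ∧
    Module.finrank ℤ (K₀.valueGroup z) = Module.finrank ℤ (K₁.extValueGroup e₁) + 1

theorem exists_unbounded_fiber {S : Set ℝ} (hS : ∀ N : ℝ, ∃ s ∈ S, N < s) [Finite κ] (F : ℝ → κ) :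
    ∃ k, ∀ N : ℝ, ∃ s ∈ S, N < s ∧ F s = k := by
  choose g hg hgN using fun n : ℕ => hS n
  obtain ⟨k, hk⟩ := Finite.exists_infinite_fiber fun n => F (g n)
  refine ⟨k, fun N => ?_⟩
  obtain ⟨a, ha⟩ := exists_nat_gt N
  obtain ⟨n, hn, han⟩ := (Set.infinite_coe_iff.1 hk).exists_gt a
  exact ⟨g n, hg n, lt_trans ha (lt_trans (by exact_mod_cast han) (hgN n)), hn⟩

/-- Moving from `x` along `x + s u` does not change its class in the star of the ray of `u`. Generic
points of this half-line at arbitrarily large `s` meet a single cone of the second subdivision, and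
this cone contains the direction `u`. The weight class is nonzero there, so the cone has the right
dimension. If `u` were interior to a cone of dimension above one, the image in `D` would have too
small a rank; so the ray belongs to both subdivisions. -/
theorem exists_endRel (hK₀ : K₀.IsConeComplex) (h₁ : K₁.IsProperSubdivision K₀)
    (h₂ : K₂.IsProperSubdivision K₀) (hD : D.IsConeComplex) (hf : K₀.IsMorphism D f) {ψ : X → ℝ}
    {c₁ : κ₁ → ℤ} {c₂ : κ₂ → ℤ} (hc : K₁.weightClass c₁ = K₂.weightClass c₂) {e : D.ExtPoint}
    {e₁ : K₁.ExtPoint} (he : extMap K₁ D f e₁ e)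
    (hr : Module.finrank ℤ (K₁.extValueGroup e₁) = Module.finrank ℤ (D.extValueGroup e))
    (hw : K₁.weightInter ψ c₁ e₁ ≠ 0) : ∃ e₂, EndRel K₀ h₁.1 h₂.1 e₁ e₂ := by
  have hK₁ := h₁.1
  have hK₂ := h₂.1
  have := hK₂.finite
  obtain ⟨ρ, x, hx, he₁⟩ : ∃ ρ x h, e₁ = hK₁.extPt ρ x h := ⟨_, hK₁.exists_eq_extPt e₁⟩
  have hw' := hw
  rw [he₁, hK₁.weightInter_extPt] at hw
  obtain ⟨⟨hd, hrk⟩, hc1⟩ := ite_ne_right_iff.1 hw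
  obtain ⟨l, hl, -, hgen, u, hu, -, hlu, hcu⟩ := hK₁.exists_ray_data hd
  set k₁ := hK₁.carrier x with hk₁
  have hxk : x ∈ K₁.cone k₁ := hK₁.mem_carrier x
  have huk : u ∈ K₁.cone k₁ := hx hu
  obtain ⟨hsub₁, -⟩ := M_carrier_of_isProperSubdivision hK₀ h₁ x
  set i₀ := hK₀.carrier x with hi₀
  have hxi : x ∈ K₀.cone i₀ := hK₀.mem_carrier x
  have hui : u ∈ K₀.cone i₀ := hsub₁ huk
  -- the points `x + s u`
  have hz : ∀ s : ℝ, ∃ z, 0 ≤ s → z ∈ K₁.cone k₁ ∧ ∀ m ∈ K₁.M k₁, m z = m x + s * m u := by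
    intro s
    by_cases hs : 0 ≤ s
    · obtain ⟨z, hz, hzm⟩ := (hK₁.isCone k₁).exists_comb hxk huk zero_le_one hs
      exact ⟨z, fun _ => ⟨hz, fun m hm => by rw [hzm m hm, one_mul]⟩⟩
    · exact ⟨x, fun h => absurd h hs⟩
  choose z hz using hz
  have hzk : ∀ {s}, 0 ≤ s → z s ∈ K₁.cone k₁ := fun hs => (hz _ hs).1
  have hzm : ∀ {s}, 0 ≤ s → ∀ m ∈ K₁.M k₁, m (z s) = m x + s * m u := fun hs => (hz _ hs).2
  have hzn : ∀ {s}, 0 ≤ s → ∀ n ∈ K₀.M i₀, n (z s) = n x + s * n u := by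
    intro s hs n hn
    obtain ⟨m, hm, hmn⟩ := exists_M_of_subdivision hK₀ h₁ hn
    rw [← hmn _ (hzk hs), hzm hs m hm, hmn x hxk, hmn u huk]
  have hzc : ∀ {s}, 0 ≤ s → hK₁.carrier (z s) = k₁ := by
    intro s hs
    refine hK₁.carrier_eq (hzk hs) fun m hm hpos hmz => hK₁.eq_zero_of_carrier hm hpos ?_
    rw [hzm hs m hm] at hmz
    have h1 := hpos x hxk
    have h2 := mul_nonneg hs (hpos u huk)
    linarith
  have hzc₀ : ∀ {s}, 0 ≤ s → hK₀.carrier (z s) = i₀ := fun hs =>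
    carrier_eq_of_subdivision hK₀ h₁ (hzc hs)
  -- the value of `m` at `u` determines the restriction of `m` to the ray
  have hann : ∀ m ∈ K₁.M k₁, m u = 0 → m ∈ ann (K₁.M k₁) (K₁.cone ρ) := by
    intro m hm hmu
    refine ⟨hm, fun t ht => ?_⟩
    obtain ⟨g, hg, hgm⟩ := exists_restrict hm (K₁.cone ρ)
    rw [← hK₁.M_of_subset hx] at hg
    obtain ⟨n, rfl⟩ := hgen g hg
    rw [← hgm u hu, Pi.smul_apply, hlu, zsmul_eq_mul, mul_one] at hmu
    rw [← hgm t ht, Pi.smul_apply, zsmul_eq_mul, hmu, zero_mul]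
  have hgenx : ∀ m ∈ ann (K₁.M k₁) (K₁.cone ρ), m x = 0 → m = 0 := by
    have h4 := hK₁.finrank_ann_add hx
    exact (finrank_valuesAt_eq_iff (ann_fg (hK₁.isCone _).fg _) x).1 (by omega)
  -- The parameters `s` at which some lattice function not vanishing at `u` vanishes at `x + s u`.
  -- They form a countable set, and outside it the point is generic.
  set B : Set ℝ := (fun m : X → ℝ => -m x / m u) '' (K₁.M k₁ : Set (X → ℝ)) with hB
  have hBc : B.Countable := (hK₁.isCone k₁).fg.countable.image _
  have hgenz : ∀ {s}, 0 ≤ s → s ∉ B →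
      Module.finrank ℤ (K₀.valueGroup (z s)) = K₁.dim k₁ := by
    intro s hs hsB
    rw [← valueGroup_of_isProperSubdivision hK₀ h₁, hK₁.finrank_valueGroup_eq_iff (hzk hs)]
    intro m hm hmz
    rw [hzm hs m hm] at hmz
    by_cases hmu : m u = 0
    · exact hgenx m (hann m hm hmu) (by rw [hmu] at hmz; linarith)
    · refine absurd ⟨m, hm, ?_⟩ hsB
      simp only
      rw [div_eq_iff hmu]
      linarith
  have hS : ∀ N : ℝ, ∃ s ∈ {s | 0 ≤ s ∧ s ∉ B}, N < s := by
    intro N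
    obtain ⟨s, hs, hs1⟩ := (hBc.dense_compl ℝ).exists_between
      (show max N 0 < max N 0 + 1 by linarith)
    exact ⟨s, ⟨le_trans (le_max_right N 0) hs1.1.le, hs⟩, lt_of_le_of_lt (le_max_left N 0) hs1.1⟩
  obtain ⟨k₂, hk₂⟩ := exists_unbounded_fiber hS fun s => hK₂.carrier (z s)
  obtain ⟨s, ⟨hs, hsB⟩, -, hsk⟩ := hk₂ 0
  obtain ⟨s', ⟨hs', -⟩, hss', hsk'⟩ := hk₂ s
  have hk₂i : K₂.cone k₂ ⊆ K₀.cone i₀ := by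
    have := (M_carrier_of_isProperSubdivision hK₀ h₂ (z s)).1
    rwa [hsk, hzc₀ hs] at this
  have hM₂ : ∀ m ∈ K₂.M k₂, ∃ n ∈ K₀.M i₀, ∀ x ∈ K₂.cone k₂, m x = n x := by
    have : ∀ m ∈ K₂.M (hK₂.carrier (z s)), ∃ n ∈ K₀.M (hK₀.carrier (z s)),
        ∀ x ∈ K₂.cone (hK₂.carrier (z s)), m x = n x := fun m hm => exists_M_subdivision hK₀ h₂ hm
    rwa [hsk, hzc₀ hs] at this
  have hM₀ : ∀ n ∈ K₀.M i₀, ∃ m ∈ K₂.M k₂, ∀ x ∈ K₂.cone k₂, m x = n x := by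
    have : ∀ n ∈ K₀.M (hK₀.carrier (z s)), ∃ m ∈ K₂.M (hK₂.carrier (z s)),
        ∀ x ∈ K₂.cone (hK₂.carrier (z s)), m x = n x :=
      fun n hn => exists_M_of_subdivision hK₀ h₂ hn
    rwa [hsk, hzc₀ hs] at this
  have hz₂ : z s ∈ K₂.cone k₂ := hsk ▸ hK₂.mem_carrier (z s)
  have hz₂' : z s' ∈ K₂.cone k₂ := hsk' ▸ hK₂.mem_carrier (z s')
  -- `u` is a real combination of two points of the half-line in this cone. An inequality of the
  -- cone that failed at `u` would also fail at points of the half-line far out, some of which lie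
  -- in the cone.
  have huk₂ : u ∈ K₂.cone k₂ := by
    have hne : s' - s ≠ 0 := by linarith
    have hcomb : ∀ n ∈ K₀.M i₀, -(s' - s)⁻¹ * n (z s) + (s' - s)⁻¹ * n (z s') = n u := by
      intro n hn
      rw [hzn hs n hn, hzn hs' n hn]
      field_simp
      ring
    obtain ⟨w, hw, hwm⟩ := (hK₂.isCone k₂).exists_real_comb (z s) (z s') (-(s' - s)⁻¹) (s' - s)⁻¹
      (by
        intro m hm hpos
        obtain ⟨n, hn, hmn⟩ := hM₂ m hm
        rw [hmn _ hz₂, hmn _ hz₂', hcomb n hn]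
        by_contra! hneg
        obtain ⟨r, ⟨hr0, -⟩, hrN, hrk⟩ := hk₂ (n x / -n u)
        have h1 : z r ∈ K₂.cone k₂ := hrk ▸ hK₂.mem_carrier (z r)
        have h2 := hpos _ h1
        rw [hmn _ h1, hzn hr0 n hn] at h2
        rw [div_lt_iff₀ (by linarith)] at hrN
        linarith)
    have : u = w := by
      refine (hK₀.isCone i₀).injOn u hui w (hk₂i hw) fun n hn => ?_
      obtain ⟨m, hm, hmn⟩ := hM₀ n hn
      rw [← hcomb n hn, ← hmn w hw, hwm m hm, hmn _ hz₂, hmn _ hz₂']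
    rwa [this]
  have hρ₂ := hK₂.carrier_subset huk₂
  have hdimk₂ : K₂.dim k₂ = K₁.dim k₁ := by
    have h1 : K₁.weightClass c₁ (z s) ≠ 0 := by
      rw [hK₁.weightClass_eq, hzc hs, valueGroup_of_isProperSubdivision hK₀ h₁,
        if_pos (hgenz hs hsB)]
      exact right_ne_zero_of_mul hc1
    rw [hc, hK₂.weightClass_eq, hsk, valueGroup_of_isProperSubdivision hK₀ h₂] at h1
    rw [← (ite_ne_right_iff.1 h1).1, hgenz hs hsB]
  have hui₀ : K₀.cone (hK₀.carrier u) ⊆ K₀.cone i₀ := hK₀.carrier_subset hui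
  have hρ₂sub := (M_carrier_of_isProperSubdivision hK₀ h₂ u).1
  -- Target functions vanishing on the stratum cone pull back to functions vanishing on the minimal
  -- cone of `u` in the second subdivision. If its dimension exceeded one, their values would have
  -- rank smaller than that of the stratum of `e₁`.
  have hdρ₂ : K₂.dim (hK₂.carrier u) = 1 := by
    apply le_antisymm
    · have h1 := hK₂.finrank_ann_add hρ₂
      have hf₁ : K₁.IsMorphism D f := hf.comp (isMorphism_id_of_isProperSubdivision h₁)
      have h2 : D.extValueGroup e ≤ valuesAt (ann (K₂.M k₂) (K₂.cone (hK₂.carrier u))) (z s) := by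
        have hx' : K₁.cone (hK₁.carrier u) ⊆ K₁.cone (hK₁.carrier x) := by
          rw [hcu]
          exact hx
        have h3 : e₁ = hK₁.extPt (hK₁.carrier u) x hx' :=
          he₁.trans (hK₁.extPt_eq_iff.2 ⟨hcu.symm, rfl, fun _ _ => rfl⟩)
        rw [h3, hf₁.extMap_iff hK₁ hD] at he
        rw [he, hD.extValueGroup_extPt]
        rintro _ ⟨n, hn, rfl⟩
        obtain ⟨m, hm, hmn⟩ := hf.exists_pullback_ann hK₀ hD hui₀ hn
        obtain ⟨g, hg, hgm⟩ := hM₀ m hm.1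
        refine ⟨g, ⟨hg, fun t ht => ?_⟩, ?_⟩
        · rw [hgm t (hρ₂ ht), hm.2 t (hρ₂sub ht)]
        · change g (z s) = n (f x)
          rw [hgm _ hz₂, hzn hs m hm.1, hm.2 u (hK₀.mem_carrier u), mul_zero, add_zero, hmn x hxi]
      have hfg := ann_fg (hK₂.isCone k₂).fg (K₂.cone (hK₂.carrier u))
      have h4 := (valuesAt_fg hfg (z s)).finrank_mono h2
      have h5 := finrank_valuesAt_le hfg (z s)
      rw [← hr, he₁, hK₁.extValueGroup_extPt, ← hk₁] at h4
      omega
    · by_contra! h0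
      have h1 := (hK₂.isCone (hK₂.carrier u)).fg.eq_bot_of_finrank_eq_zero (by
        change K₂.dim (hK₂.carrier u) = 0
        omega)
      rw [hK₁.M_of_subset hx] at hl
      obtain ⟨p, hp, hlp⟩ := exists_of_mem_restrictLattice hl
      obtain ⟨n, hn, hpn⟩ := exists_M_subdivision hK₀ h₁ hp
      obtain ⟨m, hm, hmn⟩ := hM₀ n hn
      obtain ⟨g, hg, hgm⟩ := exists_restrict hm (K₂.cone (hK₂.carrier u))
      rw [← hK₂.M_of_subset hρ₂, h1, AddSubgroup.mem_bot] at hg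
      have h2 := hgm u (hK₂.mem_carrier u)
      rw [hg, Pi.zero_apply, hmn u huk₂, ← hpn u huk, ← hlp u hu, hlu] at h2
      exact zero_ne_one h2
  have hcone : K₁.cone ρ = K₂.cone (hK₂.carrier u) := by
    rw [cone_eq_of_dim_eq_one hK₀ h₂ hdρ₂, ← cone_eq_of_dim_eq_one hK₀ h₁ (by rw [hcu]; exact hd),
      hcu]
  have hρz : K₁.cone ρ ⊆ K₁.cone (hK₁.carrier (z s)) := by rw [hzc hs]; exact hx
  refine ⟨hK₂.extPt (hK₂.carrier u) (z s) (by rw [hsk]; exact hρ₂), ρ, hK₂.carrier u, z s, hρz, _,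
    ?_, rfl, hcone, hd, ?_⟩
  · refine he₁.trans (hK₁.extPt_eq_iff.2 ⟨rfl, (hzc hs).symm, fun m hm => ?_⟩)
    rw [hzm hs m hm.1, hm.2 u hu, mul_zero, add_zero]
  · rw [hgenz hs hsB, ← hrk, he₁, hK₁.extValueGroup_extPt]

theorem EndRel.extValueGroup_eq (hK₀ : K₀.IsConeComplex) (h₁ : K₁.IsProperSubdivision K₀)
    (h₂ : K₂.IsProperSubdivision K₀) {e₁ : K₁.ExtPoint} {e₂ : K₂.ExtPoint}
    (h : EndRel K₀ h₁.1 h₂.1 e₁ e₂) : K₁.extValueGroup e₁ = K₂.extValueGroup e₂ := by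
  obtain ⟨ρ₁, ρ₂, z, k₁, k₂, rfl, rfl, hρ, -, -⟩ := h
  rw [extValueGroup_subdivision hK₀ h₁, extValueGroup_subdivision hK₀ h₂, hρ]

theorem EndRel.symm (hK₀ : K₀.IsConeComplex) (h₁ : K₁.IsProperSubdivision K₀)
    (h₂ : K₂.IsProperSubdivision K₀) {e₁ : K₁.ExtPoint} {e₂ : K₂.ExtPoint}
    (h : EndRel K₀ h₁.1 h₂.1 e₁ e₂) : EndRel K₀ h₂.1 h₁.1 e₂ e₁ := by
  have hV := h.extValueGroup_eq hK₀ h₁ h₂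
  obtain ⟨ρ₁, ρ₂, z, k₁, k₂, he₁, he₂, hρ, hd, hr⟩ := h
  refine ⟨ρ₂, ρ₁, z, k₂, k₁, he₂, he₁, hρ.symm, ?_, by rw [← hV]; exact hr⟩
  unfold dim at hd ⊢
  rwa [← M_eq_of_cone_eq hK₀ h₁ h₂ hρ]

theorem EndRel.unique (hK₀ : K₀.IsConeComplex) (h₁ : K₁.IsProperSubdivision K₀)
    (h₂ : K₂.IsProperSubdivision K₀) {e₁ : K₁.ExtPoint} {e₂ e₂' : K₂.ExtPoint}
    (h : EndRel K₀ h₁.1 h₂.1 e₁ e₂) (h' : EndRel K₀ h₁.1 h₂.1 e₁ e₂') : e₂ = e₂' := by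
  obtain ⟨ρ₁, ρ₂, z, k₁, k₂, rfl, rfl, hρ, hd, -⟩ := h
  obtain ⟨ρ₁', ρ₂', z', k₁', k₂', he₁, rfl, hρ', -, -⟩ := h'
  obtain rfl : ρ₁ = ρ₁' := congrArg Sigma.fst he₁
  obtain rfl : ρ₂ = ρ₂' := h₂.1.injective (hρ.symm.trans hρ')
  exact extPt_eq_of_extPt_eq hK₀ h₁ h₂ hd hρ he₁

/-- Equal rays carry equal lattices, so an interior point of the ray in one subdivision is interior
in the other. Both maps are then computed from the same two points. -/
theorem EndRel.extMap_iff (hK₀ : K₀.IsConeComplex) (h₁ : K₁.IsProperSubdivision K₀)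
    (h₂ : K₂.IsProperSubdivision K₀) (hD : D.IsConeComplex) (hf : K₀.IsMorphism D f)
    {e₁ : K₁.ExtPoint} {e₂ : K₂.ExtPoint} (h : EndRel K₀ h₁.1 h₂.1 e₁ e₂) {e : D.ExtPoint} :
    extMap K₁ D f e₁ e ↔ extMap K₂ D f e₂ e := by
  obtain ⟨ρ₁, ρ₂, z, k₁, k₂, rfl, rfl, hρ, hd, -⟩ := h
  have hf₁ : K₁.IsMorphism D f := hf.comp (isMorphism_id_of_isProperSubdivision h₁)
  have hf₂ : K₂.IsMorphism D f := hf.comp (isMorphism_id_of_isProperSubdivision h₂)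
  obtain ⟨u, rfl, -⟩ := h₁.1.exists_carrier_eq ρ₁
  have hu : h₂.1.carrier u = ρ₂ := by
    refine h₂.1.carrier_eq (hρ ▸ h₁.1.mem_carrier u) fun m hm hpos hmu => ?_
    rw [← M_eq_of_cone_eq hK₀ h₁ h₂ hρ] at hm
    exact h₁.1.eq_zero_of_carrier hm (by rw [hρ]; exact hpos) hmu
  subst hu
  rw [hf₁.extMap_iff h₁.1 hD, hf₂.extMap_iff h₂.1 hD]

/-- The push-forward of the intersection product does not depend on the subdivision. -/
theorem pushforward_weightInter_eq (hK₀ : K₀.IsConeComplex) (h₁ : K₁.IsProperSubdivision K₀)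
    (h₂ : K₂.IsProperSubdivision K₀) (hD : D.IsConeComplex) (hf : K₀.IsMorphism D f) (ψ : X → ℝ)
    {c₁ : κ₁ → ℤ} {c₂ : κ₂ → ℤ} (hc : K₁.weightClass c₁ = K₂.weightClass c₂) (e : D.ExtPoint) :
    pushforward K₁.extValueGroup D.extValueGroup (extMap K₁ D f) (K₁.weightInter ψ c₁) e =
      pushforward K₂.extValueGroup D.extValueGroup (extMap K₂ D f) (K₂.weightInter ψ c₂) e := by
  refine pushforward_eq_of_rel (EndRel K₀ h₁.1 h₂.1)
    (fun e₁ he hr hw => exists_endRel hK₀ h₁ h₂ hD hf hc he hr hw)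
    (fun e₂ he hr hw => ?_) (fun e₁ e₂ h => h.extMap_iff hK₀ h₁ h₂ hD hf)
    (fun e₁ e₂ h => h.extValueGroup_eq hK₀ h₁ h₂) ?_
    (fun e₁ e₂ e₂' h h' => h.unique hK₀ h₁ h₂ h')
    (fun e₁ e₁' e₂ h h' => (h.symm hK₀ h₁ h₂).unique hK₀ h₂ h₁ (h'.symm hK₀ h₁ h₂))
  · obtain ⟨e₁, h⟩ := exists_endRel hK₀ h₂ h₁ hD hf hc.symm he hr hw
    exact ⟨e₁, h.symm hK₀ h₂ h₁⟩
  · intro e₁ e₂ h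
    have hV := h.extValueGroup_eq hK₀ h₁ h₂
    obtain ⟨ρ₁, ρ₂, z, k₁, k₂, rfl, rfl, hρ, hd, hr⟩ := h
    have hM := M_eq_of_cone_eq hK₀ h₁ h₂ hρ
    have hd₂ : K₂.dim ρ₂ = 1 := by
      unfold dim at hd ⊢
      rwa [← hM]
    rw [h₁.1.weightInter_eq_mul ψ c₁ hd (by rw [valueGroup_of_isProperSubdivision hK₀ h₁, hr]),
      h₂.1.weightInter_eq_mul ψ c₂ hd₂ (by rw [valueGroup_of_isProperSubdivision hK₀ h₂, hr, hV]),
      hc]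
    congr 1
    unfold raySlope
    rw [hρ, hM]

end ends

end WComplex

theorem IsIntegralCone.comap {Y : Type v} {Z : Type v'} {S : Set Y} {M : AddSubgroup (Y → ℝ)}
    (hS : IsIntegralCone S M) {g : Z → Y} (hg : Function.Injective g) (hr : S ⊆ Set.range g)
    {N : AddSubgroup (Z → ℝ)} (hN : ∀ n, n ∈ N ↔ ∃ m ∈ M, m ∘ g = n) (hfg : N.FG) :
    IsIntegralCone (g ⁻¹' S) N where
  eq_zero_off := by
    intro n hn z hz
    obtain ⟨m, hm, rfl⟩ := (hN n).1 hn
    exact hS.eq_zero_off m hm _ hz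
  fg := hfg
  injOn := by
    intro x hx y hy h
    exact hg (hS.injOn _ hx _ hy fun m hm => h _ ((hN _).2 ⟨m, hm, rfl⟩))
  polyhedral := by
    obtain ⟨U, hU, h1, h2⟩ := hS.polyhedral
    choose p hp using fun y : U => hr (hU y.1 y.2).1
    refine polyhedral_of_family p (fun y => ⟨?_, fun n hn => ?_⟩) ?_ ?_
    · rw [Set.mem_preimage, hp]
      exact (hU y.1 y.2).1
    · obtain ⟨m, hm, rfl⟩ := (hN n).1 hn
      rw [Function.comp_apply, hp]
      exact (hU y.1 y.2).2 m hm
    · intro x hx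
      obtain ⟨a, ha, hax⟩ := h1 (g x) hx
      refine ⟨fun y => a y.1, fun y => ha y.1, fun n hn => ?_⟩
      obtain ⟨m, hm, rfl⟩ := (hN n).1 hn
      rw [Function.comp_apply, hax m hm, ← Finset.sum_coe_sort]
      exact Finset.sum_congr rfl fun y _ => by rw [Function.comp_apply, hp]
    · intro a ha
      classical
      obtain ⟨x, hx, hxm⟩ := h2 (fun y => if h : y ∈ U then a ⟨y, h⟩ else 0) fun y => by
        split_ifs
        · exact ha _
        · exact le_rfl
      obtain ⟨z, rfl⟩ := hr hx
      refine ⟨z, hx, fun n hn => ?_⟩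
      obtain ⟨m, hm, rfl⟩ := (hN n).1 hn
      rw [Function.comp_apply, hxm m hm, ← Finset.sum_coe_sort]
      exact Finset.sum_congr rfl fun y _ => by rw [Function.comp_apply, hp, dif_pos y.2]
  stronglyConvex := by
    intro x hx y hy h n hn
    obtain ⟨m, hm, rfl⟩ := (hN n).1 hn
    exact hS.stronglyConvex _ hx _ hy (fun m hm => h _ ((hN _).2 ⟨m, hm, rfl⟩)) m hm

namespace WComplex

/-! ### Transport of a complex along an injection -/

section pull

variable {ι : Type u} {Y : Type v} {L : Type w} [AddCommGroup L] {K : WComplex ι Y L}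
  {Z : Type v'} {L' : Type w'} [AddCommGroup L'] {g : Z → Y} {f : L' →+ L}

/-- The part of a complex on the image of `g : Z → Y`, as a complex on `Z`. -/
def pull (K : WComplex ι Y L) (g : Z → Y) (f : L' →+ L) :
    WComplex {i : ι // K.cone i ⊆ Set.range g} Z L' where
  cone i := g ⁻¹' K.cone i.1
  M i := (K.M i.1).map
    { toFun := fun m => m ∘ g, map_zero' := rfl, map_add' := fun _ _ => rfl }
  φ z := (K.φ (g z)).comp f
  φ_integral i l := by
    obtain ⟨m, hm, hmx⟩ := K.φ_integral i.1 (f l)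
    exact ⟨_, ⟨m, hm, rfl⟩, fun x hx => hmx _ hx⟩

theorem mem_pull_M {i : {i : ι // K.cone i ⊆ Set.range g}} {n : Z → ℝ} :
    n ∈ (K.pull g f).M i ↔ ∃ m ∈ K.M i.1, m ∘ g = n := Iff.rfl

variable (hK : K.IsConeComplex) (hg : Function.Injective g)
  (hr : ∀ i z, g z ∈ K.cone i → K.cone i ⊆ Set.range g)
include hK hg hr

/-- By `hr` a cone meeting the image of `g` lies in it, so each cone is either kept whole or
dropped. Faces and lattices are then transported by `g`. -/
theorem isConeComplex_pull : (K.pull g f).IsConeComplex := by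
  have := hK.finite
  refine IsConeComplex.of_minFace (fun i => ?_) (fun z => ?_) (fun i j hij => ?_) fun z => ?_
  · exact (hK.isCone i.1).comap hg i.2 (fun _ => Iff.rfl) ((hK.isCone i.1).fg.map_addMonoidHom _)
  · exact ⟨⟨hK.carrier (g z), hr _ z (hK.mem_carrier _)⟩, hK.mem_carrier (g z)⟩
  · have h1 := congrArg (Set.image g) (show g ⁻¹' K.cone i.1 = g ⁻¹' K.cone j.1 from hij)
    rw [Set.image_preimage_eq_of_subset i.2, Set.image_preimage_eq_of_subset j.2] at h1
    exact Subtype.ext (hK.injective h1)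
  · refine ⟨⟨hK.carrier (g z), hr _ z (hK.mem_carrier _)⟩, fun i hi => ⟨?_, ?_⟩⟩
    · change g ⁻¹' K.cone (hK.carrier (g z)) = _
      rw [hK.cone_carrier_eq_minFace (i := i.1) hi]
      ext y
      refine and_congr_right fun hy => ⟨fun h n hn hpos hn0 => ?_, fun h m hm hpos hm0 => ?_⟩
      · obtain ⟨m, hm, rfl⟩ := mem_pull_M.1 hn
        refine h m hm (fun x hx => ?_) hn0
        obtain ⟨w, rfl⟩ := i.2 hx
        exact hpos w hx
      · exact h _ (mem_pull_M.2 ⟨m, hm, rfl⟩) (fun w hw => hpos _ hw) hm0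
    · have hsub := hK.carrier_subset (x := g z) (j := i.1) hi
      refine lattice_eq_of_values (S := g ⁻¹' K.cone (hK.carrier (g z))) ?_
        (fun m hm x hx => eq_zero_of_mem_restrictLattice hm hx) ?_ ?_
      · rintro _ ⟨m, hm, rfl⟩ x hx
        exact (hK.isCone _).eq_zero_off m hm _ hx
      · rintro _ ⟨m, hm, rfl⟩
        change m ∈ K.M (hK.carrier (g z)) at hm
        rw [hK.M_of_subset hsub] at hm
        obtain ⟨n, hn, hmn⟩ := exists_of_mem_restrictLattice hm
        obtain ⟨p, hp, hpn⟩ := exists_restrict (mem_pull_M (f := f).2 ⟨n, hn, rfl⟩)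
          (g ⁻¹' K.cone (hK.carrier (g z)))
        exact ⟨p, hp, fun x hx => (hmn _ hx).trans (hpn x hx).symm⟩
      · intro p hp
        obtain ⟨p', hp', hpp⟩ := exists_of_mem_restrictLattice hp
        obtain ⟨n, hn, rfl⟩ := mem_pull_M.1 hp'
        obtain ⟨m, hm, hmn⟩ := exists_restrict hn (K.cone (hK.carrier (g z)))
        rw [← hK.M_of_subset hsub] at hm
        exact ⟨_, ⟨m, hm, rfl⟩, fun x hx => (hpp x hx).trans (hmn _ hx).symm⟩

omit hg in
theorem pull_carrier (hP : (K.pull g f).IsConeComplex) (z : Z) :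
    hP.carrier z = ⟨hK.carrier (g z), hr _ z (hK.mem_carrier _)⟩ := by
  refine hP.carrier_eq (hK.mem_carrier (g z)) fun n hn hpos hn0 => ?_
  obtain ⟨m, hm, rfl⟩ := mem_pull_M.1 hn
  have : m = 0 := hK.eq_zero_of_carrier hm (fun x hx => by
    obtain ⟨w, rfl⟩ := hr _ z (hK.mem_carrier _) hx
    exact hpos w hx) hn0
  rw [this]
  rfl

omit hg hr in
theorem pull_dim (i : {i : ι // K.cone i ⊆ Set.range g}) : (K.pull g f).dim i = K.dim i.1 := by
  refine finrank_eq_of_range (AddMonoidHom.comp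
    { toFun := fun m => m ∘ g, map_zero' := rfl, map_add' := fun _ _ => rfl } (K.M i.1).subtype)
    ?_ fun n => ?_
  · intro a b hab
    refine Subtype.ext ((hK.isCone i.1).ext_of_vanish a.2 b.2 fun x hx => ?_)
    obtain ⟨z, rfl⟩ := i.2 hx
    exact congrFun hab z
  · rw [mem_pull_M]
    constructor
    · rintro ⟨m, hm, rfl⟩
      exact ⟨⟨m, hm⟩, rfl⟩
    · rintro ⟨m, rfl⟩
      exact ⟨m.1, m.2, rfl⟩

theorem pull_valueGroup (z : Z) : (K.pull g f).valueGroup z = K.valueGroup (g z) := by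
  rw [(isConeComplex_pull hK hg hr).valueGroup_eq
    (i := ⟨hK.carrier (g z), hr _ z (hK.mem_carrier _)⟩) (hK.mem_carrier (g z)),
    hK.valueGroup_eq (hK.mem_carrier (g z))]
  ext r
  constructor
  · rintro ⟨_, ⟨m, hm, rfl⟩, rfl⟩
    exact ⟨m, hm, rfl⟩
  · rintro ⟨m, hm, rfl⟩
    exact ⟨_, ⟨m, hm, rfl⟩, rfl⟩

theorem pull_weightClass (c : ι → ℤ) (z : Z) :
    (K.pull g f).weightClass (fun i => c i.1) z = K.weightClass c (g z) := by
  rw [(isConeComplex_pull hK hg hr).weightClass_eq, hK.weightClass_eq, pull_valueGroup hK hg hr,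
    pull_carrier hK hr, pull_dim hK]

omit hK hg hr in
theorem pull_cone_subset_iff {i j : {i : ι // K.cone i ⊆ Set.range g}} :
    (K.pull g f).cone i ⊆ (K.pull g f).cone j ↔ K.cone i.1 ⊆ K.cone j.1 := by
  constructor
  · intro h x hx
    obtain ⟨z, rfl⟩ := i.2 hx
    exact h hx
  · exact fun h z hz => h hz

/-- A cofacet of a cone in the image contains the zero of that cone and therefore lies in the image
as well, so no term of the balancing sum is lost. -/
theorem isMinkowskiWeight_pull {c : ι → ℤ} (hc : K.IsMinkowskiWeight c) :
    (K.pull g f).IsMinkowskiWeight fun i => c i.1 := by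
  intro τ l hl
  have hP := isConeComplex_pull (f := f) hK hg hr
  have hl' : f l ∈ K.perp τ.1 := by
    intro t ht
    obtain ⟨z, rfl⟩ := τ.2 ht
    exact hl z ht
  rw [← hc τ.1 (f l) hl']
  have hcof : ∀ σ : {i : ι // K.cone i ⊆ Set.range g},
      σ ∈ (K.pull g f).cofacets τ ↔ σ.1 ∈ K.cofacets τ.1 := by
    intro σ
    refine and_congr (pull_cone_subset_iff) ?_
    rw [pull_dim hK, pull_dim hK]
  refine finsum_mem_eq_of_bijOn (fun σ => σ.1) ⟨fun σ hσ => (hcof σ).1 hσ,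
    fun _ _ _ _ h => Subtype.ext h, fun σ hσ => ?_⟩ fun σ hσ => ?_
  · obtain ⟨o, ho, -⟩ := (hK.isCone τ.1).exists_zero
    obtain ⟨z, rfl⟩ := τ.2 ho
    exact ⟨⟨σ, hr σ z (hσ.1 ho)⟩, (hcof ⟨σ, hr σ z (hσ.1 ho)⟩).2 hσ, rfl⟩
  · obtain ⟨x, hx, -⟩ := hP.normalVector_spec hσ
    have h1 := hP.normalVector_eq hσ hx hl
    obtain ⟨hxσ, hlat, p, ⟨hp, hp0⟩, hpx⟩ := hx
    obtain ⟨m, hm, rfl⟩ := mem_pull_M.1 hp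
    have h2 : K.IsFacetPt σ.1 τ.1 (g x) := by
      refine ⟨hxσ, fun n hn => hlat _ (mem_pull_M.2 ⟨n, hn, rfl⟩), m, ⟨hm, fun t ht => ?_⟩, hpx⟩
      obtain ⟨z, rfl⟩ := τ.2 ht
      exact hp0 z ht
    have h3 := hK.normalVector_eq ((hcof σ).1 hσ) h2 hl'
    have h4 : (K.pull g f).normalVector σ τ l = K.normalVector σ.1 τ.1 (f l) := by
      have h5 : (K.pull g f).φ x l = K.φ (g x) (f l) := rfl
      rw [h5, ← h3] at h1
      exact_mod_cast h1
    rw [h4]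

omit hK hg hr in
theorem pull_raySlope (ψ : Y → ℝ) (ρ : {i : ι // K.cone i ⊆ Set.range g}) :
    (K.pull g f).raySlope (ψ ∘ g) ρ = K.raySlope ψ ρ.1 := by
  unfold raySlope
  congr 1
  funext n
  apply propext
  constructor
  · rintro ⟨x, hx, h1, ⟨_, ⟨m, hm, rfl⟩, hmx⟩, h3⟩
    exact ⟨g x, hx, fun m hm => h1 _ ⟨m, hm, rfl⟩, ⟨m, hm, hmx⟩, h3⟩
  · rintro ⟨x, hx, h1, ⟨m, hm, hmx⟩, h3⟩
    obtain ⟨z, rfl⟩ := ρ.2 hx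
    refine ⟨z, hx, ?_, ⟨_, ⟨m, hm, rfl⟩, hmx⟩, h3⟩
    rintro _ ⟨m, hm, rfl⟩
    exact h1 m hm

variable {κ : Type*} {X : Type*} {N : Type*} [AddCommGroup N] {D : WComplex κ X N} {F : Y → X}

omit hK hg hr in
theorem isMorphism_pull (hF : K.IsMorphism D F) : (K.pull g f).IsMorphism D (F ∘ g) := by
  intro i
  obtain ⟨j, hj, hpull⟩ := hF i.1
  refine ⟨j, fun x hx => hj _ hx, fun n hn => ?_⟩
  obtain ⟨m, hm, hmx⟩ := hpull n hn
  exact ⟨_, ⟨m, hm, rfl⟩, fun x hx => hmx _ hx⟩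

/-- The push-forward of an intersection product on a part of a complex that contains all preimages
of a point. -/
theorem pushforward_weightInter_pull (hD : D.IsConeComplex) (hF : K.IsMorphism D F) (ψ : Y → ℝ)
    (c : ι → ℤ) {e : D.ExtPoint} (he : ∀ e', extMap K D F e' e → K.cone e'.1 ⊆ Set.range g) :
    pushforward (K.pull g f).extValueGroup D.extValueGroup (extMap (K.pull g f) D (F ∘ g))
        ((K.pull g f).weightInter (ψ ∘ g) fun i => c i.1) e =
      pushforward K.extValueGroup D.extValueGroup (extMap K D F) (K.weightInter ψ c) e := by
  have hP := isConeComplex_pull (f := f) hK hg hr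
  have hc := pull_carrier (f := f) hK hr hP
  have hPF := isMorphism_pull (g := g) (f := f) hF
  have hann : ∀ (ρ : {i : ι // K.cone i ⊆ Set.range g}) (z : Z) (n : Z → ℝ),
      n ∈ ann ((K.pull g f).M (hP.carrier z)) ((K.pull g f).cone ρ) ↔
        ∃ m ∈ ann (K.M (hK.carrier (g z))) (K.cone ρ.1), m ∘ g = n := by
    intro ρ z n
    rw [hc]
    constructor
    · rintro ⟨⟨m, hm, rfl⟩, h0⟩
      refine ⟨m, ⟨hm, fun t ht => ?_⟩, rfl⟩
      obtain ⟨w, rfl⟩ := ρ.2 ht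
      exact h0 w ht
    · rintro ⟨m, ⟨hm, h0⟩, rfl⟩
      exact ⟨⟨m, hm, rfl⟩, fun t ht => h0 _ ht⟩
  have hsub : ∀ {ρ : {i : ι // K.cone i ⊆ Set.range g}} {z : Z},
      (K.pull g f).cone ρ ⊆ (K.pull g f).cone (hP.carrier z) ↔
        K.cone ρ.1 ⊆ K.cone (hK.carrier (g z)) := by
    intro ρ z
    rw [hc]
    exact pull_cone_subset_iff
  have hval : ∀ (ρ : {i : ι // K.cone i ⊆ Set.range g}) (z : Z),
      valuesAt (ann ((K.pull g f).M (hP.carrier z)) ((K.pull g f).cone ρ)) z =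
        valuesAt (ann (K.M (hK.carrier (g z))) (K.cone ρ.1)) (g z) := by
    intro ρ z
    ext r
    constructor
    · rintro ⟨n, hn, rfl⟩
      obtain ⟨m, hm, rfl⟩ := (hann ρ z n).1 hn
      exact ⟨m, hm, rfl⟩
    · rintro ⟨m, hm, rfl⟩
      exact ⟨_, (hann ρ z _).2 ⟨m, hm, rfl⟩, rfl⟩
  refine pushforward_eq_of_rel (fun e₁ e₂ => ∃ ρ z h h', e₁ = hP.extPt ρ z h ∧
    e₂ = hK.extPt ρ.1 (g z) h') ?_ ?_ ?_ ?_ ?_ ?_ ?_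
  · intro e₁ _ _ _
    obtain ⟨z, h, he₁⟩ := hP.exists_eq_extPt e₁
    exact ⟨_, e₁.1, z, h, hsub.1 h, he₁, rfl⟩
  · intro e₂ he₂ _ _
    obtain ⟨y, h, hy⟩ := hK.exists_eq_extPt e₂
    obtain ⟨o, ho, -⟩ := (hK.isCone e₂.1).exists_zero
    obtain ⟨w, rfl⟩ := he e₂ he₂ ho
    obtain ⟨z, rfl⟩ := hr _ w (h ho) (hK.mem_carrier y)
    exact ⟨_, ⟨e₂.1, he e₂ he₂⟩, z, hsub.2 h, h, rfl, hy⟩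
  · rintro _ _ ⟨ρ, z, h, h', rfl, rfl⟩
    obtain ⟨u, rfl, -⟩ := hP.exists_carrier_eq ρ
    rw [hPF.extMap_iff hP hD]
    have h'' : K.cone (hK.carrier (g u)) ⊆ K.cone (hK.carrier (g z)) := by
      have := hsub.1 h
      rwa [hc] at this
    have hE : hK.extPt (hP.carrier u).1 (g z) h' = hK.extPt (hK.carrier (g u)) (g z) h'' :=
      hK.extPt_eq_iff.2 ⟨by rw [hc], rfl, fun _ _ => rfl⟩
    rw [hE, hF.extMap_iff hK hD]
    rfl
  · rintro _ _ ⟨ρ, z, h, h', rfl, rfl⟩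
    rw [hP.extValueGroup_extPt, hK.extValueGroup_extPt, hval]
  · rintro _ _ ⟨ρ, z, h, h', rfl, rfl⟩
    rw [hP.weightInter_extPt, hK.weightInter_extPt, hval, pull_dim hK, pull_dim hK,
      pull_raySlope, hc]
  · rintro _ _ _ ⟨ρ, z, h, h', rfl, rfl⟩ ⟨ρ₁, z₁, h₁, h₁', he₁, rfl⟩
    obtain ⟨rfl, h2, h3⟩ := hP.extPt_eq_iff.1 he₁
    refine hK.extPt_eq_iff.2 ⟨rfl, ?_, fun m hm => ?_⟩
    · rw [hc, hc] at h2
      exact congrArg Subtype.val h2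
    · exact h3 _ ((hann _ _ _).2 ⟨m, hm, rfl⟩)
  · rintro _ _ _ ⟨ρ, z, h, h', rfl, rfl⟩ ⟨ρ₁, z₁, h₁, h₁', rfl, he₁⟩
    obtain ⟨h1, h2, h3⟩ := hK.extPt_eq_iff.1 he₁
    obtain rfl : ρ = ρ₁ := Subtype.ext h1
    refine hP.extPt_eq_iff.2 ⟨rfl, ?_, fun n hn => ?_⟩
    · rw [hc, hc]
      exact Subtype.ext h2
    · obtain ⟨m, hm, rfl⟩ := (hann _ _ _).1 hn
      exact h3 m hm

end pull

end WComplex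

namespace WComplex

theorem IsMorphism.extMap_extPt_iff {ι : Type u} {X : Type v} {L : Type w} [AddCommGroup L]
    {K : WComplex ι X L} {κ : Type u'} {Y : Type v'} {L' : Type w'} [AddCommGroup L']
    {D : WComplex κ Y L'} {f : X → Y} (hf : K.IsMorphism D f) (hK : K.IsConeComplex)
    (hD : D.IsConeComplex) {u z : X} {ρ : ι} (hρ : hK.carrier u = ρ)
    {h : K.cone ρ ⊆ K.cone (hK.carrier z)} {e' : D.ExtPoint} :
    extMap K D f (hK.extPt ρ z h) e' ↔ ∃ h', e' = hD.extPt (hD.carrier (f u)) (f z) h' := by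
  subst hρ
  rw [hf.extMap_iff hK hD]
  exact ⟨fun he => ⟨_, he⟩, fun ⟨_, he⟩ => he⟩

/-! ### Push-forward of the graph intersected with the height -/

section graph

variable {ι : Type u} {X : Type v} {L : Type w} [AddCommGroup L] {K : WComplex ι X L}

theorem isMorphism_fst : (K.prod line).IsMorphism K Prod.fst := by
  intro p
  refine ⟨p.1, fun z hz => hz.1, fun n hn => ?_⟩
  obtain ⟨g, hg, hgm⟩ := exists_mem_prod_M (p := p) hn 0
  exact ⟨g, hg, fun z hz => by rw [hgm z hz, Int.cast_zero, zero_mul, add_zero]⟩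

theorem isMorphism_graph_fst {ψ : X → ℝ} {hψ : K.IsDivisor ψ} :
    (K.graphComplex ψ hψ).IsMorphism K Prod.fst :=
  isMorphism_fst

theorem exists_of_mem_ann_prod (hK : K.IsConeComplex) {k ρ : ι} {s t : SignType}
    (h : (K.prod line).cone (ρ, s) ⊆ (K.prod line).cone (k, t)) {g : X × ℝ → ℝ}
    (hg : g ∈ ann ((K.prod line).M (k, t)) ((K.prod line).cone (ρ, s))) :
    ∃ m ∈ ann (K.M k) (K.cone ρ), ∃ j : ℤ, (s ≠ 0 → j = 0) ∧
      ∀ z ∈ (K.prod line).cone (k, t), g z = m z.1 + j * z.2 := by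
  obtain ⟨m, hm, j, hgm⟩ := exists_of_mem_prod_M hg.1
  have h0 : ∀ x ∈ K.cone ρ, (x, (0 : ℝ)) ∈ (K.prod line).cone (ρ, s) := fun x hx =>
    ⟨hx, zero_mem_lineCone s⟩
  have hm0 : ∀ x ∈ K.cone ρ, m x = 0 := fun x hx => by
    have h1 := hg.2 _ (h0 x hx)
    rw [hgm _ (h (h0 x hx))] at h1
    simpa using h1
  refine ⟨m, ⟨hm, hm0⟩, j, fun hs => ?_, hgm⟩
  obtain ⟨o, ho, -⟩ := (hK.isCone ρ).exists_zero
  have hs' : (o, (s : ℝ)) ∈ (K.prod line).cone (ρ, s) :=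
    mem_prod_cone.2 ⟨ho, Or.inr (by cases s <;> simp)⟩
  have h1 := hg.2 _ hs'
  rw [hgm _ (h hs'), hm0 o ho, zero_add] at h1
  have h2 : (s : ℝ) ≠ 0 := by cases s <;> simp_all
  exact_mod_cast (mul_eq_zero.1 h1).resolve_right h2

theorem exists_mem_ann_prod {k ρ : ι} {s t : SignType}
    (h : (K.prod line).cone (ρ, s) ⊆ (K.prod line).cone (k, t)) {m : X → ℝ}
    (hm : m ∈ ann (K.M k) (K.cone ρ)) :
    ∃ g ∈ ann ((K.prod line).M (k, t)) ((K.prod line).cone (ρ, s)),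
      ∀ z ∈ (K.prod line).cone (k, t), g z = m z.1 := by
  obtain ⟨g, hg, hgm⟩ := exists_mem_prod_M (p := (k, t)) hm.1 0
  have hgm' : ∀ z ∈ (K.prod line).cone (k, t), g z = m z.1 := fun z hz => by
    rw [hgm z hz, Int.cast_zero, zero_mul, add_zero]
  exact ⟨g, ⟨hg, fun z hz => by rw [hgm' z (h hz), hm.2 _ hz.1]⟩, hgm'⟩

theorem mem_prod_carrier {hK : K.IsConeComplex} (x : X) (t : ℝ) :
    (x, t) ∈ (K.prod line).cone (hK.carrier x, SignType.sign t) :=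
  mem_prod_cone.2 ⟨hK.mem_carrier x, Or.inr rfl⟩

/-- The vertical term `j t` never contributes: over a vertical cone vanishing forces `j = 0`, and
otherwise `t = 0`. -/
theorem valuesAt_ann_prod (hK : K.IsConeComplex) {ρ : ι} {x : X} {s : SignType} {t : ℝ}
    (h : (K.prod line).cone (ρ, s) ⊆ (K.prod line).cone (hK.carrier x, SignType.sign t))
    (hs : s ≠ 0 ∨ t = 0) :
    valuesAt (ann ((K.prod line).M (hK.carrier x, SignType.sign t)) ((K.prod line).cone (ρ, s)))
      (x, t) = valuesAt (ann (K.M (hK.carrier x)) (K.cone ρ)) x := by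
  have hz := mem_prod_carrier (hK := hK) x t
  ext r
  constructor
  · rintro ⟨g, hg, rfl⟩
    obtain ⟨m, hm, j, hj, hgm⟩ := exists_of_mem_ann_prod hK h hg
    refine ⟨m, hm, ?_⟩
    change m x = g (x, t)
    rw [hgm _ hz]
    rcases hs with hs | rfl
    · simp [hj hs]
    · simp
  · rintro ⟨m, hm, rfl⟩
    obtain ⟨g, hg, hgm⟩ := exists_mem_ann_prod h hm
    exact ⟨g, hg, hgm _ hz⟩

variable {ψ : X → ℝ} {hψ : K.IsDivisor ψ} (hG : (K.graphComplex ψ hψ).IsConeComplex)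

theorem graph_carrier (hK : K.IsConeComplex) (x : X) (t : ℝ) :
    hG.carrier (x, t) = (hK.carrier x, SignType.sign t) :=
  prod_line_carrier hK (isConeComplex_prod_line hK) (x, t)

theorem graph_dim_zero (hK : K.IsConeComplex) (i : ι) :
    (K.graphComplex ψ hψ).dim (i, 0) = K.dim i :=
  dim_prod_line_zero hK i

theorem graph_dim_of_ne (hK : K.IsConeComplex) (i : ι) {s : SignType} (hs : s ≠ 0) :
    (K.graphComplex ψ hψ).dim (i, s) = K.dim i + 1 :=
  dim_prod_line_of_ne hK i hs

theorem graph_subset_iff (hK : K.IsConeComplex) {ρ : ι} {s : SignType} {x : X} {t : ℝ} :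
    (K.graphComplex ψ hψ).cone (ρ, s) ⊆ (K.graphComplex ψ hψ).cone (hG.carrier (x, t)) ↔
      K.cone ρ ⊆ K.cone (hK.carrier x) ∧ (s = 0 ∨ s = SignType.sign t) := by
  rw [graph_carrier hG hK]
  exact prod_cone_subset_iff hK

theorem graph_extValueGroup (hK : K.IsConeComplex) {ρ : ι} {s : SignType} {x : X} {t : ℝ} {h}
    (hs : s ≠ 0 ∨ t = 0) : (K.graphComplex ψ hψ).extValueGroup (hG.extPt (ρ, s) (x, t) h) =
      valuesAt (ann (K.M (hK.carrier x)) (K.cone ρ)) x := by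
  rw [hG.extValueGroup_extPt, graph_carrier hG hK]
  rw [graph_carrier hG hK] at h
  exact valuesAt_ann_prod hK h hs

include hG in
-- The primitive generator is `(u, 0)` in sheared coordinates, where the height is `ψ(u)`.
theorem graph_raySlope_zero (hK : K.IsConeComplex) {ρ : ι} (hd : K.dim ρ = 1) :
    (K.graphComplex ψ hψ).raySlope (fun z => z.2 + ψ z.1) (ρ, 0) = K.raySlope ψ ρ := by
  obtain ⟨l, hl, -, -, u, hu, hlat, hlu, -⟩ := hK.exists_ray_data hd
  have h1 := hK.raySlope_eq hd hψ hu hlat ⟨l, hl, hlu⟩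
  have h2 := hG.raySlope_eq (ρ := (ρ, 0)) (x := (u, 0)) ((graph_dim_zero hK ρ).trans hd)
    (isDivisor_height ψ hψ) ⟨hu, zero_mem_lineCone 0⟩ ?_ ?_
  · rw [zero_add, ← h1] at h2
    exact_mod_cast h2
  · intro g hg
    obtain ⟨m, hm, j, hgm⟩ := exists_of_mem_prod_M hg
    obtain ⟨n, hn⟩ := hlat m hm
    exact ⟨n, by rw [hgm (u, 0) ⟨hu, zero_mem_lineCone 0⟩, mul_zero, add_zero, hn]⟩
  · obtain ⟨g, hg, hgm⟩ := exists_mem_prod_M (p := (ρ, (0 : SignType))) hl 0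
    exact ⟨g, hg, by rw [hgm (u, 0) ⟨hu, zero_mem_lineCone 0⟩, mul_zero, add_zero, hlu]⟩

include hG in
-- The primitive generator is `(o, -1)` over a zero `o`, and `ψ` vanishes at `o`.
theorem graph_raySlope_neg (hK : K.IsConeComplex) {τ : ι} (hd : K.dim τ = 0) :
    (K.graphComplex ψ hψ).raySlope (fun z => z.2 + ψ z.1) (τ, -1) = -1 := by
  obtain ⟨o, ho, hom⟩ := (hK.isCone τ).exists_zero
  have ho' : (o, (-1 : ℝ)) ∈ (K.prod line).cone (τ, -1) := mem_prod_cone.2 ⟨ho, Or.inr (by simp)⟩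
  have hψo : ψ o = 0 := by
    obtain ⟨m, hm, hmx⟩ := hψ τ
    rw [hmx o ho, hom m hm]
  have h2 := hG.raySlope_eq (ρ := (τ, -1)) (x := (o, -1))
    (by rw [graph_dim_of_ne hK τ (by decide), hd]) (isDivisor_height ψ hψ) ho' ?_ ?_
  · rw [hψo, add_zero] at h2
    change _ = (-1 : ℝ) at h2
    exact_mod_cast h2
  · intro g hg
    obtain ⟨m, hm, j, hgm⟩ := exists_of_mem_prod_M hg
    exact ⟨-j, by rw [hgm _ ho', hom m hm]; push_cast; ring⟩
  · obtain ⟨g, hg, hgm⟩ := exists_mem_prod_M (p := (τ, (-1 : SignType))) (zero_mem (K.M τ)) (-1)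
    exact ⟨g, hg, by rw [hgm _ ho', Pi.zero_apply]; push_cast; ring⟩

include hG in
open Classical in
/-- The part of the push-forward from the rays on the graph of `ψ`. -/
theorem pushforward_graph_flat {κ : Type u'} {Y : Type v'} {L' : Type w'} [AddCommGroup L']
    {D : WComplex κ Y L'} {f : X → Y} (hK : K.IsConeComplex) (hD : D.IsConeComplex)
    (hf : K.IsMorphism D f) {w : ι × SignType → ℤ} {c : ι → ℤ} (hw : ∀ i, w (i, 0) = c i)
    (e : D.ExtPoint) :
    pushforward (K.graphComplex ψ hψ).extValueGroup D.extValueGroup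
        (extMap (K.graphComplex ψ hψ) D (f ∘ Prod.fst))
        (fun e => if e.1.2 = 0 then
          (K.graphComplex ψ hψ).weightInter (fun z => z.2 + ψ z.1) w e else 0) e =
      pushforward K.extValueGroup D.extValueGroup (extMap K D f) (K.weightInter ψ c) e := by
  have hGf : (K.graphComplex ψ hψ).IsMorphism D (f ∘ Prod.fst) := hf.comp isMorphism_graph_fst
  refine pushforward_eq_of_rel (fun e₀ e₁ => ∃ ρ x h h',
    e₀ = hG.extPt (ρ, 0) (x, 0) h ∧ e₁ = hK.extPt ρ x h') ?_ ?_ ?_ ?_ ?_ ?_ ?_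
  · intro e₀ he₀ hr h0
    obtain ⟨⟨x, t⟩, h, he⟩ := hG.exists_eq_extPt e₀
    obtain ⟨⟨ρ, s⟩, q⟩ := e₀
    rw [he] at he₀ hr h0 ⊢
    obtain ⟨hs, h0⟩ := ite_ne_right_iff.1 h0
    change s = 0 at hs
    subst hs
    change (K.graphComplex ψ hψ).cone (ρ, 0) ⊆ _ at h
    have hρ := ((graph_subset_iff hG hK).1 h).1
    rw [hG.weightInter_extPt] at h0
    obtain ⟨⟨hd, hdr⟩, -⟩ := ite_ne_right_iff.1 h0
    rw [graph_dim_zero hK] at hd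
    -- A weighted point off the graph lies in a cone of one dimension more than its projection, so
    -- it loses rank under the projection and is excluded from the sum.
    suffices ht : t = 0 by
      subst ht
      exact ⟨_, ρ, x, h, hρ, rfl, rfl⟩
    by_contra ht
    rw [← hG.extValueGroup_extPt (h := h), graph_carrier hG hK,
      graph_dim_of_ne hK _ (sign_ne_zero.2 ht), hr] at hdr
    obtain ⟨u, hu, -⟩ := hK.exists_carrier_eq ρ
    obtain ⟨h', he'⟩ := (hGf.extMap_extPt_iff hG hD (u := (u, 0))
      (by rw [graph_carrier hG hK, hu, sign_zero])).1 he₀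
    have h2 := hf.extValueGroup_le hK hD ((hf.extMap_extPt_iff hK hD hu (h := hρ)).2 ⟨h', he'⟩)
    have h3 := (hK.extValueGroup_fg _).finrank_mono h2
    rw [hK.extValueGroup_extPt] at h3
    have h4 := finrank_valuesAt_le (ann_fg (hK.isCone (hK.carrier x)).fg (K.cone ρ)) x
    have h5 := hK.finrank_ann_add hρ
    omega
  · intro e₁ _ _ _
    obtain ⟨x, h, he⟩ := hK.exists_eq_extPt e₁
    exact ⟨_, e₁.1, x, (graph_subset_iff hG hK).2 ⟨h, Or.inl rfl⟩, h, rfl, he⟩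
  · rintro _ _ ⟨ρ, x, h, h', rfl, rfl⟩
    obtain ⟨u, hu, -⟩ := hK.exists_carrier_eq ρ
    rw [hGf.extMap_extPt_iff hG hD (u := (u, 0)) (by rw [graph_carrier hG hK, hu, sign_zero]),
      hf.extMap_extPt_iff hK hD hu]
    rfl
  · rintro _ _ ⟨ρ, x, h, h', rfl, rfl⟩
    rw [graph_extValueGroup hG hK (Or.inr rfl), hK.extValueGroup_extPt]
  · rintro _ _ ⟨ρ, x, h, h', rfl, rfl⟩
    refine (if_pos rfl).trans ?_
    rw [hG.weightInter_extPt, hK.weightInter_extPt, ← hG.extValueGroup_extPt (h := h),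
      graph_extValueGroup hG hK (Or.inr rfl), graph_carrier hG hK, sign_zero,
      graph_dim_zero hK, graph_dim_zero hK, hw]
    split_ifs with h1
    · rw [graph_raySlope_zero hG hK h1.1]
    · rfl
  · rintro _ e₁ e₁' ⟨ρ, x, h, h', rfl, rfl⟩ ⟨ρ', x', k, k', he, rfl⟩
    obtain ⟨h1, h2, h3⟩ := hG.extPt_eq_iff.1 he
    rw [graph_carrier hG hK, graph_carrier hG hK] at h2
    rw [graph_carrier hG hK] at h h3
    refine hK.extPt_eq_iff.2 ⟨congrArg Prod.fst h1, congrArg Prod.fst h2, fun m hm => ?_⟩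
    obtain ⟨g, hg, hgm⟩ := exists_mem_ann_prod h hm
    have h4 := h3 g hg
    rw [hgm _ (mem_prod_carrier x 0), hgm _ (by rw [h2]; exact mem_prod_carrier x' 0)] at h4
    exact h4
  · rintro e₀ e₀' _ ⟨ρ, x, h, h', rfl, rfl⟩ ⟨ρ', x', k, k', rfl, he⟩
    obtain ⟨rfl, h2, h3⟩ := hK.extPt_eq_iff.1 he
    refine hG.extPt_eq_iff.2 ⟨rfl, by rw [graph_carrier hG hK, graph_carrier hG hK, h2], ?_⟩
    rw [graph_carrier hG hK] at h ⊢
    intro g hg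
    obtain ⟨m, hm, j, -, hgm⟩ := exists_of_mem_ann_prod hK h hg
    rw [hgm _ (mem_prod_carrier x 0), hgm _ (by rw [h2]; exact mem_prod_carrier x' 0), h3 m hm]

theorem ann_eq_of_dim_eq_zero (hK : K.IsConeComplex) {τ i : ι} (hd : K.dim τ = 0)
    (h : K.cone τ ⊆ K.cone i) : ann (K.M i) (K.cone τ) = K.M i :=
  le_antisymm (fun _ hm => hm.1) fun _ hm =>
    ⟨hm, fun _ ht => hK.eq_zero_of_dim_eq_zero hd h hm ht⟩

include hG in
open Classical in
/-- The part of the push-forward from the vertical rays. -/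
theorem pushforward_graph_vertical {κ : Type u'} {K₀ : WComplex κ X L} (hK₀ : K₀.IsConeComplex)
    (h' : K.IsProperSubdivision K₀) {w : ι × SignType → ℤ} {b : ι → ℤ}
    (hw : ∀ i, w (i, -1) = b i) (hw1 : ∀ i, w (i, 1) = 0) (e : K₀.ExtPoint) :
    pushforward (K.graphComplex ψ hψ).extValueGroup K₀.extValueGroup
        (extMap (K.graphComplex ψ hψ) K₀ Prod.fst)
        (fun e => if e.1.2 = 0 then 0 else
          (K.graphComplex ψ hψ).weightInter (fun z => z.2 + ψ z.1) w e) e =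
      pushforward K₀.valueGroup K₀.extValueGroup K₀.finiteIncl (fun x => -K.weightClass b x) e := by
  have hK := h'.1
  have hf : K.IsMorphism K₀ id := isMorphism_id_of_isProperSubdivision h'
  have hGf : (K.graphComplex ψ hψ).IsMorphism K₀ Prod.fst := hf.comp isMorphism_graph_fst
  refine pushforward_eq_of_rel (fun e₀ x => ∃ τ h, K.dim τ = 0 ∧
    e₀ = hG.extPt (τ, -1) (x, -1) h) ?_ ?_ ?_ ?_ ?_ ?_ ?_
  · intro e₀ he₀ hr h0
    obtain ⟨⟨x, t⟩, h, he⟩ := hG.exists_eq_extPt e₀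
    obtain ⟨⟨ρ, s⟩, q⟩ := e₀
    rw [he] at he₀ hr h0 ⊢
    obtain ⟨hs, h0⟩ := ite_ne_left_iff.1 h0
    change s ≠ 0 at hs
    change (K.graphComplex ψ hψ).cone (ρ, s) ⊆ _ at h
    obtain ⟨hρ, hst⟩ := (graph_subset_iff hG hK).1 h
    have hst := hst.resolve_left hs
    have h0 := h0.symm
    rw [hG.weightInter_extPt] at h0
    obtain ⟨⟨hd, -⟩, h1⟩ := ite_ne_right_iff.1 h0
    rw [graph_dim_of_ne hK _ hs] at hd
    rw [graph_carrier hG hK, ← hst] at h1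
    -- The cones above the graph have weight zero, so only downward vertical rays remain.
    have hs1 : s = -1 := by
      cases s with
      | zero => exact absurd rfl hs
      | neg => rfl
      | pos => exact absurd (hw1 _) (right_ne_zero_of_mul h1)
    subst hs1
    -- Modulo the vertical ray the value of `t` is irrelevant; `-1` represents the class.
    refine ⟨x, ρ, (graph_subset_iff hG hK).2 ⟨hρ, Or.inr (by simp)⟩, by omega,
      hG.extPt_eq_iff.2 ⟨rfl, ?_, ?_⟩⟩
    · rw [graph_carrier hG hK, graph_carrier hG hK, ← hst]
      simp
    · rw [graph_carrier hG hK] at h ⊢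
      intro g hg
      obtain ⟨m, hm, j, hj, hgm⟩ := exists_of_mem_ann_prod hK h hg
      rw [hgm _ (mem_prod_carrier x t), hgm _ (mem_prod_cone.2 ⟨hK.mem_carrier x,
        Or.inr (by rw [← hst]; simp)⟩), hj (by decide)]
      simp
  · intro x _ _ _
    obtain ⟨τ, hd, hτ⟩ := hK.exists_zero_cone (hK.carrier x)
    exact ⟨_, τ, (graph_subset_iff hG hK).2 ⟨hτ, Or.inr (by simp)⟩, hd, rfl⟩
  · rintro _ x ⟨τ, h, hd, rfl⟩
    have hτ := ((graph_subset_iff hG hK).1 h).1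
    obtain ⟨u, rfl, -⟩ := hK.exists_carrier_eq τ
    rw [hGf.extMap_extPt_iff hG hK₀ (u := (u, -1)) (by rw [graph_carrier hG hK]; simp),
      hK₀.finiteIncl_iff]
    have hd₀ : K₀.dim (hK₀.carrier u) = 0 := hK₀.dim_carrier_eq_zero fun n hn => by
      obtain ⟨m, hm, hmn⟩ := exists_M_of_subdivision hK₀ h' hn
      rw [← hmn u (hK.mem_carrier u)]
      exact hK.eq_zero_of_dim_eq_zero hd subset_rfl hm (hK.mem_carrier u)
    constructor
    · rintro ⟨h1, rfl⟩
      exact ⟨hd₀, h1, rfl⟩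
    · rintro ⟨h1, h2, h3⟩
      have h4 := hf.carrier_subset hK hK₀ hτ
      refine ⟨h4, h3.trans (hK₀.extPt_eq_iff.2 ⟨hK₀.eq_of_dim_eq_zero h1 hd₀ h2 h4, rfl,
        fun _ _ => rfl⟩)⟩
  · rintro _ x ⟨τ, h, hd, rfl⟩
    have hτ := ((graph_subset_iff hG hK).1 h).1
    rw [graph_extValueGroup hG hK (Or.inl (by decide)), ann_eq_of_dim_eq_zero hK hd hτ,
      ← valueGroup_of_isProperSubdivision hK₀ h', hK.valueGroup_eq (hK.mem_carrier x)]
  · rintro _ x ⟨τ, h, hd, rfl⟩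
    have hτ := ((graph_subset_iff hG hK).1 h).1
    refine (if_neg (show (-1 : SignType) ≠ 0 by decide)).trans ?_
    rw [hG.weightInter_extPt, ← hG.extValueGroup_extPt (h := h),
      graph_extValueGroup hG hK (Or.inl (by decide)), ann_eq_of_dim_eq_zero hK hd hτ,
      graph_carrier hG hK, hK.weightClass_eq, hK.valueGroup_eq (hK.mem_carrier x),
      graph_raySlope_neg hG hK hd, graph_dim_of_ne hK _ (by decide), hd,
      show SignType.sign (-1 : ℝ) = -1 by simp, hw, graph_dim_of_ne hK _ (by decide)]
    simp only [zero_add, true_and, add_left_inj, neg_mul, one_mul]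
    split_ifs <;> simp
  · rintro _ x x' ⟨τ, h, hd, rfl⟩ ⟨τ', k, hd', he⟩
    obtain ⟨h1, h2, h3⟩ := hG.extPt_eq_iff.1 he
    have hτ := ((graph_subset_iff hG hK).1 h).1
    rw [graph_carrier hG hK, graph_carrier hG hK] at h2
    rw [graph_carrier hG hK] at h h3
    have h2' : hK.carrier x = hK.carrier x' := congrArg Prod.fst h2
    refine (hK.isCone (hK.carrier x)).injOn x (hK.mem_carrier x) x' (h2' ▸ hK.mem_carrier x')
      fun m hm => ?_
    rw [← ann_eq_of_dim_eq_zero hK hd hτ] at hm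
    obtain ⟨g, hg, hgm⟩ := exists_mem_ann_prod h hm
    have h4 := h3 g hg
    rw [hgm _ (mem_prod_carrier x _), hgm _ (by rw [h2]; exact mem_prod_carrier x' _)] at h4
    exact h4
  · rintro _ _ x ⟨τ, h, hd, rfl⟩ ⟨τ', k, hd', rfl⟩
    have hτ := ((graph_subset_iff hG hK).1 h).1
    have hτ' := ((graph_subset_iff hG hK).1 k).1
    obtain rfl := hK.eq_of_dim_eq_zero hd hd' hτ hτ'
    rfl

/-- The push-forward of the intersection of the graph of `ψ` with the height function is the
difference of the intersection product and the cup product. -/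
theorem pushforward_graph {κ : Type u'} {K₀ : WComplex κ X L} (hK₀ : K₀.IsConeComplex)
    (h' : K.IsProperSubdivision K₀) (c : ι → ℤ) (e : K₀.ExtPoint) :
    pushforward (K.graphComplex ψ hψ).extValueGroup K₀.extValueGroup
        (extMap (K.graphComplex ψ hψ) K₀ Prod.fst)
        ((K.graphComplex ψ hψ).weightInter (fun z => z.2 + ψ z.1) (K.graphWeight ψ c)) e =
      pushforward K.extValueGroup K₀.extValueGroup (extMap K K₀ id) (K.weightInter ψ c) e -
        K₀.finitePart (K.weightClass (K.weightCup ψ c)) e := by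
  classical
  have hf : K.IsMorphism K₀ id := isMorphism_id_of_isProperSubdivision h'
  have hGf : (K.graphComplex ψ hψ).IsMorphism K₀ Prod.fst := hf.comp isMorphism_graph_fst
  have hG : (K.graphComplex ψ hψ).IsConeComplex := isConeComplex_graphComplex h'.1 ψ hψ
  have h1 := pushforward_graph_flat hG h'.1 hK₀ hf (w := K.graphWeight ψ c) (c := c)
    (fun _ => rfl) e
  have h2 := pushforward_graph_vertical hG hK₀ h' (w := K.graphWeight ψ c)
    (b := K.weightCup ψ c) (fun _ => rfl) (fun _ => rfl) e
  have h3 : pushforward K₀.valueGroup K₀.extValueGroup K₀.finiteIncl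
      (fun x => -K.weightClass (K.weightCup ψ c) x) e =
      -K₀.finitePart (K.weightClass (K.weightCup ψ c)) e := by
    unfold finitePart pushforward
    simp only [mul_neg]
    rw [← finsum_neg_distrib]
    exact finsum_congr fun x => finsum_neg_distrib _
  rw [sub_eq_add_neg, ← h3, ← h1, ← h2]
  -- Finiteness of the fibre allows the sum to be split into the strata of rays on the graph and of
  -- vertical rays.
  have hfin := hGf.finite_fiber hG hK₀ (fun z => z.2 + ψ z.1) (K.graphWeight ψ c) e
  unfold pushforward
  refine Eq.trans ?_ (finsum_mem_add_distrib' (hfin.subset ?_) (hfin.subset ?_))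
  · refine finsum_mem_congr rfl fun x _ => ?_
    beta_reduce
    split_ifs <;> ring
  · rintro x ⟨⟨hx, hr⟩, h0⟩
    exact ⟨hx, hr, (ite_ne_right_iff.1 (right_ne_zero_of_mul h0)).2⟩
  · rintro x ⟨⟨hx, hr⟩, h0⟩
    exact ⟨hx, hr, (ite_ne_left_iff.1 (right_ne_zero_of_mul h0)).2.symm⟩

end graph

end WComplex

namespace WComplex

/-! ### Stars of zero-dimensional cones -/

section zero

variable {ι : Type u} {X : Type v} {L : Type w} [AddCommGroup L] {K : WComplex ι X L}

/-- The inclusion into `|Σ|` of the star of a zero-dimensional cone. -/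
def starVal (hK : K.IsConeComplex) {τ : ι} (hd : K.dim τ = 0) : K.StarPoint τ → X :=
  Quot.lift (fun p => p.1.2) fun p q h =>
    (hK.isCone p.1.1).injOn _ p.2.2 _ (h.1 q.2.2) fun m hm =>
      h.2 m hm fun _ ht => hK.eq_zero_of_dim_eq_zero hd p.2.1 hm ht

variable (hK : K.IsConeComplex) {τ : ι} (hd : K.dim τ = 0)

theorem starMk_starVal (q : K.StarPoint τ) : ∃ h : K.cone τ ⊆ K.cone (hK.carrier (starVal hK hd q)),
    q = K.starMk τ _ (starVal hK hd q) h (hK.mem_carrier _) := by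
  obtain ⟨w, h, rfl⟩ := hK.exists_eq_starMk q
  exact ⟨h, rfl⟩

theorem starVal_injective : Function.Injective (starVal hK hd) := by
  intro q q' h
  obtain ⟨h1, h2⟩ := starMk_starVal hK hd q
  obtain ⟨h3, h4⟩ := starMk_starVal hK hd q'
  rw [h2, h4]
  exact (hK.starMk_carrier_eq_iff h1 h3).2 ⟨by rw [h], fun m _ => by rw [h]⟩

theorem mem_range_starVal {x : X} :
    x ∈ Set.range (starVal hK hd) ↔ K.cone τ ⊆ K.cone (hK.carrier x) := by
  constructor
  · rintro ⟨q, rfl⟩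
    exact (starMk_starVal hK hd q).1
  · exact fun h => ⟨K.starMk τ _ x h (hK.mem_carrier x), rfl⟩

theorem mem_starCone_iff {i : {i : ι // K.cone τ ⊆ K.cone i}} {q : K.StarPoint τ} :
    q ∈ K.starCone τ i ↔ starVal hK hd q ∈ K.cone i.1 := by
  constructor
  · rintro ⟨x, hx, rfl⟩
    exact hx
  · intro h
    obtain ⟨h1, h2⟩ := starMk_starVal hK hd q
    refine ⟨_, h, h2.trans (starMk_of_subset (hK.carrier_subset h) _).symm⟩

theorem mem_starM_iff {i : {i : ι // K.cone τ ⊆ K.cone i}} {g : K.StarPoint τ → ℝ} :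
    g ∈ K.starM τ i ↔ ∃ m ∈ K.M i.1, m ∘ starVal hK hd = g := by
  constructor
  · intro hg
    obtain ⟨m, hm, hgm⟩ := exists_of_mem_starM hg
    refine ⟨m, hm.1, funext fun q => ?_⟩
    by_cases hq : q ∈ K.starCone τ i
    · obtain ⟨x, hx, rfl⟩ := hq
      exact (hgm x hx).symm
    · rw [hg.1 q hq]
      exact (hK.isCone i.1).eq_zero_off m hm.1 _ fun h => hq ((mem_starCone_iff hK hd).2 h)
  · rintro ⟨m, hm, rfl⟩
    refine ⟨fun q hq => ?_, m, hm, fun t ht => hK.eq_zero_of_dim_eq_zero hd i.2 hm ht,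
      fun x hx => rfl⟩
    exact (hK.isCone i.1).eq_zero_off m hm _ fun h => hq ((mem_starCone_iff hK hd).2 h)

variable {κ : Type u'} {S : WComplex κ X L} (hS : S.IsProperSubdivision K)
include hS

/-- The star of `τ` is the part of `|Σ|` covered by cones containing `τ`. A cone of the subdivision
lies in one cone of `Σ`; if it meets this part, that cone contains `τ`, and so do the minimal cones
of all its points. -/
theorem subset_range_starVal {j : κ} {q : K.StarPoint τ} (hq : starVal hK hd q ∈ S.cone j) :
    S.cone j ⊆ Set.range (starVal hK hd) := by
  obtain ⟨i, hi, -⟩ := hS.2.2 j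
  intro y hy
  rw [mem_range_starVal]
  refine hK.subset_carrier_of_dim_eq_zero hd ?_ (hi hy)
  exact (starMk_starVal hK hd q).1.trans (hK.carrier_subset (hi hq))

/-- A subdivision induces subdivisions of the stars of the zero-dimensional cones. -/
theorem isProperSubdivision_pull_starVal :
    (S.pull (starVal hK hd) (K.perp τ).subtype).IsProperSubdivision (K.star τ) := by
  refine ⟨isConeComplex_pull hS.1 (starVal_injective hK hd)
    fun j q hq => subset_range_starVal hK hd hS hq, ?_, ?_⟩
  · funext q
    change (S.φ (starVal hK hd q)).comp _ = _
    rw [hS.2.1]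
    induction q using Quot.ind
    rfl
  · rintro ⟨j, hj⟩
    obtain ⟨i, hi, hM⟩ := hS.2.2 j
    obtain ⟨x, hx, -⟩ := hS.1.exists_carrier_eq j
    have hxj : x ∈ S.cone j := hx ▸ hS.1.mem_carrier x
    have hτi : K.cone τ ⊆ K.cone i :=
      ((mem_range_starVal hK hd).1 (hj hxj)).trans (hK.carrier_subset (hi hxj))
    refine ⟨⟨i, hτi⟩, fun q hq => (mem_starCone_iff hK hd).2 (hi hq), ?_⟩
    have hind : ∀ m : X → ℝ, (Set.indicatorHom ℝ (S.cone j) m) ∘ starVal hK hd =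
        Set.indicatorHom ℝ (starVal hK hd ⁻¹' S.cone j) (m ∘ starVal hK hd) := fun m => rfl
    ext g
    rw [mem_pull_M, hM]
    constructor
    · rintro ⟨_, ⟨m, hm, rfl⟩, rfl⟩
      exact ⟨m ∘ starVal hK hd, (mem_starM_iff hK hd).2 ⟨m, hm, rfl⟩, (hind m).symm⟩
    · rintro ⟨n, hn, rfl⟩
      obtain ⟨m, hm, rfl⟩ := (mem_starM_iff hK hd).1 hn
      exact ⟨_, ⟨m, hm, rfl⟩, hind m⟩

theorem isMorphism_pull_starVal :
    (S.pull (starVal hK hd) (K.perp τ).subtype).IsMorphism K (starVal hK hd) :=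
  isMorphism_pull (isMorphism_id_of_isProperSubdivision hS)

/-- The inclusion of the extended complex of a star, preceded by a subdivision. -/
theorem starIncl_comp_iff {x : (S.pull (starVal hK hd) (K.perp τ).subtype).ExtPoint}
    {e : K.ExtPoint} : (∃ y, extMap (S.pull (starVal hK hd) (K.perp τ).subtype) (K.star τ) id x y ∧
      K.starIncl τ y e) ↔
      extMap (S.pull (starVal hK hd) (K.perp τ).subtype) K (starVal hK hd) x e := by
  have hT := isProperSubdivision_pull_starVal hK hd hS
  have hSt := hK.isConeComplex_star τ
  have hid := isMorphism_id_of_isProperSubdivision hT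
  obtain ⟨q, p, h, rfl⟩ := hT.1.exists_eq_extPt_carrier x
  rw [(isMorphism_pull_starVal hK hd hS).extMap_iff hT.1 hK]
  obtain ⟨u, hu, rfl⟩ := hK.exists_eq_starMk q
  obtain ⟨w, hw, rfl⟩ := hK.exists_eq_starMk p
  have hc := hK.star_carrier τ hu hSt
  have huw := (isMorphism_pull_starVal hK hd hS).carrier_subset hT.1 hK h
  have hy : ∀ y, extMap (S.pull (starVal hK hd) (K.perp τ).subtype) (K.star τ) id
      (hT.1.extPt (hT.1.carrier (K.starMk τ (hK.carrier u) u hu (hK.mem_carrier u)))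
        (K.starMk τ (hK.carrier w) w hw (hK.mem_carrier w)) h) y ↔
      ∃ h', y = hSt.extPt ⟨hK.carrier u, hu⟩
        (K.starMk τ (hK.carrier w) w hw (hK.mem_carrier w)) h' := by
    intro y
    rw [hid.extMap_extPt_iff hT.1 hSt rfl]
    simp only [id, hc]
  constructor
  · rintro ⟨y, h1, h2⟩
    obtain ⟨h', rfl⟩ := (hy y).1 h1
    exact (hK.starIncl_iff hSt huw).1 h2
  · rintro rfl
    have h' : (K.star τ).cone ⟨hK.carrier u, hu⟩ ⊆ (K.star τ).cone
        (hSt.carrier (K.starMk τ (hK.carrier w) w hw (hK.mem_carrier w))) := by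
      rw [hK.star_carrier τ hw hSt]
      intro q hq
      exact (mem_starCone_iff hK hd).2 (huw ((mem_starCone_iff hK hd).1 hq))
    exact ⟨_, (hy _).2 ⟨h', rfl⟩, (hK.starIncl_iff hSt huw).2 rfl⟩

end zero

theorem extMap_comp_iff {ι : Type u} {X : Type v} {L : Type w} [AddCommGroup L]
    {K : WComplex ι X L} {κ : Type u'} {Y : Type v'} {L' : Type w'} [AddCommGroup L']
    {D : WComplex κ Y L'} {ι₃ : Type*} {Z : Type*} {L₃ : Type*} [AddCommGroup L₃]
    {E : WComplex ι₃ Z L₃} {f : X → Y} {g : Y → Z} (hK : K.IsConeComplex) (hD : D.IsConeComplex)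
    (hE : E.IsConeComplex) (hf : K.IsMorphism D f) (hg : D.IsMorphism E g) {x : K.ExtPoint}
    {z : E.ExtPoint} :
    (∃ y, extMap K D f x y ∧ extMap D E g y z) ↔ extMap K E (g ∘ f) x z := by
  obtain ⟨u, p, h, rfl⟩ := hK.exists_eq_extPt_carrier x
  rw [(hg.comp hf).extMap_iff hK hE]
  constructor
  · rintro ⟨y, h1, h2⟩
    obtain rfl := (hf.extMap_iff hK hD h).1 h1
    exact (hg.extMap_iff hD hE _).1 h2
  · rintro rfl
    exact ⟨_, (hf.extMap_iff hK hD h).2 rfl, (hg.extMap_iff hD hE _).2 rfl⟩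

section zero

variable {ι : Type u} {X : Type v} {L : Type w} [AddCommGroup L] {K : WComplex ι X L}
  (hK : K.IsConeComplex) {τ : ι} {κ : Type u'}
  {κ' : Type v'} {Y : Type w'} {L' : Type*} [AddCommGroup L'] {D : WComplex κ' Y L'} {F : X → Y}

include hK in
-- Functoriality is used twice, first for the subdivision of the star followed by its inclusion,
-- then for the map to `D`. The result is a single push-forward, to which independence of the
-- subdivision applies.
theorem pushforward_starIncl {T : WComplex κ (K.StarPoint τ) (K.perp τ)}
    (hT : T.IsProperSubdivision (K.star τ)) {v : K.StarPoint τ → X} (hv : T.IsMorphism K v)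
    (hcomp : ∀ x e, (∃ y, extMap T (K.star τ) id x y ∧ K.starIncl τ y e) ↔ extMap T K v x e)
    (hD : D.IsConeComplex) (hF : K.IsMorphism D F) (ψ : K.StarPoint τ → ℝ) (c : κ → ℤ)
    (e : D.ExtPoint) :
    pushforward K.extValueGroup D.extValueGroup (extMap K D F)
      (pushforward (K.star τ).extValueGroup K.extValueGroup (K.starIncl τ)
        (pushforward T.extValueGroup (K.star τ).extValueGroup (extMap T (K.star τ) id)
          (T.weightInter ψ c))) e =
      pushforward T.extValueGroup D.extValueGroup (extMap T D (F ∘ v)) (T.weightInter ψ c) e := by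
  have hSt := hK.isConeComplex_star τ
  have hid := isMorphism_id_of_isProperSubdivision hT
  have h1 : pushforward (K.star τ).extValueGroup K.extValueGroup (K.starIncl τ)
      (pushforward T.extValueGroup (K.star τ).extValueGroup (extMap T (K.star τ) id)
        (T.weightInter ψ c)) =
      pushforward T.extValueGroup K.extValueGroup (extMap T K v) (T.weightInter ψ c) := by
    funext y
    have h2 : ∀ (x : T.ExtPoint) (p p' : (K.star τ).ExtPoint), extMap T (K.star τ) id x p →
        extMap T (K.star τ) id x p' → p = p' := fun x p p' => hid.extMap_unique hT.1 hSt
    have h3 : ∀ (x : T.ExtPoint) (p : (K.star τ).ExtPoint), extMap T (K.star τ) id x p →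
        (K.star τ).extValueGroup p ≤ T.extValueGroup x := fun x p => hid.extValueGroup_le hT.1 hSt
    have h4 : ∀ p, K.starIncl τ p y → K.extValueGroup y ≤ (K.star τ).extValueGroup p :=
      fun p hp => (hK.extValueGroup_starIncl hSt hp).ge
    have h5 := hv.finite_fiber hT.1 hK ψ c y
    simp only [← hcomp] at h5
    refine (pushforward_comp h2 h3 h4 hT.1.extValueGroup_fg hSt.extValueGroup_fg h5).trans ?_
    simp only [hcomp]
  have h2 : ∀ (x : T.ExtPoint) (p p' : K.ExtPoint), extMap T K v x p → extMap T K v x p' → p = p' :=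
    fun x p p' => hv.extMap_unique hT.1 hK
  have h3 : ∀ (x : T.ExtPoint) (p : K.ExtPoint), extMap T K v x p →
      K.extValueGroup p ≤ T.extValueGroup x := fun x p => hv.extValueGroup_le hT.1 hK
  have h4 : ∀ p, extMap K D F p e → D.extValueGroup e ≤ K.extValueGroup p :=
    fun p => hF.extValueGroup_le hK hD
  have h5 := (hF.comp hv).finite_fiber hT.1 hD ψ c e
  have h6 : ∀ x e, (∃ y, extMap T K v x y ∧ extMap K D F y e) ↔ extMap T D (F ∘ v) x e :=
    fun x e => extMap_comp_iff hT.1 hK hD hv hF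
  simp only [← h6] at h5
  rw [h1]
  refine (pushforward_comp h2 h3 h4 hT.1.extValueGroup_fg hK.extValueGroup_fg h5).trans ?_
  simp only [h6]

open Classical in
/-- The push-forward of an intersection product on the star of a zero-dimensional cone. -/
theorem pushforward_star (hd : K.dim τ = 0) {S : WComplex κ X L} (hS : S.IsProperSubdivision K)
    (hD : D.IsConeComplex) (hF : K.IsMorphism D F) {δ : κ'}
    (hδ : ∀ u, K.cone τ ⊆ K.cone (hK.carrier u) ↔ D.cone δ ⊆ D.cone (hD.carrier (F u)))
    (ψ : X → ℝ) (c : κ → ℤ) (e : D.ExtPoint) :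
    pushforward K.extValueGroup D.extValueGroup (extMap K D F)
      (pushforward (K.star τ).extValueGroup K.extValueGroup (K.starIncl τ)
        (pushforward (S.pull (starVal hK hd) (K.perp τ).subtype).extValueGroup
          (K.star τ).extValueGroup
          (extMap (S.pull (starVal hK hd) (K.perp τ).subtype) (K.star τ) id)
          ((S.pull (starVal hK hd) (K.perp τ).subtype).weightInter (ψ ∘ starVal hK hd)
            fun i => c i.1))) e =
      if D.cone δ ⊆ D.cone e.1 then
        pushforward S.extValueGroup D.extValueGroup (extMap S D F) (S.weightInter ψ c) e else 0 := by
  have hT := isProperSubdivision_pull_starVal hK hd hS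
  have hv := isMorphism_pull_starVal hK hd hS
  refine (pushforward_starIncl hK hT hv (fun x e => starIncl_comp_iff hK hd hS) hD hF _ _ e).trans ?_
  have hSF : S.IsMorphism D F := hF.comp (isMorphism_id_of_isProperSubdivision hS)
  have hS1 := hS.1
  split_ifs with he
  · refine pushforward_weightInter_pull hS.1 (starVal_injective hK hd)
      (fun j q hq => subset_range_starVal hK hd hS hq) hD hSF ψ c fun e' he' => ?_
    obtain ⟨u, z, h, rfl⟩ := hS1.exists_eq_extPt_carrier e'
    obtain rfl := (hSF.extMap_iff hS1 hD h).1 he'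
    obtain ⟨q, hq⟩ := (mem_range_starVal hK hd).2 ((hδ u).2 he)
    exact subset_range_starVal hK hd hS (q := q) (by rw [hq]; exact hS1.mem_carrier u)
  -- Every point of the star has `τ` below it, and its image has `δ` below it, so other strata
  -- receive nothing.
  · refine pushforward_eq_zero fun x hx => absurd ?_ he
    obtain ⟨q, p, h, rfl⟩ := hT.1.exists_eq_extPt_carrier x
    obtain rfl := ((hF.comp hv).extMap_iff hT.1 hD h).1 hx
    exact (hδ _).1 (starMk_starVal hK hd q).1

end zero

end WComplex

namespace WComplex

theorem IsConeComplex.isProperSubdivision_refl {ι : Type u} {X : Type v} {L : Type w}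
    [AddCommGroup L] {K : WComplex ι X L} (hK : K.IsConeComplex) : K.IsProperSubdivision K :=
  ⟨hK, rfl, fun i => ⟨i, subset_rfl, hK.M_of_subset subset_rfl⟩⟩

theorem IsProperSubdivision.isCPDivisor {ι : Type u} {X : Type v} {L : Type w} [AddCommGroup L]
    {K : WComplex ι X L} {κ : Type u'} {K' : WComplex κ X L} (h' : K'.IsProperSubdivision K)
    {ψ : X → ℝ} (hψ : K.IsCPDivisor ψ) : K'.IsCPDivisor ψ := by
  intro j
  obtain ⟨i, hi, -⟩ := h'.2.2 j
  obtain ⟨l, hl⟩ := hψ i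
  exact ⟨l, fun x hx => by rw [h'.2.1, hl x (hi hx)]⟩

/-! ### The subdivision of the product along the graph -/

section shear

variable {ι : Type u} {X : Type v} {L : Type w} [AddCommGroup L] {K : WComplex ι X L}
  {κ : Type u'} {K₁ : WComplex κ X L} {ψ : X → ℝ}

/-- The shear of `|Σ| × ℝ` that maps the graph of `ψ` to `|Σ| × 0`. -/
def shear (ψ : X → ℝ) (z : X × ℝ) : X × ℝ := (z.1, z.2 - ψ z.1)

theorem shear_injective : Function.Injective (shear ψ) := by
  rintro ⟨x, s⟩ ⟨y, t⟩ h
  obtain ⟨h1, h2⟩ := Prod.mk.inj h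
  simp only at h1 h2
  subst h1
  rw [sub_left_inj.1 h2]

theorem mem_range_shear (z : X × ℝ) : z ∈ Set.range (shear ψ) :=
  ⟨(z.1, z.2 + ψ z.1), Prod.ext rfl (add_sub_cancel_right _ _)⟩

/-- The subdivision of `Σ × Π¹` along the graph of `ψ` and along `Σ × 0`. -/
noncomputable def graphSubdivision (K₁ : WComplex κ X L) (ψ : X → ℝ) (hψ : K₁.IsDivisor ψ) :=
  ((K₁.graphComplex ψ hψ).split fun z => z.2 + ψ z.1).pull (shear ψ) (AddMonoidHom.id (L × ℤ))

theorem isConeComplex_split_graph (hK₁ : K₁.IsConeComplex) (hψ : K₁.IsDivisor ψ) :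
    ((K₁.graphComplex ψ hψ).split fun z => z.2 + ψ z.1).IsConeComplex :=
  isConeComplex_split (isConeComplex_graphComplex hK₁ ψ hψ) (isDivisor_height ψ hψ)

/-- The shear subtracts `ψ` and the weak embedding of the graph complex adds it back, leaving the
embedding of the product. After the cut each cone has a definite sign of the second coordinate, and
since `ψ` is integral on the cones of `Σ`, the functions `m + n (t - ψ)` and `m + n t` generate the
same lattices. -/
theorem isProperSubdivision_graphSubdivision (hψ : K.IsDivisor ψ) (h₁ : K₁.IsProperSubdivision K)
    (hψ₁ : K₁.IsDivisor ψ) : (K₁.graphSubdivision ψ hψ₁).IsProperSubdivision (K.prod line) := by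
  refine ⟨isConeComplex_pull (isConeComplex_split_graph h₁.1 hψ₁) shear_injective
    fun _ _ _ _ _ => mem_range_shear _, ?_, ?_⟩
  · funext ⟨x, t⟩
    refine AddMonoidHom.ext fun l => ?_
    change K₁.φ x l.1 + (l.2 : ℝ) * (t - ψ x + ψ x) = K.φ x l.1 + (l.2 : ℝ) * t
    rw [h₁.2.1, sub_add_cancel]
  · rintro ⟨⟨⟨⟨k, s⟩, s'⟩, hp⟩, hr⟩
    obtain ⟨i, hi, hM⟩ := h₁.2.2 k
    obtain ⟨p, hp', hpψ⟩ := hψ i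
    set S := K₁.graphSubdivision ψ hψ₁ with hS
    set j : {i // ((K₁.graphComplex ψ hψ₁).split fun z => z.2 + ψ z.1).cone i ⊆
      Set.range (shear ψ)} := ⟨⟨⟨⟨k, s⟩, s'⟩, hp⟩, hr⟩ with hj
    have hcone : ∀ z : X × ℝ, z ∈ S.cone j → z.1 ∈ K₁.cone k ∧
        shear ψ z ∈ (K₁.prod line).cone (k, s) ∧ (SignType.sign z.2 = 0 ∨ SignType.sign z.2 = s') := by
      intro z hz
      obtain ⟨h1, h2⟩ := mem_split_cone.1
        (show shear ψ z ∈ ((K₁.graphComplex ψ hψ₁).split _).cone _ from hz)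
      have h3 : (shear ψ z).2 + ψ (shear ψ z).1 = z.2 := sub_add_cancel _ _
      rw [h3] at h2
      exact ⟨h1.1, h1, h2⟩
    have hsub : S.cone j ⊆ (K.prod line).cone (i, s') := fun z hz =>
      mem_prod_cone.2 ⟨hi (hcone z hz).1, (hcone z hz).2.2⟩
    refine ⟨(i, s'), hsub, ?_⟩
    refine lattice_eq_of_values (S := S.cone j) ?_
      (fun m hm x hx => eq_zero_of_mem_restrictLattice hm hx) ?_ ?_
    · rintro _ ⟨m, hm, rfl⟩ z hz
      exact eq_zero_of_mem_restrictLattice hm hz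
    · rintro _ ⟨m, hm, rfl⟩
      obtain ⟨g, hg, hmg⟩ := exists_of_mem_restrictLattice hm
      obtain ⟨m₁, hm₁, n, hgm⟩ := exists_of_mem_prod_M hg
      change m₁ ∈ K₁.M k at hm₁
      rw [hM] at hm₁
      obtain ⟨m₀, hm₀, hmm⟩ := exists_of_mem_restrictLattice hm₁
      obtain ⟨g', hg', hgm'⟩ := exists_mem_prod_M (p := (i, s')) (sub_mem hm₀ (zsmul_mem hp' n)) n
      obtain ⟨r, hr, hrg⟩ := exists_restrict hg' (S.cone j)
      refine ⟨r, hr, fun z hz => ?_⟩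
      obtain ⟨h1, h2, h3⟩ := hcone z hz
      change m (shear ψ z) = r z
      rw [hrg z hz, hgm' z (hsub hz), hmg _ hz, hgm _ h2]
      change m₁ z.1 + n * (z.2 - ψ z.1) = m₀ z.1 - (n • p) z.1 + n * z.2
      rw [hmm _ h1, hpψ _ (hi h1), Pi.smul_apply, zsmul_eq_mul]
      ring
    · intro r hr
      obtain ⟨g, hg, hrg⟩ := exists_of_mem_restrictLattice hr
      obtain ⟨m₀, hm₀, n, hgm⟩ := exists_of_mem_prod_M hg
      obtain ⟨m₁, hm₁, hmm⟩ := exists_restrict (add_mem hm₀ (zsmul_mem hp' n)) (K₁.cone k)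
      rw [← hM] at hm₁
      obtain ⟨g', hg', hgm'⟩ := exists_mem_prod_M (p := (k, s)) hm₁ n
      obtain ⟨m, hm, hmg⟩ := exists_restrict hg'
        (((K₁.graphComplex ψ hψ₁).split fun z => z.2 + ψ z.1).cone j.1)
      refine ⟨_, ⟨m, hm, rfl⟩, fun z hz => ?_⟩
      obtain ⟨h1, h2, h3⟩ := hcone z hz
      change r z = m (shear ψ z)
      rw [hmg _ hz, hgm' _ h2, hrg z hz, hgm z (hsub hz)]
      change m₀ z.1 + n * z.2 = m₁ z.1 + n * (z.2 - ψ z.1)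
      rw [hmm _ h1, Pi.add_apply, Pi.smul_apply, zsmul_eq_mul, ← hpψ _ (hi h1)]
      ring

/-- The weight on the subdivision of `Σ × Π¹` induced by `graphWeight`. -/
noncomputable def graphSubdivisionWeight (K₁ : WComplex κ X L) (ψ : X → ℝ) (hψ : K₁.IsDivisor ψ)
    (c : κ → ℤ) (i : {i // ((K₁.graphComplex ψ hψ).split fun z => z.2 + ψ z.1).cone i ⊆
      Set.range (shear ψ)}) : ℤ :=
  (K₁.graphComplex ψ hψ).splitWeight (fun z => z.2 + ψ z.1) (K₁.graphWeight ψ c) i.1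

theorem isMinkowskiWeight_graphSubdivisionWeight (hK₁ : K₁.IsConeComplex) (hψ : K₁.IsCPDivisor ψ)
    {c : κ → ℤ} (hc : K₁.IsMinkowskiWeight c) :
    (K₁.graphSubdivision ψ hψ.isDivisor).IsMinkowskiWeight
      (K₁.graphSubdivisionWeight ψ hψ.isDivisor c) :=
  isMinkowskiWeight_pull (isConeComplex_split_graph hK₁ hψ.isDivisor) shear_injective
    (fun _ _ _ _ _ => mem_range_shear _)
    (isMinkowskiWeight_splitWeight (isConeComplex_graphComplex hK₁ ψ hψ.isDivisor)
      (isDivisor_height ψ hψ.isDivisor) (isMinkowskiWeight_graphWeight hK₁ hψ hc))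

/-- In sheared coordinates the second projection is the height. The shear is a bijection, and
cutting along height zero does not change the class of the weight, so the computation on the uncut
graph complex applies. -/
theorem pushforward_graphSubdivision (hK : K.IsConeComplex) (h₁ : K₁.IsProperSubdivision K)
    (hψ₁ : K₁.IsDivisor ψ) (c : κ → ℤ) (e : K.ExtPoint) :
    pushforward (K₁.graphSubdivision ψ hψ₁).extValueGroup K.extValueGroup
        (extMap (K₁.graphSubdivision ψ hψ₁) K Prod.fst)
        ((K₁.graphSubdivision ψ hψ₁).weightInter Prod.snd (K₁.graphSubdivisionWeight ψ hψ₁ c)) e =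
      pushforward K₁.extValueGroup K.extValueGroup (extMap K₁ K id) (K₁.weightInter ψ c) e -
        K.finitePart (K₁.weightClass (K₁.weightCup ψ c)) e := by
  have hG := isConeComplex_graphComplex h₁.1 ψ hψ₁
  have hsplit := isProperSubdivision_split hG (isDivisor_height ψ hψ₁)
  have hGf : (K₁.graphComplex ψ hψ₁).IsMorphism K Prod.fst :=
    (isMorphism_id_of_isProperSubdivision h₁).comp isMorphism_graph_fst
  have hsnd : (Prod.snd : X × ℝ → ℝ) = (fun z => z.2 + ψ z.1) ∘ shear ψ :=
    funext fun z => (sub_add_cancel _ _).symm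
  refine (congrArg (fun η => pushforward (K₁.graphSubdivision ψ hψ₁).extValueGroup K.extValueGroup
    (extMap (K₁.graphSubdivision ψ hψ₁) K Prod.fst) ((K₁.graphSubdivision ψ hψ₁).weightInter η
      (K₁.graphSubdivisionWeight ψ hψ₁ c)) e) hsnd).trans ?_
  rw [← pushforward_graph (hψ := hψ₁) hK h₁ c e, ← pushforward_weightInter_eq hG hsplit
    hG.isProperSubdivision_refl hK hGf _
    (weightClass_splitWeight hG (isDivisor_height ψ hψ₁) (K₁.graphWeight ψ c)) e]
  exact pushforward_weightInter_pull (g := shear ψ) (f := AddMonoidHom.id (L × ℤ)) hsplit.1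
    shear_injective (fun _ _ _ _ _ => mem_range_shear _) hK
    (hGf.comp (isMorphism_id_of_isProperSubdivision hsplit)) _ _ fun _ _ _ _ => mem_range_shear _

end shear

open Classical in
/-- The rational equivalence on the star of a zero-dimensional cone. -/
theorem indicator_mem_ratEquivZero {ι κ : Type u} {X : Type v} {L : Type w} [AddCommGroup L]
    {K : WComplex ι X L} {K₁ : WComplex κ X L} {ψ : X → ℝ} (hK : K.IsConeComplex)
    (hψ : K.IsCPDivisor ψ) (h₁ : K₁.IsProperSubdivision K) {c : κ → ℤ}
    (hc : K₁.IsMinkowskiWeight c) {τ : ι} (hd : K.dim τ = 0) :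
    (fun e => if K.cone τ ⊆ K.cone e.1 then
      pushforward K₁.extValueGroup K.extValueGroup (extMap K₁ K id) (K₁.weightInter ψ c) e -
        K.finitePart (K₁.weightClass (K₁.weightCup ψ c)) e else 0) ∈ K.ratEquivZero := by
  have hψ₁ := h₁.isCPDivisor hψ
  have hP := isConeComplex_prod_line hK
  have hd' : (K.prod line).dim (τ, SignType.zero) = 0 := (dim_prod_line_zero hK τ).trans hd
  have hS := isProperSubdivision_graphSubdivision hψ.isDivisor h₁ hψ₁.isDivisor
  have hT := isProperSubdivision_pull_starVal hP hd' hS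
  have hTc := isMinkowskiWeight_pull (f := ((K.prod line).perp (τ, SignType.zero)).subtype) hS.1
    (starVal_injective hP hd') (fun _ _ => subset_range_starVal hP hd' hS)
    (isMinkowskiWeight_graphSubdivisionWeight h₁.1 hψ₁ hc)
  have hcoord : K.coordinate τ = Prod.snd ∘ starVal hP hd' := by
    funext q
    induction q using Quot.ind
    rfl
  -- The generator of `R_*` is the graph cycle restricted to the star of `τ × 0`. The same weight
  -- serves as its representative and as the one computing the intersection product.
  refine AddSubgroup.subset_closure ⟨τ, _, _, ⟨_, _, _, hT, hTc, rfl⟩,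
    ⟨_, _, _, ⟨hT, hTc, rfl⟩, rfl⟩, ?_⟩
  funext e
  rw [hcoord, pushforward_star hP hd' hS hK isMorphism_fst (δ := τ),
    pushforward_graphSubdivision hK h₁]
  intro u
  rw [prod_line_carrier hK hP]
  exact (prod_cone_subset_iff hK).trans (and_iff_left (Or.inl rfl))

open Classical in
-- Every cone contains exactly one zero-dimensional cone, so the relations obtained from the
-- zero-dimensional cones add up to the whole difference.
theorem sub_finitePart_mem_ratEquivZero {ι κ : Type u} {X : Type v} {L : Type w} [AddCommGroup L]
    {K : WComplex ι X L} {K₁ : WComplex κ X L} {ψ : X → ℝ} (hK : K.IsConeComplex)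
    (hψ : K.IsCPDivisor ψ) (h₁ : K₁.IsProperSubdivision K) {c : κ → ℤ}
    (hc : K₁.IsMinkowskiWeight c) :
    pushforward K₁.extValueGroup K.extValueGroup (extMap K₁ K id) (K₁.weightInter ψ c) -
      K.finitePart (K₁.weightClass (K₁.weightCup ψ c)) ∈ K.ratEquivZero := by
  have := hK.finite
  have := Fintype.ofFinite ι
  have h := sum_mem fun (τ : ι) (hτ : τ ∈ Finset.univ.filter fun τ => K.dim τ = 0) =>
    indicator_mem_ratEquivZero hK hψ h₁ hc (Finset.mem_filter.1 hτ).2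
  convert h using 1
  funext e
  obtain ⟨τ, hd, hτ⟩ := hK.exists_zero_cone e.1
  rw [Finset.sum_apply, Finset.sum_eq_single τ, if_pos hτ]
  · rfl
  · intro τ' hτ' hne
    exact if_neg fun h => hne (hK.eq_of_dim_eq_zero (Finset.mem_filter.1 hτ').2 hd h hτ)
  · exact fun h => absurd (Finset.mem_filter_univ τ |>.2 hd) h

/-! ### The finite part as a cycle on the extended complex -/

section finitePart

variable {ι : Type u} {X : Type v} {L : Type w} [AddCommGroup L] {K : WComplex ι X L}

/-- A point in the star of a zero-dimensional cone has exactly one preimage in `|Σ|`. No function is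
lost there, so the value groups agree and the index is one. -/
theorem finitePart_mk (hK : K.IsConeComplex) (A : X → ℤ) {τ : ι} (hd : K.dim τ = 0)
    (q : K.StarPoint τ) : K.finitePart A ⟨τ, q⟩ = A (starVal hK hd q) := by
  obtain ⟨h, hq⟩ := starMk_starVal hK hd q
  have hq' : (⟨τ, q⟩ : K.ExtPoint) = hK.extPt τ (starVal hK hd q) h := congrArg (Sigma.mk τ) hq
  have hV : K.extValueGroup ⟨τ, q⟩ = K.valueGroup (starVal hK hd q) := by
    rw [hq', hK.extValueGroup_extPt, ann_eq_of_dim_eq_zero hK hd h,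
      hK.valueGroup_eq (hK.mem_carrier _)]
  have hset : {x | K.finiteIncl x ⟨τ, q⟩ ∧ Module.finrank ℤ (K.valueGroup x) =
      Module.finrank ℤ (K.extValueGroup ⟨τ, q⟩)} = {starVal hK hd q} := by
    ext x
    constructor
    · rintro ⟨hx, -⟩
      obtain ⟨-, h', he⟩ := hK.finiteIncl_iff.1 hx
      have hq : q = K.starMk τ _ x h' (hK.mem_carrier x) := eq_of_heq (Sigma.mk.inj he).2
      rw [hq]
      rfl
    · rintro rfl
      exact ⟨hK.finiteIncl_iff.2 ⟨hd, h, hq'⟩, by rw [hV]⟩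
  unfold finitePart pushforward
  rw [hset, finsum_mem_singleton, hV, AddSubgroup.relIndex_self, Nat.cast_one, one_mul]

/-- The class of a Minkowski weight is a cycle on the extended complex. -/
theorem finitePart_mem_extCycles {κ : Type u} {K₁ : WComplex κ X L} (hK : K.IsConeComplex)
    (h₁ : K₁.IsProperSubdivision K) {b : κ → ℤ} (hb : K₁.IsMinkowskiWeight b) :
    K.finitePart (K₁.weightClass b) ∈ K.extCycles := by
  refine AddSubgroup.subset_closure fun τ => ?_
  by_cases hd : K.dim τ = 0
  · have hr : ∀ j q, starVal hK hd q ∈ K₁.cone j → K₁.cone j ⊆ Set.range (starVal hK hd) :=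
      fun _ _ => subset_range_starVal hK hd h₁
    refine ⟨_, _, _, isProperSubdivision_pull_starVal hK hd h₁,
      isMinkowskiWeight_pull h₁.1 (starVal_injective hK hd) hr hb, funext fun q => ?_⟩
    rw [finitePart_mk hK _ hd, pull_weightClass h₁.1 (starVal_injective hK hd) hr]
  -- On the star of a cone of positive dimension the finite part vanishes and is represented by the
  -- zero weight.
  · refine ⟨_, K.star τ, 0, (hK.isConeComplex_star τ).isProperSubdivision_refl, ?_,
      funext fun q => ?_⟩
    · intro ρ l _
      simp
    · have h0 : K.finitePart (K₁.weightClass b) ⟨τ, q⟩ = 0 :=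
        pushforward_eq_zero fun x hx => absurd hx.1 hd
      rw [h0]
      unfold weightClass
      simp

end finitePart

end WComplex

theorem mainTheorem10 {ι : Type u} {X : Type v} {L : Type w} [AddCommGroup L] [Module.Free ℤ L]
    [Module.Finite ℤ L] (K : WComplex ι X L) (hK : K.IsConeComplex)
    (ψ : X → ℝ) (hψ : K.IsCPDivisor ψ) (A : X → ℤ) (hA : A ∈ K.cycles) :
    (∃ B, K.IsCupProduct ψ A B) ∧ (∃ C, K.IsIntersectionProduct ψ A C) ∧
    ∀ B C, K.IsCupProduct ψ A B → K.IsIntersectionProduct ψ A C →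
      K.chowClass (K.finitePart B) ∈ K.chow ∧
      K.chowClass C ∈ K.chow ∧
      K.chowClass (K.finitePart B) = K.chowClass C := by
  obtain ⟨κ, K', c, hr⟩ := hA
  refine ⟨⟨_, κ, K', c, hr, rfl⟩, ⟨_, κ, K', c, hr, rfl⟩, ?_⟩
  rintro _ _ ⟨κ₁, K₁, c₁, ⟨h₁, hc₁, hA₁⟩, rfl⟩ ⟨κ₂, K₂, c₂, ⟨h₂, hc₂, hA₂⟩, rfl⟩
  have hB := K.finitePart_mem_extCycles hK h₁
    (K₁.isMinkowskiWeight_weightCup h₁.1 (h₁.isCPDivisor hψ) hc₁)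
  -- The two products may come from different weights. Both weights have the class `A`, so the
  -- intersection product can be recomputed on the subdivision used for the cup product.
  have hC := funext (WComplex.pushforward_weightInter_eq hK h₁ h₂ hK
    (WComplex.isMorphism_id_of_isProperSubdivision hK.isProperSubdivision_refl) ψ
    (hA₁.symm.trans hA₂))
  have heq : K.chowClass (K.finitePart (K₁.weightClass (K₁.weightCup ψ c₁))) =
      K.chowClass (WComplex.pushforward K₂.extValueGroup K.extValueGroup
        (WComplex.extMap K₂ K id) (K₂.weightInter ψ c₂)) := by
    have hmem := WComplex.sub_finitePart_mem_ratEquivZero hK hψ h₁ hc₁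
    rw [hC] at hmem
    refine (QuotientAddGroup.eq).2 ?_
    rwa [neg_add_eq_sub]
  have hmem : K.chowClass (K.finitePart (K₁.weightClass (K₁.weightCup ψ c₁))) ∈ K.chow :=
    ⟨_, hB, rfl⟩
  -- The class of `C` belongs to the Chow group because it equals the class of the cup product,
  -- which is represented by a cycle.
  exact ⟨hmem, heq ▸ hmem, heq⟩
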